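/- Let $R$ be a Dedekind domain that is not a field, with fraction field $K$. A lattice of rank $n$ over $R$ is a finitely generated projective $R$-module of rank $n$. Let $Q$ be a quintic ring over $R$, that is, a commutative $R$-algebra that is a lattice of rank $5$ as an $R$-module; put $L = Q/R$ (a lattice of rank $4$) and $Q_K = K \otimes_R Q$. For an $R$-module $M$ and $\mu = \sum_{i=1}^n v_i \wedge w_i \in \Lambda^2 M$ put $\mu^\square = \sum_{i<j} v_i \wedge w_i \wedge v_j \wedge w_j \in \Lambda^4 M$ (this is well defined). For $\alpha, \beta \in \Lambda^4 M$ let $\mu \mapsto \mu(\alpha,\beta)$ be the linear map $\Lambda^2 M \to (\Lambda^5 M)^{\otimes 2}$ with $(v \wedge w)(\alpha,\beta) = (\alpha \wedge v) \otimes (\beta \wedge w) - (\alpha \wedge w) \otimes (\beta \wedge v)$. A resolvent of $Q$ is a triple $(M, \phi, \theta)$ consisting of a lattice $M$ of rank $5$ over $R$ and $R$-linear maps $\phi : \Lambda^4 L \otimes L \to \Lambda^2 M$ and $\theta : \Lambda^5 M \to (\Lambda^4 L)^{\otimes 3}$ such that $$\theta^{\otimes 2}\bigl[\phi(\lambda_1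 x)\bigl(\phi(\lambda_2 y)^\square, \phi(\lambda_3 z)^\square\bigr)\bigr] = \lambda_1 \lambda_2^2 \lambda_3^2\,(x \wedge y \wedge z \wedge yz) \in (\Lambda^4 L)^{\otimes 6}$$ for all $\lambda_1, \lambda_2, \lambda_3 \in \Lambda^4 L$ and $x, y, z \in L$, where $yz$ is computed from representatives in $Q$ (the choice does not matter). The resolvent is numerical if $\theta$ is an isomorphism. An isomorphism $(M,\phi,\theta) \to (M',\phi',\theta')$ of resolvents of $Q$ is an $R$-linear isomorphism $f : M \to M'$ with $\Lambda^2 f \circ \phi = \phi'$ and $\theta' \circ \Lambda^5 f = \theta$. Theorem. Suppose that for every nonzero prime ideal $\mathfrak p$ of $R$, the $R/\mathfrak p$-vector space of those classes in $\mathfrak p^{-1}Q/Q$ whose elements are integral over $R$ has dimension at most $2$, where $\mathfrak p^{-1}Q = \{x \in Q_K : \mathfrak p x \subseteq Q\}$. Then $Q$ has a resolvent, any two resolvents of $Q$ are isomorphic, and the resolvent is numerical. -/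

import Mathlib

open scoped TensorProduct

universe u v w

/-- `M` is an `R`-lattice of rank `n`: a finitely generated projective module of rank `n`.
(Over a Dedekind domain, projective may be replaced by torsion-free.) -/
structure IsLatticeOfRank (R : Type*) (M : Type*) [CommRing R] [AddCommGroup M] [Module R M]
    (n : ℕ) : Prop where
  finite : Module.Finite R M
  projective : Module.Projective R M
  finrank_eq : Module.finrank R M = n

/-- A quintic ring over `R`: a commutative `R`-algebra that is a lattice of rank `5`. -/
def IsQuinticRing (R : Type*) (Q : Type*) [CommRing R] [CommRing Q] [Algebra R Q] : Prop :=
  IsLatticeOfRank R Q 5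

section Exterior

variable {R : Type*} {M : Type*} [CommRing R] [AddCommGroup M] [Module R M]

/-- The wedge product `Λ^i M × Λ^j M → Λ^k M`, where `k = i + j`. -/
noncomputable def wedge {i j k : ℕ} (h : i + j = k) :
    ⋀[R]^i M →ₗ[R] ⋀[R]^j M →ₗ[R] ⋀[R]^k M :=
  LinearMap.mk₂ R
    (fun a b => ⟨(a : ExteriorAlgebra R M) * b, by
      subst h
      exact SetLike.mul_mem_graded (A := fun n : ℕ => ⋀[R]^n M) a.2 b.2⟩)
    (fun a a' b => Subtype.ext (add_mul _ _ _))
    (fun c a b => Subtype.ext (smul_mul_assoc _ _ _))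
    (fun a b b' => Subtype.ext (mul_add _ _ _))
    (fun c a b => Subtype.ext (mul_smul_comm _ _ _))

theorem wedge_coe {i j k : ℕ} (h : i + j = k) (a : ⋀[R]^i M) (b : ⋀[R]^j M) :
    (wedge h a b : ExteriorAlgebra R M) = (a : ExteriorAlgebra R M) * b := rfl

/-- The decomposable bivector `x ∧ y ∈ Λ² M`. -/
noncomputable def bivec (x y : M) : ⋀[R]^2 M := exteriorPower.ιMulti R 2 ![x, y]

theorem bivec_coe (x y : M) : (bivec (R := R) x y : ExteriorAlgebra R M) =
    ExteriorAlgebra.ι R x * ExteriorAlgebra.ι R y := by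
  simp [bivec, ExteriorAlgebra.ιMulti_apply]

theorem ι_mul_ι (x y : M) : ExteriorAlgebra.ι R x * ExteriorAlgebra.ι R y =
    - (ExteriorAlgebra.ι R y * ExteriorAlgebra.ι R x) :=
  eq_neg_of_add_eq_zero_left (ExteriorAlgebra.ι_add_mul_swap x y)

theorem ι_mul_bivec (z x y : M) :
    ExteriorAlgebra.ι R z * (ExteriorAlgebra.ι R x * ExteriorAlgebra.ι R y) =
      (ExteriorAlgebra.ι R x * ExteriorAlgebra.ι R y) * ExteriorAlgebra.ι R z := by
  rw [← mul_assoc, ι_mul_ι z x, neg_mul, mul_assoc, ι_mul_ι z y, mul_neg, neg_neg, mul_assoc]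

/-- `v ∧ w ∧ v' ∧ w' = 0` as soon as one of `v, w` equals one of `v', w'`. -/
theorem wedge_bivec_eq_zero {x y x' y' : M} (h : x = x' ∨ x = y' ∨ y = x' ∨ y = y') :
    wedge (R := R) (show 2 + 2 = 4 from rfl) (bivec x y) (bivec x' y') = 0 := by
  apply Subtype.ext
  rw [wedge_coe, bivec_coe, bivec_coe]
  have sq := fun z : M => ExteriorAlgebra.ι_sq_zero (R := R) z
  rcases h with rfl | rfl | rfl | rfl
  · rw [mul_assoc, ι_mul_bivec y, ← mul_assoc, ← mul_assoc, sq]; simp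
  · rw [ι_mul_ι x' x, mul_assoc, mul_neg, ι_mul_bivec y, mul_neg, ← mul_assoc, ← mul_assoc, sq]
    simp
  · rw [mul_assoc, ← mul_assoc _ _ (ExteriorAlgebra.ι R y'), sq]; simp
  · rw [ι_mul_ι x' y, mul_neg, mul_assoc, ← mul_assoc _ _ (ExteriorAlgebra.ι R x'), sq]; simp

theorem wedge_bivec_comm (x y x' y' : M) :
    wedge (R := R) (show 2 + 2 = 4 from rfl) (bivec x y) (bivec x' y') =
      wedge (show 2 + 2 = 4 from rfl) (bivec x' y') (bivec x y) := by
  apply Subtype.ext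
  rw [wedge_coe, wedge_coe, bivec_coe, bivec_coe, mul_assoc, ι_mul_bivec y, ← mul_assoc,
    ι_mul_bivec x, mul_assoc]

namespace BoxConstruction

variable (R M)

/-- The map from the free module on pairs of vectors onto `Λ² M`. -/
noncomputable def proj : ((Fin 2 → M) →₀ R) →ₗ[R] ⋀[R]^2 M :=
  Finsupp.linearCombination R (fun g => exteriorPower.ιMulti R 2 g)

/-- The bilinear map on the free module on pairs which sends `(g, h)` to
`g 0 ∧ g 1 ∧ h 0 ∧ h 1` if `g < h` in an auxiliary linear order and to `0` otherwise. -/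
noncomputable def bilin :
    ((Fin 2 → M) →₀ R) →ₗ[R] ((Fin 2 → M) →₀ R) →ₗ[R] ⋀[R]^4 M :=
  open scoped Classical in
  Finsupp.linearCombination R (fun g =>
    Finsupp.linearCombination R (fun h =>
      if WellOrderingRel g h then
        wedge (show 2 + 2 = 4 from rfl) (exteriorPower.ιMulti R 2 g) (exteriorPower.ιMulti R 2 h)
      else 0))

variable {R M}

theorem ιMulti_eq_bivec (g : Fin 2 → M) : exteriorPower.ιMulti R 2 g = bivec (g 0) (g 1) := by
  unfold bivec
  congr 1
  ext i
  fin_cases i <;> rfl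

theorem bilin_add_swap (x y : (Fin 2 → M) →₀ R) :
    bilin R M x y + bilin R M y x =
      wedge (show 2 + 2 = 4 from rfl) (proj R M x) (proj R M y) := by
  classical
  have key : bilin R M + (bilin R M).flip =
      (wedge (show 2 + 2 = 4 from rfl)).compl₁₂ (proj R M) (proj R M) := by
    ext g h : 4
    simp only [LinearMap.coe_comp, Function.comp_apply, Finsupp.lsingle_apply,
      LinearMap.add_apply, LinearMap.flip_apply, LinearMap.compl₁₂_apply, bilin, proj,
      Finsupp.linearCombination_single, one_smul]
    rcases trichotomous_of WellOrderingRel g h with hgh | rfl | hgh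
    · rw [if_pos hgh, if_neg (asymm hgh), add_zero]
    · rw [if_neg (irrefl g), add_zero, ιMulti_eq_bivec, wedge_bivec_eq_zero (Or.inl rfl)]
    · rw [if_neg (asymm hgh), if_pos hgh, zero_add, ιMulti_eq_bivec, ιMulti_eq_bivec,
        wedge_bivec_comm]
  exact LinearMap.congr_fun (LinearMap.congr_fun key x) y

/-- The quadratic map of `bilin`. -/
noncomputable def quad : QuadraticMap R ((Fin 2 → M) →₀ R) (⋀[R]^4 M) :=
  LinearMap.BilinMap.toQuadraticMap (bilin R M)

theorem quad_add (x y : (Fin 2 → M) →₀ R) :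
    quad (x + y) = quad x + quad y +
      wedge (show 2 + 2 = 4 from rfl) (proj R M x) (proj R M y) := by
  rw [← bilin_add_swap]
  simp only [quad, LinearMap.BilinMap.toQuadraticMap_apply, map_add, LinearMap.add_apply]
  abel

theorem quad_single (g : Fin 2 → M) (c : R) : quad (Finsupp.single g c) = 0 := by
  simp [quad, bilin, LinearMap.BilinMap.toQuadraticMap_apply,
    Finsupp.linearCombination_single, irrefl (r := WellOrderingRel) g]

theorem proj_single (g : Fin 2 → M) (c : R) :
    proj R M (Finsupp.single g c) = c • bivec (g 0) (g 1) := by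
  rw [proj, Finsupp.linearCombination_single, ιMulti_eq_bivec]

theorem quad_relation (r : (exteriorPower.presentation.relations R (Fin 2) M).R) :
    quad ((exteriorPower.presentation.relations R (Fin 2) M).relation r) = 0 := by
  have two : ∀ i : Fin 2, i = 0 ∨ i = 1 := by decide
  rcases r with ⟨m, i, x, y⟩ | ⟨m, i, c, x⟩ | ⟨m, i, j, hm, hij⟩
  · change quad (Finsupp.single (Function.update m i x) (1 : R) +
      Finsupp.single (Function.update m i y) 1 -
      Finsupp.single (Function.update m i (x + y)) 1) = 0
    rw [sub_eq_add_neg, ← Finsupp.single_neg, quad_add, quad_add]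
    simp only [quad_single, map_add, proj_single, map_smul, LinearMap.add_apply,
      LinearMap.smul_apply]
    rcases two i with rfl | rfl
    · simp [wedge_bivec_eq_zero]
    · simp [wedge_bivec_eq_zero]
  · change quad (Finsupp.single (Function.update m i (c • x)) (1 : R) -
      c • Finsupp.single (Function.update m i x) 1) = 0
    rw [sub_eq_add_neg, Finsupp.smul_single, ← Finsupp.single_neg, quad_add]
    simp only [quad_single, proj_single, map_smul, LinearMap.smul_apply]
    rcases two i with rfl | rfl
    · simp [wedge_bivec_eq_zero]
    · simp [wedge_bivec_eq_zero]
  · exact quad_single m 1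

/-- The submodule of the kernel of `proj` on which `quad` vanishes. -/
def kerQuad (R : Type*) (M : Type*) [CommRing R] [AddCommGroup M] [Module R M] :
    Submodule R ((Fin 2 → M) →₀ R) where
  carrier := {x | proj R M x = 0 ∧ quad x = 0}
  zero_mem' := ⟨map_zero _, QuadraticMap.map_zero _⟩
  add_mem' := by
    rintro y z ⟨hy, hy'⟩ ⟨hz, hz'⟩
    refine ⟨by rw [map_add, hy, hz, add_zero], ?_⟩
    rw [quad_add, hy', hz', hy]
    simp
  smul_mem' := by
    rintro c y ⟨hy, hy'⟩
    exact ⟨by rw [map_smul, hy, smul_zero], by rw [QuadraticMap.map_smul, hy', smul_zero]⟩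

/-- The standard relations between decomposable bivectors. -/
noncomputable def rel (R : Type*) (M : Type*) [CommRing R] [AddCommGroup M] [Module R M]
    (r : (exteriorPower.presentation.relations R (Fin 2) M).R) : (Fin 2 → M) →₀ R :=
  (exteriorPower.presentation.relations R (Fin 2) M).relation r

theorem ker_proj : LinearMap.ker (proj R M) = Submodule.span R (Set.range (rel R M)) :=
  (exteriorPower.presentation R 2 M).toIsPresentation.ker_π

theorem quad_eq_zero_of_proj {x : (Fin 2 → M) →₀ R} (hx : proj R M x = 0) : quad x = 0 := by
  have hle : Submodule.span R (Set.range (rel R M)) ≤ kerQuad R M := by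
    rw [Submodule.span_le]
    rintro _ ⟨r, rfl⟩
    exact ⟨ker_proj.ge (Submodule.subset_span ⟨r, rfl⟩), quad_relation r⟩
  exact (hle (ker_proj.le hx)).2

theorem quad_eq_of_proj {x y : (Fin 2 → M) →₀ R} (h : proj R M x = proj R M y) :
    quad x = quad y := by
  have h0 : proj R M (y - x) = 0 := by rw [map_sub, h, sub_self]
  have := quad_add x (y - x)
  rw [h0, quad_eq_zero_of_proj h0] at this
  simpa using this.symm

theorem proj_surjective : Function.Surjective (proj R M) := by
  rw [← LinearMap.range_eq_top, proj, Finsupp.range_linearCombination]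
  exact exteriorPower.ιMulti_span R 2 M

/-- An arbitrary lift of a bivector to the free module on pairs. -/
noncomputable def lift (μ : ⋀[R]^2 M) : (Fin 2 → M) →₀ R := (proj_surjective μ).choose

theorem proj_lift (μ : ⋀[R]^2 M) : proj R M (lift μ) = μ := (proj_surjective μ).choose_spec

end BoxConstruction

open BoxConstruction in
/-- The quadratic map `μ ↦ μ^□` from `Λ² M` to `Λ⁴ M`, given by
`(∑ i, v i ∧ w i)^□ = ∑ i < j, v i ∧ w i ∧ v j ∧ w j` (see `box_sum`). -/
noncomputable def box : QuadraticMap R (⋀[R]^2 M) (⋀[R]^4 M) where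
  toFun μ := quad (lift μ)
  toFun_smul c μ := by
    rw [← QuadraticMap.map_smul]
    apply quad_eq_of_proj
    rw [map_smul, proj_lift, proj_lift]
  exists_companion' := ⟨wedge (show 2 + 2 = 4 from rfl), fun μ ν => by
    have : quad (lift (μ + ν)) = quad (lift μ + lift ν) := by
      apply quad_eq_of_proj
      rw [map_add, proj_lift, proj_lift, proj_lift]
    rw [this, quad_add, proj_lift, proj_lift]⟩

theorem box_add (μ ν : ⋀[R]^2 M) :
    box (μ + ν) = box μ + box ν + wedge (show 2 + 2 = 4 from rfl) μ ν := by
  change BoxConstruction.quad _ = BoxConstruction.quad _ + BoxConstruction.quad _ + _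
  have : BoxConstruction.quad (BoxConstruction.lift (μ + ν)) =
      BoxConstruction.quad (BoxConstruction.lift μ + BoxConstruction.lift ν) := by
    apply BoxConstruction.quad_eq_of_proj
    rw [map_add, BoxConstruction.proj_lift, BoxConstruction.proj_lift,
      BoxConstruction.proj_lift]
  rw [this, BoxConstruction.quad_add, BoxConstruction.proj_lift, BoxConstruction.proj_lift]

theorem box_bivec (x y : M) : box (bivec (R := R) x y) = 0 := by
  change BoxConstruction.quad _ = 0
  rw [← BoxConstruction.quad_single (R := R) ![x, y] 1]
  apply BoxConstruction.quad_eq_of_proj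
  rw [BoxConstruction.proj_lift, BoxConstruction.proj_single]
  simp

/-- The defining formula of `μ^□`. -/
theorem box_sum {n : ℕ} (a b : Fin n → M) :
    box (∑ i, bivec (R := R) (a i) (b i)) =
      ∑ j, ∑ i ∈ Finset.univ.filter (fun i => i < j),
        exteriorPower.ιMulti R 4 ![a i, b i, a j, b j] := by
  have hw : ∀ x y z t : M, exteriorPower.ιMulti R 4 ![x, y, z, t] =
      wedge (show 2 + 2 = 4 from rfl) (bivec x y) (bivec z t) := by
    intro x y z t
    apply Subtype.ext
    rw [wedge_coe, bivec_coe, bivec_coe]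
    simp [ExteriorAlgebra.ιMulti_apply, mul_assoc]
  simp only [hw, Finset.sum_filter]
  induction n with
  | zero => simp
  | succ n ih =>
    rw [Fin.sum_univ_castSucc, box_add, box_bivec, ih, Fin.sum_univ_castSucc, add_zero]
    congr 1
    · refine Finset.sum_congr rfl fun j _ => ?_
      rw [Fin.sum_univ_castSucc, if_neg (not_lt.mpr (Fin.le_last _)), add_zero]
      simp
    · rw [Fin.sum_univ_castSucc]
      simp [Fin.castSucc_lt_last]

/-- For `α ∈ Λ⁴ M`, the linear map `v ↦ α ∧ v` from `M` to `Λ⁵ M`; this is `α` regarded as an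
element of `Λ⁵ M ⊗ M^*`. -/
noncomputable def wedgeVec (α : ⋀[R]^4 M) : M →ₗ[R] ⋀[R]^5 M :=
  wedge (show 4 + 1 = 5 from rfl) α ∘ₗ
    (ExteriorAlgebra.ι R).codRestrict (⋀[R]^1 M) (fun x => by
      simp [ExteriorAlgebra.exteriorPower])

theorem wedgeVec_coe (α : ⋀[R]^4 M) (x : M) :
    (wedgeVec α x : ExteriorAlgebra R M) = (α : ExteriorAlgebra R M) * ExteriorAlgebra.ι R x :=
  rfl

/-- For linear maps `f, g : M → N`, the alternating map
`(v, w) ↦ f v ⊗ g w - f w ⊗ g v`, i.e. `f ∧ g`. -/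
noncomputable def wedgeMaps {N : Type*} [AddCommGroup N] [Module R N] (f g : M →ₗ[R] N) :
    M [⋀^Fin 2]→ₗ[R] N ⊗[R] N where
  toFun m := f (m 0) ⊗ₜ[R] g (m 1) - f (m 1) ⊗ₜ[R] g (m 0)
  map_update_add' m i x y := by
    fin_cases i <;> simp [TensorProduct.add_tmul, TensorProduct.tmul_add] <;> abel
  map_update_smul' m i c x := by
    fin_cases i <;> simp [TensorProduct.smul_tmul', TensorProduct.tmul_smul, smul_sub]
  map_eq_zero_of_eq' m i j h hij := by
    have : m 0 = m 1 := by
      fin_cases i <;> fin_cases j <;> simp_all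
    simp [this]

/-- The contraction `μ(α, β) ∈ (Λ⁵ M)^{⊗2}` of `μ ∈ Λ² M` with `α, β ∈ Λ⁴ M`. It is linear in `μ`
and satisfies `(v ∧ w)(α, β) = (α ∧ v) ⊗ (β ∧ w) - (α ∧ w) ⊗ (β ∧ v)`. -/
noncomputable def contract (μ : ⋀[R]^2 M) (α β : ⋀[R]^4 M) : ⋀[R]^5 M ⊗[R] ⋀[R]^5 M :=
  exteriorPower.alternatingMapLinearEquiv (wedgeMaps (wedgeVec α) (wedgeVec β)) μ

theorem contract_bivec (x y : M) (α β : ⋀[R]^4 M) :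
    contract (bivec x y) α β =
      wedgeVec α x ⊗ₜ[R] wedgeVec β y - wedgeVec α y ⊗ₜ[R] wedgeVec β x := by
  rw [contract, bivec, exteriorPower.alternatingMapLinearEquiv_apply_ιMulti]
  rfl

end Exterior

section Resolvents

variable (R : Type*) (Q : Type*) [CommRing R] [CommRing Q] [Algebra R Q]

/-- The module `L = Q / R`. -/
abbrev ModBase : Type _ := Q ⧸ LinearMap.range (Algebra.linearMap R Q)

/-- The class in `L = Q / R` of an element of `Q`. -/
abbrev toModBase : Q →ₗ[R] ModBase R Q := Submodule.mkQ _

/-- The line `Λ⁴ L`, where `L = Q / R`. -/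
abbrev TopL : Type _ := ⋀[R]^4 (ModBase R Q)

/-- `(Λ⁴ L)^{⊗3}`. -/
abbrev TopLCube : Type _ := TopL R Q ⊗[R] (TopL R Q ⊗[R] TopL R Q)

/-- Resolvent data on a module `M` for the `R`-algebra `Q`: linear maps
`φ : Λ⁴ L ⊗ L → Λ² M` and `θ : Λ⁵ M → (Λ⁴ L)^{⊗3}`, where `L = Q / R`, such that
`θ^{⊗2} [φ(λ₁ x) (φ(λ₂ y)^□, φ(λ₃ z)^□)] = λ₁ λ₂² λ₃² (x ∧ y ∧ z ∧ yz)` in `(Λ⁴ L)^{⊗6}`,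
for all `λ₁, λ₂, λ₃ ∈ Λ⁴ L` and all `x, y, z ∈ L` (given by representatives in `Q`). -/
structure Resolvent (M : Type*) [AddCommGroup M] [Module R M] where
  phi : TopL R Q ⊗[R] ModBase R Q →ₗ[R] ⋀[R]^2 M
  theta : ⋀[R]^5 M →ₗ[R] TopLCube R Q
  identity : ∀ (l₁ l₂ l₃ : TopL R Q) (x y z : Q),
    TensorProduct.map theta theta
      (contract (phi (l₁ ⊗ₜ[R] toModBase R Q x))
        (box (phi (l₂ ⊗ₜ[R] toModBase R Q y)))
        (box (phi (l₃ ⊗ₜ[R] toModBase R Q z)))) =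
    (l₁ ⊗ₜ[R] (l₂ ⊗ₜ[R] l₂)) ⊗ₜ[R]
      (l₃ ⊗ₜ[R] (l₃ ⊗ₜ[R] exteriorPower.ιMulti R 4
        ![toModBase R Q x, toModBase R Q y, toModBase R Q z, toModBase R Q (y * z)]))

variable {R Q}

/-- A resolvent is numerical if `θ` is an isomorphism. -/
def Resolvent.IsNumerical {M : Type*} [AddCommGroup M] [Module R M] (ρ : Resolvent R Q M) : Prop :=
  Function.Bijective ρ.theta

/-- Two resolvents `(M, φ, θ)` and `(N, φ', θ')` of `Q` are isomorphic if there is an isomorphism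
`f : M ≃ N` with `Λ² f ∘ φ = φ'` and `θ' ∘ Λ⁵ f = θ`. -/
def Resolvent.Isomorphic {M N : Type*} [AddCommGroup M] [Module R M] [AddCommGroup N] [Module R N]
    (ρ : Resolvent R Q M) (σ : Resolvent R Q N) : Prop :=
  ∃ f : M ≃ₗ[R] N,
    exteriorPower.map 2 f.toLinearMap ∘ₗ ρ.phi = σ.phi ∧
      σ.theta ∘ₗ exteriorPower.map 5 f.toLinearMap = ρ.theta

end Resolvents

section IntegralClasses

variable (R : Type*) (K : Type*) (Q : Type*) [CommRing R] [CommRing K] [Algebra R K]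
  [CommRing Q] [Algebra R Q]

/-- The quotient `Q_K / Q`, where `Q_K = K ⊗ Q`. -/
abbrev GenericQuot : Type _ :=
  (K ⊗[R] Q) ⧸ LinearMap.range
    (Algebra.TensorProduct.includeRight : Q →ₐ[R] K ⊗[R] Q).toLinearMap

/-- The `R/p`-module `p⁻¹Q / Q`, where `p⁻¹Q` is the set of all `x ∈ Q_K` with `p x ⊆ Q`: it is
the set of elements of `Q_K / Q` which are killed by `p`. -/
abbrev InvQuot (p : Ideal R) : Type _ := Submodule.torsionBySet R (GenericQuot R K Q) (p : Set R)

/-- The `R/p`-subspace of `p⁻¹Q / Q` of the classes whose elements are integral over `R`.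
(If `Q` is integral over `R`, one element of a class is integral over `R` iff all are.) -/
def integralClasses (p : Ideal R) : Submodule (R ⧸ p) (InvQuot R K Q p) where
  carrier := {c | ∃ x : K ⊗[R] Q, IsIntegral R x ∧ Submodule.Quotient.mk x = c.1}
  zero_mem' := ⟨0, isIntegral_zero, rfl⟩
  add_mem' := by
    rintro c d ⟨x, hx, hxc⟩ ⟨y, hy, hyd⟩
    exact ⟨x + y, hx.add hy, by rw [Submodule.Quotient.mk_add, hxc, hyd]; rfl⟩
  smul_mem' := by
    intro r c hc
    obtain ⟨r, rfl⟩ := Ideal.Quotient.mk_surjective r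
    obtain ⟨x, hx, hxc⟩ := hc
    exact ⟨r • x, hx.smul r, by rw [Submodule.Quotient.mk_smul, hxc]; rfl⟩

end IntegralClasses

/-! ### Pfaffians of alternating 5 × 5 matrices. -/

section PfaffianVector

variable {A : Type*} [CommRing A]

/-! In coordinates a resolvent is linear algebra. Over K, choose a basis of Q_K beginning with 1.
Then φ becomes a linear family a(x) of alternating 5 × 5 matrices, φ(y)^□ becomes the vector
pf(a(y)) of 4 × 4 sub-Pfaffians, θ becomes a multiple of the volume form, and the identity reads
q(y)·a(x)q(z) = det(x, y, z, yz) with q a multiple of pf ∘ a. The proof first forgets the relation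
between q and a: a model (`IsModel`) is a pair (a, q), with the values of q spanning, that satisfies
this identity. Putting x = z gives a(z)q(z) = 0, so pf(a(z)) is parallel to q(z) (`pfVec_mul_comm`),
and unique factorization of polynomials gives pf ∘ a = c q with a constant c
(`IsModel.exists_pfVec_eq_smul`). It remains to find a model over K and to show that c becomes a
unit at every prime once q is normalized integrally.

Existence over K. For fixed x, the expression det(x, y, z, yz) extends to an alternating form on the
ten-dimensional space of symmetric arrays spanned by the squares y² (`squareForm`). A symmetric
Q_K-linear map from the dual of Q_K to Q_K yields a vector in the radical of all these forms
(`squareForm_balancedBlock`). Five independent ones leave a five-dimensional quotient, which carries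
a and q. If Q_K is Frobenius, multiplications supply the five maps. Otherwise the socle contains a
simple module twice; the hypothesis at one prime bounds the nilpotents by dimension two, so Q_K is
K[x, y]/(x, y)² times a quadratic algebra, and the five maps are written down.

Unit. Let A be the local ring at a prime, and take the A-span of the values of q as the lattice A⁵.
Then a is automatically integral and the constant lies in A. If it were not a unit, every form a(x)
would be decomposable over the residue field. The classification of linear families of such forms
(`decomposable_family`) then gives det(x, y, z, yz) = ℓ(y)ℓ(z) det(x, y, z, w), and hence linear
forms χ, ℓ on the reduction with χ(1) = 1 and (ker χ ∩ ker ℓ) · ker χ = 0 (`IsModel.degenerate`).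
Lifts of three independent elements of ker χ ∩ ker ℓ, divided by a uniformizer, preserve the lattice
χ = 0 and are therefore integral, against the hypothesis (`IntegralRankLETwo.not_degenerate`).

Gluing. M is the lattice of all m in K⁵ with m·q(y) in Λ⁴L for every y (`dualLattice`), and θ is c⁻¹
times the volume. Since c is locally a unit after normalization, φ and θ are integral on M and θ is
an isomorphism. Conversely, over K every resolvent can be brought to the same a and c⁻¹ vol
(`IsModel.exists_transform`). Integrality of θ then puts its lattice inside M; integrality of φ
shows that the local index matrix g has all entries divisible by det g, so that det g = (det g)⁵ d
for some d and det g is a unit. Every resolvent thus has the lattice M, which is uniqueness. -/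

/-- A square matrix of an alternating bilinear form. -/
def IsAltMatrix {n : ℕ} (B : Matrix (Fin n) (Fin n) A) : Prop :=
  (∀ i, B i i = 0) ∧ ∀ i j, B j i = -B i j

/-- The vector of signed `4 × 4` sub-Pfaffians of an alternating `5 × 5` matrix. -/
def pfVec (B : Matrix (Fin 5) (Fin 5) A) : Fin 5 → A :=
  ![B 1 2 * B 3 4 - B 1 3 * B 2 4 + B 1 4 * B 2 3,
    -(B 0 2 * B 3 4 - B 0 3 * B 2 4 + B 0 4 * B 2 3),
    B 0 1 * B 3 4 - B 0 3 * B 1 4 + B 0 4 * B 1 3,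
    -(B 0 1 * B 2 4 - B 0 2 * B 1 4 + B 0 4 * B 1 2),
    B 0 1 * B 2 3 - B 0 2 * B 1 3 + B 0 3 * B 1 2]

/-- The polar form of `pfVec`. -/
def pfPolar (B C : Matrix (Fin 5) (Fin 5) A) : Fin 5 → A :=
  ![B 1 2 * C 3 4 - B 1 3 * C 2 4 + B 1 4 * C 2 3 + (C 1 2 * B 3 4 - C 1 3 * B 2 4 + C 1 4 * B 2 3),
    -(B 0 2 * C 3 4 - B 0 3 * C 2 4 + B 0 4 * C 2 3 +
      (C 0 2 * B 3 4 - C 0 3 * B 2 4 + C 0 4 * B 2 3)),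
    B 0 1 * C 3 4 - B 0 3 * C 1 4 + B 0 4 * C 1 3 + (C 0 1 * B 3 4 - C 0 3 * B 1 4 + C 0 4 * B 1 3),
    -(B 0 1 * C 2 4 - B 0 2 * C 1 4 + B 0 4 * C 1 2 +
      (C 0 1 * B 2 4 - C 0 2 * B 1 4 + C 0 4 * B 1 2)),
    B 0 1 * C 2 3 - B 0 2 * C 1 3 + B 0 3 * C 1 2 + (C 0 1 * B 2 3 - C 0 2 * B 1 3 + C 0 3 * B 1 2)]

theorem pfVec_smul (c : A) (B : Matrix (Fin 5) (Fin 5) A) : pfVec (c • B) = c ^ 2 • pfVec B := by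
  ext i
  fin_cases i <;> simp [pfVec] <;> ring

theorem pfVec_add (B C : Matrix (Fin 5) (Fin 5) A) :
    pfVec (B + C) = pfVec B + pfVec C + pfPolar B C := by
  ext i
  fin_cases i <;> simp [pfVec, pfPolar] <;> ring

theorem pfVec_map {A' : Type*} [CommRing A'] (f : A →+* A') (B : Matrix (Fin 5) (Fin 5) A) :
    pfVec (B.map f) = fun i => f (pfVec B i) := by
  ext i
  fin_cases i <;> simp [pfVec]

/-- The difference of the two sides is a combination, with entries of `B` as coefficients, of the
three coordinates of `B v` whose indices differ from `i` and `j`. No division occurs. -/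
theorem pfVec_mul_comm {B : Matrix (Fin 5) (Fin 5) A} (hB : IsAltMatrix B) {v : Fin 5 → A}
    (hv : B.mulVec v = 0) (i j : Fin 5) : pfVec B i * v j = pfVec B j * v i := by
  have h : ∀ i, B i 0 * v 0 + B i 1 * v 1 + B i 2 * v 2 + B i 3 * v 3 + B i 4 * v 4 = 0 := by
    intro i
    have := congrFun hv i
    simpa [Matrix.mulVec, dotProduct, Fin.sum_univ_five] using this
  have h0 := h 0
  have h1 := h 1
  have h2 := h 2
  have h3 := h 3
  have h4 := h 4
  simp only [hB.1, hB.2 0 1, hB.2 0 2, hB.2 0 3, hB.2 0 4, hB.2 1 2, hB.2 1 3, hB.2 1 4,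
    hB.2 2 3, hB.2 2 4, hB.2 3 4] at h0 h1 h2 h3 h4
  have key : ∀ i j : Fin 5, i < j → pfVec B i * v j = pfVec B j * v i := by
    intro i j hij
    fin_cases i <;> fin_cases j <;> first | (exact absurd hij (by decide)) | skip
    all_goals simp [pfVec]
    · linear_combination -(B 3 4 * h2 - B 2 4 * h3 + B 2 3 * h4)
    · linear_combination (B 3 4 * h1 - B 1 4 * h3 + B 1 3 * h4)
    · linear_combination -(B 2 4 * h1 - B 1 4 * h2 + B 1 2 * h4)
    · linear_combination (B 2 3 * h1 - B 1 3 * h2 + B 1 2 * h3)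
    · linear_combination -(B 3 4 * h0 - B 0 4 * h3 + B 0 3 * h4)
    · linear_combination (B 2 4 * h0 - B 0 4 * h2 + B 0 2 * h4)
    · linear_combination -(B 2 3 * h0 - B 0 3 * h2 + B 0 2 * h3)
    · linear_combination -(B 1 4 * h0 - B 0 4 * h1 + B 0 1 * h4)
    · linear_combination (B 1 3 * h0 - B 0 3 * h1 + B 0 1 * h3)
    · linear_combination -(B 1 2 * h0 - B 0 2 * h1 + B 0 1 * h2)
  rcases lt_trichotomy i j with hij | rfl | hij
  · exact key i j hij
  · rfl
  · exact (key j i hij).symm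

end PfaffianVector

/-! ### Volume, Plücker coordinates and the square map in coordinates. -/

section LatticeCoordinates

variable {R K N : Type*} [CommRing R] [CommRing K] [Algebra R K] [AddCommGroup N] [Module R N]

/-- The determinant as an alternating map in coordinates `N → Kⁿ`. -/
noncomputable def detAlt {n : ℕ} (c : N →ₗ[R] (Fin n → K)) : N [⋀^Fin n]→ₗ[R] K where
  toMultilinearMap :=
    ((Matrix.detRowAlternating (n := Fin n) (R := K)).toMultilinearMap.restrictScalars
      R).compLinearMap fun _ => c
  map_eq_zero_of_eq' v i j h hij :=
    (Matrix.detRowAlternating (n := Fin n) (R := K)).map_eq_zero_of_eq (fun i => c (v i))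
      (by simp [h]) hij

/-- The volume form `Λⁿ N → K` attached to coordinates `N → Kⁿ`. -/
noncomputable def vol {n : ℕ} (c : N →ₗ[R] (Fin n → K)) : ⋀[R]^n N →ₗ[R] K :=
  exteriorPower.alternatingMapLinearEquiv (detAlt c)

theorem vol_ιMulti {n : ℕ} (c : N →ₗ[R] (Fin n → K)) (v : Fin n → N) :
    vol c (exteriorPower.ιMulti R n v) = Matrix.det (Matrix.of fun i => c (v i)) := by
  rw [vol, exteriorPower.alternatingMapLinearEquiv_apply_ιMulti]
  rfl

/-- The alternating map `(v, w) ↦ (v i * w j - v j * w i)`. -/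
noncomputable def minorsAlt {n : ℕ} (c : N →ₗ[R] (Fin n → K)) :
    N [⋀^Fin 2]→ₗ[R] Matrix (Fin n) (Fin n) K where
  toFun m := Matrix.of fun i j => c (m 0) i * c (m 1) j - c (m 0) j * c (m 1) i
  map_update_add' m i x y := by
    ext k l
    fin_cases i <;> simp <;> ring
  map_update_smul' m i r x := by
    ext k l
    fin_cases i <;> simp [smul_sub]
  map_eq_zero_of_eq' m i j h hij := by
    have : m 0 = m 1 := by
      fin_cases i <;> fin_cases j <;> simp_all
    ext k l
    simp [this, mul_comm]

/-- The Plücker coordinates `Λ² N → Alt_n(K)` attached to coordinates `N → Kⁿ`. -/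
noncomputable def minors {n : ℕ} (c : N →ₗ[R] (Fin n → K)) :
    ⋀[R]^2 N →ₗ[R] Matrix (Fin n) (Fin n) K :=
  exteriorPower.alternatingMapLinearEquiv (minorsAlt c)

theorem minors_bivec {n : ℕ} (c : N →ₗ[R] (Fin n → K)) (v w : N) (i j : Fin n) :
    minors c (bivec v w) i j = c v i * c w j - c v j * c w i := by
  rw [minors, bivec, exteriorPower.alternatingMapLinearEquiv_apply_ιMulti]
  rfl

theorem bivec_induction {P : ⋀[R]^2 N → Prop} (h0 : P 0) (hb : ∀ v w, P (bivec v w))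
    (hs : ∀ (r : R) μ, P μ → P (r • μ)) (ha : ∀ μ ν, P μ → P ν → P (μ + ν)) (μ) : P μ := by
  have hμ : μ ∈ Submodule.span R (Set.range (exteriorPower.ιMulti R 2 (M := N))) := by
    rw [exteriorPower.ιMulti_span]; trivial
  induction hμ using Submodule.span_induction with
  | mem x hx =>
    obtain ⟨g, rfl⟩ := hx
    rw [BoxConstruction.ιMulti_eq_bivec]
    exact hb _ _
  | zero => exact h0
  | add x y _ _ hx hy => exact ha _ _ hx hy
  | smul r x _ hx => exact hs _ _ hx

theorem minors_isAlt {n : ℕ} (c : N →ₗ[R] (Fin n → K)) (μ : ⋀[R]^2 N) :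
    IsAltMatrix (minors c μ) := by
  induction μ using bivec_induction with
  | h0 => simp [IsAltMatrix]
  | hb v w =>
    refine ⟨fun i => ?_, fun i j => ?_⟩
    · rw [minors_bivec]; ring
    · rw [minors_bivec, minors_bivec]; ring
  | hs r μ h => exact ⟨fun i => by simp [h.1 i], fun i j => by simp [h.2 i j]⟩
  | ha μ ν h h' =>
    exact ⟨fun i => by simp [h.1 i, h'.1 i], fun i j => by simp [h.2 i j, h'.2 i j, add_comm]⟩

/-- Laplace expansion: first along the last row, then each 4 × 4 minor along its first two rows. -/
theorem det_five_pfPolar (v w x y n : Fin 5 → K) :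
    Matrix.det (Matrix.of ![v, w, x, y, n]) =
      pfPolar (Matrix.of fun i j => v i * w j - v j * w i)
        (Matrix.of fun i j => x i * y j - x j * y i) ⬝ᵥ n := by
  simp [Matrix.det_succ_row_zero, Fin.sum_univ_succ, pfPolar, dotProduct, Fin.succAbove,
    Matrix.submatrix]
  ring

theorem vol_wedgeVec_wedge (c : N →ₗ[R] (Fin 5 → K)) (μ ν : ⋀[R]^2 N) (n : N) :
    vol c (wedgeVec (wedge (show 2 + 2 = 4 from rfl) μ ν) n) =
      pfPolar (minors c μ) (minors c ν) ⬝ᵥ c n := by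
  have hadd : ∀ B B' C : Matrix (Fin 5) (Fin 5) K,
      pfPolar (B + B') C = pfPolar B C + pfPolar B' C := by
    intro B B' C
    ext i; fin_cases i <;> simp [pfPolar] <;> ring
  have hadd' : ∀ C B B' : Matrix (Fin 5) (Fin 5) K,
      pfPolar C (B + B') = pfPolar C B + pfPolar C B' := by
    intro C B B'
    ext i; fin_cases i <;> simp [pfPolar] <;> ring
  have hsm : ∀ (r : R) (B C : Matrix (Fin 5) (Fin 5) K), pfPolar (r • B) C = r • pfPolar B C := by
    intro r B C
    ext i; fin_cases i <;> simp [pfPolar, Algebra.smul_def] <;> ring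
  have hsm' : ∀ (r : R) (B C : Matrix (Fin 5) (Fin 5) K), pfPolar C (r • B) = r • pfPolar C B := by
    intro r B C
    ext i; fin_cases i <;> simp [pfPolar, Algebra.smul_def] <;> ring
  have h0 : ∀ C : Matrix (Fin 5) (Fin 5) K, pfPolar 0 C = 0 := by
    intro C
    ext i; fin_cases i <;> simp [pfPolar]
  have h0' : ∀ C : Matrix (Fin 5) (Fin 5) K, pfPolar C 0 = 0 := by
    intro C
    ext i; fin_cases i <;> simp [pfPolar]
  have wadd : ∀ a b : ⋀[R]^4 N, wedgeVec (a + b) n = wedgeVec a n + wedgeVec b n := by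
    intro a b; apply Subtype.ext; simp [wedgeVec_coe, add_mul]
  have wsm : ∀ (r : R) (a : ⋀[R]^4 N), wedgeVec (r • a) n = r • wedgeVec a n := by
    intro r a; apply Subtype.ext; simp [wedgeVec_coe]
  have wz : wedgeVec (0 : ⋀[R]^4 N) n = 0 := by
    apply Subtype.ext; simp [wedgeVec_coe]
  induction μ using bivec_induction with
  | h0 => simp [h0, wz]
  | hs r μ h => simp [hsm, wsm, h]
  | ha μ μ' h h' => simp [hadd, wadd, h, h', add_dotProduct]
  | hb v w =>
    induction ν using bivec_induction with
    | h0 => simp [h0', wz]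
    | hs r μ h => simp [hsm', wsm, h]
    | ha μ μ' h h' => simp [hadd', wadd, h, h', add_dotProduct]
    | hb x y =>
      have e : wedgeVec (wedge (show 2 + 2 = 4 from rfl) (bivec v w) (bivec x y)) n =
          exteriorPower.ιMulti R 5 ![v, w, x, y, n] := by
        apply Subtype.ext
        rw [wedgeVec_coe, wedge_coe, bivec_coe, bivec_coe]
        simp [ExteriorAlgebra.ιMulti_apply, mul_assoc]
      have e1 : minors c (bivec v w) = Matrix.of fun i j => c v i * c w j - c v j * c w i := by
        ext i j; exact minors_bivec c v w i j
      have e2 : minors c (bivec x y) = Matrix.of fun i j => c x i * c y j - c x j * c y i := by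
        ext i j; exact minors_bivec c x y i j
      rw [e, vol_ιMulti, e1, e2, ← det_five_pfPolar]
      congr 1
      ext i j
      fin_cases i <;> rfl

/-- This is how the square map enters coordinates. Both sides are quadratic in `μ`, have the same
polar form by `vol_wedgeVec_wedge`, and vanish on decomposable bivectors. -/
theorem vol_wedgeVec_box (c : N →ₗ[R] (Fin 5 → K)) (μ : ⋀[R]^2 N) (n : N) :
    vol c (wedgeVec (box μ) n) = pfVec (minors c μ) ⬝ᵥ c n := by
  have wadd : ∀ a b : ⋀[R]^4 N, wedgeVec (a + b) n = wedgeVec a n + wedgeVec b n := by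
    intro a b; apply Subtype.ext; simp [wedgeVec_coe, add_mul]
  have wsm : ∀ (r : R) (a : ⋀[R]^4 N), wedgeVec (r • a) n = r • wedgeVec a n := by
    intro r a; apply Subtype.ext; simp [wedgeVec_coe]
  have wz : wedgeVec (0 : ⋀[R]^4 N) n = 0 := by
    apply Subtype.ext; simp [wedgeVec_coe]
  induction μ using bivec_induction with
  | h0 =>
    have : pfVec (0 : Matrix (Fin 5) (Fin 5) K) = 0 := by
      ext i; fin_cases i <;> simp [pfVec]
    simp [wz, this]
  | hb v w =>
    have : pfVec (minors c (bivec (R := R) v w)) = 0 := by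
      ext i
      fin_cases i <;> simp [pfVec, minors_bivec] <;> ring
    rw [box_bivec, wz, this]
    simp
  | hs r μ h =>
    have : pfVec (r • minors c μ) = (r * r) • pfVec (minors c μ) := by
      rw [← algebraMap_smul K r, pfVec_smul, ← algebraMap_smul K (r * r), map_mul, sq]
    rw [QuadraticMap.map_smul, wsm, map_smul, map_smul, this, h, smul_dotProduct]
  | ha μ ν h h' =>
    rw [box_add, wadd, wadd, map_add, map_add, h, h', vol_wedgeVec_wedge, map_add, pfVec_add,
      add_dotProduct, add_dotProduct]

/-- The effect of a change of coordinates. -/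
theorem vol_mulVec (c : N →ₗ[R] (Fin 5 → K)) (g : Matrix (Fin 5) (Fin 5) K) (u : ⋀[R]^5 N) :
    vol ((g.mulVecLin.restrictScalars R) ∘ₗ c) u = g.det * vol c u := by
  have : vol ((g.mulVecLin.restrictScalars R) ∘ₗ c) = (LinearMap.mulLeft R g.det) ∘ₗ vol c := by
    apply exteriorPower.linearMap_ext
    ext v
    simp only [LinearMap.compAlternatingMap_apply, LinearMap.comp_apply, vol_ιMulti,
      LinearMap.mulLeft_apply]
    have : (Matrix.of fun i => ((g.mulVecLin.restrictScalars R) ∘ₗ c) (v i)) =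
        (Matrix.of fun i => c (v i)) * g.transpose := by
      ext i j
      simp [Matrix.mul_apply, Matrix.mulVec, dotProduct, mul_comm]
    simp only [LinearMap.comp_apply] at this
    rw [this, Matrix.det_mul, Matrix.det_transpose, mul_comm]
  rw [this]; rfl

theorem minors_mulVec (c : N →ₗ[R] (Fin 5 → K)) (g : Matrix (Fin 5) (Fin 5) K) (u : ⋀[R]^2 N) :
    minors ((g.mulVecLin.restrictScalars R) ∘ₗ c) u = g * minors c u * g.transpose := by
  induction u using bivec_induction with
  | h0 => simp
  | hs r μ h => simp [h]
  | ha μ ν h h' => simp [h, h', mul_add, add_mul]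
  | hb v w =>
    have : minors c (bivec (R := R) v w) =
        Matrix.vecMulVec (c v) (c w) - Matrix.vecMulVec (c w) (c v) := by
      ext i j
      rw [minors_bivec]
      simp [Matrix.vecMulVec_apply, mul_comm]
    rw [this, mul_sub, sub_mul, Matrix.mul_vecMulVec, Matrix.mul_vecMulVec, Matrix.vecMulVec_mul,
      Matrix.vecMulVec_mul, Matrix.vecMul_transpose, Matrix.vecMul_transpose]
    ext i j
    rw [minors_bivec]
    simp [Matrix.vecMulVec_apply, mul_comm]

/-- Allows identities for alternating matrices to be read off from the functoriality of exterior
powers instead of being expanded. -/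
theorem exists_minors_eq (B : Matrix (Fin 5) (Fin 5) K) (hB : IsAltMatrix B) :
    ∃ μ : ⋀[K]^2 (Fin 5 → K), minors (LinearMap.id : (Fin 5 → K) →ₗ[K] _) μ = B := by
  refine ⟨∑ i, ∑ j, if i < j then B i j • bivec (Pi.single i 1) (Pi.single j 1) else 0, ?_⟩
  have h : ∀ i j : Fin 5, minors (LinearMap.id : (Fin 5 → K) →ₗ[K] _)
      (if i < j then B i j • bivec (Pi.single i 1) (Pi.single j 1) else 0) =
      if i < j then Matrix.of (fun k l => B i j * ((Pi.single i 1 : Fin 5 → K) k *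
        (Pi.single j 1 : Fin 5 → K) l - (Pi.single i 1 : Fin 5 → K) l *
        (Pi.single j 1 : Fin 5 → K) k)) else 0 := by
    intro i j
    split_ifs
    · ext k l
      rw [map_smul, Matrix.smul_apply, minors_bivec]
      rfl
    · simp
  simp only [map_sum, h]
  ext k l
  have hB2 := hB.2
  fin_cases k <;> fin_cases l <;>
    simp [Matrix.sum_apply, Fin.sum_univ_five, hB.1, Pi.single_apply] <;>
    exact (hB2 _ _).symm

theorem pfVec_minors_congr (c : N →ₗ[R] (Fin 5 → K)) (g : Matrix (Fin 5) (Fin 5) K)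
    (μ : ⋀[R]^2 N) (n : N) :
    pfVec (g * minors c μ * g.transpose) ⬝ᵥ g.mulVec (c n) =
      g.det * (pfVec (minors c μ) ⬝ᵥ c n) := by
  rw [← minors_mulVec, ← vol_wedgeVec_box, ← vol_mulVec, vol_wedgeVec_box]
  rfl

/-- Paired with an arbitrary vector, this is the change-of-coordinates formula for the volume form.
The matrix `g` need not be invertible. -/
theorem pfVec_congr (g B : Matrix (Fin 5) (Fin 5) K) (hB : IsAltMatrix B) :
    g.transpose.mulVec (pfVec (g * B * g.transpose)) = g.det • pfVec B := by
  obtain ⟨μ, rfl⟩ := exists_minors_eq B hB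
  apply dotProduct_eq
  intro n
  have h := pfVec_minors_congr (LinearMap.id : (Fin 5 → K) →ₗ[K] _) g μ n
  refine Eq.trans ?_ (h.trans ?_)
  · rw [Matrix.mulVec_transpose, ← Matrix.dotProduct_mulVec]
    rfl
  · exact (smul_dotProduct g.det _ n).symm

end LatticeCoordinates

/-! ### Linear families of decomposable alternating forms. -/

section DecomposableFamilies

variable {k X E : Type*} [Field k] [AddCommGroup X] [Module k X] [AddCommGroup E] [Module k E]

/-- The polarization of the Plücker relation for a linear family of decomposable forms. -/
theorem plucker_polar (β : X →ₗ[k] E →ₗ[k] E →ₗ[k] k)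
    (hP : ∀ x u v s t, β x u v * β x s t - β x u s * β x v t + β x u t * β x v s = 0)
    (x y : X) (u v s t : E) :
    β x u v * β y s t - β x u s * β y v t + β x u t * β y v s +
      (β y u v * β x s t - β y u s * β x v t + β y u t * β x v s) = 0 := by
  have h := hP (x + y) u v s t
  simp only [map_add, LinearMap.add_apply] at h
  linear_combination h - hP x u v s t - hP y u v s t

/-- Two non-proportional decomposable forms with decomposable sum. -/
theorem exists_adapted_vectors (β : X →ₗ[k] E →ₗ[k] E →ₗ[k] k) (halt : ∀ x s, β x s s = 0)
    (hP : ∀ x u v s t, β x u v * β x s t - β x u s * β x v t + β x u t * β x v s = 0)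
    {x y : X} {u v : E} (huv : β x u v = 1) (hxy : ∀ c : k, β y ≠ c • β x) :
    ∃ u v s : E, β x u v = 1 ∧ β x u s = 0 ∧ β x v s = 0 ∧
      β y u v = 0 ∧ β y u s = 0 ∧ β y v s = 1 := by
  have hsw : ∀ z a b, β z a b = -β z b a := by
    intro z a b
    have h := halt z (a + b)
    simp only [map_add, LinearMap.add_apply, halt, zero_add, add_zero] at h
    linear_combination h
  -- Once `s` is orthogonal to `u` and `v` under `β x` but not to `v` under `β y`, correcting `u` by
  -- multiples of `v` and `s` and rescaling `s` gives the normal form.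
  have key : ∀ u v s : E, β x u v = 1 → β x u s = 0 → β x v s = 0 → β y v s ≠ 0 →
      ∃ u v s : E, β x u v = 1 ∧ β x u s = 0 ∧ β x v s = 0 ∧
        β y u v = 0 ∧ β y u s = 0 ∧ β y v s = 1 := by
    intro u v s h1 h2 h3 h4
    set m := β y v s with hm
    set d := β y u s
    set c := β y u v
    refine ⟨u - (d / m) • v + (c / m) • s, v, m⁻¹ • s, ?_, ?_, ?_, ?_, ?_, ?_⟩
    · simp [halt, h1, hsw x s v, h3]
    · simp [halt, h2, h3]
    · simp [h3]
    · have : β y s v = -m := hsw y s v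
      simp only [map_add, map_sub, map_smul, LinearMap.add_apply, LinearMap.sub_apply,
        LinearMap.smul_apply, halt, smul_eq_mul, mul_zero, sub_zero, this]
      change c + c / m * -m = 0
      field_simp
      ring
    · simp only [map_add, map_sub, map_smul, LinearMap.add_apply, LinearMap.sub_apply,
        LinearMap.smul_apply, halt, smul_eq_mul, mul_zero, add_zero]
      change m⁻¹ * (d - d / m * m) = 0
      field_simp
      ring
    · simp only [map_smul, smul_eq_mul]
      exact inv_mul_cancel₀ h4
  -- If `β y` also vanished between `u`, `v` and everything orthogonal to them under `β x`, the
  -- polar Plücker relation would make `β y` a multiple of `β x`.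
  have hex : ∃ s, β x u s = 0 ∧ β x v s = 0 ∧ (β y v s ≠ 0 ∨ β y u s ≠ 0) := by
    by_contra hcon
    push Not at hcon
    apply hxy (β y u v)
    ext a b
    have hproj : ∀ a : E, β x u (a - β x u a • v + β x v a • u) = 0 ∧
        β x v (a - β x u a • v + β x v a • u) = 0 := by
      intro a
      constructor
      · simp [halt, huv]
      · simp [halt, hsw x v u, huv]
    have hva := fun a => (hcon _ (hproj a).1 (hproj a).2).1
    have hua := fun a => (hcon _ (hproj a).1 (hproj a).2).2
    simp only [map_add, map_sub, map_smul, smul_eq_mul, halt] at hva hua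
    have h1 := plucker_polar β hP x y u v a b
    have h2 := hP x u v a b
    have e1 := hsw y v u
    rw [huv] at h1 h2
    simp only [LinearMap.smul_apply, smul_eq_mul]
    linear_combination h1 - (β y u v) * 2 * h2 + β x u a * hva b - β x u b * hva a
      + β x v a * (-hua b) + β x v b * hua a - β x u a * β x v b * e1 + β x u b * β x v a * e1
  obtain ⟨s, h1, h2, h3⟩ := hex
  by_cases h4 : β y v s = 0
  · have h5 : β y u s ≠ 0 := by
      rcases h3 with h3 | h3
      · exact absurd h4 h3
      · exact h3
    exact key (-v) u s (by simp [hsw x v u, huv]) (by simp [h2]) h1 h5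
  · exact key u v s huv h1 h2 h4

/-- Linear families of decomposable alternating forms: either all forms have a common linear
factor, or they are all pulled back from a three-dimensional space. -/
theorem decomposable_family (β : X →ₗ[k] E →ₗ[k] E →ₗ[k] k) (halt : ∀ x s, β x s s = 0)
    (hP : ∀ x u v s t, β x u v * β x s t - β x u s * β x v t + β x u t * β x v s = 0) :
    (∀ x s t, β x s t = 0) ∨
    (∃ f : E →ₗ[k] k, f ≠ 0 ∧ ∀ x, ∃ g : E →ₗ[k] k, ∀ s t, β x s t = f s * g t - f t * g s) ∨
    (∃ F : E →ₗ[k] (Fin 3 → k), Function.Surjective F ∧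
      ∃ τ : X →ₗ[k] (Fin 3 → k), Function.Surjective τ ∧
        ∀ x s t, β x s t = Matrix.det (Matrix.of ![τ x, F s, F t])) := by
  have hsw : ∀ z a b, β z a b = -β z b a := by
    intro z a b
    have h := halt z (a + b)
    simp only [map_add, LinearMap.add_apply, halt, zero_add, add_zero] at h
    linear_combination h
  by_cases h0 : ∀ x s t, β x s t = 0
  · exact Or.inl h0
  right
  push Not at h0
  obtain ⟨x₁, u, v, huv⟩ := h0
  have huv' : β x₁ ((β x₁ u v)⁻¹ • u) v = 1 := by simp [huv]
  by_cases hA : ∀ y, ∃ c : k, β y = c • β x₁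
  · left
    refine ⟨β x₁ ((β x₁ u v)⁻¹ • u), ?_, fun y => ?_⟩
    · intro h; rw [h] at huv'; simp at huv'
    · obtain ⟨c, hc⟩ := hA y
      refine ⟨c • β x₁ v, fun s t => ?_⟩
      have := hP x₁ ((β x₁ u v)⁻¹ • u) v s t
      rw [huv'] at this
      rw [hc]
      simp only [LinearMap.smul_apply, smul_eq_mul]
      linear_combination c * this
  push Not at hA
  obtain ⟨x₂, hx₂⟩ := hA
  clear huv
  obtain ⟨u, v, s, h1, h2, h3, h4, h5, h6⟩ := exists_adapted_vectors β halt hP huv' hx₂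
  -- In this notation `β x₁ = f ∧ g₁` and `β x₂ = f ∧ g₂`; every other form is compared with these
  -- two.
  set f := β x₁ u with hf
  set g₁ := β x₁ v with hg₁
  set g₂ := β x₂ v with hg₂
  have fu : f u = 0 := halt _ _
  have g1u : g₁ u = -1 := by rw [hg₁, hsw, h1]
  have g1v : g₁ v = 0 := halt _ _
  have g2v : g₂ v = 0 := halt _ _
  have g2u : g₂ u = 0 := by rw [hg₂, hsw, h4, neg_zero]
  have hβ2s : ∀ t, β x₂ s t = -f t := by
    intro t
    have := plucker_polar β hP x₁ x₂ u v s t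
    rw [← hf, ← hg₁, h1, h2, h3, h4, h5, ← hg₂, h6] at this
    linear_combination this
  have hZ : ∀ z b, f b = 0 → g₁ b = 0 → g₂ b = 0 → β z u b = 0 ∧ β z s b = 0 := by
    intro z b hb1 hb2 hb3
    have e1 := plucker_polar β hP x₁ z u v s b
    have e2 := plucker_polar β hP x₂ z v s u b
    have e3 : β x₂ s u = 0 := by rw [hβ2s, fu, neg_zero]
    have e4 : β x₁ s b = 0 := by
      have := hP x₁ u v s b
      rw [← hf, ← hg₁, h1, h2, h3] at this
      linear_combination this
    have e5 : β x₂ u b = 0 := by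
      have := hP x₂ v s u b
      rw [← hg₂, h6, g2u, hb3] at this
      linear_combination this
    rw [← hf, ← hg₁, h1, h2, hb1, e4, h3, hb2] at e1
    rw [← hg₂, h6, g2u, hb3, e5, hβ2s b, hb1, e3] at e2
    constructor
    · linear_combination e2
    · linear_combination e1
  have hZ2 : ∀ z a b, f a = 0 → g₁ a = 0 → f b = 0 → g₁ b = 0 → β z a b = 0 := by
    intro z a b ha1 ha2 hb1 hb2
    have e1 := plucker_polar β hP x₁ z u v a b
    have e4 : β x₁ a b = 0 := by
      have := hP x₁ u v a b
      rw [← hf, ← hg₁, h1, ha1, ha2] at this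
      linear_combination this
    rw [← hf, ← hg₁, h1, ha1, hb1, e4, hb2, ha2] at e1
    linear_combination e1
  -- `r` projects onto the common kernel of `f`, `g₁`, `g₂` along the span of `u`, `v`, `s`.
  set r : E → E := fun a => a - f a • v + g₁ a • u - g₂ a • s with hr
  have hr1 : ∀ a, f (r a) = 0 := by intro a; simp [hr, h1, fu, h2]
  have hr2 : ∀ a, g₁ (r a) = 0 := by intro a; simp [hr, g1v, g1u, h3]
  have hr3 : ∀ a, g₂ (r a) = 0 := by intro a; simp [hr, g2v, g2u, h6]
  have hdec : ∀ a, a = f a • v - g₁ a • u + g₂ a • s + r a := by intro a; simp only [hr]; abel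
  have hexp : ∀ z a b, β z a b = β z v u * (-(f a * g₁ b) + g₁ a * f b)
      + β z v s * (f a * g₂ b - g₂ a * f b) + β z u s * (-(g₁ a * g₂ b) + g₂ a * g₁ b)
      + f a * β z v (r b) - f b * β z v (r a) := by
    intro z a b
    conv_lhs => rw [hdec a, hdec b]
    have a1 := hZ z _ (hr1 a) (hr2 a) (hr3 a)
    have b1 := hZ z _ (hr1 b) (hr2 b) (hr3 b)
    have c1 := hZ2 z _ _ (hr1 a) (hr2 a) (hr1 b) (hr2 b)
    simp only [map_add, map_sub, map_smul, LinearMap.add_apply, LinearMap.sub_apply,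
      LinearMap.smul_apply, smul_eq_mul, halt, a1, b1, c1, hsw z (r a), hsw z u v, hsw z s u,
      hsw z s v]
    ring
  -- Up to sign, `β z u s` is the coefficient of `g₁ ∧ g₂`. If it always vanishes, `f` divides every
  -- form. If it is nonzero for some `x₃`, the Plücker relations with `x₃` remove all terms outside
  -- the span of `f`, `g₁`, `g₂`.
  by_cases hB : ∀ z, β z u s = 0
  · left
    refine ⟨f, ?_, fun z => ⟨β z v, fun a b => ?_⟩⟩
    · intro h; rw [h] at h1; simp at h1
    · have e1 : ∀ a, β z v a = -(g₁ a * β z v u) + g₂ a * β z v s + β z v (r a) := by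
        intro a
        conv_lhs => rw [hdec a]
        simp only [map_add, map_sub, map_smul, smul_eq_mul, halt]
        ring
      rw [hexp, hB, e1 a, e1 b]
      ring
  right
  push Not at hB
  obtain ⟨x₃, hx₃⟩ := hB
  have hZ3 : ∀ b, f b = 0 → g₁ b = 0 → g₂ b = 0 → β x₃ v b = 0 := by
    intro b hb1 hb2 hb3
    have := hP x₃ u s v b
    rw [(hZ x₃ b hb1 hb2 hb3).1, (hZ x₃ b hb1 hb2 hb3).2] at this
    have h : β x₃ u s * β x₃ v b = 0 := by linear_combination this
    exact (mul_eq_zero.mp h).resolve_left hx₃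
  have hZ4 : ∀ z b, f b = 0 → g₁ b = 0 → g₂ b = 0 → β z v b = 0 := by
    intro z b hb1 hb2 hb3
    have := plucker_polar β hP x₃ z u s v b
    rw [(hZ x₃ b hb1 hb2 hb3).1, (hZ x₃ b hb1 hb2 hb3).2, hZ3 b hb1 hb2 hb3,
      (hZ z b hb1 hb2 hb3).1, (hZ z b hb1 hb2 hb3).2] at this
    have h : β x₃ u s * β z v b = 0 := by linear_combination this
    exact (mul_eq_zero.mp h).resolve_left hx₃
  refine ⟨LinearMap.pi ![f, -g₁, g₂], ?_, LinearMap.pi ![(β.flip u).flip s, -(β.flip v).flip s,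
    (β.flip v).flip u], ?_, ?_⟩
  · intro t
    refine ⟨t 0 • v + t 1 • u + t 2 • s, ?_⟩
    ext i
    fin_cases i <;> simp [h1, h2, h3, fu, g1u, g1v, g2v, g2u, h6]
  · intro t
    have e1 : β x₁ v u = -1 := g1u
    have e2 : β x₂ v u = 0 := g2u
    refine ⟨(t 0 / β x₃ u s) • x₃ + (-t 2 + t 0 / β x₃ u s * β x₃ v u) • x₁ +
      (-t 1 - t 0 / β x₃ u s * β x₃ v s) • x₂, ?_⟩
    ext i
    have h2' : β x₁ u s = 0 := h2
    have h3' : β x₁ v s = 0 := h3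
    have h6' : β x₂ v s = 1 := h6
    fin_cases i
    · simp [h2', h5, hx₃]
    · simp [h3', h6']
    · simp [e1, e2]
  · intro z a b
    rw [hexp, hZ4 z _ (hr1 a) (hr2 a) (hr3 a), hZ4 z _ (hr1 b) (hr2 b) (hr3 b)]
    simp [Matrix.det_fin_three]
    ring

end DecomposableFamilies

/-! ### Symmetric products σ with y ∧ z ∧ σ(y, z) = 0. -/

section SymmetricStructureConstants

variable {k : Type*} [Field k]

/-- Structure constants `s` of a symmetric bilinear product `σ` on `k⁴` satisfy
`y ∧ z ∧ σ(y, z) = 0`. -/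
def WedgeZero (s : Fin 4 → Fin 4 → Fin 4 → k) : Prop :=
  (∀ i j m, s i j m = s j i m) ∧ ∀ x y z : Fin 4 → k,
    Matrix.det (Matrix.of ![x, y, z, fun m => ∑ i, ∑ j, y i * z j * s i j m]) = 0

theorem WedgeZero.comp {s : Fin 4 → Fin 4 → Fin 4 → k} (h : WedgeZero s)
    (f : Equiv.Perm (Fin 4)) : WedgeZero (fun i j m => s (f i) (f j) (f m)) := by
  refine ⟨fun i j m => h.1 _ _ _, fun x y z => ?_⟩
  have h1 := h.2 (x ∘ f.symm) (y ∘ f.symm) (z ∘ f.symm)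
  have h2 := Matrix.det_permute' f (Matrix.of ![x ∘ f.symm, y ∘ f.symm, z ∘ f.symm,
    fun m => ∑ i, ∑ j, (y ∘ f.symm) i * (z ∘ f.symm) j * s i j m])
  rw [h1, mul_zero] at h2
  rw [← h2]
  congr 1
  ext i m
  fin_cases i
  · simp
  · simp
  · simp
  · change (∑ i, ∑ j, y i * z j * s (f i) (f j) (f m)) =
      ∑ i, ∑ j, y (f.symm i) * z (f.symm j) * s i j (f m)
    refine Fintype.sum_equiv f _ _ fun i => Fintype.sum_equiv f _ _ fun j => ?_
    simp

/-- Only 0/1 vectors are substituted, with the fourth basis vector as `x`, because the result is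
needed over residue fields, which may be small. Further relations come from permuting the
coordinates. -/
theorem WedgeZero.basic {s : Fin 4 → Fin 4 → Fin 4 → k} (h : WedgeZero s) :
    s 0 1 2 = 0 ∧ s 0 2 1 + s 1 2 1 = s 0 2 0 + s 1 2 0 ∧ s 0 0 2 + s 0 1 2 = 0 ∧
      s 0 0 0 + s 0 2 0 + s 1 0 0 + s 1 2 0 =
        (s 0 0 1 + s 0 2 1 + s 1 0 1 + s 1 2 1) + (s 0 0 2 + s 0 2 2 + s 1 0 2 + s 1 2 2) := by
  have e1 := h.2 (Pi.single 3 1) (Pi.single 0 1) (Pi.single 1 1)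
  have e2 := h.2 (Pi.single 3 1) (Pi.single 0 1 + Pi.single 1 1) (Pi.single 2 1)
  have e3 := h.2 (Pi.single 3 1) (Pi.single 0 1) (Pi.single 0 1 + Pi.single 1 1)
  have e4 := h.2 (Pi.single 3 1) (Pi.single 0 1 + Pi.single 1 1) (Pi.single 0 1 + Pi.single 2 1)
  simp [Matrix.det_succ_row_zero, Fin.sum_univ_succ, Fin.succAbove, Pi.single_apply] at e1 e2 e3 e4
  refine ⟨?_, ?_, ?_, ?_⟩
  · linear_combination e1
  · linear_combination -e2
  · linear_combination e3
  · linear_combination e4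

/-- The permuted relations say, for distinct indices: `s i j l = 0`, `s l j j = s l i i`, `s i i l =
0` and `s i i i = 2 * s i j j`. This is the asserted shape, with `α i` the common value of `s i j j`
for `j ≠ i`. -/
theorem WedgeZero.exists_eq {s : Fin 4 → Fin 4 → Fin 4 → k} (h : WedgeZero s) :
    ∃ α : Fin 4 → k, ∀ i j m, s i j m =
      α i * (if m = j then 1 else 0) + α j * (if m = i then 1 else 0) := by
  have perm : ∀ i j l : Fin 4, i ≠ j → i ≠ l → j ≠ l →
      ∃ f : Equiv.Perm (Fin 4), f 0 = i ∧ f 1 = j ∧ f 2 = l := by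
    intro i j l hij hil hjl
    obtain ⟨n, hn⟩ : ∃ n : Fin 4, n ≠ i ∧ n ≠ j ∧ n ≠ l := by
      revert i j l; decide
    have hinj : Function.Injective ![i, j, l, n] := by
      intro a b hab
      fin_cases a <;> fin_cases b <;> simp_all
    exact ⟨Equiv.ofBijective _ (Finite.injective_iff_bijective.mp hinj), rfl, rfl, rfl⟩
  have F1 : ∀ i j l : Fin 4, i ≠ j → i ≠ l → j ≠ l → s i j l = 0 := by
    intro i j l hij hil hjl
    obtain ⟨f, rfl, rfl, rfl⟩ := perm i j l hij hil hjl
    exact (h.comp f).basic.1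
  have F2 : ∀ i j l : Fin 4, i ≠ j → i ≠ l → j ≠ l → s l j j = s l i i := by
    intro i j l hij hil hjl
    have a1 := F1 i l j hil hij hjl.symm
    have a2 := F1 j l i hjl hij.symm hil.symm
    obtain ⟨f, rfl, rfl, rfl⟩ := perm i j l hij hil hjl
    have := (h.comp f).basic.2.1
    rw [h.1 (f 2), h.1 (f 2) (f 0)]
    linear_combination this - a1 + a2
  have F3 : ∀ i l : Fin 4, i ≠ l → s i i l = 0 := by
    intro i l hil
    obtain ⟨j, h1, h2⟩ : ∃ j : Fin 4, i ≠ j ∧ j ≠ l := by revert i l; decide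
    have a1 := F1 i j l h1 hil h2
    obtain ⟨f, rfl, rfl, rfl⟩ := perm i j l h1 hil h2
    linear_combination (h.comp f).basic.2.2.1 - a1
  have F4 : ∀ i j : Fin 4, i ≠ j → s i i i = 2 * s i j j := by
    intro i j hij
    obtain ⟨l, h1, h2⟩ : ∃ l : Fin 4, i ≠ l ∧ j ≠ l := by revert i j; decide
    have a1 := F1 i l j h1 hij h2.symm
    have a2 := F1 j l i h2 hij.symm h1.symm
    have a3 := F1 j i l hij.symm h2 h1
    have a4 := F3 i j hij
    have a5 := F3 i l h1
    have b1 := F2 j l i h2 hij.symm h1.symm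
    have b2 := F2 i l j h1 hij h2.symm
    have b3 := F2 i j l hij h1 h2
    obtain ⟨f, rfl, rfl, rfl⟩ := perm i j l hij h1 h2
    have := (h.comp f).basic.2.2.2
    have c1 := h.1 (f 0) (f 2) (f 0)
    have c2 := h.1 (f 1) (f 0) (f 1)
    have c3 := h.1 (f 1) (f 2) (f 1)
    linear_combination this + a1 - a2 + a3 + a4 + a5 + c2 - c1 + c3 + b1 + b2 + b3
  -- Here `i + 1` only serves as some index different from `i`.
  refine ⟨fun i => s i (i + 1) (i + 1), fun i j m => ?_⟩
  have hne : ∀ i : Fin 4, i ≠ i + 1 := by decide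
  have hα : ∀ i j, i ≠ j → s i j j = s i (i + 1) (i + 1) := by
    intro i j hij
    by_cases hj : j = i + 1
    · rw [hj]
    · exact F2 (i + 1) j i (Ne.symm hj) (hne i).symm hij.symm
  by_cases hij : i = j
  · subst hij
    by_cases hm : m = i
    · subst hm
      rw [F4 m (m + 1) (hne m)]
      simp
      ring
    · rw [F3 i m (Ne.symm hm)]
      simp [hm]
  · by_cases hm : m = j
    · subst hm
      rw [hα i m hij]
      simp [Ne.symm hij]
    · by_cases hm' : m = i
      · subst hm'
        rw [h.1, hα j m (Ne.symm hij)]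
        simp [hij]
      · rw [F1 i j m hij (Ne.symm hm') (Ne.symm hm)]
        simp [hm, hm']

end SymmetricStructureConstants

/-! ### Quadratic vectors parallel to linear ones. -/

section ParallelQuadratic

variable {k X : Type*} [Field k] [AddCommGroup X] [Module k X]

/-- A vector of three quadratic forms which is parallel to a vector of independent linear forms
is a multiple of it by a linear form. -/
theorem exists_linear_factor (q : QuadraticMap k X (Fin 3 → k)) (τ : X →ₗ[k] (Fin 3 → k))
    (hτ : Function.Surjective τ) (h1 : ∀ z i j, τ z i * q z j = τ z j * q z i)
    (h2 : ∀ z z' i j, τ z i * QuadraticMap.polar q z z' j - τ z j * QuadraticMap.polar q z z' i =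
      -(τ z' i * q z j - τ z' j * q z i)) :
    ∃ ℓ : X →ₗ[k] k, ∀ y, q y = ℓ y • τ y := by
  -- The hypothesis `h2` is the part of `h1` at `z + z'` that is quadratic in `z`. It is supplied
  -- separately since over a small field homogeneous parts cannot be isolated by scaling.
  choose e he using fun i : Fin 3 => hτ (Pi.single i 1)
  have hq0 : ∀ i j, j ≠ i → q (e i) j = 0 := by
    intro i j hij
    have := h1 (e i) i j
    rw [he] at this
    simpa [hij] using this
  -- A candidate for `ℓ`, read off from the `i`-th coordinate of the polar form with `e i`. It works
  -- in the coordinates other than `i`, so two values of `i` cover all three coordinates once the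
  -- candidates are known to agree.
  set lam : Fin 3 → X →ₗ[k] k := fun i =>
    LinearMap.proj i ∘ₗ QuadraticMap.polarBilin q (e i) - q (e i) i • (LinearMap.proj i ∘ₗ τ)
    with hlam
  have hl : ∀ i y, QuadraticMap.polar q (e i) y i = q (e i) i * τ y i + lam i y := by
    intro i y
    simp [hlam, QuadraticMap.polarBilin_apply_apply]
  have hpol : ∀ i j y, j ≠ i → QuadraticMap.polar q (e i) y j = q (e i) i * τ y j := by
    intro i j y hij
    have := h2 (e i) y i j
    rw [he, hq0 i j hij] at this
    simp [hij] at this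
    linear_combination this
  have key : ∀ i j y, j ≠ i → q y j = lam i y * τ y j := by
    intro i j y hij
    have a := h1 (e i + y) i j
    have hq : ∀ m, q (e i + y) m = q (e i) m + q y m + QuadraticMap.polar q (e i) y m := by
      intro m; simp [QuadraticMap.polar]
    rw [hq, hq, hl, hpol i j y hij, hq0 i j hij, map_add, he] at a
    have b := h1 y i j
    simp [hij] at a
    linear_combination a - b
  have hlam_eq : ∀ i j, i ≠ j → ∀ y, lam i y = lam j y := by
    intro i j hij y
    have a1 := key i j (e j + y) hij.symm
    have a2 := key i j y hij.symm
    have a3 := key i j (e j) hij.symm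
    have hq : q (e j + y) j = q (e j) j + q y j + QuadraticMap.polar q (e j) y j := by
      simp [QuadraticMap.polar]
    rw [hq, hl, map_add, map_add] at a1
    simp [he] at a1 a3
    linear_combination -a1 + a2 + a3 * (1 + τ y j)
  refine ⟨lam 0, fun y => ?_⟩
  ext j
  by_cases hj : j = 0
  · subst hj
    rw [key 1 0 y (by decide), hlam_eq 1 0 (by decide)]
    rfl
  · rw [key 0 j y hj]
    rfl

/-- Pulling back the determinant from a three-dimensional quotient. -/
theorem exists_det_three_eq (τ : (Fin 4 → k) →ₗ[k] (Fin 3 → k)) :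
    ∃ w : Fin 4 → k, ∀ x y z, Matrix.det (Matrix.of ![τ x, τ y, τ z]) =
      Matrix.det (Matrix.of ![x, y, z, w]) := by
  set T : Fin 3 → Fin 4 → k := fun i m => τ (Pi.single m 1) i with hT
  have hτ : ∀ x i, τ x i = T i 0 * x 0 + T i 1 * x 1 + T i 2 * x 2 + T i 3 * x 3 := by
    intro x i
    conv_lhs => rw [LinearMap.pi_apply_eq_sum_univ τ x]
    simp only [Fin.sum_univ_four, Pi.add_apply, Pi.smul_apply, smul_eq_mul, hT]
    have : ∀ m : Fin 4, (fun j => if m = j then (1 : k) else 0) = Pi.single m 1 := by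
      intro m; ext j; simp [Pi.single_apply, eq_comm]
    simp only [this]
    ring
  -- The maximal minors of the matrix of `τ`; with alternating signs they are the coordinates of
  -- `w`, as in a cross product.
  set d : Fin 4 → Fin 4 → Fin 4 → k := fun a b c => T 0 a * (T 1 b * T 2 c - T 1 c * T 2 b) -
    T 0 b * (T 1 a * T 2 c - T 1 c * T 2 a) + T 0 c * (T 1 a * T 2 b - T 1 b * T 2 a) with hd
  refine ⟨![-d 1 2 3, d 0 2 3, -d 0 1 3, d 0 1 2], fun x y z => ?_⟩
  simp [Matrix.det_succ_row_zero, Fin.sum_univ_succ, Fin.succAbove, hτ, hd]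
  ring

end ParallelQuadratic

/-! ### Coordinate models of a resolvent. -/

section Models

variable {k Q : Type*} [CommRing k] [CommRing Q] [Algebra k Q]

/-- The last four coordinates with respect to a basis of a quintic algebra. -/
noncomputable def tailCoords (b : Module.Basis (Fin 5) k Q) : Q →ₗ[k] (Fin 4 → k) :=
  LinearMap.pi fun i => b.coord i.succ

theorem tailCoords_apply (b : Module.Basis (Fin 5) k Q) (y : Q) (i : Fin 4) :
    tailCoords b y i = b.repr y i.succ := rfl

theorem tailCoords_surjective (b : Module.Basis (Fin 5) k Q) :
    Function.Surjective (tailCoords b) := by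
  intro y
  refine ⟨∑ i : Fin 4, y i • b i.succ, ?_⟩
  ext j
  rw [tailCoords_apply, map_sum, Finsupp.finsetSum_apply]
  simp [Finsupp.single_apply]

theorem eq_of_tailCoords (b : Module.Basis (Fin 5) k Q) (hb : b 0 = 1) (y : Q) :
    y = b.repr y 0 • 1 + ∑ i : Fin 4, tailCoords b y i • b i.succ := by
  conv_lhs => rw [← b.sum_repr y, Fin.sum_univ_succ, hb]
  rfl

theorem tailCoords_one (b : Module.Basis (Fin 5) k Q) (hb : b 0 = 1) : tailCoords b 1 = 0 := by
  ext i
  rw [tailCoords_apply, ← hb, b.repr_self]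
  simp

theorem tailCoords_eq_zero (b : Module.Basis (Fin 5) k Q) (hb : b 0 = 1) {y : Q}
    (hy : tailCoords b y = 0) : y = b.repr y 0 • 1 := by
  conv_lhs => rw [eq_of_tailCoords b hb y, hy]
  simp

/-- A model of the resolvent of a quintic algebra in coordinates. -/
structure IsModel (b : Module.Basis (Fin 5) k Q) (a : (Fin 4 → k) →ₗ[k] Matrix (Fin 5) (Fin 5) k)
    (q : QuadraticMap k (Fin 4 → k) (Fin 5 → k)) : Prop where
  alt : ∀ x, IsAltMatrix (a x)
  span_eq_top : Submodule.span k (Set.range q) = ⊤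
  eq_det : ∀ x y z : Q, q (tailCoords b y) ⬝ᵥ (a (tailCoords b x)).mulVec (q (tailCoords b z)) =
    Matrix.det (Matrix.of ![tailCoords b x, tailCoords b y, tailCoords b z, tailCoords b (y * z)])

variable {b : Module.Basis (Fin 5) k Q} {a : (Fin 4 → k) →ₗ[k] Matrix (Fin 5) (Fin 5) k}
  {q : QuadraticMap k (Fin 4 → k) (Fin 5 → k)}

theorem IsModel.eq_of_dotProduct (h : IsModel b a q) {v w : Fin 5 → k}
    (hv : ∀ y, q y ⬝ᵥ v = q y ⬝ᵥ w) : v = w := by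
  have : ∀ u : Fin 5 → k, u ⬝ᵥ v = u ⬝ᵥ w := by
    intro u
    have hu : u ∈ Submodule.span k (Set.range q) := by rw [h.span_eq_top]; trivial
    induction hu using Submodule.span_induction with
    | mem x hx => obtain ⟨y, rfl⟩ := hx; exact hv y
    | zero => simp
    | add x y _ _ hx hy => rw [add_dotProduct, add_dotProduct, hx, hy]
    | smul r x _ hx => rw [smul_dotProduct, smul_dotProduct, hx]
  apply dotProduct_eq
  intro u
  rw [dotProduct_comm, this, dotProduct_comm]

/-- For `x = z` the determinant in the identity has two equal rows, and the values of `q` span. -/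
theorem IsModel.mulVec_self (h : IsModel b a q) (z : Fin 4 → k) : (a z).mulVec (q z) = 0 := by
  apply h.eq_of_dotProduct
  intro y
  obtain ⟨Y, rfl⟩ := tailCoords_surjective b y
  obtain ⟨Z, rfl⟩ := tailCoords_surjective b z
  rw [h.eq_det, dotProduct_zero]
  exact Matrix.det_zero_of_row_eq (i := 0) (j := 2) (by decide) rfl

/-- The linearization of `mulVec_self`, taken from the determinants themselves so that it also holds
over small fields. -/
theorem IsModel.mulVec_polar (h : IsModel b a q) (z z' : Fin 4 → k) :
    (a z).mulVec (QuadraticMap.polar q z z') = -(a z').mulVec (q z) := by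
  apply h.eq_of_dotProduct
  intro y
  obtain ⟨Y, rfl⟩ := tailCoords_surjective b y
  obtain ⟨Z, rfl⟩ := tailCoords_surjective b z
  obtain ⟨Z', rfl⟩ := tailCoords_surjective b z'
  rw [QuadraticMap.polar, Matrix.mulVec_sub, Matrix.mulVec_sub, dotProduct_sub, dotProduct_sub,
    dotProduct_neg, ← map_add, h.eq_det, h.eq_det, h.eq_det, h.eq_det, mul_add, map_add, map_add]
  simp [Matrix.det_succ_row_zero, Fin.sum_univ_succ, Fin.succAbove]
  ring

end Models

/-! ### Models all of whose forms are decomposable. -/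

section Degenerate

variable {k Q : Type*} [Field k] [CommRing Q] [Algebra k Q]
variable {b : Module.Basis (Fin 5) k Q} {a : (Fin 4 → k) →ₗ[k] Matrix (Fin 5) (Fin 5) k}
  {q : QuadraticMap k (Fin 4 → k) (Fin 5 → k)}

/-- The left side is the sum, over the sets of four indices, of the sub-Pfaffian of `B` times the
corresponding 4 × 4 minor of `u, v, s, t`. In the proof `m` is that minor, expanded along two pairs
of rows. -/
theorem plucker_of_pfVec_eq_zero {B : Matrix (Fin 5) (Fin 5) k} (hB : IsAltMatrix B)
    (h : pfVec B = 0) (u v s t : Fin 5 → k) :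
    u ⬝ᵥ B.mulVec v * (s ⬝ᵥ B.mulVec t) - u ⬝ᵥ B.mulVec s * (v ⬝ᵥ B.mulVec t) +
      u ⬝ᵥ B.mulVec t * (v ⬝ᵥ B.mulVec s) = 0 := by
  have hform : ∀ v w : Fin 5 → k, v ⬝ᵥ B.mulVec w =
      B 0 1 * (v 0 * w 1 - v 1 * w 0) + B 0 2 * (v 0 * w 2 - v 2 * w 0) +
      B 0 3 * (v 0 * w 3 - v 3 * w 0) + B 0 4 * (v 0 * w 4 - v 4 * w 0) +
      B 1 2 * (v 1 * w 2 - v 2 * w 1) + B 1 3 * (v 1 * w 3 - v 3 * w 1) +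
      B 1 4 * (v 1 * w 4 - v 4 * w 1) + B 2 3 * (v 2 * w 3 - v 3 * w 2) +
      B 2 4 * (v 2 * w 4 - v 4 * w 2) + B 3 4 * (v 3 * w 4 - v 4 * w 3) := by
    intro v w
    simp only [Matrix.mulVec, dotProduct, Fin.sum_univ_five, hB.1, hB.2 0 1, hB.2 0 2, hB.2 0 3,
      hB.2 0 4, hB.2 1 2, hB.2 1 3, hB.2 1 4, hB.2 2 3, hB.2 2 4, hB.2 3 4]
    ring
  set m : Fin 5 → Fin 5 → Fin 5 → Fin 5 → k := fun a b c d =>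
    (u a * v b - u b * v a) * (s c * t d - s d * t c) -
    (u a * v c - u c * v a) * (s b * t d - s d * t b) +
    (u a * v d - u d * v a) * (s b * t c - s c * t b) +
    (u b * v c - u c * v b) * (s a * t d - s d * t a) -
    (u b * v d - u d * v b) * (s a * t c - s c * t a) +
    (u c * v d - u d * v c) * (s a * t b - s b * t a) with hm
  have h0 := congrFun h 0
  have h1 := congrFun h 1
  have h2 := congrFun h 2
  have h3 := congrFun h 3
  have h4 := congrFun h 4
  simp [pfVec] at h0 h1 h2 h3 h4
  simp only [hform]
  linear_combination (exp := 1) m 1 2 3 4 * h0 - m 0 2 3 4 * h1 + m 0 1 3 4 * h2 - m 0 1 2 4 * h3 +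
    m 0 1 2 3 * h4

/-- `decomposable_family` leaves three cases. Zero forms are trivial. A common linear factor would
vanish on every value of `q`, although these span. For forms pulled back from a three-dimensional
space, `mulVec_self` makes the image of `q z` parallel to `τ z`, hence equal to `ℓ z • τ z`. -/
theorem IsModel.exists_linear_forms (h : IsModel b a q) (hpf : ∀ x, pfVec (a x) = 0) :
    ∃ (ℓ : (Fin 4 → k) →ₗ[k] k) (w : Fin 4 → k), ∀ x y z : Q,
      Matrix.det (Matrix.of ![tailCoords b x, tailCoords b y, tailCoords b z,
        tailCoords b (y * z)]) = ℓ (tailCoords b y) * ℓ (tailCoords b z) *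
      Matrix.det (Matrix.of ![tailCoords b x, tailCoords b y, tailCoords b z, w]) := by
  set β : (Fin 4 → k) →ₗ[k] (Fin 5 → k) →ₗ[k] (Fin 5 → k) →ₗ[k] k :=
    (Matrix.toBilin' (n := Fin 5) (R₁ := k)).toLinearMap ∘ₗ a with hβdef
  have hβ : ∀ x s t, β x s t = s ⬝ᵥ (a x).mulVec t := fun x s t => by
    simp [hβdef, Matrix.toBilin'_apply']
  have hself : ∀ z t, β z (q z) t = 0 := by
    intro z t
    have hsw : β z (q z) t = -(t ⬝ᵥ (a z).mulVec (q z)) := by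
      rw [hβ, Matrix.dotProduct_mulVec, ← Matrix.mulVec_transpose, dotProduct_comm]
      have : (a z).transpose = -(a z) := by ext i j; simp [(h.alt z).2 i j]
      rw [this, Matrix.neg_mulVec, dotProduct_neg]
    rw [hsw, h.mulVec_self, dotProduct_zero, neg_zero]
  have halt : ∀ x s, β x s s = 0 := by
    intro x s
    rw [hβ]
    have hB := h.alt x
    simp only [Matrix.mulVec, dotProduct, Fin.sum_univ_five, hB.1, hB.2 0 1, hB.2 0 2, hB.2 0 3,
      hB.2 0 4, hB.2 1 2, hB.2 1 3, hB.2 1 4, hB.2 2 3, hB.2 2 4, hB.2 3 4]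
    ring
  have hsw : ∀ z a b, β z a b = -β z b a := by
    intro z a b
    have h := halt z (a + b)
    simp only [map_add, LinearMap.add_apply, halt, zero_add, add_zero] at h
    linear_combination h
  have hpolar : ∀ z z' t, β z (QuadraticMap.polar q z z') t = -β z' (q z) t := by
    intro z z' t
    rw [hsw, hβ, h.mulVec_polar, dotProduct_neg, neg_neg, hsw z', hβ, neg_neg]
  have hspan : ∀ f : (Fin 5 → k) →ₗ[k] k, (∀ y, f (q y) = 0) → f = 0 := by
    intro f hf
    apply LinearMap.ext_on_range (v := q) h.span_eq_top
    intro y; simp [hf y]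
  have heq : ∀ x y z : Q, Matrix.det (Matrix.of ![tailCoords b x, tailCoords b y, tailCoords b z,
        tailCoords b (y * z)]) =
        β (tailCoords b x) (q (tailCoords b y)) (q (tailCoords b z)) := by
    intro x y z
    rw [hβ, h.eq_det]
  rcases decomposable_family β halt (fun x u v s t => by
    simp only [hβ]; exact plucker_of_pfVec_eq_zero (h.alt x) (hpf x) u v s t) with
    h0 | ⟨f, hf0, hf⟩ | ⟨F, hF, τ, hτ, hdet⟩
  · exact ⟨0, 0, fun x y z => by rw [heq, h0]; simp⟩
  · by_cases hz : ∀ z s t, β z s t = 0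
    · exact ⟨0, 0, fun x y z => by rw [heq, hz]; simp⟩
    · exfalso
      push Not at hz
      obtain ⟨z, s₀, t₀, hz⟩ := hz
      -- A vector in the radical of a nonzero form `f ∧ g` is killed by `f`.
      have vanish : ∀ z u, (∃ s t, β z s t ≠ 0) → (∀ t, β z u t = 0) → f u = 0 := by
        rintro z u ⟨s, t, hst⟩ hu
        by_contra hfu
        obtain ⟨g, hg⟩ := hf z
        apply hst
        have h1 : ∀ t, g t = f t * g u / f u := by
          intro t
          have := hu t
          rw [hg] at this
          field_simp
          linear_combination this
        rw [hg, h1 s, h1 t]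
        field_simp
        ring
      apply hf0
      apply hspan
      intro y
      by_cases hy : ∃ s t, β y s t ≠ 0
      · exact vanish y (q y) hy (hself y)
      · push Not at hy
        -- When the form at `y` is zero, `q y` is reached through `z + y`, whose form is that of
        -- `z`.
        have e1 := vanish z (q z) ⟨s₀, t₀, hz⟩ (hself z)
        have e2 : f (QuadraticMap.polar q z y) = 0 :=
          vanish z _ ⟨s₀, t₀, hz⟩ fun t => by rw [hpolar, hy, neg_zero]
        have e3 : f (q (z + y)) = 0 :=
          vanish (z + y) _ ⟨s₀, t₀, by simpa [hy] using hz⟩ (hself _)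
        rw [QuadraticMap.polar, map_sub, map_sub, e3, e1] at e2
        simpa using e2
  · have hpar : ∀ (τ q : Fin 3 → k), (∀ t, Matrix.det (Matrix.of ![τ, q, F t]) = 0) →
        ∀ i j, τ i * q j = τ j * q i := by
      intro τ q ht
      have e : ∀ m, Matrix.det (Matrix.of ![τ, q, Pi.single m 1]) = 0 := by
        intro m
        obtain ⟨t, ht'⟩ := hF (Pi.single m 1)
        rw [← ht']; exact ht t
      have e0 := e 0
      have e1 := e 1
      have e2 := e 2
      simp [Matrix.det_fin_three] at e0 e1 e2
      intro i j
      fin_cases i <;> fin_cases j <;> simp <;>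
        first
        | ring1
        | linear_combination e0 | linear_combination e1 | linear_combination e2
        | linear_combination -e0 | linear_combination -e1 | linear_combination -e2
    obtain ⟨ℓ, hℓ⟩ := exists_linear_factor (F.compQuadraticMap q) τ hτ
      (fun z => hpar _ _ fun t => by rw [← hself z t, hdet]; rfl)
      (fun z z' i j => by
        have hP : QuadraticMap.polar (F.compQuadraticMap q) z z' =
            F (QuadraticMap.polar q z z') := by
          simp [QuadraticMap.polar]
        have e : ∀ t, Matrix.det (Matrix.of ![τ z, F (QuadraticMap.polar q z z'), F t]) +
            Matrix.det (Matrix.of ![τ z', F (q z), F t]) = 0 := by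
          intro t
          rw [← hdet, ← hdet, hpolar]; ring
        have e' : ∀ m, Matrix.det (Matrix.of ![τ z, F (QuadraticMap.polar q z z'),
            Pi.single m 1]) + Matrix.det (Matrix.of ![τ z', F (q z), Pi.single m 1]) = 0 := by
          intro m
          obtain ⟨t, ht'⟩ := hF (Pi.single m 1)
          rw [← ht']; exact e t
        have e0 := e' 0
        have e1 := e' 1
        have e2 := e' 2
        rw [hP]
        simp [Matrix.det_fin_three] at e0 e1 e2
        fin_cases i <;> fin_cases j <;> simp <;>
          first
          | ring1
          | linear_combination e0 | linear_combination e1 | linear_combination e2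
          | linear_combination -e0 | linear_combination -e1 | linear_combination -e2)
    obtain ⟨w, hw⟩ := exists_det_three_eq τ
    refine ⟨ℓ, w, fun x y z => ?_⟩
    have hℓ' : ∀ y, F (q y) = ℓ y • τ y := hℓ
    rw [heq, hdet, hℓ', hℓ', ← hw]
    simp [Matrix.det_fin_three]
    ring

/-- After subtraction of the term `ℓ(y)ℓ(z)w`, the product satisfies `WedgeZero`. Hence yz = χ(y)z +
χ(z)y + ℓ(y)ℓ(z)w modulo multiples of `1`, and associativity removes the remaining scalars on the
stated elements. -/
theorem IsModel.degenerate (hb : b 0 = 1) (h : IsModel b a q) (hpf : ∀ x, pfVec (a x) = 0) :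
    ∃ χ ℓ : Q →ₗ[k] k, χ 1 = 1 ∧ ∀ y z, χ y = 0 → ℓ y = 0 → χ z = 0 → y * z = 0 := by
  obtain ⟨ℓ, w, hw⟩ := h.exists_linear_forms hpf
  set t := tailCoords b with ht
  set s : Fin 4 → Fin 4 → Fin 4 → k := fun i j =>
    t (b i.succ * b j.succ) - (ℓ (t (b i.succ)) * ℓ (t (b j.succ))) • w with hs
  have hsum : ∀ y : Fin 4 → k, t (∑ i, y i • b i.succ) = y := by
    intro y
    ext j
    rw [ht, tailCoords_apply, map_sum, Finsupp.finsetSum_apply]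
    simp [Finsupp.single_apply]
  have hbil : ∀ (y z : Fin 4 → k), (fun m => ∑ i, ∑ j, y i * z j * s i j m) =
      t ((∑ i, y i • b i.succ) * ∑ j, z j • b j.succ) - (ℓ y * ℓ z) • w := by
    intro y z
    have e1 : ℓ y = ∑ i, y i * ℓ (t (b i.succ)) := by
      conv_lhs => rw [← hsum y]
      simp [map_sum]
    have e2 : ℓ z = ∑ i, z i * ℓ (t (b i.succ)) := by
      conv_lhs => rw [← hsum z]
      simp [map_sum]
    ext m
    rw [Finset.sum_mul_sum, e1, e2, Finset.sum_mul_sum]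
    simp only [map_sum, Finset.sum_apply, Pi.sub_apply, Pi.smul_apply, smul_eq_mul,
      Finset.sum_mul, ← Finset.sum_sub_distrib, hs]
    refine Finset.sum_congr rfl fun i _ => Finset.sum_congr rfl fun j _ => ?_
    rw [smul_mul_smul_comm, map_smul, Pi.smul_apply, smul_eq_mul]
    ring
  have hW : WedgeZero s := by
    refine ⟨fun i j m => ?_, fun x y z => ?_⟩
    · simp only [hs]; rw [mul_comm (b i.succ), mul_comm (ℓ (t (b i.succ)))]
    · rw [hbil]
      have := hw (∑ i, x i • b i.succ) (∑ i, y i • b i.succ) (∑ i, z i • b i.succ)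
      rw [hsum, hsum, hsum] at this
      have hadd : ∀ p r : Fin 4 → k, ∀ c : k, Matrix.det (Matrix.of ![x, y, z, p - c • r]) =
          Matrix.det (Matrix.of ![x, y, z, p]) - c * Matrix.det (Matrix.of ![x, y, z, r]) := by
        intro p r c
        simp [Matrix.det_succ_row_zero, Fin.sum_univ_succ, Fin.succAbove]
        ring
      rw [hadd, this]
      ring
  obtain ⟨α, hα⟩ := hW.exists_eq
  set χ : Q →ₗ[k] k := b.coord 0 + (Fintype.linearCombination k α) ∘ₗ t with hχ
  have hχ' : ∀ y, χ y = b.repr y 0 + ∑ i, t y i * α i := by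
    intro y; simp [hχ, Fintype.linearCombination_apply]
  have hprod : ∀ y z, t (y * z) = χ y • t z + χ z • t y + (ℓ (t y) * ℓ (t z)) • w := by
    intro y z
    have hy := eq_of_tailCoords b hb y
    have hz := eq_of_tailCoords b hb z
    have e := hbil (t y) (t z)
    set y' := ∑ i, t y i • b i.succ with hy'
    set z' := ∑ i, t z i • b i.succ with hz'
    have e2 : t (y * z) = b.repr y 0 • t z + b.repr z 0 • t y + t (y' * z') := by
      have : y * z = b.repr y 0 • z + b.repr z 0 • y + y' * z' -
          (b.repr y 0 * b.repr z 0) • 1 := by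
        have hy1 : y - b.repr y 0 • 1 = y' := sub_eq_iff_eq_add'.mpr hy
        have hz1 : z - b.repr z 0 • 1 = z' := sub_eq_iff_eq_add'.mpr hz
        rw [← hy1, ← hz1]
        simp only [Algebra.smul_def, map_mul, mul_one]
        ring
      rw [this]
      simp only [map_add, map_sub, map_smul, ht, tailCoords_one b hb, smul_zero, sub_zero]
    have e3 : t (y' * z') = (∑ i, t y i * α i) • t z + (∑ i, t z i * α i) • t y +
        (ℓ (t y) * ℓ (t z)) • w := by
      rw [← sub_eq_iff_eq_add, ← e]
      ext m
      simp only [hα, Pi.add_apply, Pi.smul_apply, smul_eq_mul, Fin.sum_univ_four]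
      fin_cases m <;> simp <;> ring
    rw [e2, e3, hχ', hχ']
    module
  have hχ1 : χ 1 = 1 := by
    rw [hχ', ht, tailCoords_one b hb, ← hb, b.repr_self]
    simp
  have hfin : Module.Finite k Q := Module.Finite.of_basis b
  have hdim : Module.finrank k Q = 5 := by
    rw [Module.finrank_eq_card_basis b]; rfl
  refine ⟨χ, ℓ ∘ₗ t, hχ1, fun y z hy hℓy hz => ?_⟩
  have scal : ∀ y z, χ y = 0 → ℓ (t y) = 0 → χ z = 0 → ∃ c : k, y * z = c • 1 := by
    intro y z hy hℓy hz
    refine ⟨_, tailCoords_eq_zero b hb ?_⟩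
    rw [← ht, hprod, hy, hz, hℓy]
    simp
  by_cases hy0 : y = 0
  · rw [hy0, zero_mul]
  -- The common kernel of `χ` and `ℓ` has dimension at least three, so it is not contained in the
  -- line of `y`. The products `y z` and `y' z` are scalars `c` and `c'`, and (yz)y' = (y'z)y then
  -- forces `c = 0`.
  obtain ⟨y', hy'1, hy'2, hy'3⟩ : ∃ y', χ y' = 0 ∧ ℓ (t y') = 0 ∧ y' ∉ Submodule.span k {y} := by
    by_contra hcon
    push Not at hcon
    have hle : LinearMap.ker (χ.prod (ℓ ∘ₗ t)) ≤ Submodule.span k {y} := by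
      intro v hv
      have hv' := Prod.mk.inj (LinearMap.mem_ker.mp hv)
      exact hcon v hv'.1 hv'.2
    have h1 := Submodule.finrank_mono hle
    have h2 := finrank_span_singleton (K := k) hy0
    have h3 := LinearMap.finrank_range_add_finrank_ker (χ.prod (ℓ ∘ₗ t))
    have h4 := Submodule.finrank_le (LinearMap.range (χ.prod (ℓ ∘ₗ t)))
    rw [Module.finrank_prod, Module.finrank_self] at h4
    omega
  obtain ⟨c, hc⟩ := scal y z hy hℓy hz
  obtain ⟨c', hc'⟩ := scal y' z hy'1 hy'2 hz
  have e : c • y' = c' • y := by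
    have : (y * z) * y' = (y' * z) * y := by ring
    rw [hc, hc'] at this
    simpa using this
  by_cases hc0 : c = 0
  · rw [hc, hc0, zero_smul]
  · exfalso
    apply hy'3
    rw [Submodule.mem_span_singleton]
    refine ⟨c⁻¹ * c', ?_⟩
    rw [mul_smul, ← e, smul_smul, inv_mul_cancel₀ hc0, one_smul]

end Degenerate

/-! ### The determinant form on symmetric squares. -/

section SymmetricSquares

variable {K : Type*} [CommRing K]

/-- The square of a vector, as a symmetric array. -/
def symSquare : QuadraticMap K (Fin 4 → K) (Sym2 (Fin 4) → K) where
  toFun y := fun s => (s.map y).mul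
  toFun_smul c y := by
    ext s
    induction s using Sym2.ind with | _ i j
    simp [Sym2.mul]
    ring
  exists_companion' := ⟨LinearMap.mk₂ K (fun y z s => Sym2.lift ⟨fun i j => y i * z j + y j * z i,
      fun i j => by ring⟩ s)
      (fun y y' z => by
        ext s; induction s using Sym2.ind with | _ i j
        simp; ring)
      (fun c y z => by
        ext s; induction s using Sym2.ind with | _ i j
        simp; ring)
      (fun y z z' => by
        ext s; induction s using Sym2.ind with | _ i j
        simp; ring)
      (fun c y z => by
        ext s; induction s using Sym2.ind with | _ i j
        simp; ring), fun y z => by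
        ext s; induction s using Sym2.ind with | _ i j
        simp [Sym2.mul]; ring⟩

theorem symSquare_apply (y : Fin 4 → K) (i j : Fin 4) : symSquare y s(i, j) = y i * y j := by
  simp [symSquare, Sym2.mul]

/-- The squares of basis vectors and of sums of two of them suffice. An off-diagonal entry is
recorded once in the array, so 2 is never inverted. -/
theorem span_range_symSquare : Submodule.span K (Set.range (symSquare (K := K))) = ⊤ := by
  have hsq : ∀ y, symSquare (K := K) y ∈ Submodule.span K (Set.range (symSquare (K := K))) :=
    fun y => Submodule.subset_span ⟨y, rfl⟩
  have hsing : ∀ i : Fin 4, symSquare (K := K) (Pi.single i 1) = Pi.single s(i, i) 1 := by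
    intro i
    ext s; induction s using Sym2.ind with | _ k l
    rw [symSquare_apply]
    simp only [Pi.single_apply, Sym2.eq_iff]
    by_cases hk : k = i <;> by_cases hl : l = i <;> simp [hk, hl]
  have hmix : ∀ i j : Fin 4, i ≠ j → symSquare (K := K) (Pi.single i 1 + Pi.single j 1) =
      Pi.single s(i, i) 1 + Pi.single s(j, j) 1 + Pi.single s(i, j) 1 := by
    intro i j hij
    ext s; induction s using Sym2.ind with | _ k l
    rw [symSquare_apply]
    simp only [Pi.add_apply, Pi.single_apply, Sym2.eq_iff]
    by_cases hk : k = i <;> by_cases hl : l = i <;> by_cases hk' : k = j <;>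
      by_cases hl' : l = j <;> simp_all
  rw [eq_top_iff, ← (Pi.basisFun K (Sym2 (Fin 4))).span_eq, Submodule.span_le]
  rintro _ ⟨s, rfl⟩
  rw [Pi.basisFun_apply]
  induction s using Sym2.ind with | _ i j
  by_cases hij : i = j
  · subst hij; rw [← hsing]; exact hsq i |> fun _ => hsq _
  · have := hmix i j hij
    rw [← hsing, ← hsing] at this
    have e : (Pi.single s(i, j) 1 : Sym2 (Fin 4) → K) =
        symSquare (K := K) (Pi.single i 1 + Pi.single j 1) -
          symSquare (K := K) (Pi.single i 1) - symSquare (K := K) (Pi.single j 1) := by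
      rw [this]; abel
    rw [e]
    exact Submodule.sub_mem _ (Submodule.sub_mem _ (hsq _) (hsq _)) (hsq _)

variable {Q : Type*} [CommRing Q] [Algebra K Q]

/-- The bilinear form on symmetric arrays which sends `(y², z²)` to the determinant
of `x, y, z, yz`. -/
noncomputable def squareForm (b : Module.Basis (Fin 5) K Q) (x : Fin 4 → K) :
    (Sym2 (Fin 4) → K) →ₗ[K] (Sym2 (Fin 4) → K) →ₗ[K] K :=
  ∑ i : Fin 4, ∑ j : Fin 4, ∑ k : Fin 4, ∑ l : Fin 4,
    (LinearMap.proj s(i, j) : (Sym2 (Fin 4) → K) →ₗ[K] K).smulRight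
      (Matrix.det (Matrix.of ![x, Pi.single i 1, Pi.single k 1,
        tailCoords b (b j.succ * b l.succ)]) •
        (LinearMap.proj s(k, l) : (Sym2 (Fin 4) → K) →ₗ[K] K))

theorem squareForm_apply (b : Module.Basis (Fin 5) K Q) (x : Fin 4 → K)
    (S S' : Sym2 (Fin 4) → K) : squareForm b x S S' =
      ∑ i : Fin 4, ∑ j : Fin 4, ∑ k : Fin 4, ∑ l : Fin 4, S s(i, j) * (Matrix.det (Matrix.of
        ![x, Pi.single i 1, Pi.single k 1, tailCoords b (b j.succ * b l.succ)]) * S' s(k, l)) := by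
  simp [squareForm, LinearMap.sum_apply]

/-- The determinant with fixed first and third row. -/
noncomputable def detAux (x z : Fin 4 → K) : (Fin 4 → K) →ₗ[K] (Fin 4 → K) →ₗ[K] K :=
  LinearMap.mk₂ K (fun p r => Matrix.det (Matrix.of ![x, p, z, r]))
    (fun _ _ _ => by
      simp [Matrix.det_succ_row_zero, Fin.sum_univ_succ, Fin.succAbove]; ring)
    (fun _ _ _ => by
      simp [Matrix.det_succ_row_zero, Fin.sum_univ_succ, Fin.succAbove]; ring)
    (fun _ _ _ => by
      simp [Matrix.det_succ_row_zero, Fin.sum_univ_succ, Fin.succAbove]; ring)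
    (fun _ _ _ => by
      simp [Matrix.det_succ_row_zero, Fin.sum_univ_succ, Fin.succAbove]; ring)

theorem detAux_apply (x z p r : Fin 4 → K) :
    detAux x z p r = Matrix.det (Matrix.of ![x, p, z, r]) := rfl

theorem detAux_sum_left (x z p r : Fin 4 → K) :
    detAux x z p r = ∑ i, p i * detAux x z (Pi.single i 1) r := by
  conv_lhs => rw [pi_eq_sum_univ' p]
  simp only [map_sum, LinearMap.sum_apply, map_smul, LinearMap.smul_apply, smul_eq_mul]

theorem detAux_sum_right (x z p r : Fin 4 → K) :
    detAux x z p r = ∑ k, r k * detAux x z p (Pi.single k 1) := by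
  conv_lhs => rw [pi_eq_sum_univ' r]
  simp only [map_sum, map_smul, smul_eq_mul]

theorem det_sum_third (x p r z : Fin 4 → K) :
    ∑ k, z k * Matrix.det (Matrix.of ![x, p, Pi.single k 1, r]) =
      Matrix.det (Matrix.of ![x, p, z, r]) := by
  simp [Matrix.det_succ_row_zero, Fin.sum_univ_succ, Fin.succAbove, Pi.single_apply]
  ring

theorem squareForm_square (b : Module.Basis (Fin 5) K Q) (x z : Fin 4 → K)
    (S : Sym2 (Fin 4) → K) : squareForm b x S (symSquare z) =
      ∑ i : Fin 4, ∑ j : Fin 4, S s(i, j) * detAux x z (Pi.single i 1)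
        (tailCoords b (b j.succ * ∑ l, z l • b l.succ)) := by
  rw [squareForm_apply]
  refine Finset.sum_congr rfl fun i _ => Finset.sum_congr rfl fun j _ => ?_
  rw [Finset.mul_sum, map_sum, map_sum, Finset.mul_sum, Finset.sum_comm]
  refine Finset.sum_congr rfl fun l _ => ?_
  rw [← Finset.mul_sum]
  congr 1
  rw [mul_smul_comm, map_smul, map_smul, detAux_apply, ← det_sum_third, smul_eq_mul,
    Finset.mul_sum]
  refine Finset.sum_congr rfl fun k _ => ?_
  rw [symSquare_apply]
  ring

theorem sum_tailCoords (b : Module.Basis (Fin 5) K Q) (y : Fin 4 → K) :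
    tailCoords b (∑ i, y i • b i.succ) = y := by
  ext j
  rw [tailCoords_apply, map_sum, Finsupp.finsetSum_apply]
  simp [Finsupp.single_apply]

/-- The defining sum multiplies only the components outside `1`. The omitted components change `y *
z` by multiples of `y`, `z` and `1`, and none of these affects the determinant. -/
theorem squareForm_square_square (b : Module.Basis (Fin 5) K Q) (hb : b 0 = 1) (x : Fin 4 → K)
    (y z : Q) : squareForm b x (symSquare (tailCoords b y)) (symSquare (tailCoords b z)) =
      Matrix.det (Matrix.of ![x, tailCoords b y, tailCoords b z, tailCoords b (y * z)]) := by
  rw [squareForm_square]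
  set y' := ∑ i, tailCoords b y i • b i.succ with hy'
  set z' := ∑ i, tailCoords b z i • b i.succ with hz'
  have e1 : tailCoords b (y * z) = tailCoords b (y' * z') + b.repr y 0 • tailCoords b z +
      b.repr z 0 • tailCoords b y := by
    have hy := eq_of_tailCoords b hb y
    have hz := eq_of_tailCoords b hb z
    have hy1 : y - b.repr y 0 • 1 = y' := sub_eq_iff_eq_add'.mpr hy
    have hz1 : z - b.repr z 0 • 1 = z' := sub_eq_iff_eq_add'.mpr hz
    have : y * z = y' * z' + b.repr y 0 • z + b.repr z 0 • y -
        (b.repr y 0 * b.repr z 0) • 1 := by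
      rw [← hy1, ← hz1]
      simp only [Algebra.smul_def, map_mul, mul_one]
      ring
    rw [this]
    simp only [map_add, map_sub, map_smul, tailCoords_one b hb, smul_zero, sub_zero]
  have e2 : Matrix.det (Matrix.of ![x, tailCoords b y, tailCoords b z, tailCoords b (y * z)]) =
      detAux x (tailCoords b z) (tailCoords b y) (tailCoords b (y' * z')) := by
    rw [e1, ← detAux_apply, map_add, map_add, map_smul, map_smul, detAux_apply x _ _ (tailCoords b z),
      detAux_apply x _ _ (tailCoords b y),
      Matrix.det_zero_of_row_eq (i := 2) (j := 3) (by decide) rfl,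
      Matrix.det_zero_of_row_eq (i := 1) (j := 3) (by decide) rfl]
    simp
  rw [e2]
  have e4 : tailCoords b (y' * z') = ∑ j, tailCoords b y j • tailCoords b (b j.succ * z') := by
    rw [hy', Finset.sum_mul, map_sum]
    simp only [smul_mul_assoc, map_smul]
  rw [detAux_sum_left, e4]
  refine Finset.sum_congr rfl fun i _ => ?_
  rw [map_sum, Finset.mul_sum]
  refine Finset.sum_congr rfl fun j _ => ?_
  rw [symSquare_apply, map_smul, smul_eq_mul]
  ring

theorem squareForm_induction {P : (Sym2 (Fin 4) → K) → Prop}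
    (hsq : ∀ y, P (symSquare y)) (hadd : ∀ S S', P S → P S' → P (S + S'))
    (hsmul : ∀ (c : K) S, P S → P (c • S)) (S) : P S := by
  have hu : S ∈ Submodule.span K (Set.range (symSquare (K := K))) := by
    rw [span_range_symSquare]; trivial
  induction hu using Submodule.span_induction with
  | mem x hx => obtain ⟨y, rfl⟩ := hx; exact hsq y
  | zero => simpa using hsmul 0 _ (hsq 0)
  | add x y _ _ hx hy => exact hadd _ _ hx hy
  | smul r x _ hx => exact hsmul _ _ hx

theorem squareForm_swap (b : Module.Basis (Fin 5) K Q) (hb : b 0 = 1) (x : Fin 4 → K)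
    (S S' : Sym2 (Fin 4) → K) : squareForm b x S' S = - squareForm b x S S' := by
  induction S using squareForm_induction with
  | hsq y =>
    induction S' using squareForm_induction with
    | hsq z =>
      obtain ⟨y, rfl⟩ := tailCoords_surjective b y
      obtain ⟨z, rfl⟩ := tailCoords_surjective b z
      rw [squareForm_square_square b hb, squareForm_square_square b hb, mul_comm z y]
      have e : Matrix.of ![x, tailCoords b z, tailCoords b y, tailCoords b (y * z)] =
          (Matrix.of ![x, tailCoords b y, tailCoords b z, tailCoords b (y * z)]).submatrix
            (Equiv.swap 1 2) id := by
        ext i j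
        fin_cases i <;> rfl
      rw [e, Matrix.det_permute, Equiv.Perm.sign_swap (by decide)]
      simp
    | hadd S S' h h' => rw [map_add, map_add, LinearMap.add_apply, h, h']; ring
    | hsmul c S h => rw [map_smul, map_smul, LinearMap.smul_apply, h, smul_neg]
  | hadd S S' h h' => rw [map_add, map_add, LinearMap.add_apply, h, h']; ring
  | hsmul c S h => rw [map_smul, map_smul, LinearMap.smul_apply, h, smul_neg]

theorem squareForm_self (b : Module.Basis (Fin 5) K Q) (hb : b 0 = 1) (x : Fin 4 → K)
    (S : Sym2 (Fin 4) → K) : squareForm b x S S = 0 := by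
  induction S using squareForm_induction with
  | hsq y =>
    obtain ⟨y, rfl⟩ := tailCoords_surjective b y
    rw [squareForm_square_square b hb]
    exact Matrix.det_zero_of_row_eq (i := 1) (j := 2) (by decide) rfl
  | hadd S S' h h' =>
    rw [map_add, map_add, LinearMap.add_apply, LinearMap.add_apply, h, h',
      squareForm_swap b hb x S]
    ring
  | hsmul c S h => rw [map_smul, map_smul, LinearMap.smul_apply, h, smul_zero, smul_zero]

end SymmetricSquares

/-! ### Balanced maps and the common radical. -/

section BalancedMaps

variable {K : Type*} [CommRing K] {Q : Type*} [CommRing Q] [Algebra K Q]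

/-- Symmetric `Q`-linear maps from the dual of `Q` to `Q`. -/
structure IsBalanced (U : Module.Dual K Q →ₗ[K] Q) : Prop where
  symm : ∀ φ ψ : Module.Dual K Q, φ (U ψ) = ψ (U φ)
  map_mul : ∀ (h : Q) (φ : Module.Dual K Q), U (φ ∘ₗ LinearMap.mulLeft K h) = h * U φ

/-- The symmetric array of a symmetric map. -/
noncomputable def balancedBlock (b : Module.Basis (Fin 5) K Q) {U : Module.Dual K Q →ₗ[K] Q}
    (hU : IsBalanced U) : Sym2 (Fin 4) → K :=
  Sym2.lift ⟨fun i j => b.coord i.succ (U (b.coord j.succ)), fun _ _ => hU.symm _ _⟩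

theorem balancedBlock_apply (b : Module.Basis (Fin 5) K Q) {U : Module.Dual K Q →ₗ[K] Q}
    (hU : IsBalanced U) (i j : Fin 4) :
    balancedBlock b hU s(i, j) = b.coord i.succ (U (b.coord j.succ)) := rfl

/-- Off-diagonal terms cancel in pairs. The induction on the size avoids division by 2. -/
theorem sum_symm_mul_alt {n : ℕ} (A D : Fin n → Fin n → K) (hA : ∀ i j, A i j = A j i)
    (hD : ∀ i, D i i = 0) (hD' : ∀ i j, D j i = - D i j) : ∑ i, ∑ j, A i j * D i j = 0 := by
  induction n with
  | zero => simp
  | succ n ih =>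
    simp only [Fin.sum_univ_succ]
    rw [Finset.sum_add_distrib, ih (fun i j => A i.succ j.succ) (fun i j => D i.succ j.succ)
      (fun _ _ => hA _ _) (fun _ => hD _) (fun _ _ => hD' _ _), hD, mul_zero, zero_add, add_zero,
      ← Finset.sum_add_distrib]
    refine Finset.sum_eq_zero fun i _ => ?_
    rw [hA i.succ, hD' 0]
    ring

/-- Against a square `z²`, the form becomes the sum of `A i k` times det(x, e_i, z, e_k), where `A`
is the matrix of multiplication by `Z` after `U`. Balancedness makes `A` symmetric, and the
determinant is alternating in i and k. -/
theorem squareForm_balancedBlock (b : Module.Basis (Fin 5) K Q) (hb : b 0 = 1)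
    {U : Module.Dual K Q →ₗ[K] Q} (hU : IsBalanced U) (x : Fin 4 → K) (S : Sym2 (Fin 4) → K) :
    squareForm b x (balancedBlock b hU) S = 0 := by
  induction S using squareForm_induction with
  | hadd S S' h h' => rw [map_add, h, h', add_zero]
  | hsmul c S h => rw [map_smul, h, smul_zero]
  | hsq z =>
    rw [squareForm_square]
    set Z := ∑ l, z l • b l.succ with hZ
    have hκ : tailCoords b Z = z := sum_tailCoords b z
    set A : Fin 4 → Fin 4 → K := fun i k => b.coord i.succ (Z * U (b.coord k.succ)) with hA
    have hAsymm : ∀ i k, A i k = A k i := by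
      intro i k
      simp only [hA]
      rw [← hU.map_mul, hU.symm, LinearMap.comp_apply, LinearMap.mulLeft_apply]
    have hdual : ∀ k : Fin 4, (b.coord k.succ) ∘ₗ LinearMap.mulLeft K Z =
        ∑ j, b.coord k.succ (b j * Z) • b.coord j := by
      intro k
      refine b.ext fun j => ?_
      simp [Finsupp.single_apply, mul_comm]
    -- `A` involves all five coordinates, the block only four. The subtracted term with index 0
    -- later gives a determinant whose third and fourth rows are both `z`.
    have hV : ∀ i k : Fin 4, ∑ j : Fin 4, balancedBlock b hU s(i, j) *
        b.coord k.succ (b j.succ * Z) =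
        A i k - b.coord i.succ (U (b.coord 0)) * b.coord k.succ (b 0 * Z) := by
      intro i k
      simp only [hA]
      rw [← hU.map_mul, hdual, map_sum, map_sum]
      conv_rhs => rw [Fin.sum_univ_succ]
      simp only [map_smul, smul_eq_mul, balancedBlock_apply]
      rw [mul_comm (b.coord k.succ (b 0 * Z)), add_sub_cancel_left]
      exact Finset.sum_congr rfl fun j _ => mul_comm _ _
    have e1 : ∀ i j : Fin 4, detAux x z (Pi.single i 1) (tailCoords b (b j.succ * Z)) =
        ∑ k : Fin 4, b.coord k.succ (b j.succ * Z) *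
          detAux x z (Pi.single i 1) (Pi.single k 1) := by
      intro i j
      exact detAux_sum_right _ _ _ _
    have e2 : ∑ i : Fin 4, ∑ j : Fin 4, balancedBlock b hU s(i, j) *
        detAux x z (Pi.single i 1) (tailCoords b (b j.succ * Z)) =
        ∑ i : Fin 4, ∑ k : Fin 4, (A i k - b.coord i.succ (U (b.coord 0)) *
          b.coord k.succ (b 0 * Z)) * detAux x z (Pi.single i 1) (Pi.single k 1) := by
      refine Finset.sum_congr rfl fun i _ => ?_
      simp only [e1, Finset.mul_sum]
      rw [Finset.sum_comm]
      refine Finset.sum_congr rfl fun k _ => ?_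
      rw [← hV, Finset.sum_mul]
      exact Finset.sum_congr rfl fun j _ => by ring
    rw [e2]
    simp only [sub_mul, Finset.sum_sub_distrib]
    rw [sum_symm_mul_alt A _ hAsymm, zero_sub, neg_eq_zero]
    · refine Finset.sum_eq_zero fun i _ => ?_
      simp only [mul_assoc, ← Finset.mul_sum]
      have : ∑ k : Fin 4, b.coord k.succ (b 0 * Z) * detAux x z (Pi.single i 1) (Pi.single k 1) =
          detAux x z (Pi.single i 1) z := by
        rw [hb, one_mul, detAux_sum_right x z _ z]
        refine Finset.sum_congr rfl fun k _ => ?_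
        congr 1
        exact congrFun hκ k
      rw [this, detAux_apply, Matrix.det_zero_of_row_eq (i := 2) (j := 3) (by decide) rfl, mul_zero]
    · intro i
      rw [detAux_apply, Matrix.det_zero_of_row_eq (i := 1) (j := 3) (by decide) rfl]
    · intro i j
      simp [detAux_apply, Matrix.det_succ_row_zero, Fin.sum_univ_succ, Fin.succAbove]
      ring

end BalancedMaps

/-! ### From five balanced maps to a model. -/

section ModelOfBalanced

variable {K : Type*} [Field K] {Q : Type*} [CommRing Q] [Algebra K Q]

/-- The blocks form a five-dimensional subspace of the common radical in the ten-dimensional space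
of arrays. On the quotient, `q` is the image of the square and `a x` is the induced form. -/
theorem exists_isModel_of_balanced (b : Module.Basis (Fin 5) K Q) (hb : b 0 = 1)
    (U : (Fin 5 → K) →ₗ[K] Module.Dual K Q →ₗ[K] Q) (hU : ∀ c, IsBalanced (U c))
    (hinj : ∀ c, (∀ φ ψ : Module.Dual K Q, φ 1 = 0 → ψ 1 = 0 → φ (U c ψ) = 0) → c = 0) :
    ∃ a q, IsModel b a q := by
  set S : (Fin 5 → K) →ₗ[K] (Sym2 (Fin 4) → K) :=
    { toFun := fun c => balancedBlock b (hU c)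
      map_add' := fun c d => by
        ext s; induction s using Sym2.ind with | _ i j
        simp [balancedBlock_apply]
      map_smul' := fun r c => by
        ext s; induction s using Sym2.ind with | _ i j
        simp [balancedBlock_apply] } with hS
  have hSinj : LinearMap.ker S = ⊥ := by
    rw [LinearMap.ker_eq_bot']
    intro c hc
    apply hinj
    intro φ ψ hφ hψ
    -- Functionals vanishing at `1` are combinations of the last four coordinates, so the hypothesis
    -- of `hinj` concerns only the block of `U c`.
    have expand : ∀ φ : Module.Dual K Q, φ 1 = 0 → φ = ∑ i : Fin 4, φ (b i.succ) • b.coord i.succ := by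
      intro φ hφ
      refine b.ext fun j => ?_
      refine Fin.cases ?_ (fun j => ?_) j
      · have h1 : ∀ i : Fin 4, b.coord i.succ 1 = 0 := fun i => by rw [← hb]; simp
        rw [hb, hφ, LinearMap.sum_apply]
        simp only [LinearMap.smul_apply, h1, smul_zero, Finset.sum_const_zero]
      · simp [Finsupp.single_apply]
    rw [expand φ hφ, expand ψ hψ]
    simp only [map_sum, LinearMap.sum_apply, map_smul, LinearMap.smul_apply]
    refine Finset.sum_eq_zero fun i _ => ?_
    refine smul_eq_zero_of_right _ (Finset.sum_eq_zero fun j _ => smul_eq_zero_of_right _ ?_)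
    exact congrFun hc s(j, i)
  set E := (Sym2 (Fin 4) → K) ⧸ LinearMap.range S
  have hE : Module.finrank K E = 5 := by
    have h1 := Submodule.finrank_quotient_add_finrank (LinearMap.range S)
    have h2 := LinearMap.finrank_range_add_finrank_ker S
    rw [hSinj, finrank_bot, Module.finrank_fin_fun] at h2
    rw [Module.finrank_fintype_fun_eq_card] at h1
    have h3 : Fintype.card (Sym2 (Fin 4)) = 10 := by decide
    have h4 : Module.finrank K E + Module.finrank K (LinearMap.range S) = 10 := by
      rw [← h3]; exact h1
    omega
  let e : E ≃ₗ[K] (Fin 5 → K) := LinearEquiv.ofFinrankEq _ _ (by rw [hE, Module.finrank_fin_fun])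
  let π : (Sym2 (Fin 4) → K) →ₗ[K] (Fin 5 → K) := e.toLinearMap ∘ₗ Submodule.mkQ _
  have hπ : Function.Surjective π := e.surjective.comp (Submodule.mkQ_surjective _)
  have hker : ∀ s, π s = 0 → s ∈ LinearMap.range S := by
    intro s hs
    have : e (Submodule.mkQ _ s) = 0 := hs
    rw [LinearEquiv.map_eq_zero_iff] at this
    exact (Submodule.Quotient.mk_eq_zero _).mp this
  -- Lifts of the standard basis of the quotient. Their choice is immaterial, because the forms
  -- vanish on the range of `S`.
  choose T hT using fun i : Fin 5 => hπ (Pi.single i 1)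
  have hform : ∀ x s t, (∑ i, π s i * ∑ j, π t j * squareForm b x (T i) (T j)) =
      squareForm b x s t := by
    intro x s t
    have lift : ∀ s, ∃ c, s = ∑ i, π s i • T i + S c := by
      intro s
      have : π (s - ∑ i, π s i • T i) = 0 := by
        rw [map_sub, map_sum]
        simp only [map_smul, hT]
        rw [← pi_eq_sum_univ', sub_self]
      obtain ⟨c, hc⟩ := hker _ this
      exact ⟨c, by rw [hc]; abel⟩
    obtain ⟨c, hc⟩ := lift s
    obtain ⟨d, hd⟩ := lift t
    have z1 : ∀ c t, squareForm b x (S c) t = 0 := fun c t => squareForm_balancedBlock b hb (hU c) x t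
    have z2 : ∀ c t, squareForm b x t (S c) = 0 := fun c t => by
      rw [squareForm_swap b hb, z1, neg_zero]
    conv_rhs => rw [hc, hd]
    simp only [map_add, LinearMap.add_apply, z1, z2, add_zero]
    simp only [map_sum, LinearMap.sum_apply, map_smul, LinearMap.smul_apply, smul_eq_mul]
    simp only [Finset.mul_sum]
    rw [Finset.sum_comm]
    refine Finset.sum_congr rfl fun j _ => Finset.sum_congr rfl fun i _ => by ring
  have hlin : ∀ s t (x y : Fin 4 → K), squareForm b (x + y) s t =
      squareForm b x s t + squareForm b y s t := by
    intro s t x y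
    have key : ∀ u v w : Fin 4 → K, Matrix.det (Matrix.of ![x + y, u, v, w]) =
        Matrix.det (Matrix.of ![x, u, v, w]) + Matrix.det (Matrix.of ![y, u, v, w]) := by
      intro u v w
      simp [Matrix.det_succ_row_zero, Fin.sum_univ_succ, Fin.succAbove]; ring
    simp only [squareForm_apply, key, add_mul, mul_add, Finset.sum_add_distrib]
  have hlin' : ∀ s t (c : K) (x : Fin 4 → K), squareForm b (c • x) s t =
      c * squareForm b x s t := by
    intro s t c x
    have key : ∀ u v w : Fin 4 → K, Matrix.det (Matrix.of ![c • x, u, v, w]) =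
        c * Matrix.det (Matrix.of ![x, u, v, w]) := by
      intro u v w
      simp [Matrix.det_succ_row_zero, Fin.sum_univ_succ, Fin.succAbove]; ring
    simp only [squareForm_apply, key, Finset.mul_sum]
    refine Finset.sum_congr rfl fun i _ => Finset.sum_congr rfl fun j _ =>
      Finset.sum_congr rfl fun k _ => Finset.sum_congr rfl fun l _ => by ring
  refine ⟨{ toFun := fun x => Matrix.of fun i j => squareForm b x (T i) (T j)
            map_add' := fun x y => by ext i j; simp [hlin]
            map_smul' := fun c x => by ext i j; simp [hlin'] },
    π.compQuadraticMap symSquare, ⟨fun x => ⟨fun i => ?_, fun i j => ?_⟩, ?_, fun x y z => ?_⟩⟩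
  · exact squareForm_self b hb x _
  · exact squareForm_swap b hb x _ _
  · have : Set.range (π.compQuadraticMap symSquare) = π '' Set.range symSquare := by
      rw [← Set.range_comp]; rfl
    rw [this, Submodule.span_image, span_range_symSquare, Submodule.map_top,
      LinearMap.range_eq_top.mpr hπ]
  · have h1 := hform (tailCoords b x) (symSquare (tailCoords b y)) (symSquare (tailCoords b z))
    rw [squareForm_square_square b hb] at h1
    rw [← h1]
    simp only [dotProduct, Matrix.mulVec]
    refine Finset.sum_congr rfl fun i _ => ?_
    congr 1
    exact Finset.sum_congr rfl fun j _ => mul_comm _ _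

end ModelOfBalanced

/-! ### Frobenius algebras and repeated simple modules in the socle. -/

section NondegenerateForm

variable {K : Type*} [Field K] {Q : Type*} [CommRing Q] [Algebra K Q]

/-- A finite-dimensional algebra is Frobenius unless its socle contains a simple module twice. -/
theorem exists_nondegenerate_form_or_pair [Infinite K] [Module.Finite K Q] :
    (∃ t : Module.Dual K Q, ∀ h, (∀ g, t (g * h) = 0) → h = 0) ∨
    ∃ x y : Q, x ≠ 0 ∧ y ≠ 0 ∧ (∀ r, r * x = 0 ↔ r * y = 0) ∧ ∀ r s, r * x = s * y → r * x = 0 := by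
  have : IsArtinianRing Q := IsArtinianRing.of_finite K Q
  have hat : IsAtomic (Ideal Q) := isAtomic_of_orderBot_wellFounded_lt wellFounded_lt
  have hgen : ∀ I : Ideal Q, IsAtom I → ∃ x ∈ I, x ≠ 0 := fun I hI =>
    Submodule.exists_mem_ne_zero_of_ne_bot hI.1
  choose! ξ hξI hξ0 using hgen
  have hξ : ∀ I : Ideal Q, IsAtom I → ∀ z ∈ I, z ≠ 0 → Ideal.span {z} = I := by
    intro I hI z hz hz0
    have hle : Ideal.span {z} ≤ I := (Ideal.span_singleton_le_iff_mem _).mpr hz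
    refine (hI.le_iff.mp hle).resolve_left ?_
    rwa [Ideal.span_singleton_eq_bot]
  have hdvd : ∀ I : Ideal Q, IsAtom I → ∀ z ∈ I, z ≠ 0 → ∀ w ∈ I, ∃ s, s * z = w := by
    intro I hI z hz hz0 w hw
    rw [← hξ I hI z hz hz0] at hw
    exact Ideal.mem_span_singleton'.mp hw
  let ann : Ideal Q → Ideal Q := fun I => LinearMap.ker (LinearMap.toSpanSingleton Q Q (ξ I))
  have hann : ∀ I r, r ∈ ann I ↔ r * ξ I = 0 := by
    intro I r; simp [ann, LinearMap.mem_ker]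
  have hmax : ∀ I, IsAtom I → (ann I).IsMaximal := by
    intro I hI
    rw [Ideal.isMaximal_iff]
    refine ⟨fun h => hξ0 I hI (by simpa using (hann I 1).mp h), fun J r hJ hr hrJ => ?_⟩
    rw [hann] at hr
    obtain ⟨s, hs⟩ := hdvd I hI _ (I.mul_mem_left r (hξI I hI)) hr _ (hξI I hI)
    have : 1 - s * r ∈ J := hJ ((hann I _).mpr (by rw [sub_mul, one_mul, mul_assoc, hs, sub_self]))
    simpa using J.add_mem this (J.mul_mem_left s hrJ)
  -- If minimal ideals are determined by their annihilators, there are finitely many, since an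
  -- Artinian ring has finitely many maximal ideals. Over an infinite field some functional avoids
  -- the finitely many proper subspaces of functionals that vanish on a minimal ideal; its kernel
  -- then contains no nonzero ideal.
  by_cases hinj : Set.InjOn ann {I | IsAtom I}
  · left
    have hfin : {I : Ideal Q | IsAtom I}.Finite := by
      have hfm : {J : Ideal Q | J.IsMaximal}.Finite := by
        have := (Set.finite_range (MaximalSpectrum.asIdeal (R := Q)))
        refine this.subset fun J hJ => ⟨⟨J, hJ⟩, rfl⟩
      exact Set.Finite.of_finite_image (hfm.subset (by rintro _ ⟨I, hI, rfl⟩; exact hmax I hI)) hinj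
    let V : Ideal Q → Subspace K (Module.Dual K Q) := fun I => (I.restrictScalars K).dualAnnihilator
    have htop : ⊤ ∉ V '' {I | IsAtom I} := by
      rintro ⟨I, hI, hV⟩
      apply hξ0 I hI
      rw [← Module.forall_dual_apply_eq_zero_iff K]
      intro φ
      have : φ ∈ V I := by rw [hV]; trivial
      exact (Submodule.mem_dualAnnihilator φ).mp this _ (hξI I hI)
    have hne := Subspace.biUnion_ne_univ_of_top_notMem (s := (hfin.image V).toFinset)
      (by simpa using htop)
    rw [Ne, Set.eq_univ_iff_forall] at hne
    push Not at hne
    obtain ⟨t, ht⟩ := hne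
    refine ⟨t, fun h hh => ?_⟩
    by_contra hne
    rcases hat.eq_bot_or_exists_atom_le (Ideal.span {h}) with hb | ⟨I, hI, hIh⟩
    · exact hne (Ideal.span_singleton_eq_bot.mp hb)
    · apply ht
      simp only [Set.mem_iUnion, Set.Finite.mem_toFinset]
      refine ⟨V I, ⟨I, hI, rfl⟩, ?_⟩
      refine (Submodule.mem_dualAnnihilator t).mpr fun w hw => ?_
      obtain ⟨g, rfl⟩ := Ideal.mem_span_singleton'.mp (hIh hw)
      exact hh g
  -- Two distinct minimal ideals with the same annihilator meet in zero; their generators are the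
  -- required pair.
  · right
    simp only [Set.InjOn, not_forall] at hinj
    obtain ⟨I, hI, J, hJ, hIJ, hne⟩ := hinj
    refine ⟨ξ I, ξ J, hξ0 I hI, hξ0 J hJ, fun r => ?_, fun r s hrs => ?_⟩
    · rw [← hann, ← hann, hIJ]
    · by_contra h0
      apply hne
      have h1 : r * ξ I ∈ I := I.mul_mem_left r (hξI I hI)
      have h2 : r * ξ I ∈ J := by rw [hrs]; exact J.mul_mem_left s (hξI J hJ)
      rw [← hξ I hI _ h1 h0, ← hξ J hJ _ h2 h0]

end NondegenerateForm

/-! ### Balanced maps of a Frobenius algebra. -/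

section Frobenius

variable {K : Type*} [Field K] {Q : Type*} [CommRing Q] [Algebra K Q]

/-- The kernel of `t` has dimension at least four and is multiplied by `h` into a line, so some
nonzero `g` has `g * h = 0`. If `t` vanishes on the annihilator of `h`, then `g` contradicts
nondegeneracy. Otherwise all multiples of `h` are scalars, so `h` is a nonzero scalar, again
contradicting `g * h = 0`. -/
theorem eq_zero_of_mul_ker_le [Module.Finite K Q] (hQ : 5 ≤ Module.finrank K Q)
    (t : Module.Dual K Q)
    (ht : ∀ h, (∀ g, t (g * h) = 0) → h = 0) (h : Q) (hh : ∀ g, t g = 0 → ∃ c : K, g * h = c • 1) :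
    h = 0 := by
  by_contra h0
  have hex : ∃ g, g * h = 0 ∧ g ≠ 0 ∧ t g = 0 := by
    have hmap : ∀ g : LinearMap.ker t, g.1 * h ∈ Submodule.span K {(1 : Q)} := by
      intro g
      obtain ⟨c, hc⟩ := hh g.1 g.2
      exact Submodule.mem_span_singleton.mpr ⟨c, hc.symm⟩
    let f : LinearMap.ker t →ₗ[K] Submodule.span K {(1 : Q)} :=
      ((LinearMap.mulRight K h).domRestrict (LinearMap.ker t)).codRestrict _ hmap
    have h1 := LinearMap.finrank_range_add_finrank_ker f
    have h2 := LinearMap.finrank_range_add_finrank_ker t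
    have h3 := Submodule.finrank_le (LinearMap.range f)
    have h4 := Submodule.finrank_le (LinearMap.range t)
    have h5 := finrank_span_le_card (R := K) {(1 : Q)}
    rw [Module.finrank_self] at h4
    simp only [Set.toFinset_singleton, Finset.card_singleton] at h5
    have h6 : LinearMap.ker f ≠ ⊥ := by
      intro hb
      rw [hb, finrank_bot] at h1
      omega
    obtain ⟨g, hg, hg0⟩ := Submodule.exists_mem_ne_zero_of_ne_bot h6
    refine ⟨g.1, congrArg Subtype.val (LinearMap.mem_ker.mp hg), ?_, g.2⟩
    simpa using hg0
  obtain ⟨g, hgh, hg0, -⟩ := hex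
  by_cases hann : ∀ r, r * h = 0 → t r = 0
  · exact hg0 (ht g fun r => hann _ (by rw [mul_assoc, hgh, mul_zero]))
  · push Not at hann
    obtain ⟨r, hr, hr0⟩ := hann
    have hall : ∀ g, ∃ c : K, g * h = c • 1 := by
      intro g
      obtain ⟨c, hc⟩ := hh (g - (t g / t r) • r) (by simp [hr0])
      refine ⟨c, ?_⟩
      rw [← hc, sub_mul, smul_mul_assoc, hr, smul_zero, sub_zero]
    obtain ⟨c, hc⟩ := hall 1
    rw [one_mul] at hc
    have hc0 : c ≠ 0 := by rintro rfl; exact h0 (by simpa using hc)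
    apply hg0
    rw [hc, mul_smul_comm, mul_one, smul_eq_zero] at hgh
    exact hgh.resolve_left hc0

/-- The form identifies `Q` with its dual, and `U` is then multiplication. If the block of
multiplication by `h` is zero, then `h` times the kernel of `t` is orthogonal to that kernel, so
consists of scalars, and `eq_zero_of_mul_ker_le` applies. -/
theorem exists_balanced_of_nondegenerate [Module.Finite K Q] (hQ : Module.finrank K Q = 5)
    (t : Module.Dual K Q) (ht : ∀ h, (∀ g, t (g * h) = 0) → h = 0) :
    ∃ U : (Fin 5 → K) →ₗ[K] Module.Dual K Q →ₗ[K] Q, (∀ c, IsBalanced (U c)) ∧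
      ∀ c, (∀ φ ψ : Module.Dual K Q, φ 1 = 0 → ψ 1 = 0 → φ (U c ψ) = 0) → c = 0 := by
  let T : Q →ₗ[K] Module.Dual K Q := LinearMap.mk₂ K (fun h g => t (h * g))
    (fun _ _ _ => by rw [add_mul, map_add]) (fun _ _ _ => by rw [smul_mul_assoc, map_smul])
    (fun _ _ _ => by rw [mul_add, map_add]) (fun _ _ _ => by rw [mul_smul_comm, map_smul])
  have hT : ∀ h g, T h g = t (h * g) := fun _ _ => rfl
  have hinj : Function.Injective T := by
    rw [← LinearMap.ker_eq_bot, LinearMap.ker_eq_bot']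
    intro h hh
    apply ht
    intro g
    rw [mul_comm, ← hT, hh, LinearMap.zero_apply]
  let e : Q ≃ₗ[K] Module.Dual K Q :=
    LinearEquiv.ofInjectiveOfFinrankEq T hinj Subspace.dual_finrank_eq.symm
  have he : ∀ h g, e h g = t (h * g) := hT
  let ε : (Fin 5 → K) ≃ₗ[K] Q := LinearEquiv.ofFinrankEq _ _ (by rw [hQ, Module.finrank_fin_fun])
  let U : Q →ₗ[K] Module.Dual K Q →ₗ[K] Q := (LinearMap.mul K Q).compl₂ e.symm.toLinearMap
  have hU : ∀ h g, U h (e g) = h * g := by intro h g; simp [U]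
  have hbal : ∀ c, IsBalanced (U c) := by
    intro c
    constructor
    · intro φ ψ
      obtain ⟨g, rfl⟩ := e.surjective φ
      obtain ⟨g', rfl⟩ := e.surjective ψ
      rw [hU, hU, he, he]
      congr 1; ring
    · intro h φ
      obtain ⟨g, rfl⟩ := e.surjective φ
      have : e g ∘ₗ LinearMap.mulLeft K h = e (g * h) := by
        ext r; simp [he, mul_assoc]
      rw [this, hU, hU]
      ring
  refine ⟨U ∘ₗ ε.toLinearMap, fun c => hbal _, fun c hc => ?_⟩
  have : ε c = 0 := by
    apply eq_zero_of_mul_ker_le hQ.ge t ht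
    intro g hg
    set h := ε c with hh
    have h1 : ∀ g', t g' = 0 → t (g' * (g * h)) = 0 := by
      intro g' hg'
      have := hc (e g') (e g) (by rw [he, mul_one, hg']) (by rw [he, mul_one, hg])
      rw [LinearMap.comp_apply, LinearEquiv.coe_coe, ← hh, hU, he] at this
      rw [mul_comm g h]; exact this
    by_cases ht1 : ∀ g', t g' = 0
    · exact ⟨0, by rw [zero_smul]; exact ht _ fun _ => ht1 _⟩
    · push Not at ht1
      obtain ⟨r, hr⟩ := ht1
      -- The orthogonal complement of the kernel of `t` is the line of `1`; pairing with `r` outside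
      -- this kernel determines the multiple.
      refine ⟨t (r * (g * h)) / t r, ?_⟩
      rw [← sub_eq_zero]
      apply ht
      intro s
      have := h1 (s - (t s / t r) • r) (by simp [hr])
      rw [sub_mul, map_sub, smul_mul_assoc, map_smul, smul_eq_mul, sub_eq_zero] at this
      rw [mul_sub, map_sub, this, mul_smul_comm, map_smul, mul_one, smul_eq_mul]
      field_simp
      ring
  simpa using this

end Frobenius

/-! ### The remaining algebras, and existence of a model over the field. -/

section DoubleSocle

variable {K : Type*} [Field K] {Q : Type*} [CommRing Q] [Algebra K Q]

/-- The nilpotents form the plane of `x` and `y`. The common annihilator of `x` and `y` has a power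
generated by an idempotent `e`, and `Q` splits as K[x, y]/(x, y)² times the algebra `e Q`, which is
generated by `z`. -/
theorem exists_basis_of_pair [Module.Finite K Q] (hQ : Module.finrank K Q = 5)
    (hnil : ∀ v : Fin 3 → Q, (∀ i, IsNilpotent (v i)) → ¬ LinearIndependent K v)
    {x y : Q} (hx : x ≠ 0) (hy : y ≠ 0) (hxy : ∀ r, r * x = 0 ↔ r * y = 0)
    (hdisj : ∀ r s, r * x = s * y → r * x = 0) :
    ∃ (e z : Q) (b : Module.Basis (Fin 5) K Q) (α β : K), ⇑b = ![1, x, y, e, z] ∧ x * x = 0 ∧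
      y * y = 0 ∧ x * y = 0 ∧ e * x = 0 ∧ e * y = 0 ∧ z * x = 0 ∧ z * y = 0 ∧ e * e = e ∧
      e * z = z ∧ z * z = α • z + β • e := by
  have hart : IsArtinianRing Q := IsArtinianRing.of_finite K Q
  have h1 : x * y = 0 := by
    rw [mul_comm]; exact hdisj y x (mul_comm y x)
  have h2 : y * y = 0 := (hxy y).mp (by rw [mul_comm, h1])
  have h3 : x * x = 0 := (hxy x).mpr h1
  have hlin : ∀ a b : K, a • x + b • y = 0 → a = 0 ∧ b = 0 := by
    intro a b h
    have hd := hdisj (algebraMap K Q a) (algebraMap K Q (-b)) (by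
      rw [map_neg, neg_mul, ← Algebra.smul_def, ← Algebra.smul_def]
      exact eq_neg_of_add_eq_zero_left h)
    rw [← Algebra.smul_def] at hd
    rw [hd, zero_add] at h
    exact ⟨(smul_eq_zero.mp hd).resolve_right hx, (smul_eq_zero.mp h).resolve_right hy⟩
  have hnx : IsNilpotent x := ⟨2, by rw [pow_two, h3]⟩
  have hny : IsNilpotent y := ⟨2, by rw [pow_two, h2]⟩
  have hnil' : ∀ w, IsNilpotent w → ∃ a b : K, w = a • x + b • y := by
    intro w hw
    have := hnil ![x, y, w] (by intro i; fin_cases i <;> assumption)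
    rw [Fintype.not_linearIndependent_iff] at this
    obtain ⟨g, hg, i, hi⟩ := this
    simp only [Fin.sum_univ_three, Matrix.cons_val_zero, Matrix.cons_val_one,
      Matrix.cons_val_two] at hg
    simp at hg
    have hg2 : g 2 ≠ 0 := by
      intro h
      rw [h, zero_smul, add_zero] at hg
      obtain ⟨h0, h1⟩ := hlin _ _ hg
      fin_cases i <;> simp_all
    refine ⟨-(g 2)⁻¹ * g 0, -(g 2)⁻¹ * g 1, ?_⟩
    have : g 2 • w = -(g 0 • x + g 1 • y) := eq_neg_of_add_eq_zero_right hg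
    rw [← inv_smul_smul₀ hg2 w, this]
    module
  let n : Ideal Q := LinearMap.ker (LinearMap.toSpanSingleton Q Q x)
  have hn : ∀ r, r ∈ n ↔ r * x = 0 := by
    intro r; simp [n, LinearMap.mem_ker]
  have hstab : ∃ k, 0 < k ∧ IsIdempotentElem (n ^ k) := by
    let f : ℕ →o (Submodule Q Q)ᵒᵈ := ⟨fun k => OrderDual.toDual (n ^ k), fun i j hij =>
      Ideal.pow_le_pow_right hij⟩
    obtain ⟨k, hk⟩ := IsArtinian.monotone_stabilizes f
    have hk' : ∀ m, k ≤ m → n ^ k = n ^ m := fun m hm => hk m hm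
    refine ⟨k + 1, k.succ_pos, ?_⟩
    rw [IsIdempotentElem, ← pow_add, ← hk' (k + 1) (by omega), ← hk' _ (by omega)]
  obtain ⟨k, hk0, hk⟩ := hstab
  have hnoeth : IsNoetherianRing Q := inferInstance
  obtain ⟨e, he, hspan⟩ := (Ideal.isIdempotentElem_iff_of_fg _ (IsNoetherian.noetherian _)).mp hk
  have hen : e ∈ n := Ideal.pow_le_self hk0.ne' (by rw [hspan]; exact Submodule.mem_span_singleton_self e)
  have hex : e * x = 0 := (hn e).mp hen
  have hey : e * y = 0 := (hxy e).mp hex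
  have hdecomp : ∀ v ∈ n, ∃ a b : K, v = v * e + (a • x + b • y) := by
    intro v hv
    have hnv : IsNilpotent (v * (1 - e)) := by
      refine ⟨k, ?_⟩
      have : v ^ k ∈ Ideal.span {e} := by
        change v ^ k ∈ Submodule.span Q {e}
        rw [← hspan]; exact Ideal.pow_mem_pow hv k
      obtain ⟨r, hr⟩ := Ideal.mem_span_singleton'.mp this
      obtain ⟨m, rfl⟩ := Nat.exists_eq_succ_of_ne_zero hk0.ne'
      rw [mul_pow, ← hr, pow_succ]
      have : e * (1 - e) = 0 := by rw [mul_sub, mul_one, he.eq, sub_self]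
      linear_combination r * (1 - e) ^ m * this
    obtain ⟨a, b, hab⟩ := hnil' _ hnv
    exact ⟨a, b, by rw [← hab]; ring⟩
  -- The multiples of `x` are nilpotent, hence lie in the plane of `x` and `y`; by `hdisj` they lie
  -- in the line of `x`.
  have hndim : 4 ≤ Module.finrank K (LinearMap.ker (LinearMap.mulRight K x)) := by
    have hr : LinearMap.range (LinearMap.mulRight K x) ≤ Submodule.span K {x} := by
      rintro _ ⟨q, rfl⟩
      rw [LinearMap.mulRight_apply]
      have : IsNilpotent (q * x) := ⟨2, by rw [mul_pow, pow_two x, h3, mul_zero]⟩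
      obtain ⟨a, b, hab⟩ := hnil' _ this
      have hb := hdisj (q - algebraMap K Q a) (algebraMap K Q b) (by
        rw [sub_mul, hab, Algebra.smul_def, Algebra.smul_def]; ring)
      rw [sub_mul, sub_eq_zero, ← Algebra.smul_def] at hb
      exact Submodule.mem_span_singleton.mpr ⟨a, hb.symm⟩
    have h1 := LinearMap.finrank_range_add_finrank_ker (LinearMap.mulRight K x)
    have h2 := Submodule.finrank_mono hr
    rw [finrank_span_singleton hx] at h2
    omega
  -- Otherwise the annihilator of `x` would lie in the span of `x`, `y`, `e`, which is too small.
  obtain ⟨z, hz, hze⟩ : ∃ z, e * z = z ∧ ∀ c : K, z ≠ c • e := by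
    by_contra hcon
    push Not at hcon
    have hle : LinearMap.ker (LinearMap.mulRight K x) ≤ Submodule.span K (Set.range ![x, y, e]) := by
      intro v hv
      have hv' : v ∈ n := (hn v).mpr (by simpa using hv)
      obtain ⟨a, b, hab⟩ := hdecomp v hv'
      obtain ⟨c, hc⟩ := hcon (v * e) (by rw [mul_comm, mul_assoc, he.eq])
      rw [hab, hc]
      have hm : ∀ i, (![x, y, e] : Fin 3 → Q) i ∈ Submodule.span K (Set.range ![x, y, e]) :=
        fun i => Submodule.subset_span ⟨i, rfl⟩
      exact Submodule.add_mem _ (Submodule.smul_mem _ _ (hm 2))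
        (Submodule.add_mem _ (Submodule.smul_mem _ _ (hm 0)) (Submodule.smul_mem _ _ (hm 1)))
    have h1 := Submodule.finrank_mono hle
    have h2 := finrank_range_le_card (R := K) ![x, y, e]
    rw [Fintype.card_fin, Set.finrank] at h2
    omega
  have hzx : z * x = 0 := by rw [← hz]; linear_combination z * hex
  have hzy : z * y = 0 := by rw [← hz]; linear_combination z * hey
  have he0 : e ≠ 0 := by
    rintro rfl
    exact hze 0 (by rw [← hz]; simp)
  have hli : LinearIndependent K ![1, x, y, e, z] := by
    rw [Fintype.linearIndependent_iff]
    intro g hg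
    simp only [Fin.sum_univ_five, Matrix.cons_val] at hg
    have e0 : g 0 • x = 0 := by
      have := congrArg (· * x) hg
      simpa [add_mul, h3, hex, hzx, mul_comm y x, h1] using this
    have g0 := (smul_eq_zero.mp e0).resolve_right hx
    rw [g0, zero_smul, zero_add] at hg
    have e1 : g 3 • e + g 4 • z = 0 := by
      have := congrArg (e * ·) hg
      simpa [mul_add, hex, hey, he.eq, hz] using this
    have g4 : g 4 = 0 := by
      by_contra h
      apply hze (-(g 4)⁻¹ * g 3)
      have : g 4 • z = -(g 3 • e) := eq_neg_of_add_eq_zero_right e1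
      rw [← inv_smul_smul₀ h z, this]
      module
    have g3 : g 3 = 0 := by
      rw [g4, zero_smul, add_zero] at e1
      exact (smul_eq_zero.mp e1).resolve_right he0
    rw [g3, g4, zero_smul, zero_smul, add_zero, add_zero] at hg
    obtain ⟨g1, g2⟩ := hlin _ _ hg
    intro i
    fin_cases i <;> assumption
  let b := basisOfLinearIndependentOfCardEqFinrank hli (by rw [hQ]; rfl)
  have hb : ⇑b = ![1, x, y, e, z] := coe_basisOfLinearIndependentOfCardEqFinrank _ _
  refine ⟨e, z, b, b.repr (z * z) 4, b.repr (z * z) 0 + b.repr (z * z) 3, hb, h3, h2, h1, hex, hey,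
    hzx, hzy, he.eq, hz, ?_⟩
  have := b.sum_repr (z * z)
  simp only [hb, Fin.sum_univ_five, Matrix.cons_val] at this
  have h' := congrArg (e * ·) this
  simp only [mul_add, mul_smul_comm, hex, hey, he.eq, hz, smul_zero, mul_one, add_zero] at h'
  rw [← mul_assoc, hz] at h'
  refine h'.symm.trans ?_
  module

/-- On the factor K[x, y]/(x, y)², every symmetric tensor in `x` and `y` is balanced, which gives
three parameters. On the quadratic factor, `c 3` belongs to a generator of the balanced maps and `c
4` to `z` times it. -/
theorem exists_balanced_of_basis {x y e z : Q} (b : Module.Basis (Fin 5) K Q) {α β : K}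
    (hb : ⇑b = ![1, x, y, e, z]) (hxx : x * x = 0) (hyy : y * y = 0) (hxy : x * y = 0)
    (hex : e * x = 0) (hey : e * y = 0) (hzx : z * x = 0) (hzy : z * y = 0) (hee : e * e = e)
    (hez : e * z = z) (hzz : z * z = α • z + β • e) :
    ∃ U : (Fin 5 → K) →ₗ[K] Module.Dual K Q →ₗ[K] Q, (∀ c, IsBalanced (U c)) ∧
      ∀ c, (∀ φ ψ : Module.Dual K Q, φ 1 = 0 → ψ 1 = 0 → φ (U c ψ) = 0) → c = 0 := by
  let U : (Fin 5 → K) →ₗ[K] Module.Dual K Q →ₗ[K] Q := LinearMap.mk₂ K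
    (fun c φ => (c 0 * φ x) • x + c 1 • (φ x • y + φ y • x) + (c 2 * φ y) • y +
      c 3 • (φ e • z + φ z • e - (α * φ e) • e) + c 4 • (φ z • z + (β * φ e) • e))
    (fun c d φ => by simp only [Pi.add_apply]; module)
    (fun r c φ => by simp only [Pi.smul_apply, smul_eq_mul]; module)
    (fun c φ ψ => by simp only [LinearMap.add_apply]; module)
    (fun r c φ => by simp only [LinearMap.smul_apply, smul_eq_mul]; module)
  have hU : ∀ c φ, U c φ = (c 0 * φ x) • x + c 1 • (φ x • y + φ y • x) + (c 2 * φ y) • y +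
      c 3 • (φ e • z + φ z • e - (α * φ e) • e) + c 4 • (φ z • z + (β * φ e) • e) :=
    fun _ _ => rfl
  refine ⟨U, fun c => ⟨fun φ ψ => ?_, fun h φ => ?_⟩, fun c hc => ?_⟩
  · simp only [hU, map_add, map_sub, map_smul, smul_eq_mul]
    ring
  · have hh := b.sum_repr h
    simp only [hb, Fin.sum_univ_five, Matrix.cons_val] at hh
    generalize b.repr h 0 = r0 at hh
    generalize b.repr h 1 = r1 at hh
    generalize b.repr h 2 = r2 at hh
    generalize b.repr h 3 = r3 at hh
    generalize b.repr h 4 = r4 at hh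
    have m1 : h * x = r0 • x := by
      rw [← hh]; simp [add_mul, hxx, mul_comm y x, hxy, hex, hzx]
    have m2 : h * y = r0 • y := by
      rw [← hh]; simp [add_mul, hxy, hyy, hey, hzy]
    have m3 : h * e = (r0 + r3) • e + r4 • z := by
      rw [← hh]; simp [add_mul, mul_comm x e, hex, mul_comm y e, hey, hee, mul_comm z e, hez]
      module
    have m4 : h * z = (r0 + r3) • z + r4 • (α • z + β • e) := by
      rw [← hh, ← hzz]; simp [add_mul, mul_comm x z, hzx, mul_comm y z, hzy, hez]
      module
    simp only [hU, LinearMap.comp_apply, LinearMap.mulLeft_apply, mul_add, mul_sub, mul_smul_comm,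
      m1, m2, m3, m4, map_add, map_smul, smul_eq_mul]
    module
  · have hc' : ∀ i j : Fin 4, b.coord i.succ (U c (b.coord j.succ)) = 0 := by
      have h1 : ∀ i : Fin 4, b.coord i.succ 1 = 0 := fun i => by
        have : b 0 = 1 := by rw [hb]; rfl
        rw [← this]; simp
      exact fun i j => hc _ _ (h1 i) (h1 j)
    have hbx : x = b 1 := by rw [hb]; rfl
    have hby : y = b 2 := by rw [hb]; rfl
    have hbe : e = b 3 := by rw [hb]; rfl
    have hbz : z = b 4 := by rw [hb]; rfl
    have c0 := hc' 0 0
    have c1 := hc' 0 1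
    have c2 := hc' 1 1
    have c3 := hc' 2 3
    have c4 := hc' 3 3
    rw [hU, hbx, hby, hbe, hbz] at c0 c1 c2 c3 c4
    simp at c0 c1 c2 c3 c4
    ext i
    fin_cases i <;> assumption

theorem exists_basis_zero_eq_one [Module.Finite K Q] [Nontrivial Q] {n : ℕ}
    (hQ : Module.finrank K Q = n + 1) : ∃ b : Module.Basis (Fin (n + 1)) K Q, b 0 = 1 := by
  have hdim : Module.finrank K (Q ⧸ Submodule.span K {(1 : Q)}) = n := by
    have := Submodule.finrank_quotient_add_finrank (Submodule.span K {(1 : Q)})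
    rw [finrank_span_singleton one_ne_zero] at this
    omega
  let c := Module.finBasisOfFinrankEq K _ hdim
  choose v hv using fun i => Submodule.mkQ_surjective (Submodule.span K {(1 : Q)}) (c i)
  have hmap : ⇑(Submodule.mkQ (Submodule.span K {(1 : Q)})) ∘ v = c := funext hv
  have hli : LinearIndependent K (Fin.cons (1 : Q) v : Fin (n + 1) → Q) := by
    rw [linearIndependent_finCons]
    refine ⟨LinearIndependent.of_comp (Submodule.mkQ (Submodule.span K {(1 : Q)}))
      (by rw [hmap]; exact c.linearIndependent), fun h1 => ?_⟩
    obtain ⟨r, hr⟩ := (Submodule.mem_span_range_iff_exists_fun K).mp h1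
    have h0 := congrArg (Submodule.mkQ (Submodule.span K {(1 : Q)})) hr
    rw [map_sum] at h0
    simp only [map_smul, hv] at h0
    have h2 : Submodule.mkQ (Submodule.span K {(1 : Q)}) 1 = 0 :=
      (Submodule.Quotient.mk_eq_zero _).mpr (Submodule.mem_span_singleton_self _)
    rw [h2] at h0
    have hr0 := Fintype.linearIndependent_iff.mp c.linearIndependent r h0
    simp [hr0] at hr
  refine ⟨basisOfLinearIndependentOfCardEqFinrank hli (by rw [hQ, Fintype.card_fin]), ?_⟩
  rw [coe_basisOfLinearIndependentOfCardEqFinrank, Fin.cons_zero]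

theorem exists_isModel [Infinite K] [Module.Finite K Q] (hQ : Module.finrank K Q = 5)
    (hnil : ∀ v : Fin 3 → Q, (∀ i, IsNilpotent (v i)) → ¬ LinearIndependent K v) :
    ∃ (b : Module.Basis (Fin 5) K Q) (a : (Fin 4 → K) →ₗ[K] Matrix (Fin 5) (Fin 5) K)
      (q : QuadraticMap K (Fin 4 → K) (Fin 5 → K)), b 0 = 1 ∧ IsModel b a q := by
  have hnt : Nontrivial Q := Module.nontrivial_of_finrank_pos (R := K) (by omega)
  obtain ⟨b, hb⟩ := exists_basis_zero_eq_one (K := K) (Q := Q) hQ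
  obtain ⟨U, hU, hinj⟩ : ∃ U : (Fin 5 → K) →ₗ[K] Module.Dual K Q →ₗ[K] Q,
      (∀ c, IsBalanced (U c)) ∧
      ∀ c, (∀ φ ψ : Module.Dual K Q, φ 1 = 0 → ψ 1 = 0 → φ (U c ψ) = 0) → c = 0 := by
    rcases exists_nondegenerate_form_or_pair (K := K) (Q := Q) with ⟨t, ht⟩ | ⟨x, y, hx, hy, h1, h2⟩
    · exact exists_balanced_of_nondegenerate hQ t ht
    · obtain ⟨e, z, b, α, β, hb, a1, a2, a3, a4, a5, a6, a7, a8, a9, a10⟩ :=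
        exists_basis_of_pair hQ hnil hx hy h1 h2
      exact exists_balanced_of_basis b hb a1 a2 a3 a4 a5 a6 a7 a8 a9 a10
  obtain ⟨a, q, h⟩ := exists_isModel_of_balanced b hb U hU hinj
  exact ⟨b, a, q, hb, h⟩

end DoubleSocle

/-! ### Proportional systems of quadrics. -/

section ProportionalQuadraticMaps

variable {K : Type*} [Field K]

theorem QuadraticMap.exists_mvPolynomial {n : ℕ} (f : QuadraticMap K (Fin n → K) K) :
    ∃ P : MvPolynomial (Fin n) K, P.IsHomogeneous 2 ∧ ∀ y, MvPolynomial.eval y P = f y := by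
  obtain ⟨B, hB⟩ := LinearMap.BilinMap.toQuadraticMap_surjective (R := K) (M := Fin n → K) (N := K) f
  refine ⟨∑ i, ∑ j, MvPolynomial.C (B (Pi.single i 1) (Pi.single j 1)) *
    (MvPolynomial.X i * MvPolynomial.X j), ?_, fun y => ?_⟩
  · refine MvPolynomial.IsHomogeneous.sum _ _ _ fun i _ =>
      MvPolynomial.IsHomogeneous.sum _ _ _ fun j _ => MvPolynomial.IsHomogeneous.C_mul ?_ _
    exact (MvPolynomial.isHomogeneous_X K i).mul (MvPolynomial.isHomogeneous_X K j)
  · rw [← hB, LinearMap.BilinMap.toQuadraticMap_apply]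
    conv_rhs => rw [pi_eq_sum_univ' y]
    simp only [map_sum, LinearMap.sum_apply, map_smul, LinearMap.smul_apply, smul_eq_mul, map_mul,
      MvPolynomial.eval_C, MvPolynomial.eval_X]
    rw [Finset.sum_comm]
    refine Finset.sum_congr rfl fun j _ => ?_
    rw [Finset.mul_sum]
    exact Finset.sum_congr rfl fun i _ => by ring

/-- Pairwise proportional quadrics that span a space of dimension five differ by a constant. -/
theorem QuadraticMap.exists_eq_smul [Infinite K] (p q : QuadraticMap K (Fin 4 → K) (Fin 5 → K))
    (hq : Submodule.span K (Set.range q) = ⊤) (h : ∀ y i j, p y i * q y j = p y j * q y i) :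
    ∃ c : K, ∀ y, p y = c • q y := by
  choose P hP hPe using fun i => QuadraticMap.exists_mvPolynomial
    ((LinearMap.proj i : (Fin 5 → K) →ₗ[K] K).compQuadraticMap p)
  choose q' hQ hQe using fun i => QuadraticMap.exists_mvPolynomial
    ((LinearMap.proj i : (Fin 5 → K) →ₗ[K] K).compQuadraticMap q)
  simp only [LinearMap.compQuadraticMap_apply, LinearMap.proj_apply] at hPe hQe
  have hPQ : ∀ i j, P i * q' j = P j * q' i := by
    intro i j
    apply MvPolynomial.funext
    intro y
    rw [map_mul, map_mul, hPe, hQe, hPe, hQe, h]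
  -- A linear relation among the polynomials is a linear form vanishing on all values of `q`, which
  -- span.
  have hind : ∀ l : Fin 5 → K, ∑ j, MvPolynomial.C (l j) * q' j = 0 → l = 0 := by
    intro l hl
    have hf : Fintype.linearCombination K l = 0 := by
      apply LinearMap.ext_on_range (v := q) hq
      intro y
      have := congrArg (MvPolynomial.eval y) hl
      simp only [map_sum, map_mul, MvPolynomial.eval_C, hQe, map_zero] at this
      rw [Fintype.linearCombination_apply, LinearMap.zero_apply, ← this]
      exact Finset.sum_congr rfl fun j _ => mul_comm _ _
    ext j
    have := LinearMap.congr_fun hf (Pi.single j 1)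
    rw [Fintype.linearCombination_apply_single] at this
    simpa using this
  have hq0 : ∀ j, q' j ≠ 0 := by
    intro j hj
    have := hind (Pi.single j 1) (Finset.sum_eq_zero fun i _ => by
      by_cases hij : i = j
      · subst hij; rw [hj, mul_zero]
      · simp [hij])
    simpa using congrFun this j
  by_cases hP0 : P 0 = 0
  · refine ⟨0, fun y => ?_⟩
    ext j
    have := hPQ j 0
    rw [hP0, zero_mul] at this
    have := (mul_eq_zero.mp this).resolve_right (hq0 0)
    rw [← hPe, this]
    simp
  -- `A / B` is `P 0 / q' 0` in lowest terms; by proportionality `B` divides every `q' j`. A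
  -- nonconstant `B` would leave five quotients `r j` in too small a space.
  obtain ⟨A, B, g, hrel, hA, hB⟩ :=
    UniqueFactorizationMonoid.exists_reduced_factors' (P 0) (q' 0) (hq0 0)
  have hg : g ≠ 0 := by rintro rfl; exact hP0 (by rw [← hA, zero_mul])
  have hB0 : B ≠ 0 := by rintro rfl; exact hq0 0 (by rw [← hB, mul_zero])
  have hA0 : A ≠ 0 := by rintro rfl; exact hP0 (by rw [← hA, mul_zero])
  have hAB : ∀ j, A * q' j = B * P j := by
    intro j
    have := hPQ 0 j
    rw [← hA, ← hB] at this
    apply mul_left_cancel₀ hg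
    linear_combination this
  have hdvd : ∀ j, B ∣ q' j := fun j => hrel.symm.dvd_of_dvd_mul_left ⟨P j, hAB j⟩
  choose r hr using hdvd
  have hr0 : ∀ j, r j ≠ 0 := fun j hj => hq0 j (by rw [hr, hj, mul_zero])
  have hdeg : ∀ j, B.totalDegree + (r j).totalDegree = 2 := by
    intro j
    rw [← MvPolynomial.totalDegree_mul_of_isDomain hB0 (hr0 j), ← hr]
    exact (hQ j).totalDegree (hq0 j)
  have hBdeg : B.totalDegree = 0 := by
    by_contra hne
    have hB1 : 1 ≤ B.totalDegree := Nat.one_le_iff_ne_zero.mpr hne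
    -- If `B` has degree two, the `r j` are five constants. If it has degree one, each `r j` has
    -- four linear coefficients, and a relation among these holds up to a constant `s`; then `B * s`
    -- is homogeneous of degree two but of degree at most one, hence zero.
    obtain ⟨l, hl0, hl⟩ : ∃ l : Fin 5 → K, l ≠ 0 ∧ ∃ s : K,
        ∑ j, MvPolynomial.C (l j) * r j = MvPolynomial.C s ∧ (s = 0 ∨ B.totalDegree < 2) := by
      by_cases hB2 : B.totalDegree = 2
      · have : ∀ j, ∃ s, r j = MvPolynomial.C s := fun j =>
          ⟨_, MvPolynomial.totalDegree_eq_zero_iff_eq_C.mp (by have := hdeg j; omega)⟩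
        choose s hs using this
        have hker : LinearMap.ker (Fintype.linearCombination K s) ≠ ⊥ := by
          intro hb
          have := LinearMap.finrank_range_add_finrank_ker (Fintype.linearCombination K s)
          have h2 := Submodule.finrank_le (LinearMap.range (Fintype.linearCombination K s))
          rw [hb, finrank_bot, Module.finrank_fin_fun] at this
          rw [Module.finrank_self] at h2
          omega
        obtain ⟨l, hl, hl0⟩ := Submodule.exists_mem_ne_zero_of_ne_bot hker
        refine ⟨l, hl0, 0, ?_, Or.inl rfl⟩
        rw [LinearMap.mem_ker, Fintype.linearCombination_apply] at hl
        simp only [smul_eq_mul] at hl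
        simp only [hs, ← map_mul, ← map_sum, hl]
      · let f : (Fin 5 → K) →ₗ[K] (Fin 4 → K) := Fintype.linearCombination K fun j i =>
          (r j).coeff (Finsupp.single i 1)
        have hker : LinearMap.ker f ≠ ⊥ := by
          intro hb
          have := LinearMap.finrank_range_add_finrank_ker f
          have h2 := Submodule.finrank_le (LinearMap.range f)
          rw [hb, finrank_bot, Module.finrank_fin_fun] at this
          rw [Module.finrank_fin_fun] at h2
          omega
        obtain ⟨l, hl, hl0⟩ := Submodule.exists_mem_ne_zero_of_ne_bot hker
        refine ⟨l, hl0, (∑ j, MvPolynomial.C (l j) * r j).coeff 0, ?_,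
          Or.inr (by have := hdeg 0; omega)⟩
        rw [LinearMap.mem_ker] at hl
        rw [Fintype.linearCombination_apply] at hl
        ext d
        by_cases hd0 : d = 0
        · rw [hd0]; simp
        rw [MvPolynomial.coeff_C, if_neg (Ne.symm hd0), MvPolynomial.coeff_sum]
        simp only [MvPolynomial.coeff_C_mul]
        by_cases hd1 : d.degree = 1
        · obtain ⟨i, rfl⟩ := (Set.ext_iff.mp Finsupp.range_single_one d).mpr hd1
          have := congrFun hl i
          simpa using this
        · refine Finset.sum_eq_zero fun j _ => ?_
          rw [MvPolynomial.coeff_eq_zero_of_totalDegree_lt, mul_zero]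
          have h0 : d.degree ≠ 0 := by rwa [Ne, Finsupp.degree_eq_zero_iff]
          have h2 : d.degree = ∑ i ∈ d.support, d i := rfl
          have h3 := hdeg j
          omega
    obtain ⟨s, hs, hs'⟩ := hl
    apply hl0
    apply hind
    have e : ∑ j, MvPolynomial.C (l j) * q' j = B * MvPolynomial.C s := by
      rw [← hs, Finset.mul_sum]
      refine Finset.sum_congr rfl fun j _ => ?_
      rw [hr]; ring
    rcases hs' with rfl | hB2
    · rw [e, map_zero, mul_zero]
    · by_contra hne
      have hh : (∑ j, MvPolynomial.C (l j) * q' j).IsHomogeneous 2 :=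
        MvPolynomial.IsHomogeneous.sum _ _ _ fun j _ => (hQ j).C_mul _
      have h1 := hh.totalDegree hne
      have h2 := MvPolynomial.totalDegree_mul B (MvPolynomial.C s)
      rw [← e, h1, MvPolynomial.totalDegree_C] at h2
      omega
  have hAdeg : A.totalDegree = 0 := by
    have h1 := congrArg MvPolynomial.totalDegree (hAB 0)
    rw [MvPolynomial.totalDegree_mul_of_isDomain hA0 (hq0 0),
      MvPolynomial.totalDegree_mul_of_isDomain hB0 hP0, (hP 0).totalDegree hP0,
      (hQ 0).totalDegree (hq0 0), hBdeg] at h1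
    omega
  rw [MvPolynomial.totalDegree_eq_zero_iff_eq_C] at hAdeg hBdeg
  set α := A.coeff 0
  set β := B.coeff 0
  have hβ : β ≠ 0 := by
    intro h; rw [h, map_zero] at hBdeg; exact hB0 hBdeg
  refine ⟨β⁻¹ * α, fun y => ?_⟩
  ext j
  have := congrArg (MvPolynomial.eval y) (hAB j)
  rw [hAdeg, hBdeg, map_mul, map_mul, MvPolynomial.eval_C, MvPolynomial.eval_C, hPe, hQe] at this
  rw [Pi.smul_apply, smul_eq_mul, mul_assoc, this, inv_mul_cancel_left₀ hβ]

end ProportionalQuadraticMaps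

/-! ### Pfaffians of a model. -/

section PfaffianMap

variable {A : Type*} [CommRing A]

/-- The quadratic map of Pfaffians. -/
def pfQuad : QuadraticMap A (Matrix (Fin 5) (Fin 5) A) (Fin 5 → A) where
  toFun := pfVec
  toFun_smul c B := by rw [pfVec_smul, pow_two]
  exists_companion' := ⟨LinearMap.mk₂ A pfPolar
    (fun B B' C => by ext i; fin_cases i <;> simp [pfPolar] <;> ring)
    (fun c B C => by ext i; fin_cases i <;> simp [pfPolar] <;> ring)
    (fun B C C' => by ext i; fin_cases i <;> simp [pfPolar] <;> ring)
    (fun c B C => by ext i; fin_cases i <;> simp [pfPolar] <;> ring),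
    fun B C => pfVec_add B C⟩

variable {K Q : Type*} [Field K] [CommRing Q] [Algebra K Q]
  {b : Module.Basis (Fin 5) K Q} {a : (Fin 4 → K) →ₗ[K] Matrix (Fin 5) (Fin 5) K}
  {q : QuadraticMap K (Fin 4 → K) (Fin 5 → K)}

/-- `a y` annihilates `q y`, so `pfVec_mul_comm` makes the two quadratic maps proportional at every
point. -/
theorem IsModel.exists_pfVec_eq_smul [Infinite K] (h : IsModel b a q) :
    ∃ c : K, ∀ y, pfVec (a y) = c • q y := by
  obtain ⟨c, hc⟩ := QuadraticMap.exists_eq_smul (pfQuad.comp a) q h.span_eq_top fun y i j =>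
    pfVec_mul_comm (h.alt y) (h.mulVec_self y) i j
  exact ⟨c, hc⟩

end PfaffianMap

/-! ### Integrality and reduction modulo a uniformizer. -/

section IntegralElements

/-- Cayley–Hamilton for multiplication by `x` on `N`; evaluation at the non-zero-divisor `u`
transfers the equation to `x`. -/
theorem isIntegral_of_mul_mem {A E : Type*} [CommRing A] [CommRing E] [Algebra A E]
    (N : Submodule A E) (hN : N.FG) {u : E} (hu : u ∈ N) (hu' : ∀ y, y * u = 0 → y = 0) (x : E)
    (hx : ∀ z ∈ N, x * z ∈ N) : IsIntegral A x := by
  have : Module.Finite A N := Module.Finite.iff_fg.mpr hN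
  let f : N →ₗ[A] N := (LinearMap.mulLeft A x).restrict hx
  obtain ⟨P, hP, hPf⟩ := LinearMap.exists_monic_and_aeval_eq_zero A f
  refine ⟨P, hP, ?_⟩
  have key : ∀ (P : Polynomial A) (z : N),
      ((Polynomial.aeval f P z : N) : E) = Polynomial.aeval x P * z := by
    intro P
    induction P using Polynomial.induction_on with
    | C a => intro z; simp [Algebra.smul_def]
    | add p q hp hq => intro z; simp [hp, hq, add_mul]
    | monomial n a h =>
      intro z
      have e : (Polynomial.C a * Polynomial.X ^ (n + 1) : Polynomial A) =
          (Polynomial.C a * Polynomial.X ^ n) * Polynomial.X := by ring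
      rw [e, map_mul (Polynomial.aeval f), map_mul (Polynomial.aeval x), Polynomial.aeval_X,
        Polynomial.aeval_X, Module.End.mul_apply, h, mul_assoc]
      rfl
  apply hu'
  have := key P ⟨u, hu⟩
  rw [hPf] at this
  exact this.symm

end IntegralElements

section Reduction

open IsLocalRing

variable {A : Type*} [CommRing A] [IsDomain A] [IsDiscreteValuationRing A]
  {B : Type*} [CommRing B] [Algebra A B]

theorem residue_tmul_surjective (u : ResidueField A ⊗[A] B) : ∃ x : B, 1 ⊗ₜ[A] x = u := by
  induction u using TensorProduct.induction_on with
  | zero => exact ⟨0, TensorProduct.tmul_zero _ _⟩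
  | tmul c x =>
    obtain ⟨a, rfl⟩ := IsLocalRing.residue_surjective c
    refine ⟨a • x, ?_⟩
    rw [← TensorProduct.smul_tmul, Algebra.smul_def, mul_one]
    rfl
  | add u v hu hv =>
    obtain ⟨x, rfl⟩ := hu
    obtain ⟨y, rfl⟩ := hv
    exact ⟨x + y, TensorProduct.tmul_add _ _ _⟩

theorem residue_tmul_smul (a : A) (x : B) :
    (1 : ResidueField A) ⊗ₜ[A] (a • x) = residue A a • (1 ⊗ₜ[A] x) := by
  rw [TensorProduct.tmul_smul]
  exact algebra_compatible_smul (ResidueField A) a _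

theorem residue_tmul_eq_zero {ι : Type*} (β : Module.Basis ι A B) {π : A}
    (hπ : maximalIdeal A = Ideal.span {π}) {x : B} (hx : (1 : ResidueField A) ⊗ₜ[A] x = 0) :
    ∃ w, x = π • w := by
  have h : ∀ i, ∃ c, c * π = β.repr x i := by
    intro i
    have := congrArg (fun u => (Algebra.TensorProduct.basis (ResidueField A) β).repr u i) hx
    simp only [Algebra.TensorProduct.basis_repr_tmul, one_smul, Finsupp.mapRange_apply, map_zero,
      Finsupp.zero_apply] at this
    have h2 : residue A (β.repr x i) = 0 := this
    rw [residue_eq_zero_iff, hπ] at h2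
    exact Ideal.mem_span_singleton'.mp h2
  choose c hc using h
  refine ⟨(β.repr x).sum fun i _ => c i • β i, ?_⟩
  conv_lhs => rw [← β.linearCombination_repr x, Finsupp.linearCombination_apply]
  rw [Finsupp.smul_sum]
  refine Finsupp.sum_congr fun i _ => ?_
  rw [smul_smul, ← hc i, mul_comm]

end Reduction

theorem exists_three_independent {k V : Type*} [Field k] [AddCommGroup V] [Module k V]
    [Module.Finite k V] (hV : Module.finrank k V = 5) (χ ℓ : V →ₗ[k] k) :
    ∃ w : Fin 3 → V, LinearIndependent k w ∧ (∀ i, χ (w i) = 0) ∧ ∀ i, ℓ (w i) = 0 := by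
  have h1 := LinearMap.finrank_range_add_finrank_ker (χ.prod ℓ)
  have h2 := Submodule.finrank_le (LinearMap.range (χ.prod ℓ))
  rw [Module.finrank_prod, Module.finrank_self] at h2
  have h3 : 3 ≤ Module.finrank k (LinearMap.ker (χ.prod ℓ)) := by omega
  let c := Module.finBasis k (LinearMap.ker (χ.prod ℓ))
  have hker : ∀ i, χ (c i : V) = 0 ∧ ℓ (c i : V) = 0 := fun i =>
    Prod.mk.inj (LinearMap.mem_ker.mp (c i).2)
  exact ⟨fun i => c (Fin.castLE h3 i),
    (c.linearIndependent.comp _ (Fin.castLE_injective h3)).map'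
      (LinearMap.ker (χ.prod ℓ)).subtype (Submodule.ker_subtype _),
    fun i => (hker _).1, fun i => (hker _).2⟩

theorem exists_notMem_span_singleton {k V : Type*} [Field k] [AddCommGroup V] [Module k V]
    {w : Fin 3 → V} (hw : LinearIndependent k w) (y : V) : ∃ i, w i ∉ Submodule.span k {y} := by
  by_contra hcon
  push Not at hcon
  have hle : Submodule.span k (Set.range w) ≤ Submodule.span k {y} := by
    rw [Submodule.span_le]; rintro _ ⟨i, rfl⟩; exact hcon i
  have h1 := Submodule.finrank_mono hle
  have h2 := finrank_span_le_card (R := k) {y}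
  rw [finrank_span_eq_card hw, Fintype.card_fin] at h1
  simp only [Set.toFinset_singleton, Finset.card_singleton] at h2
  omega

/-! ### Consequences of the integrality condition over a local ring. -/

section LocalCondition

variable {A : Type*} [CommRing A]
  {K : Type*} [Field K] [Algebra A K]
  {E : Type*} [CommRing E] [Algebra K E] [Algebra A E] [IsScalarTower A K E]
  {k V : Type*} [Field k] [CommRing V] [Algebra k V]

/-- `V` is the reduction of the `A`-algebra `B` modulo `π`. -/
structure IsReduction {B : Type*} [CommRing B] [Algebra A B] (π : A) (res : A →+* k)
    (ρ : B →+* V) : Prop where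
  res_surjective : Function.Surjective res
  res_eq_zero : ∀ a, res a = 0 ↔ ∃ c, a = π * c
  surjective : Function.Surjective ρ
  map_smul : ∀ (a : A) (x : B), ρ (a • x) = res a • ρ x
  eq_zero : ∀ x, ρ x = 0 → ∃ w, x = π • w

/-- The elements of `B` which are integral after division by `π` span at most a plane
modulo `π`. -/
def IntegralRankLETwo (K : Type*) [Field K] [Algebra A K] [Algebra K E] (B : Subalgebra A E)
    (π : A) (ρ : B →+* V) : Prop :=
  ∀ v : Fin 3 → B, (∀ i, IsIntegral A ((algebraMap A K π)⁻¹ • (v i : E))) →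
    ¬ LinearIndependent k fun i => ρ (v i)

omit [Algebra A K] in
theorem smul_cancel_of_fraction [Algebra A K] [IsScalarTower A K E] {π : A}
    (hK : algebraMap A K π ≠ 0) (B : Subalgebra A E) {x y : B}
    (h : π • x = π • y) : x = y := by
  apply Subtype.ext
  have h' : π • (x : E) = π • (y : E) := congrArg Subtype.val h
  rw [algebra_compatible_smul K π, algebra_compatible_smul K π (y : E)] at h'
  rwa [smul_right_inj hK] at h'

/-- Lift three independent vectors of ker χ ∩ ker ℓ to `w i`. Division by `π` turns each into an
endomorphism of the lattice `N` of elements on which `χ` vanishes modulo `π`, so it becomes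
integral; this gives three independent integral classes. -/
theorem IntegralRankLETwo.not_degenerate [IsNoetherianRing A] (B : Subalgebra A E)
    [Module.Finite A B] {π : A}
    (hK : algebraMap A K π ≠ 0) {res : A →+* k} {ρ : B →+* V} (hρ : IsReduction π res ρ)
    (hB : IntegralRankLETwo (k := k) K B π ρ) [Module.Finite k V] (hV : Module.finrank k V = 5) :
    ¬ ∃ χ ℓ : V →ₗ[k] k, χ 1 = 1 ∧ ∀ y z, χ y = 0 → ℓ y = 0 → χ z = 0 → y * z = 0 := by
  rintro ⟨χ, ℓ, hχ1, hdeg⟩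
  have hres : res π = 0 := (hρ.res_eq_zero _).mpr ⟨1, (mul_one _).symm⟩
  obtain ⟨w', hw', hwχ', hwℓ'⟩ := exists_three_independent hV χ ℓ
  choose w hww using fun i => hρ.surjective (w' i)
  have hw : LinearIndependent k fun i => ρ (w i) := by simpa only [hww] using hw'
  have hwχ : ∀ i, χ (ρ (w i)) = 0 := by simpa only [hww] using hwχ'
  have hwℓ : ∀ i, ℓ (ρ (w i)) = 0 := by simpa only [hww] using hwℓ'
  -- Choose `w i` off the line of `y` modulo `π`, and write `w i * z = π • t'`. Then `t * w i = t' *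
  -- y`. Modulo `π`, multiplication by an element acts on ker χ ∩ ker ℓ as its value under `χ`, so
  -- independence gives χ(t) = 0.
  have hquot : ∀ y z t : B, χ (ρ y) = 0 → ℓ (ρ y) = 0 → χ (ρ z) = 0 → y * z = π • t →
      χ (ρ t) = 0 := by
    intro y z t hy hy' hz ht
    obtain ⟨i, hi⟩ := exists_notMem_span_singleton hw (ρ y)
    have hz0 : ρ (w i * z) = 0 := by rw [map_mul]; exact hdeg _ _ (hwχ i) (hwℓ i) hz
    obtain ⟨t', ht'⟩ := hρ.eq_zero _ hz0
    have he : t * w i = t' * y := by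
      apply smul_cancel_of_fraction hK
      rw [← smul_mul_assoc, ← smul_mul_assoc, ← ht, ← ht']
      ring
    have hlin : ∀ t y, χ (ρ y) = 0 → ℓ (ρ y) = 0 → ρ (t * y) = χ (ρ t) • ρ y := by
      intro t y hy hy'
      have := hdeg (ρ y) (ρ t - χ (ρ t) • 1) hy hy'
        (by rw [map_sub, _root_.map_smul, hχ1, smul_eq_mul, mul_one, sub_self])
      rw [mul_sub, mul_smul_comm, mul_one, sub_eq_zero] at this
      rw [map_mul, mul_comm, this]
    have he' := congrArg ρ he
    rw [hlin _ _ (hwχ i) (hwℓ i), hlin _ _ hy hy'] at he'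
    by_contra hne
    apply hi
    rw [Submodule.mem_span_singleton]
    exact ⟨(χ (ρ t))⁻¹ * χ (ρ t'), by rw [mul_smul, ← he', inv_smul_smul₀ hne]⟩
  let N : Submodule A B :=
    { carrier := {z | χ (ρ z) = 0}
      zero_mem' := by
        change χ (ρ 0) = 0
        rw [map_zero, map_zero]
      add_mem' := fun {x y} hx hy => by
        change χ (ρ (x + y)) = 0
        rw [map_add, map_add, show χ (ρ x) = 0 from hx, show χ (ρ y) = 0 from hy, add_zero]
      smul_mem' := fun a x hx => by
        change χ (ρ (a • x)) = 0
        rw [hρ.map_smul, _root_.map_smul, show χ (ρ x) = 0 from hx, smul_zero] }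
  refine hB w (fun i => ?_) hw
  refine isIntegral_of_mul_mem (N.map B.val.toLinearMap)
    ((IsNoetherian.noetherian N).map _) (u := algebraMap A E π)
    ⟨π • 1, ?_, ?_⟩ (fun y hy => ?_) _ ?_
  · change χ (ρ (π • 1)) = 0
    rw [hρ.map_smul, hres, zero_smul, map_zero]
  · change ((π • 1 : B) : E) = _
    rw [Algebra.algebraMap_eq_smul_one]; rfl
  · rw [mul_comm, ← Algebra.smul_def, algebra_compatible_smul K] at hy
    exact (smul_eq_zero.mp hy).resolve_left hK
  · rintro _ ⟨z, hz, rfl⟩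
    have hz0 : ρ (w i * z) = 0 := by rw [map_mul]; exact hdeg _ _ (hwχ i) (hwℓ i) hz
    obtain ⟨t, ht⟩ := hρ.eq_zero _ hz0
    refine ⟨t, hquot _ _ _ (hwχ i) (hwℓ i) hz ht, ?_⟩
    have ht' : (w i : E) * (z : E) = π • (t : E) := congrArg Subtype.val ht
    change (t : E) = (algebraMap A K π)⁻¹ • (w i : E) * (z : E)
    rw [smul_mul_assoc, ht', algebra_compatible_smul K π, inv_smul_smul₀ hK]

/-- Three independent nilpotents span a space whose intersection `W` with `B` has rank at least
three. Basis elements of `W` stay nilpotent, hence integral, after division by `π`, and they stay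
independent modulo `π` because `W` is saturated in `B`. -/
theorem IntegralRankLETwo.nilpotent_dependent [IsDomain A] [IsPrincipalIdealRing A]
    [IsFractionRing A K] (B : Subalgebra A E) {m : ℕ} (β : Module.Basis (Fin m) A B) {π : A}
    (hK : algebraMap A K π ≠ 0) {res : A →+* k} {ρ : B →+* V} (hρ : IsReduction π res ρ)
    (hB : IntegralRankLETwo (k := k) K B π ρ) (hBE : ∀ x : E, ∃ a : A, a ≠ 0 ∧ a • x ∈ B)
    (v : Fin 3 → E) (hv : ∀ i, IsNilpotent (v i)) : ¬ LinearIndependent K v := by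
  intro hli
  let S := Submodule.span K (Set.range v)
  let W : Submodule A B := (S.restrictScalars A).comap B.val.toLinearMap
  have hW : ∀ x : B, x ∈ W ↔ (x : E) ∈ S := fun x => Iff.rfl
  have hSnil : ∀ x ∈ S, IsNilpotent x := by
    intro x hx
    have : S ≤ (nilradical E).restrictScalars K := by
      rw [Submodule.span_le]; rintro _ ⟨i, rfl⟩; exact hv i
    exact this hx
  obtain ⟨r, ⟨w⟩⟩ := Submodule.nonempty_basis_of_pid β W
  choose a ha haB using fun i => hBE (v i)
  let u : Fin 3 → W := fun i => ⟨⟨a i • v i, haB i⟩, by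
    have : a i • v i ∈ S := by
      rw [algebra_compatible_smul K]
      exact S.smul_mem _ (Submodule.subset_span ⟨i, rfl⟩)
    exact this⟩
  have hu : LinearIndependent A u := by
    rw [Fintype.linearIndependent_iff]
    intro g hg i
    have h1 : ∑ i, (algebraMap A K (g i) * algebraMap A K (a i)) • v i = 0 := by
      have h := congrArg (B.val.toLinearMap ∘ₗ W.subtype) hg
      rw [map_sum, map_zero] at h
      rw [← h]
      refine Finset.sum_congr rfl fun i _ => ?_
      rw [_root_.map_smul, ← map_mul, algebraMap_smul, mul_smul]
      rfl
    have h2 := Fintype.linearIndependent_iff.mp hli _ h1 i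
    rw [← map_mul, IsFractionRing.to_map_eq_zero_iff] at h2
    exact (mul_eq_zero.mp h2).resolve_right (ha i)
  have hr : 3 ≤ r := by
    have : Module.Finite A W := Module.Finite.of_basis w
    have h1 := hu.fintype_card_le_finrank
    rwa [Module.finrank_eq_card_basis w, Fintype.card_fin, Fintype.card_fin] at h1
  refine hB (fun i => w (Fin.castLE hr i)) (fun i => ?_) ?_
  · obtain ⟨n, hn⟩ := hSnil _ (S.smul_mem (algebraMap A K π)⁻¹ (w (Fin.castLE hr i)).2)
    exact ⟨Polynomial.X ^ n, Polynomial.monic_X_pow n, by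
      rw [Polynomial.eval₂_pow, Polynomial.eval₂_X]; exact hn⟩
  · rw [Fintype.linearIndependent_iff]
    intro g hg i
    choose c hc using hρ.res_surjective
    have h1 : ρ (∑ i, c (g i) • (w (Fin.castLE hr i) : B)) = 0 := by
      rw [map_sum, ← hg]
      refine Finset.sum_congr rfl fun i _ => ?_
      rw [hρ.map_smul, hc]
    obtain ⟨x, hx⟩ := hρ.eq_zero _ h1
    have hxW : x ∈ W := by
      have h2 : (π • x : B) ∈ W := by
        rw [← hx]
        exact W.sum_mem fun i _ => W.smul_mem _ (w _).2
      rw [hW] at h2 ⊢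
      have h3 : (algebraMap A K π) • (x : E) ∈ S := by
        rw [algebraMap_smul]; exact h2
      have h4 := S.smul_mem (algebraMap A K π)⁻¹ h3
      rwa [inv_smul_smul₀ hK] at h4
    have h4 : ∑ i, c (g i) • w (Fin.castLE hr i) = π • (⟨x, hxW⟩ : W) := by
      apply Subtype.ext
      simpa using hx
    have h5 := congrArg (fun z => w.repr z (Fin.castLE hr i)) h4
    simp only [map_sum, _root_.map_smul, Finsupp.finsetSum_apply, Finsupp.smul_apply,
      w.repr_self, smul_eq_mul, Finsupp.single_apply, (Fin.castLE_injective hr).eq_iff,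
      mul_ite, mul_one, mul_zero, Finset.sum_ite_eq', Finset.mem_univ, if_true] at h5
    rw [← hc (g i), hρ.res_eq_zero]
    exact ⟨_, h5⟩

end LocalCondition

section ResidueReduction

open IsLocalRing

variable {A : Type*} [CommRing A] [IsDomain A] [IsDiscreteValuationRing A]
  {B : Type*} [CommRing B] [Algebra A B]

theorem isReduction_residue {ι : Type*} (β : Module.Basis ι A B) {π : A}
    (hπ : maximalIdeal A = Ideal.span {π}) :
    IsReduction π (residue A) (Algebra.TensorProduct.includeRight :
      B →ₐ[A] ResidueField A ⊗[A] B).toRingHom where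
  res_surjective := residue_surjective
  res_eq_zero a := by
    rw [residue_eq_zero_iff, hπ, Ideal.mem_span_singleton]
    rfl
  surjective := residue_tmul_surjective
  map_smul := residue_tmul_smul
  eq_zero _ hx := residue_tmul_eq_zero β hπ hx

end ResidueReduction

/-! ### Base change and descent of models. -/

section BaseChange

variable {A k B : Type*} [CommRing A] [CommRing k] [Algebra A k] [CommRing B] [Algebra A B]

omit [Algebra A k] in
theorem QuadraticMap.exists_map {n m : ℕ} (q : QuadraticMap A (Fin n → A) (Fin m → A))
    (f : A →+* k) : ∃ q' : QuadraticMap k (Fin n → k) (Fin m → k),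
      ∀ y, q' (f ∘ y) = f ∘ q y := by
  obtain ⟨β, hβ⟩ := LinearMap.BilinMap.toQuadraticMap_surjective (R := A) (M := Fin n → A)
    (N := Fin m → A) q
  let β' : (Fin n → k) →ₗ[k] (Fin n → k) →ₗ[k] (Fin m → k) :=
    ∑ i, ∑ j, (LinearMap.proj i : (Fin n → k) →ₗ[k] k).smulRight
      ((LinearMap.proj j : (Fin n → k) →ₗ[k] k).smulRight
        (f ∘ β (Pi.single i 1) (Pi.single j 1)))
  refine ⟨LinearMap.BilinMap.toQuadraticMap β', fun y => ?_⟩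
  rw [LinearMap.BilinMap.toQuadraticMap_apply, ← hβ, LinearMap.BilinMap.toQuadraticMap_apply]
  conv_rhs => rw [pi_eq_sum_univ' y]
  ext l
  simp [β', LinearMap.sum_apply, Finset.sum_apply, Finset.mul_sum]
  rw [Finset.sum_comm]
  exact Finset.sum_congr rfl fun i _ => Finset.sum_congr rfl fun j _ => by ring

omit [Algebra A k] in
theorem LinearMap.exists_map_matrix {n m : ℕ} (a : (Fin n → A) →ₗ[A] Matrix (Fin m) (Fin m) A)
    (f : A →+* k) : ∃ a' : (Fin n → k) →ₗ[k] Matrix (Fin m) (Fin m) k,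
      ∀ x, a' (f ∘ x) = (a x).map f := by
  refine ⟨∑ i, (LinearMap.proj i : (Fin n → k) →ₗ[k] k).smulRight ((a (Pi.single i 1)).map f),
    fun x => ?_⟩
  conv_rhs => rw [pi_eq_sum_univ' x]
  ext r s
  simp [LinearMap.sum_apply, Matrix.sum_apply]

theorem tailCoords_baseChange (β : Module.Basis (Fin 5) A B) (x : B) :
    tailCoords (Algebra.TensorProduct.basis k β) (1 ⊗ₜ[A] x) = algebraMap A k ∘ tailCoords β x := by
  ext i
  simp [tailCoords_apply]

theorem IsModel.exists_baseChange {β : Module.Basis (Fin 5) A B}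
    {a : (Fin 4 → A) →ₗ[A] Matrix (Fin 5) (Fin 5) A}
    {q : QuadraticMap A (Fin 4 → A) (Fin 5 → A)} (h : IsModel β a q)
    (hk : Function.Surjective (algebraMap A k)) : ∃ a' q',
      IsModel (Algebra.TensorProduct.basis k β) a' q' ∧
        ∀ x, a' (algebraMap A k ∘ x) = (a x).map (algebraMap A k) := by
  obtain ⟨q', hq'⟩ := QuadraticMap.exists_map q (algebraMap A k)
  obtain ⟨a', ha'⟩ := LinearMap.exists_map_matrix a (algebraMap A k)
  have hlift : ∀ {n : ℕ} (x : Fin n → k), ∃ y : Fin n → A, algebraMap A k ∘ y = x := by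
    intro n x
    choose y hy using fun i => hk (x i)
    exact ⟨y, funext hy⟩
  have hliftB : ∀ x : k ⊗[A] B, ∃ y : B, 1 ⊗ₜ[A] y = x := by
    intro x
    induction x using TensorProduct.induction_on with
    | zero => exact ⟨0, TensorProduct.tmul_zero _ _⟩
    | tmul c x =>
      obtain ⟨a, rfl⟩ := hk c
      exact ⟨a • x, by rw [← TensorProduct.smul_tmul, Algebra.smul_def, mul_one]⟩
    | add u v hu hv =>
      obtain ⟨x, rfl⟩ := hu
      obtain ⟨y, rfl⟩ := hv
      exact ⟨x + y, TensorProduct.tmul_add _ _ _⟩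
  refine ⟨a', q', ⟨fun x => ?_, ?_, fun x y z => ?_⟩, ha'⟩
  · obtain ⟨x, rfl⟩ := hlift x
    rw [ha']
    exact ⟨fun i => by simp [(h.alt x).1 i], fun i j => by simp [(h.alt x).2 i j]⟩
  · rw [eq_top_iff, ← (Pi.basisFun k (Fin 5)).span_eq, Submodule.span_le]
    have : ∀ u : Fin 5 → A, algebraMap A k ∘ u ∈ Submodule.span k (Set.range q') := by
      intro u
      have hu : u ∈ Submodule.span A (Set.range q) := by rw [h.span_eq_top]; trivial
      induction hu using Submodule.span_induction with
      | mem x hx =>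
        obtain ⟨y, rfl⟩ := hx
        rw [← hq']
        exact Submodule.subset_span ⟨_, rfl⟩
      | zero =>
        have : algebraMap A k ∘ (0 : Fin 5 → A) = 0 := by ext; simp
        rw [this]; exact Submodule.zero_mem _
      | add x y _ _ hx hy =>
        have : algebraMap A k ∘ (x + y) = algebraMap A k ∘ x + algebraMap A k ∘ y := by
          ext; simp
        rw [this]; exact Submodule.add_mem _ hx hy
      | smul r x _ hx =>
        have : algebraMap A k ∘ (r • x) = algebraMap A k r • (algebraMap A k ∘ x) := by
          ext; simp
        rw [this]; exact Submodule.smul_mem _ _ hx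
    rintro _ ⟨i, rfl⟩
    obtain ⟨u, hu⟩ := hlift (Pi.basisFun k (Fin 5) i)
    rw [← hu]
    exact this u
  · obtain ⟨x, rfl⟩ := hliftB x
    obtain ⟨y, rfl⟩ := hliftB y
    obtain ⟨z, rfl⟩ := hliftB z
    rw [Algebra.TensorProduct.tmul_mul_tmul, mul_one]
    simp only [tailCoords_baseChange, hq', ha']
    have h1 := congrArg (algebraMap A k) (h.eq_det x y z)
    rw [RingHom.map_det] at h1
    have h2 : (algebraMap A k).mapMatrix (Matrix.of ![tailCoords β x, tailCoords β y,
        tailCoords β z, tailCoords β (y * z)]) = Matrix.of ![algebraMap A k ∘ tailCoords β x,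
        algebraMap A k ∘ tailCoords β y, algebraMap A k ∘ tailCoords β z,
        algebraMap A k ∘ tailCoords β (y * z)] := by
      ext i j
      fin_cases i <;> rfl
    rw [h2] at h1
    rw [← h1]
    simp [dotProduct, Matrix.mulVec]

end BaseChange

section Descent

variable {A K B E : Type*} [CommRing A] [CommRing K] [Algebra A K] [CommRing B] [Algebra A B]
  [CommRing E] [Algebra K E]

/-- A model over `K` whose structure maps are integral over `A` comes from a model over `A`. -/
theorem IsModel.exists_descent (hinj : Function.Injective (algebraMap A K))
    {b : Module.Basis (Fin 5) K E} {a : (Fin 4 → K) →ₗ[K] Matrix (Fin 5) (Fin 5) K}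
    {q : QuadraticMap K (Fin 4 → K) (Fin 5 → K)} (h : IsModel b a q)
    (β : Module.Basis (Fin 5) A B) (ι : B →+* E)
    (hι : ∀ x, tailCoords b (ι x) = algebraMap A K ∘ tailCoords β x)
    (ha : ∀ x : Fin 4 → A, ∃ C : Matrix (Fin 5) (Fin 5) A, a (algebraMap A K ∘ x) =
      C.map (algebraMap A K))
    (hq : ∀ y : Fin 4 → A, ∃ v : Fin 5 → A, q (algebraMap A K ∘ y) = algebraMap A K ∘ v)
    (hspan : ∀ u : Fin 5 → A, algebraMap A K ∘ u ∈
      Submodule.span A (Set.range fun y : Fin 4 → A => q (algebraMap A K ∘ y))) :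
    ∃ a' q', IsModel β a' q' ∧
      (∀ x, a (algebraMap A K ∘ x) = (a' x).map (algebraMap A K)) ∧
      ∀ y, q (algebraMap A K ∘ y) = algebraMap A K ∘ q' y := by
  have hadd : ∀ {n : ℕ} (x y : Fin n → A), algebraMap A K ∘ (x + y) =
      algebraMap A K ∘ x + algebraMap A K ∘ y := by intro n x y; ext; simp
  have hsub : ∀ {n : ℕ} (x y : Fin n → A), algebraMap A K ∘ (x - y) =
      algebraMap A K ∘ x - algebraMap A K ∘ y := by intro n x y; ext; simp
  have hsmul : ∀ {n : ℕ} (c : A) (x : Fin n → A), algebraMap A K ∘ (c • x) =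
      algebraMap A K c • (algebraMap A K ∘ x) := by intro n c x; ext; simp
  have hvinj : ∀ {n : ℕ} {x y : Fin n → A}, algebraMap A K ∘ x = algebraMap A K ∘ y → x = y :=
    fun h => funext fun i => hinj (congrFun h i)
  have hminj : ∀ {x y : Matrix (Fin 5) (Fin 5) A}, x.map (algebraMap A K) =
      y.map (algebraMap A K) → x = y :=
    fun h => Matrix.ext fun i j => hinj (congrFun (congrFun h i) j)
  choose a' ha' using ha
  choose q' hq' using hq
  let aA : (Fin 4 → A) →ₗ[A] Matrix (Fin 5) (Fin 5) A :=
    { toFun := a'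
      map_add' := fun x y => hminj (by
        rw [← ha', hadd, map_add, ha', ha']; ext; simp)
      map_smul' := fun c x => hminj (by
        rw [← ha', hsmul, map_smul, ha']; ext; simp) }
  have hpol : ∀ x y, algebraMap A K ∘ QuadraticMap.polar q' x y =
      QuadraticMap.polar q (algebraMap A K ∘ x) (algebraMap A K ∘ y) := by
    intro x y
    rw [QuadraticMap.polar, QuadraticMap.polar, hsub, hsub, ← hq', ← hq', ← hq', hadd]
  let qA : QuadraticMap A (Fin 4 → A) (Fin 5 → A) := QuadraticMap.ofPolar q'
    (fun c x => hvinj (by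
      rw [← hq', hsmul, QuadraticMap.map_smul, hq', hsmul, map_mul]))
    (fun x x' y => hvinj (by
      rw [hpol, hadd, hadd, hpol, hpol, QuadraticMap.polar_add_left]))
    (fun c x y => hvinj (by
      rw [hpol, hsmul, hsmul, hpol, QuadraticMap.polar_smul_left]))
  refine ⟨aA, qA, ⟨fun x => ⟨fun i => hinj ?_, fun i j => hinj ?_⟩, ?_, fun x y z => hinj ?_⟩,
    ha', hq'⟩
  · have := (h.alt (algebraMap A K ∘ x)).1 i
    rw [ha'] at this
    rw [map_zero]; exact this
  · have := (h.alt (algebraMap A K ∘ x)).2 i j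
    rw [ha'] at this
    rw [map_neg]; exact this
  · rw [eq_top_iff]
    intro u _
    have hmap := hspan u
    let F : (Fin 5 → A) →ₗ[A] (Fin 5 → K) := (Algebra.linearMap A K).compLeft (Fin 5)
    have hF : ∀ v, F v = algebraMap A K ∘ v := fun v => rfl
    have hr : (Set.range fun y : Fin 4 → A => q (algebraMap A K ∘ y)) = F '' Set.range qA := by
      rw [← Set.range_comp]
      congr 1
      ext1 y
      exact hq' y
    rw [hr, Submodule.span_image, Submodule.mem_map] at hmap
    obtain ⟨v, hv, hvu⟩ := hmap
    rwa [← hvinj ((hF v).symm.trans hvu)]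
  · have h1 := h.eq_det (ι x) (ι y) (ι z)
    rw [← map_mul, hι, hι, hι, hι, ha', hq', hq'] at h1
    have h2 : (algebraMap A K).mapMatrix (Matrix.of ![tailCoords β x, tailCoords β y,
        tailCoords β z, tailCoords β (y * z)]) = Matrix.of ![algebraMap A K ∘ tailCoords β x,
        algebraMap A K ∘ tailCoords β y, algebraMap A K ∘ tailCoords β z,
        algebraMap A K ∘ tailCoords β (y * z)] := by
      ext i j
      fin_cases i <;> rfl
    rw [← h2, ← RingHom.map_det] at h1
    rw [← h1]
    simp [dotProduct, Matrix.mulVec, aA, qA]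

end Descent

/-! ### The Pfaffian constant of an integral model. -/

section UnitConstant

open IsLocalRing

variable {A : Type*} [CommRing A] [IsDomain A] [IsDiscreteValuationRing A]
  {K : Type*} [Field K] [Algebra A K] [IsFractionRing A K]
  {E : Type*} [CommRing E] [Algebra K E] [Algebra A E] [IsScalarTower A K E]

/-- The model descends to `A` and reduces to the residue field. If the constant were in the maximal
ideal, all Pfaffians of the reduction would vanish, and the reduction would be degenerate. -/
theorem IsModel.isUnit_constant {b : Module.Basis (Fin 5) K E}
    {a : (Fin 4 → K) →ₗ[K] Matrix (Fin 5) (Fin 5) K}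
    {q : QuadraticMap K (Fin 4 → K) (Fin 5 → K)} (h : IsModel b a q) {c : K}
    (hc : ∀ y, pfVec (a y) = c • q y) (B : Subalgebra A E) (β : Module.Basis (Fin 5) A B)
    (hβ : β 0 = 1) (hι : ∀ x : B, tailCoords b (x : E) = algebraMap A K ∘ tailCoords β x)
    (ha : ∀ x : Fin 4 → A, ∃ C : Matrix (Fin 5) (Fin 5) A, a (algebraMap A K ∘ x) =
      C.map (algebraMap A K))
    (hq : ∀ y : Fin 4 → A, ∃ v : Fin 5 → A, q (algebraMap A K ∘ y) = algebraMap A K ∘ v)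
    (hspan : ∀ u : Fin 5 → A, algebraMap A K ∘ u ∈
      Submodule.span A (Set.range fun y : Fin 4 → A => q (algebraMap A K ∘ y)))
    {π : A} (hπ : maximalIdeal A = Ideal.span {π})
    (hB : IntegralRankLETwo (k := ResidueField A) K B π (Algebra.TensorProduct.includeRight :
      B →ₐ[A] ResidueField A ⊗[A] B).toRingHom) :
    ∃ u : A, IsUnit u ∧ algebraMap A K u = c := by
  have hinj := IsFractionRing.injective A K
  obtain ⟨a', q', hm, ha', hq'⟩ := h.exists_descent hinj β B.val.toRingHom hι ha hq hspan
  have hpf : ∀ y, algebraMap A K ∘ pfVec (a' y) = c • (algebraMap A K ∘ q' y) := by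
    intro y
    rw [← hq', ← hc, ha', pfVec_map]
    rfl
  obtain ⟨u, hu⟩ : ∃ u : A, algebraMap A K u = c := by
    -- Multiplication by `c` takes values of `q'` to integral Pfaffian vectors. These values span
    -- `A⁵`, so it preserves `A⁵`, and a basis vector shows that `c` lies in `A`.
    have key : ∀ v : Fin 5 → A, ∃ w : Fin 5 → A, algebraMap A K ∘ w = c • (algebraMap A K ∘ v) := by
      intro v
      have hv : v ∈ Submodule.span A (Set.range q') := by rw [hm.span_eq_top]; trivial
      induction hv using Submodule.span_induction with
      | mem x hx => obtain ⟨y, rfl⟩ := hx; exact ⟨_, hpf y⟩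
      | zero => exact ⟨0, by ext; simp⟩
      | add x y _ _ hx hy =>
        obtain ⟨w, hw⟩ := hx
        obtain ⟨w', hw'⟩ := hy
        refine ⟨w + w', ?_⟩
        ext i
        have e1 := congrFun hw i
        have e2 := congrFun hw' i
        simp at e1 e2 ⊢
        rw [e1, e2]; ring
      | smul r x _ hx =>
        obtain ⟨w, hw⟩ := hx
        refine ⟨r • w, ?_⟩
        ext i
        have e1 := congrFun hw i
        simp at e1 ⊢
        rw [e1]; ring
    obtain ⟨w, hw⟩ := key (Pi.single 0 1)
    exact ⟨w 0, by simpa using congrFun hw 0⟩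
  refine ⟨u, ?_, hu⟩
  by_contra hnu
  have hres : residue A u = 0 := by
    rw [residue_eq_zero_iff]; exact hnu
  obtain ⟨a₁, q₁, hm₁, ha₁⟩ := hm.exists_baseChange (k := ResidueField A) residue_surjective
  have hpf0 : ∀ x, pfVec (a₁ x) = 0 := by
    intro x
    choose y hy using fun i => residue_surjective (x i)
    have hx : x = algebraMap A (ResidueField A) ∘ y := funext fun i => (hy i).symm
    rw [hx, ha₁, pfVec_map]
    ext i
    have e : pfVec (a' y) i = u * q' y i := by
      apply hinj
      rw [map_mul, hu]
      exact congrFun (hpf y) i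
    rw [e, map_mul]
    have : algebraMap A (ResidueField A) u = 0 := hres
    rw [this, zero_mul]; rfl
  have hfin : Module.Finite A B := Module.Finite.of_basis β
  have hfin' : Module.Finite (ResidueField A) (ResidueField A ⊗[A] B) := inferInstance
  have hK : algebraMap A K π ≠ 0 := by
    rw [Ne, IsFractionRing.to_map_eq_zero_iff]
    rintro rfl
    rw [Ideal.span_singleton_eq_bot.mpr rfl] at hπ
    exact IsDiscreteValuationRing.not_a_field A hπ
  refine hB.not_degenerate B hK (isReduction_residue β hπ) ?_ (hm₁.degenerate ?_ hpf0)
  · rw [Module.finrank_eq_card_basis (Algebra.TensorProduct.basis (ResidueField A) β)]; rfl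
  · rw [Algebra.TensorProduct.basis_apply, hβ]; rfl

end UnitConstant

/-! ### Common denominators and exterior powers of lattices. -/

section CommonDenominators

variable {R N X : Type*} [CommRing R] [AddCommGroup N] [Module R N] [AddCommGroup X] [Module R X]

theorem exists_smul_mem_of_forall [Module.Finite R N] (S : Submonoid R) (P : Submodule R X)
    (f : N →ₗ[R] X) (h : ∀ x, ∃ s ∈ S, s • f x ∈ P) : ∃ s ∈ S, ∀ x, s • f x ∈ P := by
  obtain ⟨T, hT⟩ := Module.Finite.fg_top (R := R) (M := N)
  choose s hs hsP using h
  refine ⟨∏ t ∈ T, s t, S.prod_mem fun t _ => hs t, fun x => ?_⟩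
  have hx : x ∈ Submodule.span R (T : Set N) := by rw [hT]; trivial
  induction hx using Submodule.span_induction with
  | mem x hx =>
    obtain ⟨r, hr⟩ := Finset.dvd_prod_of_mem s (Finset.mem_coe.mp hx)
    rw [hr, mul_comm, mul_smul]
    exact P.smul_mem _ (hsP x)
  | zero => simp
  | add x y _ _ hx hy => rw [map_add, smul_add]; exact P.add_mem hx hy
  | smul r x _ hx => rw [map_smul, smul_comm]; exact P.smul_mem _ hx

end CommonDenominators

section ExteriorLattices

variable {R N : Type*} [CommRing R] [AddCommGroup N] [Module R N]

/-- A projective module is a direct summand of a free one, and exterior powers preserve the split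
embedding. -/
theorem exteriorPower.isTorsionFree [IsDomain R] [Module.Projective R N] (n : ℕ) :
    Module.IsTorsionFree R (⋀[R]^n N) := by
  obtain ⟨f, hf⟩ := Module.projective_def'.mp (inferInstance : Module.Projective R N)
  exact Function.Injective.moduleIsTorsionFree (exteriorPower.map n f)
    (exteriorPower.map_injective _ hf) fun r m => map_smul _ r m

theorem exteriorPower.exists_smul_eq_map {n k : ℕ} {s : R} {ν : Fin n → N}
    (h : ∀ x, s • x ∈ Submodule.span R (Set.range ν)) (u : ⋀[R]^k N) :
    ∃ w : ⋀[R]^k (Fin n → R), s ^ k • u =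
      exteriorPower.map k (Fintype.linearCombination R ν) w := by
  have hu : u ∈ Submodule.span R (Set.range (exteriorPower.ιMulti R k (M := N))) := by
    rw [exteriorPower.ιMulti_span]; trivial
  induction hu using Submodule.span_induction with
  | mem x hx =>
    obtain ⟨v, rfl⟩ := hx
    choose w hw using fun i => (Submodule.mem_span_range_iff_exists_fun R).mp (h (v i))
    refine ⟨exteriorPower.ιMulti R k w, ?_⟩
    rw [exteriorPower.map_apply_ιMulti]
    have : Fintype.linearCombination R ν ∘ w = fun i => s • v i := by
      ext i; rw [← hw]; rfl
    rw [this, AlternatingMap.map_smul_univ]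
    simp
  | zero => exact ⟨0, by simp⟩
  | add x y _ _ hx hy =>
    obtain ⟨w, hw⟩ := hx
    obtain ⟨w', hw'⟩ := hy
    exact ⟨w + w', by rw [smul_add, hw, hw', map_add]⟩
  | smul r x _ hx =>
    obtain ⟨w, hw⟩ := hx
    exact ⟨r • w, by rw [smul_comm, hw, map_smul]⟩

theorem eq_vol_smul {n : ℕ} (w : ⋀[R]^n (Fin n → R)) :
    w = vol (LinearMap.id : (Fin n → R) →ₗ[R] _) w •
      exteriorPower.ιMulti R n (fun i => (Pi.single i 1 : Fin n → R)) := by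
  have : (LinearMap.id : ⋀[R]^n (Fin n → R) →ₗ[R] _) =
      (vol (LinearMap.id : (Fin n → R) →ₗ[R] _)).smulRight
        (exteriorPower.ιMulti R n (fun i => (Pi.single i 1 : Fin n → R))) := by
    apply exteriorPower.linearMap_ext
    refine (Pi.basisFun R (Fin n)).ext_alternating fun v hv => ?_
    simp only [LinearMap.compAlternatingMap_apply, LinearMap.id_apply, LinearMap.smulRight_apply,
      vol_ιMulti, Pi.basisFun_apply]
    let σ : Equiv.Perm (Fin n) := Equiv.ofBijective v (Finite.injective_iff_bijective.mp hv)
    have h1 : (fun i => (Pi.single (v i) 1 : Fin n → R)) =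
        (fun i => (Pi.single i 1 : Fin n → R)) ∘ σ := rfl
    rw [h1, AlternatingMap.map_perm]
    have h2 : (Matrix.of fun i => ((fun i => (Pi.single i 1 : Fin n → R)) ∘ σ) i) =
        σ.toPEquiv.toMatrix := by
      ext i j
      rw [Equiv.toPEquiv, PEquiv.toMatrix_apply]
      simp [Pi.single_apply, eq_comm]
    rw [h2, Matrix.det_permutation]
    rcases Int.units_eq_one_or (Equiv.Perm.sign σ) with h | h <;> simp [h]
  exact LinearMap.congr_fun this w

theorem eq_sum_minors_smul (w : ⋀[R]^2 (Fin 5 → R)) :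
    w = ∑ i, ∑ j, if i < j then minors (LinearMap.id : (Fin 5 → R) →ₗ[R] _) w i j •
      bivec (Pi.single i 1) (Pi.single j 1) else 0 := by
  have : (LinearMap.id : ⋀[R]^2 (Fin 5 → R) →ₗ[R] _) =
      ∑ i, ∑ j, if i < j then ((Matrix.entryLinearMap R R i j) ∘ₗ
          minors (LinearMap.id : (Fin 5 → R) →ₗ[R] _)).smulRight
        (bivec (Pi.single i 1) (Pi.single j 1)) else 0 := by
    apply exteriorPower.linearMap_ext
    refine (Pi.basisFun R (Fin 5)).ext_alternating fun v hv => ?_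
    have hne : v 0 ≠ v 1 := fun h => absurd (hv h) (by decide)
    have hsw : ∀ x y : Fin 5 → R, bivec (R := R) y x = - bivec x y := by
      intro x y
      apply Subtype.ext
      rw [bivec_coe, ι_mul_ι]
      simp [bivec_coe]
    simp only [LinearMap.compAlternatingMap_apply, LinearMap.id_apply, Pi.basisFun_apply,
      BoxConstruction.ιMulti_eq_bivec, LinearMap.sum_apply]
    generalize v 0 = a at *
    generalize v 1 = b at *
    have h : ∀ i j : Fin 5, (if i < j then ((Matrix.entryLinearMap R R i j) ∘ₗ
          minors (LinearMap.id : (Fin 5 → R) →ₗ[R] _)).smulRight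
        (bivec (Pi.single i 1) (Pi.single j 1)) else 0)
          (bivec (Pi.single a 1 : Fin 5 → R) (Pi.single b 1)) =
        if i < j then ((if i = a ∧ j = b then 1 else 0) - (if j = a ∧ i = b then 1 else 0) : R) •
          bivec (R := R) (Pi.single i 1 : Fin 5 → R) (Pi.single j 1) else 0 := by
      intro i j
      by_cases hij : i < j
      · rw [if_pos hij, if_pos hij]
        change minors (LinearMap.id : (Fin 5 → R) →ₗ[R] _) (bivec (Pi.single a 1 : Fin 5 → R) (Pi.single b 1)) i j •
            bivec (R := R) (Pi.single i 1 : Fin 5 → R) (Pi.single j 1) = _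
        rw [minors_bivec]
        congr 1
        simp only [LinearMap.id_apply, Pi.single_apply, ite_and, mul_ite, mul_one, mul_zero]
        by_cases h1 : i = a <;> by_cases h2 : j = b <;> by_cases h3 : j = a <;>
          by_cases h4 : i = b <;> simp [h1, h2, h3, h4, hne, hne.symm]
      · rw [if_neg hij, if_neg hij]
        rfl
    simp only [h]
    rcases lt_or_gt_of_ne hne with hab | hab
    · rw [Finset.sum_eq_single a, Finset.sum_eq_single b]
      · simp [hab, hne, hne.symm]
      · intro j _ hj; simp [hj, hne]
      · simp
      · intro i _ hi
        refine Finset.sum_eq_zero fun j _ => ?_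
        by_cases h1 : j = a ∧ i = b
        · obtain ⟨rfl, rfl⟩ := h1; simp [hab.not_gt]
        · simp [h1, hi]
      · simp
    · rw [Finset.sum_eq_single b, Finset.sum_eq_single a]
      · rw [if_pos hab, hsw (Pi.single b 1) (Pi.single a 1)]
        simp only [hne, hne.symm, and_self, if_true, if_false, zero_sub]
        exact (neg_one_smul R _).symm
      · intro j _ hj; simp [hj, hne.symm]
      · simp
      · intro i _ hi
        refine Finset.sum_eq_zero fun j _ => ?_
        by_cases h1 : i = a ∧ j = b
        · obtain ⟨rfl, rfl⟩ := h1; simp [hab.not_gt]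
        · simp [h1, hi]
      · simp
  have h := LinearMap.congr_fun this w
  rw [LinearMap.id_apply] at h
  conv_lhs => rw [h]
  simp only [LinearMap.sum_apply]
  refine Finset.sum_congr rfl fun i _ => Finset.sum_congr rfl fun j _ => ?_
  split_ifs <;> rfl

end ExteriorLattices

/-! ### Injectivity of the coordinate maps. -/

section Injectivity

variable {R K N N' : Type*} [CommRing R] [CommRing K] [Algebra R K] [AddCommGroup N] [Module R N]
  [AddCommGroup N'] [Module R N']

theorem vol_map {n : ℕ} (c : N →ₗ[R] (Fin n → K)) (f : N' →ₗ[R] N) (u : ⋀[R]^n N') :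
    vol c (exteriorPower.map n f u) = vol (c ∘ₗ f) u := by
  have : vol c ∘ₗ exteriorPower.map n f = vol (c ∘ₗ f) := by
    apply exteriorPower.linearMap_ext
    ext v
    simp only [LinearMap.compAlternatingMap_apply, LinearMap.comp_apply,
      exteriorPower.map_apply_ιMulti, vol_ιMulti]
    rfl
  exact LinearMap.congr_fun this u

theorem minors_map {n : ℕ} (c : N →ₗ[R] (Fin n → K)) (f : N' →ₗ[R] N) (u : ⋀[R]^2 N') :
    minors c (exteriorPower.map 2 f u) = minors (c ∘ₗ f) u := by
  have : minors c ∘ₗ exteriorPower.map 2 f = minors (c ∘ₗ f) := by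
    apply exteriorPower.linearMap_ext
    ext v
    simp only [LinearMap.compAlternatingMap_apply, LinearMap.comp_apply,
      BoxConstruction.ιMulti_eq_bivec]
    have : exteriorPower.map 2 f (bivec (v 0) (v 1)) = bivec (f (v 0)) (f (v 1)) := by
      rw [bivec, exteriorPower.map_apply_ιMulti, BoxConstruction.ιMulti_eq_bivec]
      rfl
    rw [this, minors_bivec, minors_bivec]
    rfl
  exact LinearMap.congr_fun this u

/-- The coordinates of `Rⁿ` in `Kⁿ`. -/
def algebraMapPi (R K : Type*) [CommRing R] [CommRing K] [Algebra R K] (n : ℕ) :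
    (Fin n → R) →ₗ[R] (Fin n → K) := (Algebra.linearMap R K).compLeft (Fin n)

theorem minors_algebraMapPi {n : ℕ} (w : ⋀[R]^2 (Fin n → R)) :
    minors (algebraMapPi R K n) w = (minors LinearMap.id w).map (algebraMap R K) := by
  induction w using bivec_induction with
  | h0 => ext i j; simp
  | hb v w =>
    ext i j
    rw [minors_bivec, Matrix.map_apply, minors_bivec]
    simp [algebraMapPi]
  | hs r μ h => 
    rw [map_smul, map_smul, h]
    ext i j
    rw [Matrix.map_apply, Matrix.smul_apply, Matrix.smul_apply, smul_eq_mul, map_mul,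
      Algebra.smul_def, Matrix.map_apply]
  | ha μ ν h h' => rw [map_add, map_add, h, h']; ext i j; simp

theorem comp_linearCombination {n : ℕ} (c : N →ₗ[R] (Fin n → K)) (ν : Fin n → N) :
    c ∘ₗ Fintype.linearCombination R ν =
      ((Matrix.of fun i => c (ν i)).transpose.mulVecLin.restrictScalars R) ∘ₗ
        algebraMapPi R K n := by
  refine LinearMap.pi_ext' fun i => LinearMap.ext_ring ?_
  ext j
  simp [algebraMapPi, Matrix.vecMul, dotProduct, Pi.single_apply]

variable [IsDomain R] [IsDomain K] [FaithfulSMul R K] [Module.Projective R N]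

/-- A power of `s` moves the argument into the exterior power of the frame `ν`, which is generated
by one element of nonzero volume; torsion-freeness removes `s`. -/
theorem vol_injective {n : ℕ} (c : N →ₗ[R] (Fin n → K)) {ν : Fin n → N}
    (hν : Matrix.det (Matrix.of fun i => c (ν i)) ≠ 0) {s : R} (hs : s ≠ 0)
    (h : ∀ x, s • x ∈ Submodule.span R (Set.range ν)) : Function.Injective (vol c) := by
  have := exteriorPower.isTorsionFree (R := R) (N := N) n
  rw [← LinearMap.ker_eq_bot, LinearMap.ker_eq_bot']
  intro u hu
  obtain ⟨w, hw⟩ := exteriorPower.exists_smul_eq_map (k := n) h u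
  rw [eq_vol_smul w, map_smul, exteriorPower.map_apply_ιMulti] at hw
  have hw0 : vol (LinearMap.id : (Fin n → R) →ₗ[R] _) w = 0 := by
    have h1 := congrArg (vol c) hw
    rw [map_smul, hu, smul_zero, map_smul, vol_ιMulti] at h1
    have h2 : (Matrix.of fun i => c ((Fintype.linearCombination R ν ∘
        fun i => (Pi.single i 1 : Fin n → R)) i)) = Matrix.of fun i => c (ν i) := by
      ext i j; simp
    rw [h2, Algebra.smul_def] at h1
    have h3 := (mul_eq_zero.mp h1.symm).resolve_right hν
    exact (FaithfulSMul.algebraMap_eq_zero_iff R K).mp h3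
  rw [hw0, zero_smul] at hw
  exact (smul_eq_zero.mp hw).resolve_left (pow_ne_zero _ hs)

theorem minors_injective (c : N →ₗ[R] (Fin 5 → K)) {ν : Fin 5 → N}
    (hν : Matrix.det (Matrix.of fun i => c (ν i)) ≠ 0) {s : R} (hs : s ≠ 0)
    (h : ∀ x, s • x ∈ Submodule.span R (Set.range ν)) : Function.Injective (minors c) := by
  have := exteriorPower.isTorsionFree (R := R) (N := N) 2
  rw [← LinearMap.ker_eq_bot, LinearMap.ker_eq_bot']
  intro u hu
  obtain ⟨w, hw⟩ := exteriorPower.exists_smul_eq_map (k := 2) h u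
  have hw0 : minors (LinearMap.id : (Fin 5 → R) →ₗ[R] _) w = 0 := by
    have h1 := congrArg (minors c) hw
    rw [map_smul, hu, smul_zero, minors_map, comp_linearCombination, minors_mulVec,
      minors_algebraMapPi] at h1
    set P := Matrix.of fun i => c (ν i)
    rw [Matrix.transpose_transpose] at h1
    have h2 : (P.det * P.det) • (minors (LinearMap.id : (Fin 5 → R) →ₗ[R] _) w).map
        (algebraMap R K) = 0 := by
      have h3 := congrArg (fun X => P.transpose.adjugate * X * P.adjugate) h1.symm
      simp only [mul_zero, zero_mul] at h3
      rw [← h3, ← Matrix.mul_assoc, ← Matrix.mul_assoc, Matrix.adjugate_mul, Matrix.mul_assoc,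
        Matrix.mul_adjugate, Matrix.det_transpose]
      simp [smul_smul]
    rw [smul_eq_zero] at h2
    have h3 := h2.resolve_left (mul_ne_zero hν hν)
    ext i j
    have h4 := congrFun (congrFun h3 i) j
    exact (FaithfulSMul.algebraMap_eq_zero_iff R K).mp h4
  rw [eq_sum_minors_smul w, hw0] at hw
  simp at hw
  exact hw.resolve_left hs

/-- The product of two linear forms on a tensor product. -/
noncomputable def tensorMul (f : N →ₗ[R] K) (g : N' →ₗ[R] K) : N ⊗[R] N' →ₗ[R] K :=
  LinearMap.mul' R K ∘ₗ TensorProduct.map f g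

omit [IsDomain R] [IsDomain K] [FaithfulSMul R K] [Module.Projective R N] in
theorem tensorMul_tmul (f : N →ₗ[R] K) (g : N' →ₗ[R] K) (x : N) (y : N') :
    tensorMul f g (x ⊗ₜ y) = f x * g y := rfl

end Injectivity

section TensorInjectivity

variable {R K N N' : Type*} [CommRing R] [IsDomain R] [Field K] [Algebra R K] [IsFractionRing R K]
  [AddCommGroup N] [Module R N] [AddCommGroup N'] [Module R N']

theorem exists_smul_eq_smul (f : N →ₗ[R] K) (hf : Function.Injective f) {p : N} (hp : p ≠ 0)
    (x : N) : ∃ r r' : R, r ≠ 0 ∧ r • x = r' • p := by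
  have hp' : f p ≠ 0 := by rwa [Ne, LinearMap.map_eq_zero_iff f hf]
  obtain ⟨r', r, hr, h⟩ := IsFractionRing.div_surjective (A := R) (f x / f p)
  have hr0 : r ≠ 0 := nonZeroDivisors.ne_zero hr
  have hrK : algebraMap R K r ≠ 0 := by rwa [Ne, IsFractionRing.to_map_eq_zero_iff]
  refine ⟨r, r', hr0, hf ?_⟩
  rw [map_smul, map_smul, Algebra.smul_def, Algebra.smul_def]
  field_simp at h
  exact h.symm

/-- Modules that embed in `K` have rank at most one, so every tensor is commensurable with one fixed
`p ⊗ p'`, whose value is nonzero. -/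
theorem tensorMul_injective [Module.IsTorsionFree R (N ⊗[R] N')] (f : N →ₗ[R] K)
    (g : N' →ₗ[R] K) (hf : Function.Injective f) (hg : Function.Injective g) :
    Function.Injective (tensorMul f g) := by
  by_cases hN : ∃ p : N, p ≠ 0
  swap
  · push Not at hN
    intro u v _
    have : ∀ u : N ⊗[R] N', u = 0 := by
      intro u
      induction u using TensorProduct.induction_on with
      | zero => rfl
      | tmul x y => rw [hN x, TensorProduct.zero_tmul]
      | add u v hu hv => rw [hu, hv, add_zero]
    rw [this u, this v]
  by_cases hN' : ∃ p : N', p ≠ 0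
  swap
  · push Not at hN'
    intro u v _
    have : ∀ u : N ⊗[R] N', u = 0 := by
      intro u
      induction u using TensorProduct.induction_on with
      | zero => rfl
      | tmul x y => rw [hN' y, TensorProduct.tmul_zero]
      | add u v hu hv => rw [hu, hv, add_zero]
    rw [this u, this v]
  obtain ⟨p, hp⟩ := hN
  obtain ⟨p', hp'⟩ := hN'
  have key : ∀ u : N ⊗[R] N', ∃ r r' : R, r ≠ 0 ∧ r • u = r' • (p ⊗ₜ[R] p') := by
    intro u
    induction u using TensorProduct.induction_on with
    | zero => exact ⟨1, 0, one_ne_zero, by simp⟩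
    | tmul x y =>
      obtain ⟨r, r', hr, h⟩ := exists_smul_eq_smul f hf hp x
      obtain ⟨q, q', hq, h'⟩ := exists_smul_eq_smul g hg hp' y
      refine ⟨r * q, r' * q', mul_ne_zero hr hq, ?_⟩
      rw [← TensorProduct.smul_tmul_smul, h, h', TensorProduct.smul_tmul_smul]
    | add u v hu hv =>
      obtain ⟨r, r', hr, h⟩ := hu
      obtain ⟨q, q', hq, h'⟩ := hv
      refine ⟨r * q, q * r' + r * q', mul_ne_zero hr hq, ?_⟩
      rw [smul_add, mul_smul, smul_comm r q u, h, mul_smul, h', add_smul, mul_smul, mul_smul]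
  rw [← LinearMap.ker_eq_bot, LinearMap.ker_eq_bot']
  intro u hu
  obtain ⟨r, r', hr, h⟩ := key u
  have h1 := congrArg (tensorMul f g) h
  rw [map_smul, hu, smul_zero, map_smul, tensorMul_tmul, Algebra.smul_def] at h1
  have h2 : f p * g p' ≠ 0 := by
    refine mul_ne_zero ?_ ?_
    · rwa [Ne, LinearMap.map_eq_zero_iff f hf]
    · rwa [Ne, LinearMap.map_eq_zero_iff g hg]
  have h3 := (mul_eq_zero.mp h1.symm).resolve_right h2
  rw [IsFractionRing.to_map_eq_zero_iff] at h3
  rw [h3, zero_smul] at h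
  exact (smul_eq_zero.mp h).resolve_left hr

end TensorInjectivity

section FreeLattices

variable {A K : Type*} [CommRing A] [IsDomain A] [IsPrincipalIdealRing A] [Field K] [Algebra A K]
  [IsFractionRing A K]

/-- Over a principal ideal domain the lattice is free; the rows of `D` are a basis. -/
theorem exists_matrix_of_isLattice {n : ℕ} (S : Submodule A (Fin n → K)) (hfg : S.FG)
    (hspan : Submodule.span K (S : Set (Fin n → K)) = ⊤) :
    ∃ D : Matrix (Fin n) (Fin n) K, D.det ≠ 0 ∧
      ∀ v, v ∈ S ↔ ∃ u : Fin n → A, v = D.transpose.mulVec (algebraMap A K ∘ u) := by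
  have hS : Submodule.IsLattice K S := ⟨hfg, hspan⟩
  have htf : Module.IsTorsionFree A K := inferInstance
  have hfree : Module.Free A S := Submodule.IsLattice.free (K := K) S
  let d := Module.finBasisOfFinrankEq A S (n := n) (by
    rw [Submodule.IsLattice.finrank_of_pi (K := K)]; simp)
  let d' := d.extendOfIsLattice K
  refine ⟨Matrix.of fun i => (d i : Fin n → K), ?_, fun v => ?_⟩
  · have h1 : LinearIndependent K (Matrix.of fun i => (d i : Fin n → K)).row := by
      have := d'.linearIndependent
      have e : (d' : Fin n → Fin n → K) = fun i => (d i : Fin n → K) := by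
        ext1 i; exact d.extendOfIsLattice_apply K i
      rw [e] at this
      exact this
    rw [Matrix.linearIndependent_rows_iff_isUnit, Matrix.isUnit_iff_isUnit_det] at h1
    exact h1.ne_zero
  · have key : ∀ u : Fin n → A, (Matrix.of fun i => (d i : Fin n → K)).transpose.mulVec
        (algebraMap A K ∘ u) = (∑ i, u i • d i : S) := by
      intro u
      ext j
      simp [Matrix.mulVec, dotProduct, Algebra.smul_def, mul_comm]
    constructor
    · intro hv
      refine ⟨d.repr ⟨v, hv⟩, ?_⟩
      rw [key, d.sum_repr]
    · rintro ⟨u, rfl⟩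
      rw [key]
      exact Subtype.prop _

end FreeLattices

/-! ### Integral normal form of a model at a prime. -/

section Frames

open IsLocalRing

theorem IsAltMatrix.smul {A : Type*} [CommRing A] {n : ℕ} {B : Matrix (Fin n) (Fin n) A}
    (hB : IsAltMatrix B) (c : A) : IsAltMatrix (c • B) :=
  ⟨fun i => by simp [hB.1 i], fun i j => by simp [hB.2 i j]⟩

theorem IsAltMatrix.congr {K : Type*} [Field K] {B : Matrix (Fin 5) (Fin 5) K}
    (hB : IsAltMatrix B) (g : Matrix (Fin 5) (Fin 5) K) :
    IsAltMatrix (g * B * g.transpose) := by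
  obtain ⟨μ, rfl⟩ := exists_minors_eq B hB
  rw [← minors_mulVec]
  exact minors_isAlt _ _

theorem tailCoords_eq_mulVec {K E : Type*} [Field K] [CommRing E] [Algebra K E]
    (b b' : Module.Basis (Fin 5) K E) (hb : b 0 = 1) (hb' : b' 0 = 1) (x : E) :
    tailCoords b x =
      (Matrix.of fun i : Fin 4 => tailCoords b (b' i.succ)).transpose.mulVec (tailCoords b' x) := by
  conv_lhs => rw [eq_of_tailCoords b' hb' x]
  rw [map_add, map_smul, tailCoords_one b hb, smul_zero, zero_add, map_sum]
  ext j
  simp [Matrix.mulVec, dotProduct, mul_comm]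

theorem det_tailCoords {K E : Type*} [Field K] [CommRing E] [Algebra K E]
    (b b' : Module.Basis (Fin 5) K E) (hb : b 0 = 1) (hb' : b' 0 = 1) (x : Fin 4 → E) :
    Matrix.det (Matrix.of fun i => tailCoords b (x i)) =
      Matrix.det (Matrix.of fun i => tailCoords b' (x i)) *
        Matrix.det (Matrix.of fun i : Fin 4 => tailCoords b (b' i.succ)) := by
  rw [← Matrix.det_mul]
  congr 1
  ext i j
  rw [Matrix.of_apply, tailCoords_eq_mulVec b b' hb hb', Matrix.mul_apply]
  simp [Matrix.mulVec, dotProduct, mul_comm]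

theorem det_tailCoords_ne_zero {K E : Type*} [Field K] [CommRing E] [Algebra K E]
    (b b' : Module.Basis (Fin 5) K E) (hb : b 0 = 1) (hb' : b' 0 = 1) :
    Matrix.det (Matrix.of fun i : Fin 4 => tailCoords b (b' i.succ)) ≠ 0 := by
  intro h
  have := det_tailCoords b b' hb hb' (fun i : Fin 4 => b i.succ)
  rw [h, mul_zero] at this
  have e : (Matrix.of fun i : Fin 4 => tailCoords b (b i.succ)) = 1 := by
    ext i j
    rw [Matrix.of_apply, tailCoords_apply, b.repr_self, Matrix.one_apply]
    simp [Finsupp.single_apply]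
  rw [e, Matrix.det_one] at this
  exact one_ne_zero this

/-- `q` is transformed by `G` and `a` contragrediently by `D`; the factor `l⁻¹` compensates the
effect of the new basis of the algebra on the determinant. -/
theorem IsModel.exists_congr {K E : Type*} [Field K] [CommRing E] [Algebra K E]
    {b : Module.Basis (Fin 5) K E} (hb : b 0 = 1)
    {a : (Fin 4 → K) →ₗ[K] Matrix (Fin 5) (Fin 5) K}
    {q : QuadraticMap K (Fin 4 → K) (Fin 5 → K)} (h : IsModel b a q)
    (b' : Module.Basis (Fin 5) K E) (hb' : b' 0 = 1) {D G : Matrix (Fin 5) (Fin 5) K}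
    (hGD : G * D.transpose = 1) (hDG : D.transpose * G = 1) {l : K} (hl0 : l ≠ 0)
    (hl : l = Matrix.det (Matrix.of fun i : Fin 4 => tailCoords b (b' i.succ))) :
    ∃ a' q', IsModel b' a' q' ∧
      (∀ x, q' (tailCoords b' x) = G.mulVec (q (tailCoords b x))) ∧
      (∀ x, a' (tailCoords b' x) = l⁻¹ • (D * a (tailCoords b x) * D.transpose)) := by
  set T := Matrix.of fun i : Fin 4 => tailCoords b (b' i.succ) with hT
  have hTx : ∀ x : E, tailCoords b x = T.transpose.mulVec (tailCoords b' x) :=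
    tailCoords_eq_mulVec b b' hb hb'
  have hGv : ∀ v, G.mulVec (D.transpose.mulVec v) = v := fun v => by
    rw [Matrix.mulVec_mulVec, hGD, Matrix.one_mulVec]
  have hDv : ∀ v, D.transpose.mulVec (G.mulVec v) = v := fun v => by
    rw [Matrix.mulVec_mulVec, hDG, Matrix.one_mulVec]
  let q' : QuadraticMap K (Fin 4 → K) (Fin 5 → K) :=
    G.mulVecLin.compQuadraticMap (q.comp T.transpose.mulVecLin)
  let a' : (Fin 4 → K) →ₗ[K] Matrix (Fin 5) (Fin 5) K :=
    { toFun := fun x => l⁻¹ • (D * a (T.transpose.mulVec x) * D.transpose)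
      map_add' := fun x y => by rw [Matrix.mulVec_add, map_add, mul_add, add_mul, smul_add]
      map_smul' := fun r x => by
        rw [Matrix.mulVec_smul, map_smul, Matrix.mul_smul, Matrix.smul_mul, smul_comm]; rfl }
  have hq' : ∀ x, q' (tailCoords b' x) = G.mulVec (q (tailCoords b x)) := fun x => by
    rw [hTx]; rfl
  have ha' : ∀ x, a' (tailCoords b' x) = l⁻¹ • (D * a (tailCoords b x) * D.transpose) :=
    fun x => by rw [hTx]; rfl
  refine ⟨a', q', ⟨fun x => ((h.alt _).congr D).smul _, ?_, fun x y z => ?_⟩, hq', ha'⟩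
  · have : Set.range q' = G.mulVecLin '' Set.range q := by
      ext v
      constructor
      · rintro ⟨y, rfl⟩; exact ⟨_, ⟨_, rfl⟩, rfl⟩
      · rintro ⟨_, ⟨y, rfl⟩, rfl⟩
        obtain ⟨Y, rfl⟩ := tailCoords_surjective b y
        exact ⟨_, hq' Y⟩
    rw [this, Submodule.span_image, h.span_eq_top, Submodule.map_top, LinearMap.range_eq_top]
    exact fun v => ⟨D.transpose.mulVec v, hGv v⟩
  · have e : ∀ v w : Fin 5 → K, G.mulVec v ⬝ᵥ D.mulVec w = v ⬝ᵥ w := by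
      intro v w
      rw [Matrix.dotProduct_mulVec, ← Matrix.mulVec_transpose, hDv]
    rw [hq', hq', ha', Matrix.smul_mulVec, dotProduct_smul, ← Matrix.mulVec_mulVec, hDv,
      ← Matrix.mulVec_mulVec, e, h.eq_det]
    have h4 := det_tailCoords b b' hb hb' ![x, y, z, y * z]
    have e1 : ∀ β : Module.Basis (Fin 5) K E, (Matrix.of fun i => tailCoords β
        ((![x, y, z, y * z] : Fin 4 → E) i)) = Matrix.of ![tailCoords β x, tailCoords β y,
          tailCoords β z, tailCoords β (y * z)] := by
      intro β
      ext i j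
      fin_cases i <;> rfl
    rw [e1, e1, ← hl] at h4
    rw [h4, smul_eq_mul]
    field_simp

variable {A : Type*} [CommRing A] [IsDomain A] [IsDiscreteValuationRing A]
  {K : Type*} [Field K] [Algebra A K] [IsFractionRing A K]
  {E : Type*} [CommRing E] [Algebra K E] [Algebra A E] [IsScalarTower A K E]

omit [IsDomain A] [IsDiscreteValuationRing A] [IsFractionRing A K] in
theorem dotProduct_mem_of_mem_span {n : ℕ} {Z : Set (Fin n → K)} (N : Submodule A K)
    (w : Fin n → K) (hZ : ∀ z ∈ Z, z ⬝ᵥ w ∈ N) {u : Fin n → K} (hu : u ∈ Submodule.span A Z) :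
    u ⬝ᵥ w ∈ N := by
  induction hu using Submodule.span_induction with
  | mem x hx => exact hZ x hx
  | zero => simp
  | add x y _ _ hx hy => rw [add_dotProduct]; exact N.add_mem hx hy
  | smul r x _ hx => rw [smul_dotProduct]; exact N.smul_mem r hx

/-- The values and polar values on a finite generating set generate the span. -/
theorem QuadraticMap.span_range_fg {R N X : Type*} [CommRing R] [AddCommGroup N] [Module R N]
    [AddCommGroup X] [Module R X] [Module.Finite R N] (Q : QuadraticMap R N X) :
    (Submodule.span R (Set.range Q)).FG := by
  obtain ⟨t, ht⟩ := Module.Finite.fg_top (R := R) (M := N)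
  set Z : Set X := Q '' t ∪ (fun p : N × N => QuadraticMap.polar Q p.1 p.2) '' (t ×ˢ t) with hZ
  have hpol : ∀ x y : N, QuadraticMap.polar Q x y ∈ Submodule.span R Z := by
    intro x y
    have hx : x ∈ Submodule.span R (t : Set N) := by rw [ht]; trivial
    have hy : y ∈ Submodule.span R (t : Set N) := by rw [ht]; trivial
    induction hx, hy using Submodule.span_induction₂ with
    | mem_mem x y hx hy => exact Submodule.subset_span (Or.inr ⟨(x, y), ⟨hx, hy⟩, rfl⟩)
    | zero_left y hy => simp
    | zero_right x hx => simp
    | add_left x y z _ _ _ h h' => rw [QuadraticMap.polar_add_left]; exact add_mem h h'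
    | add_right x y z _ _ _ h h' => rw [QuadraticMap.polar_add_right]; exact add_mem h h'
    | smul_left r x y _ _ h => rw [QuadraticMap.polar_smul_left]; exact Submodule.smul_mem _ r h
    | smul_right r x y _ _ h => rw [QuadraticMap.polar_smul_right]; exact Submodule.smul_mem _ r h
  have hval : ∀ x : N, Q x ∈ Submodule.span R Z := by
    intro x
    have hx : x ∈ Submodule.span R (t : Set N) := by rw [ht]; trivial
    induction hx using Submodule.span_induction with
    | mem x hx => exact Submodule.subset_span (Or.inl ⟨x, hx, rfl⟩)
    | zero => simp
    | add x y _ _ h h' =>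
      have : Q (x + y) = Q x + Q y + QuadraticMap.polar Q x y := by
        rw [QuadraticMap.polar]; abel
      rw [this]
      exact add_mem (add_mem h h') (hpol x y)
    | smul r x _ h => rw [QuadraticMap.map_smul]; exact Submodule.smul_mem _ _ h
  have hle : Submodule.span R Z ≤ Submodule.span R (Set.range Q) := by
    rw [Submodule.span_le]
    rintro _ (⟨x, _, rfl⟩ | ⟨⟨x, y⟩, _, rfl⟩)
    · exact Submodule.subset_span ⟨x, rfl⟩
    · have hs : ∀ z, Q z ∈ Submodule.span R (Set.range Q) := fun z =>
        Submodule.subset_span ⟨z, rfl⟩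
      exact sub_mem (sub_mem (hs _) (hs _)) (hs _)
  have heq : Submodule.span R (Set.range Q) = Submodule.span R Z :=
    le_antisymm (Submodule.span_le.mpr (by rintro _ ⟨x, rfl⟩; exact hval x)) hle
  rw [heq]
  exact Submodule.fg_span (((Finset.finite_toSet t).image _).union
    (((Finset.finite_toSet t).prod (Finset.finite_toSet t)).image _))

-- Integrality of `a` comes for free: its values on pairs of values of `q` are determinants of
-- integral vectors, and the values of `q` generate `A⁵`.
omit [IsDiscreteValuationRing A] in
omit [IsDomain A] [IsFractionRing A K] [IsScalarTower A K E] in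
theorem IsModel.exists_matrix_eq {b : Module.Basis (Fin 5) K E}
    {a : (Fin 4 → K) →ₗ[K] Matrix (Fin 5) (Fin 5) K}
    {q : QuadraticMap K (Fin 4 → K) (Fin 5 → K)} (h : IsModel b a q)
    (B : Subalgebra A E) (β : Module.Basis (Fin 5) A B)
    (hι : ∀ x : B, tailCoords b (x : E) = algebraMap A K ∘ tailCoords β x)
    (hspan : ∀ u : Fin 5 → A, algebraMap A K ∘ u ∈
      Submodule.span A (Set.range fun y : B => q (tailCoords b (y : E)))) (x : Fin 4 → A) :
    ∃ C : Matrix (Fin 5) (Fin 5) A, a (algebraMap A K ∘ x) = C.map (algebraMap A K) := by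
  obtain ⟨X, rfl⟩ := tailCoords_surjective β x
  set N : Submodule A K := LinearMap.range (Algebra.linearMap A K) with hN
  have h0 : ∀ y z : B, q (tailCoords b y) ⬝ᵥ (a (algebraMap A K ∘ tailCoords β X)).mulVec
      (q (tailCoords b z)) ∈ N := by
    intro y z
    rw [← hι, h.eq_det]
    refine ⟨Matrix.det (Matrix.of ![tailCoords β X, tailCoords β y, tailCoords β z,
      tailCoords β (y * z)]), ?_⟩
    rw [Algebra.linearMap_apply, RingHom.map_det]
    congr 1
    ext i j
    have e := hι (y * z)
    rw [MulMemClass.coe_mul] at e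
    fin_cases i <;> simp [hι, e]
  have h1 : ∀ (u : Fin 5 → A) (z : B), (algebraMap A K ∘ u) ⬝ᵥ
      (a (algebraMap A K ∘ tailCoords β X)).mulVec (q (tailCoords b z)) ∈ N := by
    intro u z
    refine dotProduct_mem_of_mem_span N _ ?_ (hspan u)
    rintro _ ⟨y, rfl⟩
    exact h0 y z
  have h2 : ∀ u v : Fin 5 → A, (algebraMap A K ∘ u) ⬝ᵥ
      (a (algebraMap A K ∘ tailCoords β X)).mulVec (algebraMap A K ∘ v) ∈ N := by
    intro u v
    rw [Matrix.dotProduct_mulVec, dotProduct_comm]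
    refine dotProduct_mem_of_mem_span N _ ?_ (hspan v)
    rintro _ ⟨y, rfl⟩
    have := h1 u y
    rw [Matrix.dotProduct_mulVec, dotProduct_comm] at this
    exact this
  choose C hC using fun i j => h2 (Pi.single i 1) (Pi.single j 1)
  refine ⟨Matrix.of C, ?_⟩
  ext i j
  rw [Matrix.map_apply, Matrix.of_apply]
  have h3 := hC i j
  rw [Algebra.linearMap_apply] at h3
  have e : ∀ i : Fin 5, algebraMap A K ∘ (Pi.single i 1 : Fin 5 → A) = Pi.single i 1 := by
    intro i; ext k; simp [Pi.single_apply, apply_ite (algebraMap A K)]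
  rw [h3, e, e]
  simp

/-- The `A`-span of the values of `q` is free with basis the rows of `D`. In the dual coordinates
`G` the model is integral, so its constant is a unit `u` by `isUnit_constant`. -/
theorem IsModel.exists_frame {b : Module.Basis (Fin 5) K E} (hb : b 0 = 1)
    {a : (Fin 4 → K) →ₗ[K] Matrix (Fin 5) (Fin 5) K}
    {q : QuadraticMap K (Fin 4 → K) (Fin 5 → K)} (h : IsModel b a q) {c : K}
    (hc : ∀ y, pfVec (a y) = c • q y) (B : Subalgebra A E) (β : Module.Basis (Fin 5) A B)
    (hβ : β 0 = 1) (b' : Module.Basis (Fin 5) K E) (hb' : ∀ i, b' i = β i)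
    (hBE : ∀ x : E, ∃ r : A, r ≠ 0 ∧ r • x ∈ B)
    {π : A} (hπ : maximalIdeal A = Ideal.span {π})
    (hB : IntegralRankLETwo (k := ResidueField A) K B π (Algebra.TensorProduct.includeRight :
      B →ₐ[A] ResidueField A ⊗[A] B).toRingHom) :
    ∃ (l : K) (P : Matrix (Fin 5) (Fin 5) K) (u : A), l ≠ 0 ∧ IsUnit u ∧
      l = Matrix.det (Matrix.of fun i : Fin 4 => tailCoords b (β i.succ)) ∧
      (∀ x : Fin 4 → B, ∃ r : A, Matrix.det (Matrix.of fun i => tailCoords b (x i : E)) =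
        algebraMap A K r * l) ∧
      P.det * algebraMap A K u = c * l ^ 3 ∧ P.det ≠ 0 ∧
      (∀ y : B, ∃ v : Fin 5 → A, P.mulVec (q (tailCoords b (y : E))) = l • (algebraMap A K ∘ v)) ∧
      (∀ v : Fin 5 → A, algebraMap A K ∘ v ∈ Submodule.span A
        (Set.range fun y : B => l⁻¹ • P.mulVec (q (tailCoords b (y : E))))) ∧
      (∀ y : B, ∃ C : Matrix (Fin 5) (Fin 5) A, 
        l • a (tailCoords b (y : E)) = P.transpose * C.map (algebraMap A K) * P) := by
  have hinj := IsFractionRing.injective A K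
  have hb0' : b' 0 = 1 := by rw [hb', hβ]; rfl
  have hι : ∀ x : B, tailCoords b' (x : E) = algebraMap A K ∘ tailCoords β x := by
    intro x
    conv_lhs => rw [← β.sum_repr x]
    ext j
    rw [tailCoords_apply, Function.comp_apply, tailCoords_apply]
    simp only [AddSubmonoidClass.coe_finsetSum, SetLike.val_smul, map_sum, ← hb',
      algebra_compatible_smul K (β.repr x _), map_smul, b'.repr_self]
    simp [Finsupp.single_apply, Algebra.algebraMap_eq_smul_one]
  set T := Matrix.of fun i : Fin 4 => tailCoords b (b' i.succ) with hT
  set l := T.det with hl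
  have hl0 : l ≠ 0 := det_tailCoords_ne_zero b b' hb hb0'
  have hdet4 : ∀ x : Fin 4 → B, ∃ r : A, Matrix.det (Matrix.of fun i => tailCoords b (x i : E)) =
        algebraMap A K r * l := by
    intro x
    refine ⟨Matrix.det (Matrix.of fun i => tailCoords β (x i)), ?_⟩
    rw [det_tailCoords b b' hb hb0', RingHom.map_det]
    congr 2
    ext i j
    simp [hι]
  have hDB : Module.Finite A B := Module.Finite.of_basis β
  set κ : B →ₗ[A] (Fin 4 → K) := (tailCoords b).restrictScalars A ∘ₗ B.val.toLinearMap with hκ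
  have hκa : ∀ y : B, κ y = tailCoords b (y : E) := fun y => rfl
  set S : Submodule A (Fin 5 → K) := Submodule.span A (Set.range fun y : B => q (κ y)) with hS
  have hSfg : S.FG := QuadraticMap.span_range_fg (((q.restrictScalars : QuadraticMap A (Fin 4 → K) (Fin 5 → K)).comp κ))
  have hSK : Submodule.span K (S : Set (Fin 5 → K)) = ⊤ := by
    rw [eq_top_iff, ← h.span_eq_top, Submodule.span_le]
    rintro _ ⟨y, rfl⟩
    obtain ⟨Y, rfl⟩ := tailCoords_surjective b y
    obtain ⟨r, hr, hY⟩ := hBE Y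
    have hrK : algebraMap A K r ≠ 0 := by rwa [Ne, IsFractionRing.to_map_eq_zero_iff]
    have h1 : q (κ ⟨r • Y, hY⟩) ∈ Submodule.span K (S : Set (Fin 5 → K)) :=
      Submodule.subset_span (Submodule.subset_span ⟨_, rfl⟩)
    have h2 : κ ⟨r • Y, hY⟩ = algebraMap A K r • tailCoords b Y := by
      rw [hκa, ← map_smul, algebraMap_smul]
    rw [h2, QuadraticMap.map_smul, Submodule.smul_mem_iff _ (mul_ne_zero hrK hrK)] at h1
    exact h1
  obtain ⟨D, hD0, hD⟩ := exists_matrix_of_isLattice S hSfg hSK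
  have hDu : IsUnit D.transpose.det := by rw [Matrix.det_transpose]; exact hD0.isUnit
  set G := D.transpose⁻¹ with hG
  have hGD : G * D.transpose = 1 := Matrix.nonsing_inv_mul _ hDu
  have hDG : D.transpose * G = 1 := Matrix.mul_nonsing_inv _ hDu
  have hGtD : G.transpose * D = 1 := by
    rw [← Matrix.transpose_transpose D, ← Matrix.transpose_mul, hDG, Matrix.transpose_one]
  have hGv : ∀ v, G.mulVec (D.transpose.mulVec v) = v := fun v => by
    rw [Matrix.mulVec_mulVec, hGD, Matrix.one_mulVec]
  have hDv : ∀ v, D.transpose.mulVec (G.mulVec v) = v := fun v => by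
    rw [Matrix.mulVec_mulVec, hDG, Matrix.one_mulVec]
  obtain ⟨a', q', hm, hq'a, ha'a⟩ := h.exists_congr hb b' hb0' hGD hDG hl0 rfl
  have hqint : ∀ y : Fin 4 → A, ∃ v : Fin 5 → A, q' (algebraMap A K ∘ y) = algebraMap A K ∘ v := by
    intro y
    obtain ⟨Y, rfl⟩ := tailCoords_surjective β y
    obtain ⟨u, hu⟩ := (hD (q (κ Y))).mp (Submodule.subset_span ⟨Y, rfl⟩)
    refine ⟨u, ?_⟩
    rw [← hι, hq'a, ← hκa, hu, hGv]
  have hqspanB : ∀ u : Fin 5 → A, algebraMap A K ∘ u ∈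
      Submodule.span A (Set.range fun y : B => G.mulVec (q (κ y))) := by
    intro u
    have hu : D.transpose.mulVec (algebraMap A K ∘ u) ∈ S := (hD _).mpr ⟨u, rfl⟩
    have h1 := Submodule.mem_map_of_mem (f := G.mulVecLin.restrictScalars A) hu
    rw [hS, Submodule.map_span, ← Set.range_comp] at h1
    have h2 : (G.mulVecLin.restrictScalars A) (D.transpose.mulVec (algebraMap A K ∘ u)) =
        algebraMap A K ∘ u := hGv _
    rw [h2] at h1
    exact h1
  have hqspan' : ∀ u : Fin 5 → A, algebraMap A K ∘ u ∈
      Submodule.span A (Set.range fun y : B => q' (tailCoords b' (y : E))) := by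
    simpa only [hq'a, hκa] using hqspanB
  have hqspan : ∀ u : Fin 5 → A, algebraMap A K ∘ u ∈
      Submodule.span A (Set.range fun y : Fin 4 → A => q' (algebraMap A K ∘ y)) := by
    intro u
    refine Submodule.span_mono ?_ (hqspan' u)
    rintro _ ⟨y, rfl⟩
    exact ⟨tailCoords β y, by simp only [hι]⟩
  have haint := hm.exists_matrix_eq B β hι hqspan'
  have hpf : ∀ x, pfVec (a' x) = (l⁻¹ ^ 2 * D.det * c) • q' x := by
    intro x
    obtain ⟨X, rfl⟩ := tailCoords_surjective b' x
    have h1 := congrArg G.mulVec (pfVec_congr D (a (tailCoords b X)) (h.alt _))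
    rw [hGv, hc] at h1
    rw [ha'a, pfVec_smul, h1, hq'a, Matrix.mulVec_smul, Matrix.mulVec_smul, smul_smul, smul_smul]
  obtain ⟨u, hu, huc⟩ := hm.isUnit_constant hpf B β hβ hι haint hqint hqspan hπ hB
  have hdetG : G.det * D.det = 1 := by
    rw [← Matrix.det_transpose D, ← Matrix.det_mul, hGD, Matrix.det_one]
  have hPdet : (l • G).det = l ^ 5 * G.det := by rw [Matrix.det_smul]; simp
  -- The factor `l` makes the rows of `P` a basis of the vectors whose products with the values of
  -- `q` lie in `A l`, rather than in `A`. The relation for the determinant combines det P = l⁵ det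
  -- G with u = l⁻² det D · c.
  refine ⟨l, l • G, u, hl0, hu, ?_, hdet4, ?_, ?_, fun y => ?_, fun v => ?_, fun y => ?_⟩
  · rw [hl, hT]; simp only [hb']
  · rw [hPdet, huc]
    calc l ^ 5 * G.det * (l⁻¹ ^ 2 * D.det * c) = (G.det * D.det) * (l * l⁻¹) ^ 2 * c * l ^ 3 := by
          ring
      _ = _ := by rw [hdetG, mul_inv_cancel₀ hl0]; ring
  · rw [hPdet]
    exact mul_ne_zero (pow_ne_zero _ hl0) (left_ne_zero_of_mul (hdetG.trans_ne one_ne_zero))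
  · obtain ⟨v, hv⟩ := hqint (tailCoords β y)
    rw [← hι, hq'a] at hv
    exact ⟨v, by rw [Matrix.smul_mulVec, hv]⟩
  · simpa only [Matrix.smul_mulVec, smul_smul, inv_mul_cancel₀ hl0, one_smul, hκa] using hqspanB v
  · obtain ⟨C, hC⟩ := haint (tailCoords β y)
    refine ⟨C, ?_⟩
    rw [← hC, ← hι, ha'a, Matrix.transpose_smul]
    simp only [Matrix.smul_mul, Matrix.mul_smul, smul_smul]
    have : G.transpose * (D * a (tailCoords b (y : E)) * D.transpose) * G =
        (G.transpose * D) * a (tailCoords b (y : E)) * (D.transpose * G) := by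
      simp only [Matrix.mul_assoc]
    rw [this, hGtD, hDG, one_mul, mul_one]
    congr 1
    field_simp

end Frames

/-! ### The quotient by the base ring, and bases that begin with 1. -/

section BaseQuotient

variable {R Q E : Type*} [CommRing R] [IsDomain R] [IsIntegrallyClosed R] [CommRing Q]
  [Algebra R Q] [Module.Finite R Q] [CommRing E] [Nontrivial E] [Algebra R E]

-- `Q` is integral over the integrally closed ring `R`, so an element of `Q` that is a fraction of
-- elements of `R` lies in `R`. Torsion-freeness of `Q / R` follows.
omit [IsDomain R] in
theorem exists_algebraMap_eq_of_smul (K : Type*) [Field K] [Algebra R K]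
    [IsFractionRing R K] [Algebra K E] [IsScalarTower R K E] (ι : Q →ₐ[R] E) (hι : Function.Injective ι) {r r' : R}
    (hr : r ≠ 0) {y : Q} (h : r • y = algebraMap R Q r') : ∃ x : R, y = algebraMap R Q x := by
  have hrK : algebraMap R K r ≠ 0 := by rwa [Ne, IsFractionRing.to_map_eq_zero_iff]
  have h1 : ι y = algebraMap K E (algebraMap R K r' / algebraMap R K r) := by
    have h2 := congrArg ι h
    rw [map_smul, AlgHom.commutes, algebra_compatible_smul K, Algebra.smul_def,
      IsScalarTower.algebraMap_apply R K E] at h2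
    have h3 : IsUnit (algebraMap K E (algebraMap R K r)) := (IsUnit.mk0 _ hrK).map _
    apply h3.mul_left_cancel
    rw [h2, ← map_mul, mul_div_cancel₀ _ hrK]
  have h4 : IsIntegral R (algebraMap K E (algebraMap R K r' / algebraMap R K r)) := by
    rw [← h1]
    exact (Algebra.IsIntegral.isIntegral (R := R) y).map ι
  have h5 : IsIntegral R (algebraMap R K r' / algebraMap R K r) :=
    (isIntegral_algebraMap_iff (algebraMap K E).injective).mp h4
  obtain ⟨x, hx⟩ := IsIntegrallyClosed.isIntegral_iff.mp h5
  refine ⟨x, hι ?_⟩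
  rw [h1, ← hx, AlgHom.commutes, ← IsScalarTower.algebraMap_apply]

theorem ModBase.isTorsionFree (K : Type*) [Field K] [Algebra R K]
    [IsFractionRing R K] [Algebra K E] [IsScalarTower R K E] (ι : Q →ₐ[R] E) (hι : Function.Injective ι) :
    Module.IsTorsionFree R (ModBase R Q) := by
  apply Module.IsTorsionFree.of_smul_eq_zero
  intro r x h
  obtain ⟨y, rfl⟩ := Submodule.mkQ_surjective _ x
  by_cases hr : r = 0
  · exact Or.inl hr
  right
  rw [← map_smul, Submodule.mkQ_apply, Submodule.Quotient.mk_eq_zero] at h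
  obtain ⟨r', hr'⟩ := h
  obtain ⟨x, hx⟩ := exists_algebraMap_eq_of_smul K ι hι hr hr'.symm
  rw [Submodule.mkQ_apply, Submodule.Quotient.mk_eq_zero]
  exact ⟨x, hx.symm⟩

end BaseQuotient

section SubalgebraBases

variable {A K E : Type*} [CommRing A] [IsDomain A] [IsPrincipalIdealRing A] [Field K] [Algebra A K]
  [IsFractionRing A K] [CommRing E] [Nontrivial E] [Algebra K E] [Algebra A E]
  [IsScalarTower A K E]

/-- The quotient of `B` by `A` is torsion-free, hence free, so the extension splits and `1` can be
completed to a basis, which is also a basis over `K`. -/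
theorem exists_basis_of_subalgebra {n : ℕ} (hE : Module.finrank K E = n + 1) (B : Subalgebra A E)
    [Module.Finite A B] (hBE : ∀ x : E, ∃ r : A, r ≠ 0 ∧ r • x ∈ B) :
    ∃ (β : Module.Basis (Fin (n + 1)) A B) (b' : Module.Basis (Fin (n + 1)) K E),
      β 0 = 1 ∧ ∀ i, b' i = β i := by
  have htfL : Module.IsTorsionFree A (ModBase A B) :=
    ModBase.isTorsionFree K B.val Subtype.val_injective
  have hfree : Module.Free A (ModBase A B) := inferInstance
  have htfE : Module.IsTorsionFree A E := Module.IsTorsionFree.trans_faithfulSMul A K E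
  have hBn : Nontrivial B := ⟨⟨0, 1, fun h => zero_ne_one (congrArg Subtype.val h)⟩⟩
  obtain ⟨σ, hσ⟩ := Module.projective_lifting_property (toModBase A B) LinearMap.id
    (Submodule.mkQ_surjective _)
  have hσ' : ∀ x, toModBase A B (σ x) = x := fun x => LinearMap.congr_fun hσ x
  have hσi : Function.Injective σ := fun x y h => by rw [← hσ' x, h, hσ']
  let e := Module.finBasis A (ModBase A B)
  let N := LinearMap.range σ
  let eN : Module.Basis _ A N := e.map (LinearEquiv.ofInjective σ hσi)
  have hli : ∀ (c : A), ∀ x ∈ N, c • (1 : B) + x = 0 → c = 0 := by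
    rintro c _ ⟨x, rfl⟩ h
    have h1 := congrArg (toModBase A B) h
    have h2 : toModBase A B (c • (1 : B)) = 0 := by
      rw [Submodule.mkQ_apply, Submodule.Quotient.mk_eq_zero]
      exact ⟨c, by rw [Algebra.linearMap_apply, Algebra.algebraMap_eq_smul_one]⟩
    rw [map_add, h2, hσ', zero_add, map_zero] at h1
    rw [h1, map_zero, add_zero] at h
    exact (smul_eq_zero.mp h).resolve_right one_ne_zero
  have hsp : ∀ z : B, ∃ c : A, z + c • (1 : B) ∈ N := by
    intro z
    have h1 : toModBase A B (z - σ (toModBase A B z)) = 0 := by rw [map_sub, hσ', sub_self]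
    rw [Submodule.mkQ_apply, Submodule.Quotient.mk_eq_zero] at h1
    obtain ⟨c, hc⟩ := h1
    refine ⟨-c, toModBase A B z, ?_⟩
    rw [Algebra.linearMap_apply, Algebra.algebraMap_eq_smul_one] at hc
    rw [neg_smul, hc]
    abel
  let β₀ := Module.Basis.mkFinCons (1 : B) eN hli hsp
  have hβ₀ : β₀ 0 = 1 := by
    rw [Module.Basis.coe_mkFinCons]; rfl
  let S : Submodule A E := B.toSubmodule
  let β₁ : Module.Basis _ A S := β₀
  have hSl : Submodule.IsLattice K S := by
    refine ⟨?_, ?_⟩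
    · exact (Module.Finite.iff_fg (N := S)).mp (inferInstanceAs (Module.Finite A B))
    · rw [eq_top_iff]
      intro x _
      obtain ⟨r, hr, hx⟩ := hBE x
      have hrK : algebraMap A K r ≠ 0 := by rwa [Ne, IsFractionRing.to_map_eq_zero_iff]
      rw [← Submodule.smul_mem_iff _ hrK, algebraMap_smul]
      exact Submodule.subset_span hx
  let b₁ := β₁.extendOfIsLattice K
  have hn : Module.finrank A (ModBase A B) + 1 = n + 1 := by
    rw [← hE, Module.finrank_eq_card_basis b₁, Fintype.card_fin]
  have hn' : Module.finrank A (ModBase A B) = n := by omega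
  clear_value β₀
  refine ⟨β₀.reindex (finCongr hn), b₁.reindex (finCongr hn), ?_, fun i => ?_⟩
  · rw [Module.Basis.reindex_apply, ← hβ₀]; rfl
  · rw [Module.Basis.reindex_apply, Module.Basis.reindex_apply]
    exact β₁.extendOfIsLattice_apply K _

end SubalgebraBases

/-! ### Localization of the algebra inside its generic fibre. -/

section LocalSubalgebra

variable {R : Type*} [CommRing R] (p : Ideal R) [p.IsPrime] (A : Type*) [CommRing A] [Algebra R A]
  [IsLocalization.AtPrime A p] {Q E : Type*} [CommRing Q] [Algebra R Q] [CommRing E] [Algebra R E]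
  [Algebra A E] [IsScalarTower R A E] (ι : Q →ₐ[R] E)

/-- The localization at `p` of the image of the `R`-algebra `Q` in an `A`-algebra, where
`A` is the localization of `R` at `p`. -/
def localSubalgebra : Subalgebra A E where
  carrier := {x | ∃ s ∉ p, ∃ y, s • x = ι y}
  mul_mem' := by
    rintro x x' ⟨s, hs, y, hy⟩ ⟨s', hs', y', hy'⟩
    refine ⟨s * s', p.primeCompl.mul_mem hs hs', y * y', ?_⟩
    rw [map_mul, ← hy, ← hy', smul_mul_smul_comm]
  add_mem' := by
    rintro x x' ⟨s, hs, y, hy⟩ ⟨s', hs', y', hy'⟩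
    refine ⟨s * s', p.primeCompl.mul_mem hs hs', s' • y + s • y', ?_⟩
    rw [map_add, map_smul, map_smul, ← hy, ← hy', smul_add, mul_smul, mul_smul, smul_comm s s' x]
  algebraMap_mem' := by
    intro a
    obtain ⟨⟨r, s⟩, h⟩ := IsLocalization.surj p.primeCompl a
    refine ⟨s, s.2, algebraMap R Q r, ?_⟩
    rw [AlgHom.commutes, IsScalarTower.algebraMap_apply R A E, ← h, map_mul, mul_comm,
      ← IsScalarTower.algebraMap_apply, Algebra.smul_def]

theorem map_mem_localSubalgebra (y : Q) : ι y ∈ localSubalgebra p A ι :=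
  ⟨1, p.primeCompl.one_mem, y, one_smul _ _⟩

theorem eq_smul_of_smul_eq {s r : R} (hs : s ∉ p) {M : Type*} [AddCommGroup M] [Module R M]
    [Module A M] [IsScalarTower R A M] {x y : M} (h : s • x = r • y) :
    x = (IsLocalization.mk' A r (⟨s, hs⟩ : p.primeCompl)) • y := by
  have hu : IsUnit (algebraMap R A s) := IsLocalization.map_units A (⟨s, hs⟩ : p.primeCompl)
  rw [← hu.smul_left_cancel, algebraMap_smul, h, smul_smul, mul_comm,
    IsLocalization.mk'_spec, algebraMap_smul]

instance [Module.Finite R Q] : Module.Finite A (localSubalgebra p A ι) := by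
  classical
  obtain ⟨T, hT⟩ := Module.Finite.fg_top (R := R) (M := Q)
  let f : Q →ₗ[R] localSubalgebra p A ι :=
    { toFun := fun y => ⟨ι y, map_mem_localSubalgebra p A ι y⟩
      map_add' := fun x y => Subtype.ext (map_add ι x y)
      map_smul' := fun r x => Subtype.ext (map_smul ι r x) }
  refine ⟨⟨T.image f, ?_⟩⟩
  rw [eq_top_iff]
  rintro ⟨x, s, hs, y, hy⟩ -
  have hy' : s • (⟨x, s, hs, y, hy⟩ : localSubalgebra p A ι) = (1 : R) • f y :=
    Subtype.ext (by rw [one_smul]; exact hy)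
  rw [eq_smul_of_smul_eq p A hs hy']
  apply Submodule.smul_mem
  have h1 : f y ∈ (⊤ : Submodule R Q).map f := ⟨y, trivial, rfl⟩
  rw [← hT, Submodule.map_span] at h1
  rw [Finset.coe_image]
  exact Submodule.span_subset_span R A _ h1

end LocalSubalgebra

/-! ### Transfer of the hypothesis to the local rings. -/

section IntegralClasses

open IsLocalRing

/-- For `π` in `p` but not in `p²`, write (π) = pI. Then I is not contained in `p`, and any `t` in I
outside `p` multiplies `p` into (π). -/
theorem exists_uniformizer {R : Type*} [CommRing R] [IsDedekindDomain R] (p : Ideal R)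
    [hpp : p.IsPrime] (hp : p ≠ ⊥) : ∃ π ∈ p, ∃ t ∉ p, ∀ x ∈ p, ∃ r, t * x = r * π := by
  obtain ⟨π, hπ, hπ2⟩ := Ideal.exists_mem_pow_notMem_pow_succ p hp hpp.ne_top 1
  rw [pow_one] at hπ
  obtain ⟨I, hI⟩ := Ideal.dvd_iff_le.mpr ((Ideal.span_singleton_le_iff_mem p).mpr hπ)
  have hIp : ¬ I ≤ p := by
    intro h
    apply hπ2
    rw [← Ideal.span_singleton_le_iff_mem, hI, pow_succ, pow_one]
    exact Ideal.mul_mono_right h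
  obtain ⟨t, htI, htp⟩ := SetLike.not_le_iff_exists.mp hIp
  refine ⟨π, hπ, t, htp, fun x hx => ?_⟩
  have : t * x ∈ Ideal.span {π} := by
    rw [hI, mul_comm t x]; exact Ideal.mul_mem_mul hx htI
  obtain ⟨r, hr⟩ := Ideal.mem_span_singleton'.mp this
  exact ⟨r, hr.symm⟩

theorem maximalIdeal_eq_span_of_uniformizer {R : Type*} [CommRing R] (p : Ideal R) [p.IsPrime]
    (A : Type*) [CommRing A] [IsLocalRing A] [Algebra R A] [IsLocalization.AtPrime A p] {π t : R}
    (hπ : π ∈ p) (ht : t ∉ p) (h : ∀ x ∈ p, ∃ r, t * x = r * π) :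
    maximalIdeal A = Ideal.span {algebraMap R A π} := by
  rw [← IsLocalization.AtPrime.map_eq_maximalIdeal p A]
  apply le_antisymm
  · rw [Ideal.map_le_iff_le_comap]
    intro x hx
    obtain ⟨r, hr⟩ := h x hx
    rw [Ideal.mem_comap]
    have hu : IsUnit (algebraMap R A t) := IsLocalization.map_units A (⟨t, ht⟩ : p.primeCompl)
    rw [← Ideal.unit_mul_mem_iff_mem _ hu, ← map_mul, hr, map_mul]
    exact Ideal.mul_mem_left _ _ (Ideal.mem_span_singleton_self _)
  · rw [Ideal.span_singleton_le_iff_mem]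
    exact Ideal.mem_map_of_mem _ hπ

variable {R : Type*} {Q : Type*} {K : Type*} [CommRing R] [IsDedekindDomain R] [Field K]
  [Algebra R K] [IsFractionRing R K] [CommRing Q] [Algebra R Q]

-- Three local elements that become integral after division by `π` are, up to factors prime to `p`,
-- represented by integral classes in p⁻¹Q/Q. A relation among those classes reduces to a relation
-- modulo `π`.
omit [IsDedekindDomain R] in
theorem integralRankLETwo_localSubalgebra (p : Ideal R) [p.IsPrime]
    (hint : Module.rank (R ⧸ p) (integralClasses R K Q p) ≤ 2) {π t : R} (hπp : π ∈ p)
    (hπ0 : π ≠ 0) (htp : t ∉ p) (ht : ∀ x ∈ p, ∃ r, t * x = r * π)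
    (A : Type*) [CommRing A] [IsLocalRing A] [Algebra R A] [IsLocalization.AtPrime A p]
    [Algebra A K] [IsScalarTower R A K] :
    IntegralRankLETwo (k := ResidueField A) K
      (localSubalgebra p A (Algebra.TensorProduct.includeRight : Q →ₐ[R] K ⊗[R] Q))
      (algebraMap R A π) (Algebra.TensorProduct.includeRight : _ →ₐ[A] ResidueField A ⊗[A]
      (localSubalgebra p A (Algebra.TensorProduct.includeRight : Q →ₐ[R] K ⊗[R] Q))).toRingHom := by
  set ι := (Algebra.TensorProduct.includeRight : Q →ₐ[R] K ⊗[R] Q) with hι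
  set B := localSubalgebra p A ι with hB
  intro v hv hli
  have hmul : ∀ a b : R, a ∉ p → b ∉ p → a * b ∉ p := fun a b ha hb =>
    p.primeCompl.mul_mem ha hb
  have hKπ : algebraMap R K π ≠ 0 := by rwa [Ne, IsFractionRing.to_map_eq_zero_iff]
  rw [← IsScalarTower.algebraMap_apply] at hv
  choose s hs y hy using fun i => (v i).2
  choose m hm using fun i =>
    IsIntegral.exists_multiple_integral_of_isLocalization p.primeCompl _ (hv i)
  -- All three factors lie outside `p`: `m i` makes the element integral over `R`, `s i` clears the
  -- denominator of `v i` over `Q`, and `t` ensures that `p` multiplies `x i` into `Q`.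
  set x : Fin 3 → K ⊗[R] Q := fun i => (t * s i * m i) • ((algebraMap R K π)⁻¹ • (v i : K ⊗[R] Q))
    with hx
  have hxint : ∀ i, IsIntegral R (x i) := fun i => by
    simp only [hx, mul_smul]
    exact ((hm i).smul (s i)).smul t
  have hππ : ∀ e : K ⊗[R] Q, π • ((algebraMap R K π)⁻¹ • e) = e := fun e => by
    rw [algebra_compatible_smul K π, smul_smul, mul_inv_cancel₀ hKπ, one_smul]
  have hπx : ∀ i, π • x i = (t * s i * m i) • (v i : K ⊗[R] Q) := by
    intro i
    simp only [hx]
    rw [smul_comm, hππ]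
  have hxtors : ∀ i, ∀ z ∈ p, ∃ W, ι W = z • x i := by
    intro i z hz
    obtain ⟨r, hr⟩ := ht z hz
    refine ⟨r • (m i : R) • y i, ?_⟩
    have h1 : z • x i = (s i * m i) • (t * z) • ((algebraMap R K π)⁻¹ • (v i : K ⊗[R] Q)) := by
      simp only [hx, smul_smul]; congr 1; ring
    rw [h1, hr, mul_smul r π, hππ, map_smul, map_smul, ← hy]
    simp only [smul_smul]; congr 1; ring
  let w : Fin 3 → integralClasses R K Q p := fun i =>
    ⟨⟨Submodule.Quotient.mk (x i), by
      rw [Submodule.mem_torsionBySet_iff]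
      rintro ⟨z, hz⟩
      change z • _ = _
      rw [← Submodule.Quotient.mk_smul, Submodule.Quotient.mk_eq_zero]
      exact hxtors i z hz⟩, x i, hxint i, rfl⟩
  have hw : ¬ LinearIndependent (R ⧸ p) w := by
    intro h
    have h1 := h.cardinal_lift_le_rank.trans (Cardinal.lift_le.mpr hint)
    simp only [Cardinal.mk_fin, Cardinal.lift_natCast, Cardinal.lift_ofNat] at h1
    norm_cast at h1
  rw [Fintype.not_linearIndependent_iff] at hw
  obtain ⟨g, hg, i₀, hi₀⟩ := hw
  choose r hr using fun i => Ideal.Quotient.mk_surjective (g i)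
  have hr₀ : r i₀ ∉ p := by
    rwa [← Ideal.Quotient.eq_zero_iff_mem, hr]
  have hsum : (Submodule.Quotient.mk (∑ i, r i • x i) : GenericQuot R K Q) = 0 := by
    have h1 : ∀ i, ((g i • w i : integralClasses R K Q p) : InvQuot R K Q p).1 =
        (Submodule.Quotient.mk (r i • x i) : GenericQuot R K Q) := by
      intro i
      rw [← hr]
      rfl
    have h2 := congrArg (fun c : integralClasses R K Q p => (c : InvQuot R K Q p).1) hg
    simp only [AddSubmonoidClass.coe_finsetSum, h1] at h2
    rw [← Submodule.mkQ_apply, map_sum]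
    exact h2
  rw [Submodule.Quotient.mk_eq_zero] at hsum
  obtain ⟨W, hW⟩ := hsum
  -- The relation among the `x i` modulo `Q`, multiplied by `π`. Its coefficient at `i₀` is a unit
  -- at `p`.
  have hWB : ∑ i, algebraMap R A (r i * (t * s i * m i)) • v i =
      algebraMap R A π • (⟨ι W, map_mem_localSubalgebra p A ι W⟩ : B) := by
    apply Subtype.ext
    rw [AddSubmonoidClass.coe_finsetSum]
    change ∑ i, algebraMap R A (r i * (t * s i * m i)) • (v i : K ⊗[R] Q) =
      algebraMap R A π • ι W
    simp only [algebraMap_smul]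
    have h3 : ι W = ∑ i, r i • x i := hW
    rw [h3, Finset.smul_sum]
    refine Finset.sum_congr rfl fun i _ => ?_
    rw [smul_comm, hπx, mul_smul]
  set ρ := (Algebra.TensorProduct.includeRight : B →ₐ[A] ResidueField A ⊗[A] B) with hρ
  have hρs : ∀ (a : A) (x : B), ρ (a • x) = residue A a • ρ x := by
    intro a x
    rw [map_smul]
    exact (algebraMap_smul (ResidueField A) a (ρ x)).symm
  have h4 := congrArg ρ hWB
  have hπ0' : residue A (algebraMap R A π) = 0 := by
    rw [residue_eq_zero_iff, IsLocalization.AtPrime.to_map_mem_maximal_iff A p]; exact hπp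
  rw [hρs, hπ0', zero_smul, map_sum] at h4
  simp only [hρs] at h4
  have h5 := Fintype.linearIndependent_iff.mp hli _ h4 i₀
  rw [residue_eq_zero_iff, IsLocalization.AtPrime.to_map_mem_maximal_iff A p] at h5
  exact hmul _ _ hr₀ (hmul _ _ (hmul _ _ htp (hs i₀)) (m i₀).2) h5

end IntegralClasses

/-! ### Coordinates on lattices from the generic fibre. -/

section GenericFiber

variable {R : Type*} (K : Type*) {N : Type*} [CommRing R] [IsDomain R] [Field K] [Algebra R K]
  [IsFractionRing R K] [AddCommGroup N] [Module R N]

theorem exists_smul_eq_one_tmul (x : K ⊗[R] N) : ∃ r : R, r ≠ 0 ∧ ∃ y : N, r • x = 1 ⊗ₜ[R] y := by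
  induction x using TensorProduct.induction_on with
  | zero => exact ⟨1, one_ne_zero, 0, by simp⟩
  | tmul a y =>
    obtain ⟨r', r, hr, rfl⟩ := IsFractionRing.div_surjective (A := R) a
    have hr0 : r ≠ 0 := nonZeroDivisors.ne_zero hr
    have hrK : algebraMap R K r ≠ 0 := by rwa [Ne, IsFractionRing.to_map_eq_zero_iff]
    refine ⟨r, hr0, r' • y, ?_⟩
    rw [TensorProduct.smul_tmul', Algebra.smul_def, mul_div_cancel₀ _ hrK,
      Algebra.algebraMap_eq_smul_one, TensorProduct.smul_tmul]
  | add x x' h h' =>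
    obtain ⟨r, hr, y, hy⟩ := h
    obtain ⟨r', hr', y', hy'⟩ := h'
    refine ⟨r * r', mul_ne_zero hr hr', r' • y + r • y', ?_⟩
    rw [smul_add, mul_smul, mul_smul, smul_comm r r' x, hy, hy', TensorProduct.tmul_add,
      TensorProduct.tmul_smul, TensorProduct.tmul_smul]

omit [IsDomain R] in
theorem finrank_tensorProduct_fraction : Module.finrank K (K ⊗[R] N) = Module.finrank R N := by
  have : IsLocalizedModule (nonZeroDivisors R) (TensorProduct.mk R K N 1) :=
    (isLocalizedModule_iff_isBaseChange (nonZeroDivisors R) K _).mpr (TensorProduct.isBaseChange R N K)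
  rw [IsFractionRing.finrank_right_eq R K (K ⊗[R] N),
    IsLocalizedModule.finrank_eq (nonZeroDivisors R) (TensorProduct.mk R K N 1) le_rfl]

omit [IsDomain R] in
theorem one_tmul_injective [Module.Flat R N] :
    Function.Injective fun y : N => (1 : K) ⊗ₜ[R] y := by
  have h := (Module.Flat.rTensor_preserves_injective_linearMap (M := N) (Algebra.linearMap R K)
    (IsFractionRing.injective R K)).comp (TensorProduct.lid R N).symm.injective
  convert h using 2
  simp

theorem IsLatticeOfRank.exists_coords {n : ℕ} (h : IsLatticeOfRank R N n) :
    ∃ c : N →ₗ[R] (Fin n → K), Function.Injective c ∧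
      ∀ v, ∃ r : R, r ≠ 0 ∧ ∃ x, r • v = c x := by
  have := h.finite
  have := h.projective
  let b := Module.finBasisOfFinrankEq K (K ⊗[R] N) (n := n) (by
    rw [finrank_tensorProduct_fraction, h.finrank_eq])
  let c : N →ₗ[R] (Fin n → K) :=
    (b.equivFun.toLinearMap.restrictScalars R) ∘ₗ TensorProduct.mk R K N 1
  refine ⟨c, b.equivFun.injective.comp (one_tmul_injective K), fun v => ?_⟩
  obtain ⟨r, hr, y, hy⟩ := exists_smul_eq_one_tmul K (b.equivFun.symm v)
  refine ⟨r, hr, y, ?_⟩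
  change _ = b.equivFun (1 ⊗ₜ[R] y)
  rw [← hy, algebra_compatible_smul K r (b.equivFun.symm v), map_smul,
    LinearEquiv.apply_symm_apply, algebraMap_smul]

variable {K}

theorem exists_frame_of_coords [Module.Finite R N] {n : ℕ} (c : N →ₗ[R] (Fin n → K))
    (hc : Function.Injective c) (hspan : ∀ v, ∃ r : R, r ≠ 0 ∧ ∃ x, r • v = c x) :
    ∃ ν : Fin n → N, Matrix.det (Matrix.of fun i => c (ν i)) ≠ 0 ∧
      ∃ s : R, s ≠ 0 ∧ ∀ x, s • x ∈ Submodule.span R (Set.range ν) := by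
  choose r hr x hx using fun i : Fin n => hspan (Pi.single i 1)
  have hrK : ∀ i, algebraMap R K (r i) ≠ 0 := fun i => by
    rw [Ne, IsFractionRing.to_map_eq_zero_iff]; exact hr i
  refine ⟨x, ?_, ?_⟩
  · have : (Matrix.of fun i => c (x i)) = Matrix.diagonal fun i => algebraMap R K (r i) := by
      ext i j
      rw [Matrix.of_apply, ← hx, Pi.smul_apply, Algebra.smul_def, Matrix.diagonal_apply]
      by_cases h : i = j
      · subst h; simp
      · simp [h, Ne.symm h]
    rw [this, Matrix.det_diagonal]
    exact Finset.prod_ne_zero_iff.mpr fun i _ => hrK i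
  · suffices h : ∀ y : N, ∃ s ∈ nonZeroDivisors R,
        s • (LinearMap.id : N →ₗ[R] N) y ∈ Submodule.span R (Set.range x) by
      obtain ⟨s, hs, h⟩ := exists_smul_mem_of_forall (nonZeroDivisors R) _ _ h
      exact ⟨s, nonZeroDivisors.ne_zero hs, h⟩
    intro y
    choose m d hd hmd using fun i : Fin n =>
      IsFractionRing.div_surjective (A := R) (c y i / algebraMap R K (r i))
    refine ⟨∏ i, d i, prod_mem fun i _ => hd i, ?_⟩
    choose e he using fun i : Fin n => Finset.dvd_prod_of_mem d (Finset.mem_univ i)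
    have : (∏ i, d i) • y = ∑ i, (e i * m i) • x i := by
      apply hc
      rw [map_smul, map_sum]
      ext j
      simp only [map_smul, ← hx, Finset.sum_apply, Pi.smul_apply]
      rw [Finset.sum_eq_single j]
      · have h1 : algebraMap R K (d j) ≠ 0 := by
          rw [Ne, IsFractionRing.to_map_eq_zero_iff]; exact nonZeroDivisors.ne_zero (hd j)
        have h2 := hmd j
        have h3 := hrK j
        rw [div_eq_div_iff h1 h3] at h2
        rw [Pi.single_eq_same, he j]
        simp only [Algebra.smul_def, map_mul, mul_one]
        linear_combination (-algebraMap R K (e j)) * h2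
      · intro i _ hij
        simp [Ne.symm hij]
      · simp
    rw [LinearMap.id_apply, this]
    exact Submodule.sum_mem _ fun i _ => Submodule.smul_mem _ _ (Submodule.subset_span ⟨i, rfl⟩)

end GenericFiber

/-! ### Local frames relative to the quintic ring. -/

section LocalFrames

open IsLocalRing

variable {R : Type*} {Q : Type*} {K : Type*} [CommRing R] [IsDedekindDomain R] [Field K]
  [Algebra R K] [IsFractionRing R K] [CommRing Q] [Algebra R Q]

/-- The last four coordinates of `Q` relative to a basis of `K ⊗ Q` over `K`. -/
noncomputable def latticeCoords (b : Module.Basis (Fin 5) K (K ⊗[R] Q)) : Q →ₗ[R] (Fin 4 → K) :=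
  (tailCoords b).restrictScalars R ∘ₗ
    (Algebra.TensorProduct.includeRight : Q →ₐ[R] K ⊗[R] Q).toLinearMap

theorem localSubalgebra_exists_smul_mem (p : Ideal R) [p.IsPrime] (A : Type*) [CommRing A]
    [IsDomain A] [Algebra R A] [IsLocalization.AtPrime A p] [Algebra A K] [IsScalarTower R A K]
    (x : K ⊗[R] Q) : ∃ r : A, r ≠ 0 ∧ r • x ∈ localSubalgebra p A
      (Algebra.TensorProduct.includeRight : Q →ₐ[R] K ⊗[R] Q) := by
  obtain ⟨r, hr, y, hy⟩ := exists_smul_eq_one_tmul K x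
  refine ⟨algebraMap R A r, ?_, ?_⟩
  · rwa [Ne, IsLocalization.to_map_eq_zero_iff A p.primeCompl_le_nonZeroDivisors]
  · rw [algebraMap_smul, hy]
    exact map_mem_localSubalgebra p A _ y

theorem exists_local_data (hQ : IsQuinticRing R Q) (p : Ideal R) [p.IsPrime] (hp : p ≠ ⊥)
    (hint : Module.rank (R ⧸ p) (integralClasses R K Q p) ≤ 2)
    (A : Type*) [CommRing A] [IsDomain A] [IsDiscreteValuationRing A] [Algebra R A]
    [IsLocalization.AtPrime A p] [Algebra A K] [IsScalarTower R A K] [IsFractionRing A K] :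
    ∃ (β : Module.Basis (Fin 5) A (localSubalgebra p A
        (Algebra.TensorProduct.includeRight : Q →ₐ[R] K ⊗[R] Q)))
      (b' : Module.Basis (Fin 5) K (K ⊗[R] Q)) (π : A), β 0 = 1 ∧ (∀ i, b' i = β i) ∧
      maximalIdeal A = Ideal.span {π} ∧ algebraMap A K π ≠ 0 ∧
      IntegralRankLETwo (k := ResidueField A) K _ π (Algebra.TensorProduct.includeRight :
        _ →ₐ[A] ResidueField A ⊗[A] (localSubalgebra p A
          (Algebra.TensorProduct.includeRight : Q →ₐ[R] K ⊗[R] Q))).toRingHom := by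
  have := hQ.finite
  have hE : Module.finrank K (K ⊗[R] Q) = 4 + 1 := by
    rw [finrank_tensorProduct_fraction, hQ.finrank_eq]
  have hnt : Nontrivial (K ⊗[R] Q) := Module.nontrivial_of_finrank_pos (R := K) (by omega)
  obtain ⟨β, b', hβ, hb'⟩ := exists_basis_of_subalgebra hE
    (localSubalgebra p A (Algebra.TensorProduct.includeRight : Q →ₐ[R] K ⊗[R] Q))
    (localSubalgebra_exists_smul_mem p A)
  obtain ⟨π, hπ, t, ht, h⟩ := exists_uniformizer p hp
  have hmax := maximalIdeal_eq_span_of_uniformizer p A hπ ht h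
  have hπ0 : π ≠ 0 := by
    rintro rfl
    rw [map_zero, Ideal.span_singleton_eq_bot.mpr rfl] at hmax
    exact IsDiscreteValuationRing.not_a_field A hmax
  refine ⟨β, b', algebraMap R A π, hβ, hb', hmax, ?_,
    integralRankLETwo_localSubalgebra p hint hπ hπ0 ht h A⟩
  rw [← IsScalarTower.algebraMap_apply]
  rwa [Ne, IsFractionRing.to_map_eq_zero_iff]

/-- The bound at a single prime already restricts the generic fibre; this is what makes a model over
`K` available. -/
theorem nilpotent_dependent_of_integralClasses (hQ : IsQuinticRing R Q) (p : Ideal R) [p.IsPrime]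
    (hp : p ≠ ⊥) (hint : Module.rank (R ⧸ p) (integralClasses R K Q p) ≤ 2)
    (v : Fin 3 → K ⊗[R] Q) (hv : ∀ i, IsNilpotent (v i)) : ¬ LinearIndependent K v := by
  let A := Localization.subalgebra.ofField K p.primeCompl p.primeCompl_le_nonZeroDivisors
  have hloc : IsLocalization.AtPrime A p := inferInstanceAs (IsLocalization p.primeCompl A)
  have hA : IsDiscreteValuationRing A :=
    IsLocalization.AtPrime.isDiscreteValuationRing_of_dedekind_domain R hp A
  obtain ⟨β, b', π, -, -, hπ, hK, h⟩ := exists_local_data (K := K) hQ p hp hint A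
  exact h.nilpotent_dependent _ β hK (isReduction_residue β hπ)
    (localSubalgebra_exists_smul_mem p A) v hv

/-- Elements of the localized algebra become elements of `Q` after multiplication by units at `p`,
so the frame can be tested on `Q` alone. -/
theorem IsModel.exists_local_frame (hQ : IsQuinticRing R Q) (p : Ideal R) [p.IsPrime] (hp : p ≠ ⊥)
    (hint : Module.rank (R ⧸ p) (integralClasses R K Q p) ≤ 2)
    (A : Type*) [CommRing A] [IsDomain A] [IsDiscreteValuationRing A] [Algebra R A]
    [IsLocalization.AtPrime A p] [Algebra A K] [IsScalarTower R A K] [IsFractionRing A K]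
    {b : Module.Basis (Fin 5) K (K ⊗[R] Q)} (hb : b 0 = 1)
    {a : (Fin 4 → K) →ₗ[K] Matrix (Fin 5) (Fin 5) K}
    {q : QuadraticMap K (Fin 4 → K) (Fin 5 → K)} (h : IsModel b a q) {c : K}
    (hc : ∀ y, pfVec (a y) = c • q y) :
    ∃ (l : K) (P : Matrix (Fin 5) (Fin 5) K) (u : A), l ≠ 0 ∧ IsUnit u ∧
      (∃ s ∉ p, ∃ y : Fin 4 → Q, s • l = Matrix.det (Matrix.of fun i => latticeCoords b (y i))) ∧
      (∀ y : Fin 4 → Q, ∃ r : A, Matrix.det (Matrix.of fun i => latticeCoords b (y i)) =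
        algebraMap A K r * l) ∧
      P.det * algebraMap A K u = c * l ^ 3 ∧ P.det ≠ 0 ∧
      (∀ y : Q, ∃ v : Fin 5 → A, P.mulVec (q (latticeCoords b y)) = l • (algebraMap A K ∘ v)) ∧
      (∀ v : Fin 5 → A, algebraMap A K ∘ v ∈ Submodule.span A
        (Set.range fun y : Q => l⁻¹ • P.mulVec (q (latticeCoords b y)))) ∧
      (∀ y : Q, ∃ C : Matrix (Fin 5) (Fin 5) A,
        l • a (latticeCoords b y) = P.transpose * C.map (algebraMap A K) * P) := by
  set ι := (Algebra.TensorProduct.includeRight : Q →ₐ[R] K ⊗[R] Q) with hι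
  obtain ⟨β, b', π, hβ, hb', hπ, -, hB⟩ := exists_local_data (K := K) hQ p hp hint A
  obtain ⟨l, P, u, hl, hu, hlb, h4, hdet, hdet0, hq, hspan, ha⟩ := h.exists_frame hb hc
    (localSubalgebra p A ι) β hβ b' hb' (localSubalgebra_exists_smul_mem p A) hπ hB
  refine ⟨l, P, u, hl, hu, ?_, fun y => ?_, hdet, hdet0, fun y => ?_, fun v => ?_, fun y => ?_⟩
  · choose s hs y hy using fun i : Fin 4 => (β i.succ).2
    refine ⟨∏ i, s i, p.primeCompl.prod_mem fun i _ => hs i, y, ?_⟩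
    have e : (Matrix.of fun i => latticeCoords b (y i)) = Matrix.of fun i j =>
        algebraMap R K (s i) * (Matrix.of fun i : Fin 4 => tailCoords b (β i.succ)) i j := by
      ext i j
      have h1 : latticeCoords b (y i) = tailCoords b (ι (y i)) := rfl
      rw [Matrix.of_apply, h1, ← hy, algebra_compatible_smul K, map_smul]
      rfl
    rw [e, Matrix.det_mul_column, hlb, Algebra.smul_def, map_prod]
  · exact h4 fun i => ⟨ι (y i), map_mem_localSubalgebra p A ι _⟩
  · exact hq ⟨ι y, map_mem_localSubalgebra p A ι _⟩
  · have hle : Submodule.span A (Set.range fun y : localSubalgebra p A ι =>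
        l⁻¹ • P.mulVec (q (tailCoords b (y : K ⊗[R] Q)))) ≤ Submodule.span A
        (Set.range fun y : Q => l⁻¹ • P.mulVec (q (latticeCoords b y))) := by
      rw [Submodule.span_le]
      rintro _ ⟨⟨x, s, hs, y, hy⟩, rfl⟩
      have h1 : (s * s) • (l⁻¹ • P.mulVec (q (tailCoords b x))) =
          (1 : R) • (l⁻¹ • P.mulVec (q (latticeCoords b y))) := by
        have h2 : latticeCoords b y = algebraMap R K s • tailCoords b x := by
          rw [← map_smul, algebraMap_smul, hy]; rfl
        rw [h2, QuadraticMap.map_smul, Matrix.mulVec_smul, one_smul, ← map_mul, smul_comm l⁻¹,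
          algebraMap_smul]
      have h3 := eq_smul_of_smul_eq p A (p.primeCompl.mul_mem hs hs) h1
      change l⁻¹ • P.mulVec (q (tailCoords b x)) ∈ _
      rw [h3]
      exact Submodule.smul_mem _ _ (Submodule.subset_span ⟨y, rfl⟩)
    exact hle (hspan v)
  · exact ha ⟨ι y, map_mem_localSubalgebra p A ι _⟩

end LocalFrames

/-! ### Extending lattice maps to the fraction field. -/

section LinearAlgebra

theorem LinearMap.exists_comp_eq_of_ker_le {K V W U : Type*} [Field K] [AddCommGroup V] [Module K V]
    [AddCommGroup W] [Module K W] [AddCommGroup U] [Module K U] (f : U →ₗ[K] V) (g : U →ₗ[K] W)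
    (h : LinearMap.ker f ≤ LinearMap.ker g) : ∃ k : V →ₗ[K] W, ∀ x, k (f x) = g x := by
  obtain ⟨k, hk⟩ := LinearMap.exists_extend
    ((LinearMap.ker f).liftQ g h ∘ₗ f.quotKerEquivRange.symm.toLinearMap)
  refine ⟨k, fun x => ?_⟩
  have h1 := LinearMap.congr_fun hk ⟨f x, x, rfl⟩
  have h2 : f.quotKerEquivRange.symm ⟨f x, x, rfl⟩ = Submodule.Quotient.mk x := by
    rw [LinearEquiv.symm_apply_eq]; rfl
  rw [LinearMap.comp_apply, LinearMap.comp_apply, LinearEquiv.coe_coe, h2] at h1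
  exact h1

theorem Module.projective_of_isTorsionFree {R N : Type*} [CommRing R] [IsDedekindDomain R]
    [AddCommGroup N] [Module R N] [Module.Finite R N] [Module.IsTorsionFree R N] :
    Module.Projective R N := by
  have := Module.finitePresentation_of_finite R N
  exact Module.Flat.projective_of_finitePresentation

variable {R K N : Type*} [CommRing R] [IsDomain R] [Field K] [Algebra R K] [IsFractionRing R K]
  [AddCommGroup N] [Module R N]

theorem exists_eq_mul_of_injective (f g : N →ₗ[R] K) (hg : Function.Injective g) :
    ∃ ν : K, ∀ u, f u = ν * g u := by
  by_cases h : ∃ u₀ : N, u₀ ≠ 0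
  · obtain ⟨u₀, hu₀⟩ := h
    have hg₀ : g u₀ ≠ 0 := by rwa [Ne, LinearMap.map_eq_zero_iff g hg]
    refine ⟨f u₀ / g u₀, fun u => ?_⟩
    obtain ⟨r, r', hr, h⟩ := exists_smul_eq_smul g hg hu₀ u
    have hrK : algebraMap R K r ≠ 0 := by rwa [Ne, IsFractionRing.to_map_eq_zero_iff]
    have h1 := congrArg f h
    have h2 := congrArg g h
    rw [map_smul, map_smul, Algebra.smul_def, Algebra.smul_def] at h1 h2
    apply mul_left_cancel₀ hrK
    rw [h1, mul_left_comm, h2]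
    field_simp
  · push Not at h
    exact ⟨0, fun u => by rw [h u]; simp⟩

theorem exists_linearMap_comp_coords {V : Type*} [AddCommGroup V] [Module K V] [Module R V]
    [IsScalarTower R K V] [Module.Finite R N] {n : ℕ} (c : N →ₗ[R] (Fin n → K))
    (hc : Function.Injective c) (hspan : ∀ v, ∃ r : R, r ≠ 0 ∧ ∃ x, r • v = c x)
    (f : N →ₗ[R] V) : ∃ F : (Fin n → K) →ₗ[K] V, ∀ x, F (c x) = f x := by
  obtain ⟨ν, hν, s, hs, h⟩ := exists_frame_of_coords c hc hspan
  have hli : LinearIndependent K fun i => c (ν i) := by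
    have : IsUnit (Matrix.of fun i => c (ν i)) := by
      rw [Matrix.isUnit_iff_isUnit_det]; exact hν.isUnit
    exact Matrix.linearIndependent_rows_iff_isUnit.mpr this
  let e := basisOfLinearIndependentOfCardEqFinrank' _ hli (by simp)
  have he : ∀ i, e i = c (ν i) := fun i => by
    rw [coe_basisOfLinearIndependentOfCardEqFinrank']
  refine ⟨e.constr K fun i => f (ν i), fun x => ?_⟩
  have hsK : algebraMap R K s ≠ 0 := by rwa [Ne, IsFractionRing.to_map_eq_zero_iff]
  rw [← smul_right_inj hsK, algebraMap_smul, algebraMap_smul]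
  obtain ⟨t, ht⟩ := (Submodule.mem_span_range_iff_exists_fun R).mp (h x)
  have hF : ∀ (r : R) v, (e.constr K fun i => f (ν i)) (r • v) =
      r • (e.constr K fun i => f (ν i)) v :=
    ((e.constr K fun i => f (ν i)).restrictScalars R).map_smul
  rw [← f.map_smul, ← ht, map_sum, ← hF, ← c.map_smul, ← ht, map_sum, map_sum]
  refine Finset.sum_congr rfl fun i _ => ?_
  rw [f.map_smul, c.map_smul, hF, ← he, Module.Basis.constr_basis]

end LinearAlgebra

/-! ### The contraction in coordinates. -/

section Contraction

variable {R K N : Type*} [CommRing R] [Field K] [Algebra R K] [AddCommGroup N] [Module R N]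

theorem tensorMul_vol_contract (c : N →ₗ[R] (Fin 5 → K)) (μ ν ν' : ⋀[R]^2 N) :
    tensorMul (vol c) (vol c) (contract μ (box ν) (box ν')) =
      pfVec (minors c ν) ⬝ᵥ (minors c μ).mulVec (pfVec (minors c ν')) := by
  have hadd : ∀ μ μ' : ⋀[R]^2 N, contract (μ + μ') (box ν) (box ν') =
      contract μ (box ν) (box ν') + contract μ' (box ν) (box ν') := fun μ μ' => by
    simp only [contract, map_add]
  have hsmul : ∀ (r : R) (μ : ⋀[R]^2 N), contract (r • μ) (box ν) (box ν') =
      r • contract μ (box ν) (box ν') := fun r μ => by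
    simp only [contract, map_smul]
  induction μ using bivec_induction with
  | h0 =>
    have : contract (0 : ⋀[R]^2 N) (box ν) (box ν') = 0 := by simp [contract]
    rw [this, map_zero, map_zero, Matrix.zero_mulVec, dotProduct_zero]
  | hb v w =>
    rw [contract_bivec, map_sub, tensorMul_tmul, tensorMul_tmul]
    simp only [vol_wedgeVec_box]
    have : minors c (bivec v w) = Matrix.vecMulVec (c v) (c w) - Matrix.vecMulVec (c w) (c v) := by
      ext i j
      rw [minors_bivec, Matrix.sub_apply, Matrix.vecMulVec_apply, Matrix.vecMulVec_apply]
      ring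
    rw [this, Matrix.sub_mulVec, dotProduct_sub, Matrix.vecMulVec_mulVec, Matrix.vecMulVec_mulVec]
    simp only [dotProduct_smul, dotProduct_comm (c w), dotProduct_comm (c v)]
    simp [mul_comm]
  | hs r μ h => rw [hsmul, map_smul, map_smul, h, Matrix.smul_mulVec, dotProduct_smul]
  | ha μ μ' h h' => rw [hadd, map_add, map_add, h, h', Matrix.add_mulVec, dotProduct_add]

end Contraction

/-! ### Uniqueness of the model over the field. -/

section Normalization

/-- A second solution of the determinantal identity is obtained from a model by a linear
change of coordinates. -/
theorem IsModel.exists_transform {K E : Type*} [Field K] [CommRing E] [Algebra K E]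
    {b : Module.Basis (Fin 5) K E} {a : (Fin 4 → K) →ₗ[K] Matrix (Fin 5) (Fin 5) K}
    {q : QuadraticMap K (Fin 4 → K) (Fin 5 → K)} (h : IsModel b a q) {c : K} (hc0 : c ≠ 0)
    (hc : ∀ y, pfVec (a y) = c • q y) {a' : (Fin 4 → K) →ₗ[K] Matrix (Fin 5) (Fin 5) K}
    (halt : ∀ x, IsAltMatrix (a' x)) {ν : K}
    (h' : ∀ x y z : E, ν ^ 2 * (pfVec (a' (tailCoords b y)) ⬝ᵥ (a' (tailCoords b x)).mulVec
      (pfVec (a' (tailCoords b z)))) = Matrix.det (Matrix.of ![tailCoords b x, tailCoords b y,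
        tailCoords b z, tailCoords b (y * z)])) :
    ∃ g : Matrix (Fin 5) (Fin 5) K, (∀ x, g * a' x * g.transpose = a x) ∧ g.det ≠ 0 ∧
      c * ν = g.det := by
  set q' : (Fin 4 → K) → (Fin 5 → K) := fun y => ν • pfVec (a' y) with hq'
  have hqq : ∀ x y z, q y ⬝ᵥ (a x).mulVec (q z) = q' y ⬝ᵥ (a' x).mulVec (q' z) := by
    intro x y z
    obtain ⟨X, rfl⟩ := tailCoords_surjective b x
    obtain ⟨Y, rfl⟩ := tailCoords_surjective b y
    obtain ⟨Z, rfl⟩ := tailCoords_surjective b z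
    rw [h.eq_det, ← h', hq', Matrix.mulVec_smul, smul_dotProduct, dotProduct_smul, smul_eq_mul,
      smul_eq_mul]
    ring
  -- A nonzero vector killed by all `a x` would be parallel to every Pfaffian vector, hence to every
  -- `q x` since `c ≠ 0`, although these span a space of dimension five.
  have hker : ∀ v : Fin 5 → K, (∀ x, (a x).mulVec v = 0) → v = 0 := by
    intro v hv
    by_contra hv0
    obtain ⟨j, hj⟩ := Function.ne_iff.mp hv0
    have hsp : ∀ x, q x = (q x j / v j) • v := by
      intro x
      ext i
      have h1 := pfVec_mul_comm (h.alt x) (hv x) i j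
      rw [hc] at h1
      simp only [Pi.smul_apply, smul_eq_mul, mul_assoc] at h1 ⊢
      have h2 := mul_left_cancel₀ hc0 h1
      have hj' : v j ≠ 0 := hj
      field_simp
      linear_combination h2
    have hle : (⊤ : Submodule K (Fin 5 → K)) ≤ Submodule.span K {v} := by
      rw [← h.span_eq_top, Submodule.span_le]
      rintro _ ⟨x, rfl⟩
      rw [hsp x]
      exact Submodule.smul_mem _ _ (Submodule.mem_span_singleton_self v)
    have h5 := Submodule.finrank_mono hle
    rw [finrank_top, finrank_span_singleton hv0] at h5
    simp at h5
  -- Both systems give the same pairings of formal combinations of points. Since the forms `a x`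
  -- have no common radical, every relation among the values of `q'` holds among those of `q`; so
  -- `q` is obtained from `q'` by a linear map `k`.
  set Φ := Finsupp.linearCombination K (fun y => q y) with hΦ
  set Φ' := Finsupp.linearCombination K q' with hΦ'
  have hΦΦ : ∀ x u w, Φ u ⬝ᵥ (a x).mulVec (Φ w) = Φ' u ⬝ᵥ (a' x).mulVec (Φ' w) := by
    intro x u w
    induction u using Finsupp.induction_linear with
    | zero => simp
    | add u u' hu hu' => simp only [map_add, add_dotProduct, hu, hu']
    | single y r =>
      simp only [hΦ, hΦ', Finsupp.linearCombination_single, smul_dotProduct]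
      congr 1
      induction w using Finsupp.induction_linear with
      | zero => simp
      | add u u' hu hu' => simp only [map_add, Matrix.mulVec_add, dotProduct_add, hu, hu']
      | single z t =>
        simp only [Finsupp.linearCombination_single, Matrix.mulVec_smul, dotProduct_smul, hqq]
  have hΦs : Function.Surjective Φ := by
    rw [← LinearMap.range_eq_top, hΦ, Finsupp.range_linearCombination, ← h.span_eq_top]
  have hskew : ∀ x (v w : Fin 5 → K), v ⬝ᵥ (a x).mulVec w = - (w ⬝ᵥ (a x).mulVec v) := by
    intro x v w
    have : (a x).transpose = - a x := by
      ext i j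
      rw [Matrix.transpose_apply, (h.alt x).2 i j]; rfl
    rw [dotProduct_comm w, Matrix.dotProduct_mulVec, ← Matrix.mulVec_transpose, this,
      Matrix.neg_mulVec, neg_dotProduct]
  obtain ⟨k, hk⟩ := LinearMap.exists_comp_eq_of_ker_le Φ' Φ (by
    intro u hu
    rw [LinearMap.mem_ker] at hu ⊢
    apply hker
    intro x
    apply dotProduct_eq_zero
    intro v
    obtain ⟨w, rfl⟩ := hΦs v
    rw [dotProduct_comm, hskew, hΦΦ, hu, zero_dotProduct, neg_zero])
  have hks : Function.Surjective k := by
    intro v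
    obtain ⟨w, rfl⟩ := hΦs v
    exact ⟨_, hk w⟩
  have hki : Function.Injective k := LinearMap.injective_iff_surjective.mpr hks
  set H := LinearMap.toMatrix' k with hH
  have hHk : ∀ v, H.mulVec v = k v := fun v => by
    rw [hH, ← Matrix.toLin'_apply, Matrix.toLin'_toMatrix']
  have hHu : IsUnit H.det := by
    rw [hH, LinearMap.det_toMatrix']
    exact (LinearEquiv.ofBijective k ⟨hki, hks⟩).isUnit_det'
  have hHq : ∀ y, H.mulVec (q' y) = q y := by
    intro y
    have := hk (Finsupp.single y 1)
    simpa [hΦ, hΦ', hHk] using this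
  have hΦ's : Function.Surjective Φ' := by
    intro v
    obtain ⟨w, hw⟩ := hΦs (k v)
    exact ⟨w, hki (by rw [hk, hw])⟩
  have haa : ∀ x, a' x = H.transpose * a x * H := by
    intro x
    apply Matrix.ext_of_mulVec_single
    intro i
    apply dotProduct_eq
    intro v
    obtain ⟨u, rfl⟩ := hΦ's v
    obtain ⟨w, hw⟩ := hΦ's (Pi.single i 1)
    rw [← hw, dotProduct_comm, ← hΦΦ, ← hk, ← hk, ← hHk, ← hHk, dotProduct_comm _ (Φ' u),
      ← Matrix.mulVec_mulVec, ← Matrix.mulVec_mulVec, Matrix.dotProduct_mulVec (Φ' u),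
      Matrix.vecMul_transpose]
  set G := H.transpose⁻¹ with hG
  have hHtu : IsUnit H.transpose.det := by rwa [Matrix.det_transpose]
  have hGH : G * H.transpose = 1 := Matrix.nonsing_inv_mul _ hHtu
  have hHG : H * G.transpose = 1 := by
    rw [← Matrix.transpose_transpose H, ← Matrix.transpose_mul, hGH, Matrix.transpose_one]
  have hga : ∀ x, G * a' x * G.transpose = a x := by
    intro x
    rw [haa]
    calc G * (H.transpose * a x * H) * G.transpose = (G * H.transpose) * a x * (H * G.transpose) := by
          simp only [Matrix.mul_assoc]
      _ = a x := by rw [hGH, hHG, one_mul, mul_one]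
  have hdet : G.det * H.det = 1 := by
    rw [← Matrix.det_transpose H, ← Matrix.det_mul, hGH, Matrix.det_one]
  refine ⟨G, hga, left_ne_zero_of_mul (hdet.trans_ne one_ne_zero), ?_⟩
  -- A nonzero Pfaffian vector, compared through `pfVec_congr`, determines the scalar.
  obtain ⟨y, hy⟩ : ∃ y, pfVec (a' y) ≠ 0 := by
    by_contra! hall
    have : Submodule.span K (Set.range q) = ⊥ := by
      rw [Submodule.span_eq_bot]
      rintro _ ⟨y, rfl⟩
      rw [← hHq, hq']
      simp [hall y]
    rw [h.span_eq_top] at this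
    exact top_ne_bot this
  have h1 := pfVec_congr G (a' y) (halt y)
  rw [hga, hc, ← hHq, Matrix.mulVec_smul, Matrix.mulVec_mulVec] at h1
  have hGtH : G.transpose * H = 1 := mul_eq_one_comm.mp hHG
  rw [hGtH, Matrix.one_mulVec, hq', smul_smul] at h1
  exact smul_left_injective K hy h1

end Normalization

theorem LinearMap.exists_lift_of_range_le {R X Y V : Type*} [CommRing R] [AddCommMonoid X]
    [Module R X] [AddCommMonoid Y] [Module R Y] [AddCommMonoid V] [Module R V] (f : X →ₗ[R] V)
    (g : Y →ₗ[R] V) (hg : Function.Injective g) (h : ∀ x, f x ∈ LinearMap.range g) :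
    ∃ k : X →ₗ[R] Y, ∀ x, g (k x) = f x := by
  refine ⟨(LinearEquiv.ofInjective g hg).symm.toLinearMap ∘ₗ f.codRestrict _ h, fun x => ?_⟩
  have := (LinearEquiv.ofInjective g hg).apply_symm_apply ⟨f x, h x⟩
  exact congrArg Subtype.val this

/-! ### Resolvents in coordinates. -/

section BaseCoords

variable {R : Type*} {Q : Type*} {K : Type*} [CommRing R] [IsDedekindDomain R] [Field K]
  [Algebra R K] [IsFractionRing R K] [CommRing Q] [Algebra R Q]

/-- The coordinates of `Q / R` relative to a basis of `K ⊗ Q` which begins with `1`. -/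
noncomputable def baseCoords (b : Module.Basis (Fin 5) K (K ⊗[R] Q)) (hb : b 0 = 1) :
    ModBase R Q →ₗ[R] (Fin 4 → K) :=
  Submodule.liftQ _ (latticeCoords b) (by
    rintro _ ⟨r, rfl⟩
    rw [LinearMap.mem_ker, Algebra.linearMap_apply, Algebra.algebraMap_eq_smul_one, map_smul]
    change r • tailCoords b 1 = 0
    rw [tailCoords_one b hb, smul_zero])

variable (b : Module.Basis (Fin 5) K (K ⊗[R] Q)) (hb : b 0 = 1)

omit [IsDedekindDomain R] [IsFractionRing R K] in
theorem baseCoords_toModBase (y : Q) : baseCoords b hb (toModBase R Q y) = latticeCoords b y := rfl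

theorem baseCoords_injective (hQ : IsQuinticRing R Q) : Function.Injective (baseCoords b hb) := by
  have := hQ.finite
  have := hQ.projective
  have hnt : Nontrivial (K ⊗[R] Q) := ⟨⟨b 0, b 1, fun h => by simpa using b.injective h⟩⟩
  rw [← LinearMap.ker_eq_bot, LinearMap.ker_eq_bot']
  intro x hx
  obtain ⟨y, rfl⟩ := Submodule.mkQ_surjective _ x
  have hy : tailCoords b (1 ⊗ₜ[R] y) = 0 := hx
  have h1 := tailCoords_eq_zero b hb hy
  obtain ⟨r', r, hr, hk⟩ := IsFractionRing.div_surjective (A := R) (b.repr (1 ⊗ₜ[R] y) 0)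
  have hr0 : r ≠ 0 := nonZeroDivisors.ne_zero hr
  have hrK : algebraMap R K r ≠ 0 := by rwa [Ne, IsFractionRing.to_map_eq_zero_iff]
  have hinj := one_tmul_injective (R := R) K (N := Q)
  have h2 : r • y = algebraMap R Q r' := by
    apply hinj
    change (1 : K) ⊗ₜ[R] (r • y) = 1 ⊗ₜ[R] (algebraMap R Q r')
    rw [TensorProduct.tmul_smul, h1, ← hk, algebra_compatible_smul K, smul_smul,
      mul_div_cancel₀ _ hrK, algebraMap_smul, Algebra.algebraMap_eq_smul_one r',
      TensorProduct.tmul_smul]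
    rfl
  obtain ⟨x, rfl⟩ := exists_algebraMap_eq_of_smul K
    (Algebra.TensorProduct.includeRight : Q →ₐ[R] K ⊗[R] Q) hinj hr0 h2
  rw [Submodule.mkQ_apply, Submodule.Quotient.mk_eq_zero]
  exact ⟨x, rfl⟩

theorem baseCoords_span (v : Fin 4 → K) : ∃ r : R, r ≠ 0 ∧ ∃ x, r • v = baseCoords b hb x := by
  obtain ⟨Y, rfl⟩ := tailCoords_surjective b v
  obtain ⟨r, hr, y, hy⟩ := exists_smul_eq_one_tmul K Y
  refine ⟨r, hr, toModBase R Q y, ?_⟩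
  rw [baseCoords_toModBase]
  change _ = tailCoords b (1 ⊗ₜ y)
  rw [← hy, algebra_compatible_smul K, algebra_compatible_smul K r Y, map_smul]

theorem ModBase.projective (b : Module.Basis (Fin 5) K (K ⊗[R] Q)) (hb : b 0 = 1)
    (hQ : IsQuinticRing R Q) : Module.Projective R (ModBase R Q) := by
  have := hQ.finite
  have hinj := baseCoords_injective b hb hQ
  have : Module.IsTorsionFree R (ModBase R Q) := by
    have : Module.IsTorsionFree R (Fin 4 → K) := inferInstance
    exact Function.Injective.moduleIsTorsionFree _ hinj fun r m => map_smul _ r m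
  exact Module.projective_of_isTorsionFree

/-- The coordinate on `Λ⁴ (Q / R)`. -/
noncomputable def topCoord : TopL R Q →ₗ[R] K := vol (baseCoords b hb)

theorem topCoord_injective (hQ : IsQuinticRing R Q) : Function.Injective (topCoord b hb) := by
  have := hQ.finite
  have := ModBase.projective b hb hQ
  obtain ⟨ν, hν, s, hs, h⟩ := exists_frame_of_coords (baseCoords b hb)
    (baseCoords_injective b hb hQ) (baseCoords_span b hb)
  exact vol_injective _ hν hs h

theorem exists_topCoord_ne_zero (hQ : IsQuinticRing R Q) : ∃ l, topCoord b hb l ≠ 0 := by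
  have := hQ.finite
  obtain ⟨ν, hν, s, hs, h⟩ := exists_frame_of_coords (baseCoords b hb)
    (baseCoords_injective b hb hQ) (baseCoords_span b hb)
  exact ⟨exteriorPower.ιMulti R 4 ν, by rwa [topCoord, vol_ιMulti]⟩

/-- The coordinate on `(Λ⁴ (Q / R))^{⊗3}`. -/
noncomputable def cubeCoord : TopLCube R Q →ₗ[R] K :=
  tensorMul (topCoord b hb) (tensorMul (topCoord b hb) (topCoord b hb))

theorem TopL.isTorsionFree (b : Module.Basis (Fin 5) K (K ⊗[R] Q)) (hb : b 0 = 1)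
    (hQ : IsQuinticRing R Q) : Module.IsTorsionFree R (TopL R Q) := by
  have := ModBase.projective b hb hQ
  exact exteriorPower.isTorsionFree 4

theorem cubeCoord_injective (hQ : IsQuinticRing R Q) : Function.Injective (cubeCoord b hb) := by
  have h := topCoord_injective b hb hQ
  have := TopL.isTorsionFree b hb hQ
  exact tensorMul_injective _ _ h (tensorMul_injective _ _ h h)

/-- The coordinate on `(Λ⁴ (Q / R))^{⊗6}`. -/
noncomputable def sixthCoord : TopLCube R Q ⊗[R] TopLCube R Q →ₗ[R] K :=
  tensorMul (R := R) (N := TopLCube R Q) (N' := TopLCube R Q) (cubeCoord (R := R) (Q := Q) b hb)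
    (cubeCoord (R := R) (Q := Q) b hb)

theorem sixthCoord_injective (hQ : IsQuinticRing R Q) :
    Function.Injective (sixthCoord b hb) := by
  have h := cubeCoord_injective b hb hQ
  have := TopL.isTorsionFree b hb hQ
  exact tensorMul_injective _ _ h h

omit [IsDedekindDomain R] [IsFractionRing R K] in
theorem topCoord_ιMulti (y : Fin 4 → Q) :
    topCoord b hb (exteriorPower.ιMulti R 4 fun i => toModBase R Q (y i)) =
      Matrix.det (Matrix.of fun i => latticeCoords b (y i)) := by
  rw [topCoord, vol_ιMulti]; rfl

omit [IsDedekindDomain R] [IsFractionRing R K] in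
theorem latticeCoords_mul (x y z : Q) :
    topCoord b hb (exteriorPower.ιMulti R 4 ![toModBase R Q x, toModBase R Q y, toModBase R Q z,
      toModBase R Q (y * z)]) = Matrix.det (Matrix.of ![tailCoords b (1 ⊗ₜ[R] x),
        tailCoords b (1 ⊗ₜ[R] y), tailCoords b (1 ⊗ₜ[R] z),
        tailCoords b ((1 ⊗ₜ[R] y) * (1 ⊗ₜ[R] z))]) := by
  rw [topCoord, vol_ιMulti, Algebra.TensorProduct.tmul_mul_tmul, one_mul]
  congr 1
  ext i j
  fin_cases i <;> rfl

variable {N : Type*} [AddCommGroup N] [Module R N]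

omit [IsDedekindDomain R] [IsFractionRing R K] in
theorem sixthCoord_contract {φ : TopL R Q ⊗[R] ModBase R Q →ₗ[R] ⋀[R]^2 N}
    {θ : ⋀[R]^5 N →ₗ[R] TopLCube R Q} {cN : N →ₗ[R] (Fin 5 → K)}
    {a : (Fin 4 → K) →ₗ[K] Matrix (Fin 5) (Fin 5) K} {ν : K}
    (hφ : ∀ l x, minors cN (φ (l ⊗ₜ[R] toModBase R Q x)) = topCoord b hb l • a (latticeCoords b x))
    (hθ : ∀ u, cubeCoord b hb (θ u) = ν * vol cN u) (l₁ l₂ l₃ : TopL R Q) (x y z : Q) :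
    sixthCoord b hb (TensorProduct.map θ θ
      (contract (φ (l₁ ⊗ₜ[R] toModBase R Q x)) (box (φ (l₂ ⊗ₜ[R] toModBase R Q y)))
        (box (φ (l₃ ⊗ₜ[R] toModBase R Q z))))) =
    topCoord b hb l₁ * topCoord b hb l₂ ^ 2 * topCoord b hb l₃ ^ 2 *
      (ν ^ 2 * (pfVec (a (latticeCoords b y)) ⬝ᵥ (a (latticeCoords b x)).mulVec
        (pfVec (a (latticeCoords b z))))) := by
  have key : ∀ w : ⋀[R]^5 N ⊗[R] ⋀[R]^5 N, sixthCoord b hb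
      (TensorProduct.map θ θ w) = ν ^ 2 * tensorMul (vol cN) (vol cN) w := by
    intro w
    induction w using TensorProduct.induction_on with
    | zero => simp
    | tmul u v =>
      rw [TensorProduct.map_tmul, sixthCoord, tensorMul_tmul, tensorMul_tmul, hθ, hθ]
      ring
    | add u v hu hv => rw [map_add, map_add, map_add, hu, hv, mul_add]
  rw [key, tensorMul_vol_contract, hφ, hφ, hφ, pfVec_smul, pfVec_smul, Matrix.smul_mulVec,
    Matrix.mulVec_smul, smul_dotProduct, dotProduct_smul, dotProduct_smul]
  simp only [smul_eq_mul]
  ring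

omit [IsDedekindDomain R] [IsFractionRing R K] in
theorem sixthCoord_tmul (l₁ l₂ l₃ u : TopL R Q) :
    sixthCoord b hb
      ((l₁ ⊗ₜ[R] (l₂ ⊗ₜ[R] l₂)) ⊗ₜ[R] (l₃ ⊗ₜ[R] (l₃ ⊗ₜ[R] u))) =
    topCoord b hb l₁ * topCoord b hb l₂ ^ 2 * topCoord b hb l₃ ^ 2 * topCoord b hb u := by
  simp only [sixthCoord, tensorMul_tmul, cubeCoord]
  ring

/-- Coordinates in which a resolvent is described by given matrices. -/
structure Resolvent.IsNormalized (σ : Resolvent R Q N) (cN : N →ₗ[R] (Fin 5 → K))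
    (a : (Fin 4 → K) →ₗ[K] Matrix (Fin 5) (Fin 5) K) (c : K) : Prop where
  injective : Function.Injective cN
  span : ∀ v, ∃ r : R, r ≠ 0 ∧ ∃ x, r • v = cN x
  minors_phi : ∀ l x, minors cN (σ.phi (l ⊗ₜ[R] toModBase R Q x)) =
    topCoord b hb l • a (latticeCoords b x)
  cube_theta : ∀ u, cubeCoord b hb (σ.theta u) = c⁻¹ * vol cN u

/-- In arbitrary coordinates a resolvent gives matrices `a'` and a scalar `ν` that satisfy the
determinant identity; `exists_transform` supplies the change of coordinates to `a` and `c⁻¹`. -/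
theorem IsModel.exists_isNormalized (hQ : IsQuinticRing R Q)
    {a : (Fin 4 → K) →ₗ[K] Matrix (Fin 5) (Fin 5) K}
    {q : QuadraticMap K (Fin 4 → K) (Fin 5 → K)} (h : IsModel b a q) {c : K} (hc0 : c ≠ 0)
    (hc : ∀ y, pfVec (a y) = c • q y) (hN : IsLatticeOfRank R N 5) (σ : Resolvent R Q N) :
    ∃ cN, σ.IsNormalized b hb cN a c := by
  have := hN.finite
  have := hN.projective
  have := hQ.finite
  obtain ⟨c₀, hc₀, hs₀⟩ := hN.exists_coords K
  obtain ⟨ν', hν', s', hs', hsp'⟩ := exists_frame_of_coords c₀ hc₀ hs₀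
  have hvol : Function.Injective (vol c₀) := vol_injective c₀ hν' hs' hsp'
  obtain ⟨l₀, hl₀⟩ := exists_topCoord_ne_zero b hb hQ
  set k₀ := topCoord b hb l₀ with hk₀
  have hl₀' : l₀ ≠ 0 := by rintro rfl; simp [hk₀] at hl₀
  -- Since Λ⁴L has rank one, `φ` is determined by its values at one fixed `l₀` with nonzero
  -- coordinate.
  let f : ModBase R Q →ₗ[R] Matrix (Fin 5) (Fin 5) K :=
    (LinearMap.lsmul K _ k₀⁻¹).restrictScalars R ∘ₗ minors c₀ ∘ₗ σ.phi ∘ₗ TensorProduct.mk R _ _ l₀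
  obtain ⟨a', ha'⟩ := exists_linearMap_comp_coords (baseCoords b hb)
    (baseCoords_injective b hb hQ) (baseCoords_span b hb) f
  have hφ : ∀ l x, minors c₀ (σ.phi (l ⊗ₜ[R] toModBase R Q x)) =
      topCoord b hb l • a' (latticeCoords b x) := by
    intro l x
    have h1 : a' (latticeCoords b x) = k₀⁻¹ • minors c₀ (σ.phi (l₀ ⊗ₜ[R] toModBase R Q x)) :=
      ha' (toModBase R Q x)
    obtain ⟨r, r', hr, hl⟩ := exists_smul_eq_smul _ (topCoord_injective b hb hQ) hl₀' l
    have hrK : algebraMap R K r ≠ 0 := by rwa [Ne, IsFractionRing.to_map_eq_zero_iff]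
    have h2 := congrArg (topCoord b hb) hl
    rw [map_smul, map_smul, Algebra.smul_def, Algebra.smul_def, ← hk₀] at h2
    have h3 : r • minors c₀ (σ.phi (l ⊗ₜ[R] toModBase R Q x)) =
        r' • minors c₀ (σ.phi (l₀ ⊗ₜ[R] toModBase R Q x)) := by
      rw [← map_smul, ← map_smul, TensorProduct.smul_tmul', hl, ← TensorProduct.smul_tmul',
        map_smul, map_smul]
    rw [← smul_right_inj hrK, algebraMap_smul, h3, smul_smul, h2, h1, smul_smul, mul_assoc,
      mul_inv_cancel₀ hl₀, mul_one, algebraMap_smul]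
  obtain ⟨ν, hν⟩ := exists_eq_mul_of_injective (cubeCoord b hb ∘ₗ σ.theta) (vol c₀) hvol
  have hid : ∀ x y z : Q, ν ^ 2 * (pfVec (a' (latticeCoords b y)) ⬝ᵥ
      (a' (latticeCoords b x)).mulVec (pfVec (a' (latticeCoords b z)))) =
      Matrix.det (Matrix.of ![tailCoords b (1 ⊗ₜ[R] x), tailCoords b (1 ⊗ₜ[R] y),
        tailCoords b (1 ⊗ₜ[R] z), tailCoords b ((1 ⊗ₜ[R] y) * (1 ⊗ₜ[R] z))]) := by
    intro x y z
    have h1 := congrArg (sixthCoord b hb)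
      (σ.identity l₀ l₀ l₀ x y z)
    rw [sixthCoord_contract b hb hφ hν, sixthCoord_tmul,
      latticeCoords_mul] at h1
    exact mul_left_cancel₀ (mul_ne_zero (mul_ne_zero hl₀ (pow_ne_zero _ hl₀))
      (pow_ne_zero _ hl₀)) h1
  have halt : ∀ x, IsAltMatrix (a' x) := by
    intro x
    obtain ⟨r, hr, X, hX⟩ := baseCoords_span b hb x
    obtain ⟨y, rfl⟩ := Submodule.mkQ_surjective _ X
    have hrK : algebraMap R K r ≠ 0 := by rwa [Ne, IsFractionRing.to_map_eq_zero_iff]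
    have h1 : a' x = ((algebraMap R K r)⁻¹ * k₀⁻¹) •
        minors c₀ (σ.phi (l₀ ⊗ₜ[R] toModBase R Q y)) := by
      rw [hφ, ← hk₀, ← baseCoords_toModBase b hb, ← hX, algebra_compatible_smul K r x,
        map_smul, smul_smul, smul_smul]
      have : (algebraMap R K r)⁻¹ * k₀⁻¹ * k₀ * algebraMap R K r = 1 := by field_simp
      rw [this, one_smul]
    rw [h1]
    exact (minors_isAlt _ _).smul _
  -- The identity passes from `Q` to `K ⊗ Q` by clearing denominators `r`, `s`, `t`; both sides
  -- scale by r s² t².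
  obtain ⟨g, hg, hg0, hgν⟩ := h.exists_transform hc0 hc halt (ν := ν) (by
    intro x y z
    obtain ⟨r, hr, x', hx⟩ := exists_smul_eq_one_tmul K x
    obtain ⟨s, hs, y', hy⟩ := exists_smul_eq_one_tmul K y
    obtain ⟨t, ht, z', hz⟩ := exists_smul_eq_one_tmul K z
    have h1 := hid x' y' z'
    have hK : ∀ r : R, r ≠ 0 → algebraMap R K r ≠ 0 := fun r hr => by
      rwa [Ne, IsFractionRing.to_map_eq_zero_iff]
    have e : ∀ (r : R) (x : K ⊗[R] Q) (x' : Q), r • x = 1 ⊗ₜ[R] x' →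
        latticeCoords b x' = algebraMap R K r • tailCoords b x := by
      intro r x x' hx
      rw [← map_smul, algebraMap_smul, hx]; rfl
    have e2 : (1 ⊗ₜ[R] y' : K ⊗[R] Q) * (1 ⊗ₜ[R] z') =
        (algebraMap R K s * algebraMap R K t) • (y * z) := by
      rw [← hy, ← hz, smul_mul_smul_comm, ← map_mul, algebraMap_smul]
    have e' : ∀ (r : R) (x : K ⊗[R] Q) (x' : Q), r • x = 1 ⊗ₜ[R] x' →
        tailCoords b (1 ⊗ₜ[R] x') = algebraMap R K r • tailCoords b x := e
    rw [e r x x' hx, e s y y' hy, e t z z' hz, e2, e' r x x' hx, e' s y y' hy, e' t z z' hz,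
      map_smul, map_smul, map_smul, map_smul, pfVec_smul, pfVec_smul, Matrix.smul_mulVec,
      Matrix.mulVec_smul, smul_dotProduct, dotProduct_smul, dotProduct_smul] at h1
    have e3 : Matrix.det (Matrix.of ![algebraMap R K r • tailCoords b x,
        algebraMap R K s • tailCoords b y, algebraMap R K t • tailCoords b z,
        (algebraMap R K s * algebraMap R K t) • tailCoords b (y * z)]) =
        (algebraMap R K r * algebraMap R K s ^ 2 * algebraMap R K t ^ 2) *
        Matrix.det (Matrix.of ![tailCoords b x, tailCoords b y, tailCoords b z,
          tailCoords b (y * z)]) := by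
      have := Matrix.det_mul_column ![algebraMap R K r, algebraMap R K s, algebraMap R K t,
        algebraMap R K s * algebraMap R K t] (Matrix.of ![tailCoords b x, tailCoords b y,
          tailCoords b z, tailCoords b (y * z)])
      rw [Fin.prod_univ_four] at this
      have e4 : (algebraMap R K r * algebraMap R K s ^ 2 * algebraMap R K t ^ 2) =
        algebraMap R K r * algebraMap R K s * algebraMap R K t *
          (algebraMap R K s * algebraMap R K t) := by ring
      rw [e4]
      refine Eq.trans ?_ this
      congr 1
      ext i j
      fin_cases i <;> rfl
    rw [e3] at h1
    simp only [smul_eq_mul] at h1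
    refine mul_left_cancel₀ (mul_ne_zero (mul_ne_zero (hK r hr) (pow_ne_zero 2 (hK s hs)))
      (pow_ne_zero 2 (hK t ht))) (Eq.trans ?_ h1)
    ring)
  refine ⟨(g.mulVecLin.restrictScalars R) ∘ₗ c₀, ?_, fun v => ?_, fun l x => ?_, fun u => ?_⟩
  · have hgi : Function.Injective g.mulVec :=
      Matrix.mulVec_injective_iff_isUnit.mpr ((Matrix.isUnit_iff_isUnit_det g).mpr hg0.isUnit)
    exact hgi.comp hc₀
  · obtain ⟨r, hr, x, hx⟩ := hs₀ (g⁻¹.mulVec v)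
    refine ⟨r, hr, x, ?_⟩
    change _ = g.mulVec (c₀ x)
    rw [← hx, algebra_compatible_smul K, algebra_compatible_smul K r (g⁻¹.mulVec v),
      Matrix.mulVec_smul, Matrix.mulVec_mulVec, Matrix.mul_nonsing_inv _ hg0.isUnit,
      Matrix.one_mulVec]
  · rw [minors_mulVec, hφ, Matrix.mul_smul, Matrix.smul_mul, hg]
  · have h1 : cubeCoord b hb (σ.theta u) = ν * vol c₀ u := hν u
    rw [vol_mulVec, h1, ← hgν]
    field_simp

/-- The map `l ⊗ x ↦ l • a x` in coordinates. -/
noncomputable def phiCoord (a : (Fin 4 → K) →ₗ[K] Matrix (Fin 5) (Fin 5) K) :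
    TopL R Q ⊗[R] ModBase R Q →ₗ[R] Matrix (Fin 5) (Fin 5) K :=
  TensorProduct.lift (LinearMap.mk₂ R (fun l x => topCoord b hb l • a (baseCoords b hb x))
    (fun l l' x => by rw [map_add, add_smul])
    (fun r l x => by rw [map_smul, smul_assoc])
    (fun l x x' => by rw [map_add, map_add, smul_add])
    (fun r l x => by
      have h : ∀ v, a (r • v) = r • a v := (a.restrictScalars R).map_smul r
      rw [map_smul, h, smul_comm]))

omit [IsDedekindDomain R] [IsFractionRing R K] in
theorem phiCoord_tmul (a : (Fin 4 → K) →ₗ[K] Matrix (Fin 5) (Fin 5) K) (l : TopL R Q) (x : Q) :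
    phiCoord b hb a (l ⊗ₜ[R] toModBase R Q x) = topCoord b hb l • a (latticeCoords b x) := rfl

omit [IsDedekindDomain R] [IsFractionRing R K] in
theorem phiCoord_mem {a : (Fin 4 → K) →ₗ[K] Matrix (Fin 5) (Fin 5) K}
    {S : Submodule R (Matrix (Fin 5) (Fin 5) K)}
    (h : ∀ (l : TopL R Q) (x : Q), topCoord b hb l • a (latticeCoords b x) ∈ S)
    (w : TopL R Q ⊗[R] ModBase R Q) : phiCoord b hb a w ∈ S := by
  induction w using TensorProduct.induction_on with
  | zero => rw [map_zero]; exact zero_mem _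
  | tmul l x =>
    obtain ⟨x, rfl⟩ := Submodule.mkQ_surjective _ x
    exact h l x
  | add u v hu hv => rw [map_add]; exact add_mem hu hv

theorem IsModel.identity (hQ : IsQuinticRing R Q)
    {a : (Fin 4 → K) →ₗ[K] Matrix (Fin 5) (Fin 5) K}
    {q : QuadraticMap K (Fin 4 → K) (Fin 5 → K)} (h : IsModel b a q) {c : K} (hc0 : c ≠ 0)
    (hc : ∀ y, pfVec (a y) = c • q y) {φ : TopL R Q ⊗[R] ModBase R Q →ₗ[R] ⋀[R]^2 N}
    {θ : ⋀[R]^5 N →ₗ[R] TopLCube R Q} {cN : N →ₗ[R] (Fin 5 → K)}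
    (hφ : ∀ l x, minors cN (φ (l ⊗ₜ[R] toModBase R Q x)) = topCoord b hb l • a (latticeCoords b x))
    (hθ : ∀ u, cubeCoord b hb (θ u) = c⁻¹ * vol cN u) (l₁ l₂ l₃ : TopL R Q) (x y z : Q) :
    TensorProduct.map θ θ
      (contract (φ (l₁ ⊗ₜ[R] toModBase R Q x))
        (box (φ (l₂ ⊗ₜ[R] toModBase R Q y)))
        (box (φ (l₃ ⊗ₜ[R] toModBase R Q z)))) =
    (l₁ ⊗ₜ[R] (l₂ ⊗ₜ[R] l₂)) ⊗ₜ[R]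
      (l₃ ⊗ₜ[R] (l₃ ⊗ₜ[R] exteriorPower.ιMulti R 4
        ![toModBase R Q x, toModBase R Q y, toModBase R Q z, toModBase R Q (y * z)])) := by
  apply sixthCoord_injective b hb hQ
  rw [sixthCoord_contract b hb hφ hθ, sixthCoord_tmul, latticeCoords_mul,
    ← h.eq_det, hc, hc, Matrix.mulVec_smul, smul_dotProduct, dotProduct_smul]
  congr 1
  simp only [smul_eq_mul]
  change _ = q (latticeCoords b y) ⬝ᵥ (a (latticeCoords b x)).mulVec (q (latticeCoords b z))
  field_simp

/-- `φ` and `θ` are lifted along injective coordinate maps, and `h1`, `h2` are precisely the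
integrality this needs. The identity is then verified in coordinates. -/
theorem IsModel.exists_resolvent (hQ : IsQuinticRing R Q)
    {a : (Fin 4 → K) →ₗ[K] Matrix (Fin 5) (Fin 5) K}
    {q : QuadraticMap K (Fin 4 → K) (Fin 5 → K)} (h : IsModel b a q) {c : K} (hc0 : c ≠ 0)
    (hc : ∀ y, pfVec (a y) = c • q y) [Module.Finite R N] [Module.Projective R N]
    (cN : N →ₗ[R] (Fin 5 → K)) (hinj : Function.Injective cN)
    (hspan : ∀ v, ∃ r : R, r ≠ 0 ∧ ∃ x, r • v = cN x)
    (h1 : ∀ l x, topCoord b hb l • a (latticeCoords b x) ∈ LinearMap.range (minors cN))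
    (h2 : ∀ u, c⁻¹ * vol cN u ∈ LinearMap.range (cubeCoord b hb)) :
    ∃ σ : Resolvent R Q N, σ.IsNormalized b hb cN a c := by
  obtain ⟨ν, hν, s, hs, hsp⟩ := exists_frame_of_coords cN hinj hspan
  obtain ⟨φ, hφ⟩ := LinearMap.exists_lift_of_range_le (X := TopL R Q ⊗[R] ModBase R Q)
    (phiCoord (R := R) (Q := Q) b hb a) (minors cN) (minors_injective cN hν hs hsp)
    (phiCoord_mem b hb h1)
  obtain ⟨θ, hθ⟩ := LinearMap.exists_lift_of_range_le (Y := TopLCube R Q)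
    ((LinearMap.mulLeft K c⁻¹).restrictScalars R ∘ₗ vol cN) (cubeCoord (R := R) (Q := Q) b hb)
    (cubeCoord_injective b hb hQ) h2
  have hφ' : ∀ l x, minors cN (φ (l ⊗ₜ[R] toModBase R Q x)) =
      topCoord b hb l • a (latticeCoords b x) := fun l x => by rw [hφ, phiCoord_tmul]
  exact ⟨⟨φ, θ, h.identity b hb hQ hc0 hc hφ' hθ⟩, hinj, hspan, hφ', hθ⟩

end BaseCoords

/-! ### Local-to-global membership. -/

section LocalClosure

variable {R X : Type*} [CommRing R] [AddCommGroup X] [Module R X] (p : Ideal R) [p.IsPrime]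
  (N : Submodule R X)

/-- The elements which lie in `N` locally at `p`. -/
def localClosure : Submodule R X where
  carrier := {x | ∃ s ∉ p, s • x ∈ N}
  zero_mem' := ⟨1, p.primeCompl.one_mem, by simp⟩
  add_mem' := by
    rintro x y ⟨s, hs, hx⟩ ⟨t, ht, hy⟩
    refine ⟨s * t, p.primeCompl.mul_mem hs ht, ?_⟩
    rw [smul_add, mul_smul s t y, mul_comm s t, mul_smul t s x]
    exact N.add_mem (N.smul_mem t hx) (N.smul_mem s hy)
  smul_mem' := by
    rintro r x ⟨s, hs, hx⟩
    exact ⟨s, hs, by rw [smul_comm]; exact N.smul_mem r hx⟩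

variable {p N}

theorem le_localClosure : N ≤ localClosure p N :=
  fun x hx => ⟨1, p.primeCompl.one_mem, by rwa [one_smul]⟩

theorem mem_localClosure_of_smul_mem {x : X} {s : R} (hs : s ∉ p)
    (h : s • x ∈ localClosure p N) : x ∈ localClosure p N := by
  obtain ⟨t, ht, h⟩ := h
  exact ⟨t * s, p.primeCompl.mul_mem ht hs, by rwa [mul_smul]⟩

theorem smul_mem_localClosure {A : Type*} [CommRing A] [Algebra R A] [IsLocalization.AtPrime A p]
    [Module A X] [IsScalarTower R A X] (a : A) {x : X} (hx : x ∈ localClosure p N) :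
    a • x ∈ localClosure p N := by
  obtain ⟨⟨r, s⟩, h⟩ := IsLocalization.surj p.primeCompl a
  apply mem_localClosure_of_smul_mem s.2
  have : (s : R) • a • x = r • x := by
    rw [← algebraMap_smul A, smul_smul, mul_comm, h, algebraMap_smul]
  rw [this]
  exact Submodule.smul_mem _ r hx

/-- The ideal of scalars that carry `x` into `N` lies in no maximal ideal. Maximal ideals are
nonzero because `R` is not a field. -/
theorem mem_of_forall_mem_localClosure (hR : ¬ IsField R) {x : X}
    (h : ∀ p : Ideal R, ∀ _ : p.IsPrime, p ≠ ⊥ → x ∈ localClosure p N) : x ∈ N := by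
  let I : Ideal R := N.comap (LinearMap.toSpanSingleton R X x)
  by_contra hx
  have hI : I ≠ ⊤ := by
    intro hI
    have : (1 : R) ∈ I := by rw [hI]; trivial
    apply hx
    simpa [I] using this
  obtain ⟨m, hm, hIm⟩ := Ideal.exists_le_maximal I hI
  have hnt : Nontrivial R := ⟨⟨0, 1, fun h01 => hm.ne_top (by
    rw [Ideal.eq_top_iff_one, ← h01]; exact m.zero_mem)⟩⟩
  obtain ⟨s, hs, hsx⟩ := h m hm.isPrime (Ring.ne_bot_of_isMaximal_of_not_isField hm hR)
  exact hs (hIm (by simpa [I] using hsx))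

end LocalClosure

/-! ### The lattice of the resolvent. -/

section DualLattice

variable {R : Type*} {Q : Type*} {K : Type*} [CommRing R] [IsDedekindDomain R] [Field K]
  [Algebra R K] [IsFractionRing R K] [CommRing Q] [Algebra R Q]
  (b : Module.Basis (Fin 5) K (K ⊗[R] Q)) (hb : b 0 = 1)

/-- The lattice of vectors which have integral products with the values of `q`. -/
def dualLattice (q : QuadraticMap K (Fin 4 → K) (Fin 5 → K)) : Submodule R (Fin 5 → K) where
  carrier := {m | ∀ y : Q, m ⬝ᵥ q (latticeCoords b y) ∈ LinearMap.range (topCoord b hb)}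
  zero_mem' y := by rw [zero_dotProduct]; exact zero_mem _
  add_mem' hm hn y := by rw [add_dotProduct]; exact add_mem (hm y) (hn y)
  smul_mem' r m hm y := by rw [smul_dotProduct]; exact Submodule.smul_mem _ r (hm y)

/-- The lattice spanned by the values of `q`. -/
def valueLattice (q : QuadraticMap K (Fin 4 → K) (Fin 5 → K)) : Submodule R (Fin 5 → K) :=
  Submodule.span R (Set.range fun y : Q => q (latticeCoords b y))

omit [IsDedekindDomain R] [IsFractionRing R K] in
theorem valueLattice_fg [Module.Finite R Q] (q : QuadraticMap K (Fin 4 → K) (Fin 5 → K)) :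
    (valueLattice (R := R) (Q := Q) b q).FG :=
  QuadraticMap.span_range_fg
    ((q.restrictScalars : QuadraticMap R (Fin 4 → K) (Fin 5 → K)).comp (latticeCoords b))

variable {a : (Fin 4 → K) →ₗ[K] Matrix (Fin 5) (Fin 5) K}
  {q : QuadraticMap K (Fin 4 → K) (Fin 5 → K)}

theorem IsModel.span_valueLattice {b : Module.Basis (Fin 5) K (K ⊗[R] Q)} (h : IsModel b a q) :
    Submodule.span K (valueLattice (R := R) (Q := Q) b q : Set (Fin 5 → K)) = ⊤ := by
  rw [eq_top_iff, ← h.span_eq_top, Submodule.span_le]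
  rintro _ ⟨y, rfl⟩
  obtain ⟨Y, rfl⟩ := tailCoords_surjective b y
  obtain ⟨r, hr, y, hy⟩ := exists_smul_eq_one_tmul K Y
  have hrK : algebraMap R K r ≠ 0 := by rwa [Ne, IsFractionRing.to_map_eq_zero_iff]
  have h1 : q (latticeCoords b y) ∈
      Submodule.span K (valueLattice (R := R) (Q := Q) b q : Set (Fin 5 → K)) :=
    Submodule.subset_span (Submodule.subset_span ⟨_, rfl⟩)
  have h2 : latticeCoords b y = algebraMap R K r • tailCoords b Y := by
    rw [← map_smul, algebraMap_smul, hy]; rfl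
  rw [h2, QuadraticMap.map_smul, Submodule.smul_mem_iff _ (mul_ne_zero hrK hrK)] at h1
  exact h1

omit [IsDedekindDomain R] [IsFractionRing R K] in
theorem dotProduct_mem_of_mem_valueLattice {m d : Fin 5 → K} (hm : m ∈ dualLattice b hb q)
    (hd : d ∈ valueLattice (R := R) (Q := Q) b q) : m ⬝ᵥ d ∈ LinearMap.range (topCoord b hb) := by
  rw [dotProduct_comm]
  refine dotProduct_mem_of_mem_span _ _ ?_ hd
  rintro _ ⟨y, rfl⟩
  rw [dotProduct_comm]
  exact hm y

/-- Pairing with finitely many generators of the value lattice embeds the dual lattice in a finite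
power of the image of Λ⁴L, a Noetherian module. -/
theorem IsModel.finite_dualLattice [Module.Finite R Q] (h : IsModel b a q) :
    Module.Finite R (dualLattice b hb q) := by
  obtain ⟨T, hT⟩ := valueLattice_fg (R := R) (Q := Q) b q
  have hTm : ∀ t : T, (t : Fin 5 → K) ∈ valueLattice (R := R) (Q := Q) b q := fun t => by
    rw [← hT]; exact Submodule.subset_span t.2
  let f : dualLattice b hb q →ₗ[R] (T → LinearMap.range (topCoord b hb)) :=
    { toFun := fun m t => ⟨(m : Fin 5 → K) ⬝ᵥ t,
        dotProduct_mem_of_mem_valueLattice b hb m.2 (hTm t)⟩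
      map_add' := fun m n => by
        exact funext fun t => Subtype.ext (add_dotProduct (m : Fin 5 → K) n t)
      map_smul' := fun r m => by
        exact funext fun t => Subtype.ext (smul_dotProduct r (m : Fin 5 → K) (t : Fin 5 → K)) }
  refine Module.Finite.of_injective f ?_
  rw [← LinearMap.ker_eq_bot, LinearMap.ker_eq_bot']
  intro m hm
  apply Subtype.ext
  have hspan := h.span_valueLattice (R := R) (Q := Q)
  rw [← hT, Submodule.span_span_of_tower] at hspan
  apply dotProduct_eq_zero
  intro v
  have hv : v ∈ Submodule.span K (T : Set (Fin 5 → K)) := by rw [hspan]; trivial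
  rw [dotProduct_comm]
  induction hv using Submodule.span_induction with
  | mem t ht =>
    rw [dotProduct_comm]
    exact congrArg Subtype.val (congrFun hm ⟨t, ht⟩)
  | zero => simp
  | add x y _ _ hx hy => rw [add_dotProduct, hx, hy, add_zero]
  | smul r x _ hx => rw [smul_dotProduct, hx, smul_zero]

theorem exists_smul_mem_dualLattice (hQ : IsQuinticRing R Q) (v : Fin 5 → K) :
    ∃ r : R, r ≠ 0 ∧ r • v ∈ dualLattice b hb q := by
  have := hQ.finite
  have : Module.Finite R (valueLattice (R := R) (Q := Q) b q) :=
    Module.Finite.iff_fg.mpr (valueLattice_fg b q)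
  obtain ⟨l, hl⟩ := exists_topCoord_ne_zero b hb hQ
  let f : valueLattice (R := R) (Q := Q) b q →ₗ[R] K :=
    { toFun := fun d => v ⬝ᵥ (d : Fin 5 → K)
      map_add' := fun d d' => dotProduct_add _ _ _
      map_smul' := fun r d => dotProduct_smul _ _ _ }
  obtain ⟨s, hs, h⟩ := exists_smul_mem_of_forall (nonZeroDivisors R)
    (LinearMap.range (topCoord b hb)) f (fun d => by
      obtain ⟨r', r, hr, hd⟩ := IsFractionRing.div_surjective (A := R) (f d / topCoord b hb l)
      have hrK : algebraMap R K r ≠ 0 := by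
        rw [Ne, IsFractionRing.to_map_eq_zero_iff]; exact nonZeroDivisors.ne_zero hr
      refine ⟨r, hr, r' • l, ?_⟩
      rw [map_smul, Algebra.smul_def, Algebra.smul_def]
      rw [div_eq_div_iff hrK hl] at hd
      rw [hd, mul_comm])
  refine ⟨s, nonZeroDivisors.ne_zero hs, fun y => ?_⟩
  rw [smul_dotProduct]
  exact h ⟨_, Submodule.subset_span ⟨y, rfl⟩⟩

end DualLattice

/-! ### Frames as local bases of the dual lattice. -/

section Frames

variable {R : Type*} {Q : Type*} {K : Type*} [CommRing R] [IsDedekindDomain R] [Field K]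
  [Algebra R K] [IsFractionRing R K] [CommRing Q] [Algebra R Q]

/-- A local basis `P` of `dualLattice` together with a local generator `l` of `Λ⁴ (Q / R)`. -/
structure IsFrame (b : Module.Basis (Fin 5) K (K ⊗[R] Q)) (hb : b 0 = 1)
    (a : (Fin 4 → K) →ₗ[K] Matrix (Fin 5) (Fin 5) K)
    (q : QuadraticMap K (Fin 4 → K) (Fin 5 → K)) (c : K) (p : Ideal R) (A : Type*) [CommRing A]
    [Algebra R A] [Algebra A K] (l : K) (P : Matrix (Fin 5) (Fin 5) K) (u : A) : Prop where
  l_ne_zero : l ≠ 0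
  isUnit : IsUnit u
  mem : ∃ s ∉ p, ∃ t, s • l = topCoord b hb t
  top : ∀ t, ∃ r : A, topCoord b hb t = algebraMap A K r * l
  det_mul : P.det * algebraMap A K u = c * l ^ 3
  det_ne_zero : P.det ≠ 0
  mulVec : ∀ y : Q, ∃ v : Fin 5 → A, P.mulVec (q (latticeCoords b y)) = l • (algebraMap A K ∘ v)
  span : ∀ v : Fin 5 → A, algebraMap A K ∘ v ∈ Submodule.span A
    (Set.range fun y : Q => l⁻¹ • P.mulVec (q (latticeCoords b y)))
  matrix : ∀ y : Q, ∃ C : Matrix (Fin 5) (Fin 5) A,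
    l • a (latticeCoords b y) = P.transpose * C.map (algebraMap A K) * P

theorem IsModel.exists_isFrame (hQ : IsQuinticRing R Q) (p : Ideal R) [p.IsPrime] (hp : p ≠ ⊥)
    (hint : Module.rank (R ⧸ p) (integralClasses R K Q p) ≤ 2)
    (A : Type*) [CommRing A] [IsDomain A] [IsDiscreteValuationRing A] [Algebra R A]
    [IsLocalization.AtPrime A p] [Algebra A K] [IsScalarTower R A K] [IsFractionRing A K]
    {b : Module.Basis (Fin 5) K (K ⊗[R] Q)} (hb : b 0 = 1)
    {a : (Fin 4 → K) →ₗ[K] Matrix (Fin 5) (Fin 5) K}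
    {q : QuadraticMap K (Fin 4 → K) (Fin 5 → K)} (h : IsModel b a q) {c : K}
    (hc : ∀ y, pfVec (a y) = c • q y) :
    ∃ (l : K) (P : Matrix (Fin 5) (Fin 5) K) (u : A), IsFrame b hb a q c p A l P u := by
  obtain ⟨l, P, u, hl, hu, ⟨s, hs, y, hy⟩, h4, hdet, hdet0, hq, hspan, ha⟩ :=
    h.exists_local_frame hQ p hp hint A hb hc
  refine ⟨l, P, u, hl, hu, ⟨s, hs, _, hy.trans (topCoord_ιMulti b hb y).symm⟩, fun t => ?_, hdet,
    hdet0, hq, hspan, ha⟩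
  have ht : t ∈ Submodule.span R (Set.range (exteriorPower.ιMulti R 4 (M := ModBase R Q))) := by
    rw [exteriorPower.ιMulti_span]; trivial
  induction ht using Submodule.span_induction with
  | mem x hx =>
    obtain ⟨v, rfl⟩ := hx
    choose y hy using fun i => Submodule.mkQ_surjective _ (v i)
    obtain rfl : (fun i => toModBase R Q (y i)) = v := funext hy
    rw [topCoord_ιMulti]
    exact h4 y
  | zero => exact ⟨0, by simp⟩
  | add x y _ _ hx hy =>
    obtain ⟨r, hr⟩ := hx
    obtain ⟨r', hr'⟩ := hy
    exact ⟨r + r', by rw [map_add, hr, hr', map_add, add_mul]⟩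
  | smul s x _ hx =>
    obtain ⟨r, hr⟩ := hx
    refine ⟨algebraMap R A s * r, ?_⟩
    rw [map_smul, hr, map_mul, ← IsScalarTower.algebraMap_apply, Algebra.smul_def, mul_assoc]

variable {b : Module.Basis (Fin 5) K (K ⊗[R] Q)} {hb : b 0 = 1}
  {a : (Fin 4 → K) →ₗ[K] Matrix (Fin 5) (Fin 5) K}
  {q : QuadraticMap K (Fin 4 → K) (Fin 5 → K)} {c : K} {p : Ideal R} [p.IsPrime]
  {A : Type*} [CommRing A] [Algebra R A] [IsLocalization.AtPrime A p] [Algebra A K]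
  [IsScalarTower R A K] {l : K} {P : Matrix (Fin 5) (Fin 5) K} {u : A}

namespace IsFrame

omit [IsDedekindDomain R] [IsFractionRing R K] in
theorem mul_mem (h : IsFrame b hb a q c p A l P u) (r : A) :
    algebraMap A K r * l ∈ localClosure p (LinearMap.range (topCoord b hb)) := by
  obtain ⟨s, hs, t, ht⟩ := h.mem
  have hl : l ∈ localClosure p (LinearMap.range (topCoord b hb)) := ⟨s, hs, t, ht.symm⟩
  have := smul_mem_localClosure (A := A) r hl
  rwa [Algebra.smul_def] at this

omit [IsDedekindDomain R] [IsFractionRing R K] [p.IsPrime] [IsLocalization.AtPrime A p]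
    [IsScalarTower R A K] in
theorem exists_of_mem (h : IsFrame b hb a q c p A l P u) {k : K}
    (hk : k ∈ LinearMap.range (topCoord b hb)) : ∃ r : A, k = algebraMap A K r * l := by
  obtain ⟨t, rfl⟩ := hk
  exact h.top t

omit [IsDedekindDomain R] [IsFractionRing R K] [p.IsPrime] [IsLocalization.AtPrime A p]
    [IsScalarTower R A K] in
theorem exists_cubeCoord_eq (h : IsFrame b hb a q c p A l P u) (w : TopLCube R Q) :
    ∃ r : A, cubeCoord b hb w = algebraMap A K r * l ^ 3 := by
  have key : ∀ (t : TopL R Q) (w : TopL R Q ⊗[R] TopL R Q), ∃ r : A,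
      cubeCoord b hb (t ⊗ₜ[R] w) = algebraMap A K r * l ^ 3 := by
    intro t w
    induction w using TensorProduct.induction_on with
    | zero => exact ⟨0, by rw [TensorProduct.tmul_zero, map_zero, map_zero, zero_mul]⟩
    | tmul t' t'' =>
      obtain ⟨r, hr⟩ := h.top t
      obtain ⟨r', hr'⟩ := h.top t'
      obtain ⟨r'', hr''⟩ := h.top t''
      refine ⟨r * r' * r'', ?_⟩
      rw [cubeCoord, tensorMul_tmul, tensorMul_tmul, hr, hr', hr'', map_mul, map_mul]
      ring
    | add x y hx hy =>
      obtain ⟨r, hr⟩ := hx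
      obtain ⟨r', hr'⟩ := hy
      exact ⟨r + r', by rw [TensorProduct.tmul_add, map_add, hr, hr', map_add, add_mul]⟩
  induction w using TensorProduct.induction_on with
  | zero => exact ⟨0, by rw [map_zero, map_zero, zero_mul]⟩
  | tmul t w => exact key t w
  | add x y hx hy =>
    obtain ⟨r, hr⟩ := hx
    obtain ⟨r', hr'⟩ := hy
    exact ⟨r + r', by rw [map_add, hr, hr', map_add, add_mul]⟩

omit [IsDedekindDomain R] [IsFractionRing R K] in
theorem mul_cube_mem (h : IsFrame b hb a q c p A l P u) (r : A) :
    algebraMap A K r * l ^ 3 ∈ localClosure p (LinearMap.range (cubeCoord b hb)) := by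
  obtain ⟨s, hs, t, ht⟩ := h.mem
  have hl : l ^ 3 ∈ localClosure p (LinearMap.range (cubeCoord b hb)) := by
    refine ⟨s * s * s, p.primeCompl.mul_mem (p.primeCompl.mul_mem hs hs) hs,
      t ⊗ₜ[R] (t ⊗ₜ[R] t), ?_⟩
    rw [cubeCoord, tensorMul_tmul, tensorMul_tmul, ← ht, Algebra.smul_def, Algebra.smul_def,
      map_mul, map_mul]
    ring
  have := smul_mem_localClosure (A := A) r hl
  rwa [Algebra.smul_def] at this

-- The vectors `l⁻¹ P q(y)` generate `A⁵`, so the coordinates of `m` along the rows of `P` are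
-- `A`-combinations of the numbers `l⁻¹ (m · q(y))`. With `mulVec_mem`, the rows of `P` are a local
-- basis of the dual lattice.
omit [IsDedekindDomain R] [IsFractionRing R K] [p.IsPrime] [IsLocalization.AtPrime A p]
    [IsScalarTower R A K] in
theorem exists_eq_mulVec (h : IsFrame b hb a q c p A l P u) {m : Fin 5 → K}
    (hm : ∀ y : Q, ∃ r : A, m ⬝ᵥ q (latticeCoords b y) = algebraMap A K r * l) :
    ∃ v : Fin 5 → A, m = P.transpose.mulVec (algebraMap A K ∘ v) := by
  have hPu : IsUnit P.transpose.det := by rw [Matrix.det_transpose]; exact h.det_ne_zero.isUnit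
  set n := P.transpose⁻¹.mulVec m with hn
  have hmn : m = P.transpose.mulVec n := by
    rw [hn, Matrix.mulVec_mulVec, Matrix.mul_nonsing_inv _ hPu, Matrix.one_mulVec]
  have h1 : ∀ v : Fin 5 → A, (algebraMap A K ∘ v) ⬝ᵥ n ∈
      LinearMap.range (Algebra.linearMap A K) := by
    intro v
    refine dotProduct_mem_of_mem_span _ n ?_ (h.span v)
    rintro _ ⟨y, rfl⟩
    obtain ⟨r, hr⟩ := hm y
    refine ⟨r, ?_⟩
    rw [Algebra.linearMap_apply, smul_dotProduct, dotProduct_comm, Matrix.dotProduct_mulVec,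
      ← Matrix.mulVec_transpose, ← hmn, hr, smul_eq_mul]
    have := h.l_ne_zero
    field_simp
  choose v hv using fun i : Fin 5 => h1 (Pi.single i 1)
  refine ⟨v, ?_⟩
  have e : n = algebraMap A K ∘ v := by
    ext i
    have := hv i
    have e : algebraMap A K ∘ (Pi.single i 1 : Fin 5 → A) = Pi.single i 1 := by
      ext k; simp [Pi.single_apply, apply_ite (algebraMap A K)]
    rw [e, single_one_dotProduct] at this
    exact this.symm
  rw [← e, ← hmn]

-- The value lattice is finitely generated, so one denominator outside `p` serves all `y`.
omit [IsDedekindDomain R] [IsFractionRing R K] in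
theorem mulVec_mem [Module.Finite R Q] (h : IsFrame b hb a q c p A l P u) (v : Fin 5 → A) :
    P.transpose.mulVec (algebraMap A K ∘ v) ∈ localClosure p (dualLattice b hb q) := by
  have : Module.Finite R (valueLattice (R := R) (Q := Q) b q) :=
    Module.Finite.iff_fg.mpr (valueLattice_fg b q)
  let f : valueLattice (R := R) (Q := Q) b q →ₗ[R] K :=
    { toFun := fun d => P.transpose.mulVec (algebraMap A K ∘ v) ⬝ᵥ (d : Fin 5 → K)
      map_add' := fun d d' => dotProduct_add _ _ _
      map_smul' := fun r d => dotProduct_smul _ _ _ }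
  obtain ⟨s, hs, hf⟩ := exists_smul_mem_of_forall p.primeCompl
    (LinearMap.range (topCoord b hb)) f (fun d => by
      have : f d ∈ localClosure p (LinearMap.range (topCoord b hb)) := by
        change P.transpose.mulVec (algebraMap A K ∘ v) ⬝ᵥ (d : Fin 5 → K) ∈ _
        rw [dotProduct_comm]
        refine dotProduct_mem_of_mem_span _ _ ?_ d.2
        rintro _ ⟨y, rfl⟩
        obtain ⟨w, hw⟩ := h.mulVec y
        rw [dotProduct_comm, Matrix.mulVec_transpose, ← Matrix.dotProduct_mulVec, hw,
          dotProduct_smul, smul_eq_mul, mul_comm]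
        have e : (algebraMap A K ∘ v) ⬝ᵥ (algebraMap A K ∘ w) = algebraMap A K (v ⬝ᵥ w) := by
          simp [dotProduct, map_sum, map_mul]
        rw [e]
        exact h.mul_mem _
      exact this)
  refine ⟨s, hs, fun y => ?_⟩
  rw [smul_dotProduct]
  exact hf ⟨_, Submodule.subset_span ⟨y, rfl⟩⟩

end IsFrame

end Frames

/-! ### Local integrality of the structure maps. -/

section FrameRanges

variable {R : Type*} {Q : Type*} {K : Type*} [CommRing R] [IsDedekindDomain R] [Field K]
  [Algebra R K] [IsFractionRing R K] [CommRing Q] [Algebra R Q]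
  {b : Module.Basis (Fin 5) K (K ⊗[R] Q)} {hb : b 0 = 1}
  {a : (Fin 4 → K) →ₗ[K] Matrix (Fin 5) (Fin 5) K}
  {q : QuadraticMap K (Fin 4 → K) (Fin 5 → K)} {c : K} {p : Ideal R} [p.IsPrime]
  {A : Type*} [CommRing A] [Algebra R A] [IsLocalization.AtPrime A p] [Algebra A K]
  [IsScalarTower R A K] {l : K} {P : Matrix (Fin 5) (Fin 5) K} {u : A}
  {N : Type*} [AddCommGroup N] [Module R N] (cN : N →ₗ[R] (Fin 5 → K))

omit [IsDedekindDomain R] [IsFractionRing R K] in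
theorem minors_mem_localClosure (D : Matrix (Fin 5) (Fin 5) K)
    (hD : ∀ v : Fin 5 → A, D.mulVec (algebraMap A K ∘ v) ∈ localClosure p (LinearMap.range cN))
    (μ : ⋀[A]^2 (Fin 5 → A)) :
    D * (minors LinearMap.id μ).map (algebraMap A K) * D.transpose ∈
      localClosure p (LinearMap.range (minors cN)) := by
  rw [← minors_algebraMapPi (R := A) (K := K), ← minors_mulVec]
  induction μ using bivec_induction with
  | h0 => rw [map_zero]; exact zero_mem _
  | hb v w =>
    obtain ⟨s, hs, x, hx⟩ := hD v
    obtain ⟨t, ht, y, hy⟩ := hD w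
    refine ⟨s * t, p.primeCompl.mul_mem hs ht, bivec x y, ?_⟩
    ext i j
    have e : ∀ v : Fin 5 → A, ((D.mulVecLin.restrictScalars A) ∘ₗ algebraMapPi A K 5) v =
      D.mulVec (algebraMap A K ∘ v) := fun v => rfl
    rw [minors_bivec, Matrix.smul_apply, minors_bivec, e, e, hx, hy]
    simp only [Pi.smul_apply, Algebra.smul_def, map_mul]
    ring
  | hs r μ h => rw [map_smul]; exact smul_mem_localClosure (A := A) r h
  | ha μ ν h h' => rw [map_add]; exact add_mem h h'

omit [IsDedekindDomain R] [IsFractionRing R K] in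
theorem exists_minors_eq_congr (D : Matrix (Fin 5) (Fin 5) K)
    (hD : ∀ n, ∃ v : Fin 5 → A, cN n = D.mulVec (algebraMap A K ∘ v)) (ω : ⋀[R]^2 N) :
    ∃ μ : ⋀[A]^2 (Fin 5 → A), minors cN ω =
      D * (minors LinearMap.id μ).map (algebraMap A K) * D.transpose := by
  simp only [← minors_algebraMapPi (R := A) (K := K), ← minors_mulVec]
  induction ω using bivec_induction with
  | h0 => exact ⟨0, by rw [map_zero, map_zero]⟩
  | hb x y =>
    obtain ⟨v, hv⟩ := hD x
    obtain ⟨w, hw⟩ := hD y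
    refine ⟨bivec v w, ?_⟩
    ext i j
    rw [minors_bivec, minors_bivec, hv, hw]
    rfl
  | hs r μ h =>
    obtain ⟨ν, h⟩ := h
    exact ⟨algebraMap R A r • ν, by rw [map_smul, map_smul, h, algebraMap_smul]⟩
  | ha μ ν h h' =>
    obtain ⟨μ', h⟩ := h
    obtain ⟨ν', h'⟩ := h'
    exact ⟨μ' + ν', by rw [map_add, map_add, h, h']⟩

namespace IsFrame

-- By the frame, `l a(x)` is congruent by `P` to an alternating matrix over `A`, that is, to the
-- coordinates of a bivector over `A`; the columns of `Pᵀ` lie locally in the lattice.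
omit [IsDedekindDomain R] [IsFractionRing R K] in
theorem smul_mem_range_minors [FaithfulSMul A K] (h : IsFrame b hb a q c p A l P u)
    (halt : ∀ y, IsAltMatrix (a y))
    (hP : ∀ v : Fin 5 → A,
      P.transpose.mulVec (algebraMap A K ∘ v) ∈ localClosure p (LinearMap.range cN))
    (t : TopL R Q) (x : Q) : topCoord b hb t • a (latticeCoords b x) ∈
      localClosure p (LinearMap.range (minors cN)) := by
  obtain ⟨r, hr⟩ := h.top t
  obtain ⟨C, hC⟩ := h.matrix x
  have hinj := FaithfulSMul.algebraMap_injective A K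
  have hPu : IsUnit P.det := h.det_ne_zero.isUnit
  have e : C.map (algebraMap A K) =
      P⁻¹.transpose * (l • a (latticeCoords b x)) * P⁻¹.transpose.transpose := by
    rw [hC, Matrix.transpose_transpose, Matrix.mul_assoc, Matrix.mul_assoc,
      Matrix.mul_nonsing_inv _ hPu, Matrix.mul_one, ← Matrix.mul_assoc, ← Matrix.transpose_mul,
      Matrix.mul_nonsing_inv _ hPu, Matrix.transpose_one, Matrix.one_mul]
  have hCa : IsAltMatrix (C.map (algebraMap A K)) := by
    rw [e]; exact ((halt _).smul l).congr _
  have hCa' : IsAltMatrix C := by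
    refine ⟨fun i => hinj ?_, fun i j => hinj ?_⟩
    · rw [map_zero]; exact hCa.1 i
    · rw [map_neg]; exact hCa.2 i j
  obtain ⟨μ, hμ⟩ := exists_minors_eq C hCa'
  have h1 := minors_mem_localClosure cN P.transpose hP μ
  rw [hμ, Matrix.transpose_transpose, ← hC] at h1
  have h2 := smul_mem_localClosure (A := A) r h1
  rw [algebra_compatible_smul K r, smul_smul, ← hr] at h2
  exact h2

-- Volumes are `A`-multiples of `P.det`, and the relation `det_mul` makes `c⁻¹ * P.det` a unit times
-- `l ^ 3`, a local generator of (Λ⁴L)^{⊗3}. This is integrality of `θ`.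
omit [IsDedekindDomain R] [IsFractionRing R K] in
theorem mul_vol_mem (h : IsFrame b hb a q c p A l P u) (hc0 : c ≠ 0)
    (hN : ∀ n, ∃ v : Fin 5 → A, cN n = P.transpose.mulVec (algebraMap A K ∘ v)) (w : ⋀[R]^5 N) :
    c⁻¹ * vol cN w ∈ localClosure p (LinearMap.range (cubeCoord b hb)) := by
  have hw : w ∈ Submodule.span R (Set.range (exteriorPower.ιMulti R 5 (M := N))) := by
    rw [exteriorPower.ιMulti_span]; trivial
  induction hw using Submodule.span_induction with
  | mem x hx =>
    obtain ⟨n, rfl⟩ := hx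
    choose v hv using fun i => hN (n i)
    obtain ⟨u', hu'⟩ := h.isUnit
    have e : (Matrix.of fun i => cN (n i)) = (Matrix.of v).map (algebraMap A K) * P := by
      ext i j
      rw [Matrix.of_apply, hv, Matrix.mulVec_transpose]
      rfl
    have e1 : algebraMap A K ((u'⁻¹ : Aˣ) : A) * algebraMap A K u = 1 := by
      rw [← map_mul, ← hu', Units.inv_mul, map_one]
    have e2 : c⁻¹ * vol cN (exteriorPower.ιMulti R 5 n) =
        algebraMap A K ((Matrix.of v).det * ((u'⁻¹ : Aˣ) : A)) * l ^ 3 := by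
      rw [vol_ιMulti, e, Matrix.det_mul, map_mul, RingHom.map_det, RingHom.mapMatrix_apply]
      have hd := h.det_mul
      rw [inv_mul_eq_iff_eq_mul₀ hc0]
      linear_combination (algebraMap A K (u'⁻¹ : Aˣ) *
        ((Matrix.of v).map (algebraMap A K)).det) * hd -
        (((Matrix.of v).map (algebraMap A K)).det * P.det) * e1
    rw [e2]
    exact h.mul_cube_mem _
  | zero => rw [map_zero, mul_zero]; exact zero_mem _
  | add x y _ _ hx hy => rw [map_add, mul_add]; exact add_mem hx hy
  | smul r x _ hx => rw [map_smul, mul_smul_comm]; exact Submodule.smul_mem _ r hx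

-- The same relation read backwards; it gives surjectivity of `θ`.
omit [IsDedekindDomain R] [IsFractionRing R K] in
theorem cubeCoord_mem (h : IsFrame b hb a q c p A l P u) (hc0 : c ≠ 0)
    (hP : ∀ v : Fin 5 → A,
      P.transpose.mulVec (algebraMap A K ∘ v) ∈ localClosure p (LinearMap.range cN))
    (w : TopLCube R Q) : cubeCoord b hb w ∈ localClosure p
      (LinearMap.range ((LinearMap.mulLeft K c⁻¹).restrictScalars R ∘ₗ vol cN)) := by
  choose s hs m hm using fun i : Fin 5 => hP (Pi.single i 1)
  have e : ∀ i, s i • P i = cN (m i) := by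
    intro i
    rw [hm]
    congr 1
    ext j
    simp [Matrix.mulVec, dotProduct, Pi.single_apply, apply_ite (algebraMap A K)]
  obtain ⟨r, hr⟩ := h.exists_cubeCoord_eq w
  have h1 : c⁻¹ * P.det ∈ localClosure p
      (LinearMap.range ((LinearMap.mulLeft K c⁻¹).restrictScalars R ∘ₗ vol cN)) := by
    refine ⟨∏ i, s i, p.primeCompl.prod_mem fun i _ => hs i, exteriorPower.ιMulti R 5 m, ?_⟩
    change c⁻¹ * vol cN _ = _
    have e' : (Matrix.of fun i => cN (m i)) =
        Matrix.of fun i j => algebraMap R K (s i) * P i j := by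
      ext i j
      rw [Matrix.of_apply, ← e, Matrix.of_apply, Pi.smul_apply, Algebra.smul_def]
    rw [vol_ιMulti, e', Matrix.det_mul_column, Algebra.smul_def, map_prod]
    ring
  have h2 := smul_mem_localClosure (A := A) (r * u) h1
  have e3 : cubeCoord b hb w = (r * u) • (c⁻¹ * P.det) := by
    have hd := h.det_mul
    rw [hr, Algebra.smul_def, map_mul]
    field_simp
    linear_combination (-algebraMap A K r) * hd
  rw [e3]
  exact h2

-- Integrality of `θ` applied to φ(t y)^□ ∧ n. In coordinates this element is c⁻¹ · t² c (n · q(y))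
-- = t² (n · q(y)), and it lies in `A l³`; as `t` is a local generator, the product n · q(y) lies in
-- `A l`.
omit [IsDedekindDomain R] [IsFractionRing R K] in
theorem dotProduct_mem (h : IsFrame b hb a q c p A l P u) (hc0 : c ≠ 0)
    (hc : ∀ y, pfVec (a y) = c • q y) {σ : Resolvent R Q N} {cN : N →ₗ[R] (Fin 5 → K)}
    (hσ : σ.IsNormalized b hb cN a c) (n : N) (y : Q) :
    cN n ⬝ᵥ q (latticeCoords b y) ∈ localClosure p (LinearMap.range (topCoord b hb)) := by
  obtain ⟨s, hs, t, ht⟩ := h.mem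
  obtain ⟨r, hr⟩ := h.exists_cubeCoord_eq
    (σ.theta (wedgeVec (box (σ.phi (t ⊗ₜ[R] toModBase R Q y))) n))
  rw [hσ.cube_theta, vol_wedgeVec_box, hσ.minors_phi, pfVec_smul, hc, ← ht, smul_dotProduct,
    smul_dotProduct, dotProduct_comm] at hr
  apply mem_localClosure_of_smul_mem (p.primeCompl.mul_mem hs hs)
  have e : (s * s) • (cN n ⬝ᵥ q (latticeCoords b y)) = algebraMap A K r * l := by
    have hl := h.l_ne_zero
    rw [Algebra.smul_def s l, smul_eq_mul, smul_eq_mul] at hr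
    rw [Algebra.smul_def, map_mul]
    apply mul_left_cancel₀ (pow_ne_zero 2 hl)
    have e1 : c⁻¹ * c = 1 := inv_mul_cancel₀ hc0
    linear_combination hr - (algebraMap R K s * l) ^ 2 * (cN n ⬝ᵥ q (latticeCoords b y)) * e1
  rw [e]
  exact h.mul_mem r

end IsFrame

end FrameRanges

/-- Writing g = (det g) g' gives det g = (det g)⁵ det g', and one factor cancels. -/
theorem Matrix.isUnit_det_of_det_dvd {A : Type*} [CommRing A] [IsDomain A]
    {g : Matrix (Fin 5) (Fin 5) A} (hg : g.det ≠ 0) (h : ∀ i j, g.det ∣ g i j) :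
    IsUnit g.det := by
  choose g' hg' using h
  have e : g = g.det • Matrix.of g' := by
    ext i j
    exact hg' i j
  have e1 : g.det = g.det ^ 5 * (Matrix.of g').det := by
    conv_lhs => rw [e, Matrix.det_smul, Fintype.card_fin]
  refine IsUnit.of_mul_eq_one (g.det ^ 3 * (Matrix.of g').det * g.det ^ 0 * g.det ^ 0) ?_
  apply mul_left_cancel₀ hg
  linear_combination -e1

/-! ### The local index of a resolvent in the dual lattice. -/

section LocalRange

variable {R : Type*} {Q : Type*} {K : Type*} [CommRing R] [IsDedekindDomain R] [Field K]
  [Algebra R K] [IsFractionRing R K] [CommRing Q] [Algebra R Q]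
  {b : Module.Basis (Fin 5) K (K ⊗[R] Q)} {hb : b 0 = 1}
  {a : (Fin 4 → K) →ₗ[K] Matrix (Fin 5) (Fin 5) K}
  {q : QuadraticMap K (Fin 4 → K) (Fin 5 → K)} {c : K} {p : Ideal R} [p.IsPrime]
  {A : Type*} [CommRing A] [Algebra R A] [IsLocalization.AtPrime A p] [Algebra A K]
  [IsScalarTower R A K] {l : K} {P : Matrix (Fin 5) (Fin 5) K} {u : A}
  {N : Type*} [AddCommGroup N] [Module R N]

-- Since `φ` takes values in Λ²N, the matrix t a(y) is (gP)ᵀ H (gP) with `H` integral. Taking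
-- Pfaffians and using `det_mul`, `g` maps `l⁻¹ P q(y)` into `det g` times `A⁵`. These vectors
-- generate `A⁵`, so every entry of `g` is divisible by `det g`.
omit [IsDedekindDomain R] [IsFractionRing R K] in
theorem IsFrame.det_dvd [IsDomain A] [FaithfulSMul A K] (h : IsFrame b hb a q c p A l P u)
    (hc0 : c ≠ 0) (hc : ∀ y, pfVec (a y) = c • q y) {σ : Resolvent R Q N}
    {cN : N →ₗ[R] (Fin 5 → K)} (hσ : σ.IsNormalized b hb cN a c)
    {g : Matrix (Fin 5) (Fin 5) A} (hg : ∀ n, ∃ v : Fin 5 → A, cN n =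
      (g.map (algebraMap A K) * P).transpose.mulVec (algebraMap A K ∘ v)) (i j : Fin 5) :
    g.det ∣ g i j := by
  obtain ⟨s, hs, t, ht⟩ := h.mem
  obtain ⟨u', hu'⟩ := h.isUnit
  have hinj := FaithfulSMul.algebraMap_injective A K
  obtain ⟨s', hs'⟩ := IsLocalization.map_units A (⟨s, hs⟩ : p.primeCompl)
  have hs' : (s' : A) = algebraMap R A s := hs'
  have key : ∀ y : Q, ∃ w : Fin 5 → A, (g.map (algebraMap A K)).mulVec
      (l⁻¹ • P.mulVec (q (latticeCoords b y))) = algebraMap A K ∘ (g.det • w) := by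
    intro y
    obtain ⟨μ, hμ⟩ := exists_minors_eq_congr cN _ hg (σ.phi (t ⊗ₜ[R] toModBase R Q y))
    set H := minors LinearMap.id μ with hH
    have hHa : IsAltMatrix (H.map (algebraMap A K)) := by
      have := minors_isAlt (LinearMap.id : (Fin 5 → A) →ₗ[A] _) μ
      rw [← hH] at this
      refine ⟨fun i => ?_, fun i j => ?_⟩
      · rw [Matrix.map_apply, this.1, map_zero]
      · rw [Matrix.map_apply, Matrix.map_apply, this.2, map_neg]
    have h1 := pfVec_congr (g.map (algebraMap A K) * P).transpose _ hHa
    rw [← hμ, hσ.minors_phi, ← ht, Matrix.transpose_transpose, pfVec_smul, hc, pfVec_map,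
      Matrix.det_transpose, Matrix.det_mul, Matrix.mulVec_smul, Matrix.mulVec_smul,
      ← Matrix.mulVec_mulVec] at h1
    refine ⟨((s'⁻¹ : Aˣ) : A) ^ 2 • ((u'⁻¹ : Aˣ) : A) • pfVec H, ?_⟩
    have e1 : algebraMap A K ((u'⁻¹ : Aˣ) : A) * algebraMap A K u = 1 := by
      rw [← map_mul, ← hu', Units.inv_mul, map_one]
    have e2 : algebraMap A K ((s'⁻¹ : Aˣ) : A) * algebraMap R K s = 1 := by
      rw [IsScalarTower.algebraMap_apply R A K, ← hs', ← map_mul, Units.inv_mul, map_one]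
    have e3 : (g.map (algebraMap A K)).det = algebraMap A K g.det := by
      rw [RingHom.map_det, RingHom.mapMatrix_apply]
    have hl := h.l_ne_zero
    have hd := h.det_mul
    rw [Matrix.mulVec_smul]
    ext k
    have h2 := congrFun h1 k
    rw [e3, Algebra.smul_def s l] at h2
    simp only [Pi.smul_apply, Function.comp_apply, smul_eq_mul, map_mul, map_pow] at h2 ⊢
    set X := (g.map (algebraMap A K)).mulVec (P.mulVec (q (latticeCoords b y))) k
    set d := algebraMap A K g.det
    set si := algebraMap A K ((s'⁻¹ : Aˣ) : A)
    set ui := algebraMap A K ((u'⁻¹ : Aˣ) : A)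
    set z := algebraMap A K (pfVec H k)
    set S := algebraMap R K s
    have hcl : c * l ^ 2 ≠ 0 := mul_ne_zero hc0 (pow_ne_zero 2 hl)
    have h3 : c * l ^ 2 * X = c * l ^ 2 * (l * (d * (si ^ 2 * (ui * z)))) := by
      have hP : P.det = ui * (c * l ^ 3) := by linear_combination ui * hd - P.det * e1
      rw [hP] at h2
      have e4 : si ^ 2 * S ^ 2 = 1 := by rw [← mul_pow, e2, one_pow]
      linear_combination si ^ 2 * h2 - (c * l ^ 2 * X) * e4
    rw [mul_left_cancel₀ hcl h3]
    field_simp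
  let W : Submodule A (Fin 5 → K) := Submodule.comap
    ((g.map (algebraMap A K)).mulVecLin.restrictScalars A)
    (LinearMap.range (((Algebra.linearMap A K).compLeft (Fin 5)) ∘ₗ
      (LinearMap.lsmul A (Fin 5 → A) g.det)))
  have hW : Submodule.span A (Set.range fun y : Q => l⁻¹ • P.mulVec (q (latticeCoords b y))) ≤ W := by
    rw [Submodule.span_le]
    rintro _ ⟨y, rfl⟩
    obtain ⟨w, hw⟩ := key y
    exact ⟨w, hw.symm⟩
  obtain ⟨w, hw⟩ := hW (h.span (Pi.single j 1))
  refine ⟨w i, hinj ?_⟩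
  have h4 : algebraMap A K (g.det * w i) = _ := congrFun hw i
  rw [h4]
  change _ = ((g.map (algebraMap A K)).mulVec (algebraMap A K ∘ Pi.single j 1)) i
  simp [Matrix.mulVec, dotProduct, Pi.single_apply, apply_ite (algebraMap A K)]

-- A local basis `D` of the lattice is `G P` with `G` integral. By `det_dvd` and
-- `isUnit_det_of_det_dvd`, `G` is invertible, so the rows of `P` belong to the lattice locally.
omit [IsDedekindDomain R] in
theorem IsFrame.mulVec_mem_range [Module.Finite R N] [IsDomain A] [IsPrincipalIdealRing A]
    [IsFractionRing A K] (h : IsFrame b hb a q c p A l P u)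
    (hc0 : c ≠ 0) (hc : ∀ y, pfVec (a y) = c • q y) {σ : Resolvent R Q N}
    {cN : N →ₗ[R] (Fin 5 → K)} (hσ : σ.IsNormalized b hb cN a c)
    (hN : ∀ n, ∃ v : Fin 5 → A, cN n = P.transpose.mulVec (algebraMap A K ∘ v)) (v : Fin 5 → A) :
    P.transpose.mulVec (algebraMap A K ∘ v) ∈ localClosure p (LinearMap.range cN) := by
  let S : Submodule A (Fin 5 → K) := Submodule.span A (Set.range cN)
  have hfg : S.FG := by
    obtain ⟨T, hT⟩ := (inferInstance : Module.Finite R N).fg_top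
    refine Submodule.fg_def.mpr ⟨cN '' T, T.finite_toSet.image _, ?_⟩
    apply le_antisymm (Submodule.span_mono (Set.image_subset_range _ _))
    rw [Submodule.span_le]
    rintro _ ⟨n, rfl⟩
    have hn : n ∈ Submodule.span R (T : Set N) := by rw [hT]; trivial
    have hn' := Submodule.mem_map_of_mem (f := cN) hn
    rw [Submodule.map_span] at hn'
    exact Submodule.span_le_restrictScalars R A _ hn'
  have hspan : Submodule.span K (S : Set (Fin 5 → K)) = ⊤ := by
    rw [eq_top_iff]
    intro v _
    obtain ⟨r, hr, x, hx⟩ := hσ.span v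
    have hrK : algebraMap R K r ≠ 0 := by rwa [Ne, IsFractionRing.to_map_eq_zero_iff]
    rw [← Submodule.smul_mem_iff _ hrK, algebraMap_smul, hx]
    exact Submodule.subset_span (Submodule.subset_span ⟨x, rfl⟩)
  obtain ⟨D, hD0, hD⟩ := exists_matrix_of_isLattice S hfg hspan
  have hSP : ∀ x ∈ S, ∃ v : Fin 5 → A, x = P.transpose.mulVec (algebraMap A K ∘ v) := by
    have : S ≤ LinearMap.range ((P.transpose.mulVecLin.restrictScalars A) ∘ₗ
        (Algebra.linearMap A K).compLeft (Fin 5)) := by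
      rw [Submodule.span_le]
      rintro _ ⟨n, rfl⟩
      obtain ⟨v, hv⟩ := hN n
      exact ⟨v, hv.symm⟩
    intro x hx
    obtain ⟨v, hv⟩ := this hx
    exact ⟨v, hv.symm⟩
  choose g hg using fun i => hSP (D.transpose.mulVec (algebraMap A K ∘ Pi.single i 1))
    ((hD _).mpr ⟨_, rfl⟩)
  have hDg : D = (Matrix.of g).map (algebraMap A K) * P := by
    ext i j
    have := congrFun (hg i) j
    have e : D.transpose.mulVec (algebraMap A K ∘ Pi.single i 1) j = D i j := by
      simp [Matrix.mulVec, dotProduct, Pi.single_apply, apply_ite (algebraMap A K)]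
    rw [← e, this, Matrix.mulVec_transpose]
    rfl
  set G := Matrix.of g
  have hG0 : G.det ≠ 0 := by
    intro h0
    apply hD0
    rw [hDg, Matrix.det_mul, ← RingHom.mapMatrix_apply, ← RingHom.map_det, h0, map_zero, zero_mul]
  have hGu : IsUnit G.det := Matrix.isUnit_det_of_det_dvd hG0 (h.det_dvd hc0 hc hσ fun n => by
    obtain ⟨v, hv⟩ := (hD (cN n)).mp (Submodule.subset_span ⟨n, rfl⟩)
    exact ⟨v, by rw [← hDg]; exact hv⟩)
  have hmem : P.transpose.mulVec (algebraMap A K ∘ v) ∈ S := by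
    rw [hD]
    refine ⟨G⁻¹.transpose.mulVec v, ?_⟩
    have e : algebraMap A K ∘ (G⁻¹.transpose.mulVec v) =
        (G⁻¹.transpose.map (algebraMap A K)).mulVec (algebraMap A K ∘ v) := by
      ext i; exact RingHom.map_mulVec _ _ _ i
    rw [e, Matrix.mulVec_mulVec, hDg, Matrix.transpose_mul, Matrix.mul_assoc, ← Matrix.transpose_map,
      ← Matrix.map_mul, ← Matrix.transpose_mul, Matrix.nonsing_inv_mul _ hGu,
      Matrix.transpose_one, Matrix.map_one _ (map_zero _) (map_one _), Matrix.mul_one]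
  have hle : ∀ x ∈ S, x ∈ localClosure p (LinearMap.range cN) := by
    intro x hx
    induction hx using Submodule.span_induction with
    | mem x hx => exact le_localClosure hx
    | zero => exact zero_mem _
    | add x y _ _ hx hy => exact add_mem hx hy
    | smul r x _ hx => exact smul_mem_localClosure (A := A) r hx
  exact hle _ hmem

end LocalRange

/-! ### Gluing the local statements. -/

section GlobalRange

variable {R : Type*} {Q : Type*} {K : Type*} [CommRing R] [IsDedekindDomain R] [Field K]
  [Algebra R K] [IsFractionRing R K] [CommRing Q] [Algebra R Q]
  {b : Module.Basis (Fin 5) K (K ⊗[R] Q)} {hb : b 0 = 1}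
  {a : (Fin 4 → K) →ₗ[K] Matrix (Fin 5) (Fin 5) K}
  {q : QuadraticMap K (Fin 4 → K) (Fin 5 → K)} {c : K}

/-- There is a local frame at every nonzero prime ideal. -/
def HasFrames (b : Module.Basis (Fin 5) K (K ⊗[R] Q)) (hb : b 0 = 1)
    (a : (Fin 4 → K) →ₗ[K] Matrix (Fin 5) (Fin 5) K)
    (q : QuadraticMap K (Fin 4 → K) (Fin 5 → K)) (c : K) : Prop :=
  ∀ (p : Ideal R) (_ : p.IsPrime), p ≠ ⊥ →
    ∃ (A : Subalgebra R K) (_ : IsLocalization.AtPrime A p) (_ : IsDiscreteValuationRing A)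
      (_ : IsFractionRing A K) (l : K) (P : Matrix (Fin 5) (Fin 5) K) (u : A),
      IsFrame b hb a q c p A l P u

theorem IsModel.hasFrames (h : IsModel b a q) (hb : b 0 = 1) (hQ : IsQuinticRing R Q)
    (hint : ∀ p : Ideal R, p.IsPrime → p ≠ ⊥ →
      Module.rank (R ⧸ p) (integralClasses R K Q p) ≤ 2)
    (hc : ∀ y, pfVec (a y) = c • q y) : HasFrames b hb a q c := by
  intro p hp hp0
  let A := Localization.subalgebra.ofField K p.primeCompl p.primeCompl_le_nonZeroDivisors
  have hloc : IsLocalization.AtPrime A p := inferInstanceAs (IsLocalization p.primeCompl A)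
  have hA : IsDiscreteValuationRing A :=
    IsLocalization.AtPrime.isDiscreteValuationRing_of_dedekind_domain R hp0 A
  exact ⟨A, hloc, hA, inferInstance, h.exists_isFrame hQ p hp0 (hint p hp hp0) A hb hc⟩

namespace HasFrames

omit [IsFractionRing R K] in
theorem ne_zero (hF : HasFrames b hb a q c) (hR : ¬ IsField R) : c ≠ 0 := by
  obtain ⟨p, hp0, hp⟩ := Ring.not_isField_iff_exists_prime.mp hR
  obtain ⟨A, _, _, _, l, P, u, h⟩ := hF p hp hp0
  rintro rfl
  have h1 := h.det_mul
  rw [zero_mul] at h1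
  have h2 : algebraMap A K u ≠ 0 := by
    rw [Ne, IsFractionRing.to_map_eq_zero_iff]; exact h.isUnit.ne_zero
  exact mul_ne_zero h.det_ne_zero h2 h1

variable {N : Type*} [AddCommGroup N] [Module R N] {cN : N →ₗ[R] (Fin 5 → K)}

/-- The source of uniqueness: both inclusions are local, the first by integrality of `θ`, the second
because the local index is a unit. -/
theorem range_eq (hF : HasFrames b hb a q c) (hR : ¬ IsField R)
    (hc : ∀ y, pfVec (a y) = c • q y) [Module.Finite R N] {σ : Resolvent R Q N}
    (hσ : σ.IsNormalized b hb cN a c) : LinearMap.range cN = dualLattice b hb q := by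
  have hc0 := hF.ne_zero hR
  have hle : ∀ n, cN n ∈ dualLattice b hb q := by
    intro n y
    refine mem_of_forall_mem_localClosure hR fun p hp hp0 => ?_
    obtain ⟨A, _, _, _, l, P, u, h⟩ := hF p hp hp0
    exact h.dotProduct_mem hc0 hc hσ n y
  apply le_antisymm
  · rintro _ ⟨n, rfl⟩
    exact hle n
  · intro m hm
    refine mem_of_forall_mem_localClosure hR fun p hp hp0 => ?_
    obtain ⟨A, _, _, _, l, P, u, h⟩ := hF p hp hp0
    obtain ⟨v, rfl⟩ := h.exists_eq_mulVec fun y => h.exists_of_mem (hm y)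
    exact h.mulVec_mem_range hc0 hc hσ
      (fun n => h.exists_eq_mulVec fun y => h.exists_of_mem (hle n y)) v

theorem exists_isNumerical (hF : HasFrames b hb a q c) (hR : ¬ IsField R)
    (hQ : IsQuinticRing R Q) (h : IsModel b a q) (hc : ∀ y, pfVec (a y) = c • q y)
    [Module.Finite R N] [Module.Projective R N] (hinj : Function.Injective cN)
    (hN : LinearMap.range cN = dualLattice b hb q) :
    ∃ ρ : Resolvent R Q N, ρ.IsNormalized b hb cN a c ∧ ρ.IsNumerical := by
  have hc0 := hF.ne_zero hR
  have := hQ.finite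
  have hmem : ∀ n y, cN n ⬝ᵥ q (latticeCoords b y) ∈ LinearMap.range (topCoord b hb) := by
    intro n
    have : cN n ∈ dualLattice b hb q := hN ▸ ⟨n, rfl⟩
    exact this
  have hspan : ∀ v, ∃ r : R, r ≠ 0 ∧ ∃ x, r • v = cN x := by
    intro v
    obtain ⟨r, hr, hv⟩ := exists_smul_mem_dualLattice b hb hQ (q := q) v
    rw [← hN] at hv
    obtain ⟨x, hx⟩ := hv
    exact ⟨r, hr, x, hx.symm⟩
  obtain ⟨ρ, hρ⟩ := h.exists_resolvent b hb hQ hc0 hc cN hinj hspan (fun t x => by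
    refine mem_of_forall_mem_localClosure hR fun p hp hp0 => ?_
    obtain ⟨A, _, _, _, l, P, u, hf⟩ := hF p hp hp0
    exact hf.smul_mem_range_minors cN h.alt (fun v => hN ▸ hf.mulVec_mem v) t x) (fun w => by
    refine mem_of_forall_mem_localClosure hR fun p hp hp0 => ?_
    obtain ⟨A, _, _, _, l, P, u, hf⟩ := hF p hp hp0
    exact hf.mul_vol_mem cN hc0
      (fun n => hf.exists_eq_mulVec fun y => hf.exists_of_mem (hmem n y)) w)
  obtain ⟨ν, hν, s, hs, hsp⟩ := exists_frame_of_coords cN hinj hspan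
  refine ⟨ρ, hρ, fun w w' hw => ?_, fun w => ?_⟩
  · have h1 := congrArg (cubeCoord (R := R) (Q := Q) b hb) hw
    rw [hρ.cube_theta, hρ.cube_theta] at h1
    exact vol_injective cN hν hs hsp (mul_left_cancel₀ (inv_ne_zero hc0) h1)
  · have h1 : cubeCoord (R := R) (Q := Q) b hb w ∈
        LinearMap.range ((LinearMap.mulLeft K c⁻¹).restrictScalars R ∘ₗ vol cN) := by
      refine mem_of_forall_mem_localClosure hR fun p hp hp0 => ?_
      obtain ⟨A, _, _, _, l, P, u, hf⟩ := hF p hp hp0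
      exact hf.cubeCoord_mem cN hc0 (fun v => hN ▸ hf.mulVec_mem v) w
    obtain ⟨x, hx⟩ := h1
    refine ⟨x, cubeCoord_injective b hb hQ ?_⟩
    rw [hρ.cube_theta]
    exact hx

end HasFrames

/-- Equal images in `K⁵` identify the modules, and normalized resolvents have the same `φ` and `θ`
in these coordinates. -/
theorem Resolvent.IsNormalized.isomorphic (hQ : IsQuinticRing R Q) {M N : Type*} [AddCommGroup M]
    [Module R M] [AddCommGroup N] [Module R N] [Module.Finite R N] [Module.Projective R N]
    {cM : M →ₗ[R] (Fin 5 → K)}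
    {cN : N →ₗ[R] (Fin 5 → K)} {ρ : Resolvent R Q M} {σ : Resolvent R Q N}
    (hρ : ρ.IsNormalized b hb cM a c) (hσ : σ.IsNormalized b hb cN a c)
    (h : LinearMap.range cM = LinearMap.range cN) : ρ.Isomorphic σ := by
  let f : M ≃ₗ[R] N := LinearEquiv.ofInjective cM hρ.injective ≪≫ₗ LinearEquiv.ofEq _ _ h ≪≫ₗ
    (LinearEquiv.ofInjective cN hσ.injective).symm
  have hf : cN ∘ₗ f.toLinearMap = cM := by
    ext1 m
    have := (LinearEquiv.ofInjective cN hσ.injective).apply_symm_apply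
      (LinearEquiv.ofEq _ _ h (LinearEquiv.ofInjective cM hρ.injective m))
    exact congrArg Subtype.val this
  obtain ⟨ν, hν, s, hs, hsp⟩ := exists_frame_of_coords cN hσ.injective hσ.span
  refine ⟨f, ?_, ?_⟩
  · refine TensorProduct.ext' fun l x => ?_
    obtain ⟨x, rfl⟩ := Submodule.mkQ_surjective _ x
    apply minors_injective cN hν hs hsp
    rw [LinearMap.comp_apply, minors_map, hf]
    exact (hρ.minors_phi l x).trans (hσ.minors_phi l x).symm
  · refine LinearMap.ext fun w => cubeCoord_injective b hb hQ ?_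
    rw [LinearMap.comp_apply, hσ.cube_theta, vol_map, hf, hρ.cube_theta]

end GlobalRange

/-! ### Rank of the lattice and the final theorem. -/

theorem finrank_eq_of_coords {R K N : Type*} [CommRing R] [IsDomain R] [Field K] [Algebra R K]
    [IsFractionRing R K] [AddCommGroup N] [Module R N] {n : ℕ} (c : N →ₗ[R] (Fin n → K))
    (hc : Function.Injective c) (hspan : ∀ v, ∃ r : R, r ≠ 0 ∧ ∃ x, r • v = c x) :
    Module.finrank R N = n := by
  have : IsLocalizedModule (nonZeroDivisors R) c := by
    refine ⟨fun s => ?_, fun v => ?_, fun h => ⟨1, by rw [hc h]⟩⟩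
    · have hs : algebraMap R K s ≠ 0 := by
        rw [Ne, IsFractionRing.to_map_eq_zero_iff]; exact nonZeroDivisors.ne_zero s.2
      rw [Module.End.isUnit_iff]
      refine ⟨fun x y hxy => ?_, fun x => ⟨(algebraMap R K s)⁻¹ • x, ?_⟩⟩
      · have hxy : (s : R) • x = (s : R) • y := hxy
        rw [algebra_compatible_smul K, algebra_compatible_smul K (s : R) y] at hxy
        exact smul_right_injective _ hs hxy
      · change (s : R) • ((algebraMap R K s)⁻¹ • x) = x
        rw [algebra_compatible_smul K, smul_inv_smul₀ hs]
    · obtain ⟨r, hr, x, hx⟩ := hspan v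
      exact ⟨⟨x, r, mem_nonZeroDivisors_of_ne_zero hr⟩, hx⟩
  rw [← IsLocalizedModule.finrank_eq (nonZeroDivisors R) c le_rfl,
    ← IsFractionRing.finrank_right_eq R K, Module.finrank_fin_fun]

theorem theorem4 {R : Type u} {Q : Type v} (K : Type*)
    [CommRing R] [IsDedekindDomain R] (hR : ¬ IsField R)
    [Field K] [Algebra R K] [IsFractionRing R K]
    [CommRing Q] [Algebra R Q] (hQ : IsQuinticRing R Q)
    (hint : ∀ p : Ideal R, p.IsPrime → p ≠ ⊥ →
      Module.rank (R ⧸ p) (integralClasses R K Q p) ≤ 2) :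
    ∃ (M : Type u) (_ : AddCommGroup M) (_ : Module R M) (ρ : Resolvent R Q M),
      IsLatticeOfRank R M 5 ∧ ρ.IsNumerical ∧
        ∀ (N : Type w) [AddCommGroup N] [Module R N] (σ : Resolvent R Q N),
          IsLatticeOfRank R N 5 → ρ.Isomorphic σ := by
  -- Finite domains are fields, so `K` is infinite. This is used to avoid finitely many subspaces
  -- and to compare polynomials by their values.
  have hRinf : Infinite R := by
    by_contra h
    rw [not_infinite_iff_finite] at h
    exact hR (Finite.isField_of_domain R)
  have hKinf : Infinite K := Infinite.of_injective _ (IsFractionRing.injective R K)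
  have hfin := hQ.finite
  obtain ⟨p, hp0, hp⟩ := Ring.not_isField_iff_exists_prime.mp hR
  obtain ⟨b, a, q, hb, h⟩ := exists_isModel (K := K) (Q := K ⊗[R] Q)
    (by rw [finrank_tensorProduct_fraction, hQ.finrank_eq])
    (nilpotent_dependent_of_integralClasses hQ p hp0 (hint p hp hp0))
  obtain ⟨c, hc⟩ := h.exists_pfVec_eq_smul
  have hF := h.hasFrames hb hQ hint hc
  have hM := h.finite_dualLattice (R := R) (hb := hb)
  -- The dual lattice lives in the universe of `K`; being finite over `R`, it has a copy in the
  -- universe of `R`.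
  have hsmall : Small.{u} (dualLattice b hb q) := Module.Finite.small.{u} R _
  let e : Shrink.{u} (dualLattice b hb q) ≃ₗ[R] dualLattice b hb q := Shrink.linearEquiv R _
  let cM : Shrink.{u} (dualLattice b hb q) →ₗ[R] (Fin 5 → K) :=
    (dualLattice b hb q).subtype ∘ₗ e.toLinearMap
  have hinj : Function.Injective cM := Subtype.val_injective.comp e.injective
  have hrange : LinearMap.range cM = dualLattice b hb q := by
    rw [LinearMap.range_comp, LinearEquiv.range, Submodule.map_top, Submodule.range_subtype]
  have htf : Module.IsTorsionFree R (Shrink.{u} (dualLattice b hb q)) := by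
    have : Module.IsTorsionFree R (Fin 5 → K) := inferInstance
    exact Function.Injective.moduleIsTorsionFree _ hinj fun r m => map_smul _ r m
  have hproj : Module.Projective R (Shrink.{u} (dualLattice b hb q)) :=
    Module.projective_of_isTorsionFree
  obtain ⟨ρ, hρ, hnum⟩ := hF.exists_isNumerical hR hQ h hc hinj hrange
  refine ⟨_, _, _, ρ, ⟨inferInstance, hproj, finrank_eq_of_coords cM hinj hρ.span⟩, hnum, ?_⟩
  intro N _ _ σ hN
  have := hN.finite
  have := hN.projective
  obtain ⟨cN, hσ⟩ := h.exists_isNormalized b hb hQ (hF.ne_zero hR) hc hN σ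
  exact hρ.isomorphic hQ hσ (hrange.trans (hF.range_eq hR hc hσ).symm)
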